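/- Let $n\ge 0$, let $\mathfrak S_n$ be the symmetric group with simple transpositions $s_i=(i,i+1)$ and length function $l$, put $\varepsilon_w=(-1)^{l(w)}$, $A=\mathbb Z[v,v^{-1}]$, $K=\mathbb R(v)$. Let $\mathcal H$ be the Iwahori--Hecke algebra over $A$, free with basis $T_w$ ($w\in\mathfrak S_n$), where $T_{s}T_w=T_{sw}$ if $l(sw)=l(w)+1$ and $T_sT_w=T_{sw}+(v-v^{-1})T_w$ if $l(sw)=l(w)-1$, for $s=s_i$; let $\mathcal H_K=K\otimes_A\mathcal H$. Let $C'_w$ be the Kazhdan--Lusztig basis with $C'_w\equiv T_w$ modulo $\sum_y v^{-1}\mathbb Z[v^{-1}]T_y$, and $C_w=\varepsilon_w j(C'_w)$, where $j(\sum_w a_wT_w)=\sum_w\varepsilon_w\bar a_wT_w$ and $\bar v=v^{-1}$. For a partition $\lambda$ of $n$ let $\mathfrak S_\lambda$ be its Young subgroup, $w_\lambda$ the longest element of $\mathfrak S_\lambda$, $P_\lambda=\sum_{w\in\mathfrak S_\lambda}v^{2l(w)}$ and $x_\lambda=\sum_{w\in\mathfrak S_\lambda}v^{l(w)}T_w$.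 Let $\trianglelefteq$ be the dominance order, and $\lambda\triangleleft\mu$ mean $\lambda\trianglelefteq\mu$, $\lambda\ne\mu$. For a standard $\lambda$-tableau $\mathfrak s$ let $d(\mathfrak s)\in\mathfrak S_n$ be the permutation with $\mathfrak s=d(\mathfrak s).\mathfrak t^\lambda$, where $\mathfrak t^\lambda$ is the $\lambda$-tableau filled with $1,\dots,n$ row by row. For standard $\lambda$-tableaux $\mathfrak s,\mathfrak t$ put $$\tilde y_{\mathfrak s\mathfrak t}=T_{d(\mathfrak s)}C_{w_\lambda}T_{d(\mathfrak t)^{-1}},\qquad x_{\mathfrak s\mathfrak t}=T_{d(\mathfrak s)}\,x_\lambda\, T_{d(\mathfrak t)^{-1}},$$ and let $\hat{\mathcal N}^\lambda$ be the $A$-span of the $\tilde y_{\mathfrak u\mathfrak v}$ with $\mathfrak u,\mathfrak v$ standard $\mu$-tableaux, $\lambda\triangleleft\mu$. Label the irreducible characters of $\mathcal H_K$ as $\chi_\lambda$ ($\lambda$ a partition of $n$) such that the character induced from the sign character $T_w\mapsto\varepsilon_wv^{-l(w)}$ of the parabolic subalgebra of $\mathfrak S_\lambda$ is $\chi_\lambda$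 plus a sum of characters $\chi_\mu$ with $\lambda\triangleleft\mu$. Let $c_\lambda$ be the Schur elements, i.e. $\tau=\sum_\lambda c_\lambda^{-1}\chi_\lambda$ where $\tau(T_1)=1$ and $\tau(T_w)=0$ for $w\ne1$, and let $a(\lambda)\in\mathbb N$ be such that $c_\lambda=r\,v^{-2a(\lambda)}+$ a combination of higher powers of $v$, with $r>0$. For every $\lambda$ fix a matrix representation $\mathfrak X_\lambda:\mathcal H_K\to M_{d_\lambda}(K)$ affording $\chi_\lambda$ which is orthogonal, i.e. $\mathfrak X_\lambda(T_{w^{-1}})=P^{-1}\mathfrak X_\lambda(T_w)^{\rm tr}P$ for all $w$, with a diagonal matrix $P$ (depending on $\lambda$) having entries in $1+v\mathbb R[v]$; the leading matrix coefficient $c^{ij}_{w,\lambda}$ is $\varepsilon_w$ times the constant term of $v^{a(\lambda)}\mathfrak X_\lambda^{ij}(T_w)$. Assume the choice is such that all $c^{ij}_{w,\lambda}$ are integers and $c^{11}_{w_\lambda,\lambda}\neq0$. Let $\mathfrak R(\lambda)=\{w: c^{ij}_{w,\lambda}\ne0\text{ for some }i,j\}$; the set $\mathfrak S_n$ is the disjoint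 union of the $\mathfrak R(\lambda)$, and $\lambda_w$ denotes the partition with $w\in\mathfrak R(\lambda_w)$. Let $\mathbf w_\lambda(i,j)$ be the unique $w$ with $c^{ij}_{w,\lambda}\neq0$, and define $x_i$ ($1\le i\le d_\lambda$) by $\mathbf w_\lambda(i,1)=x_iw_\lambda$. For $w=\mathbf w_\lambda(i,j)$ let $Z_w=P_\lambda^{-1}\varepsilon_{w_\lambda}v^{l(w_\lambda)}C_{x_iw_\lambda}C_{w_\lambda x_j^{-1}}\in\mathcal H_K$. Then there are signs $\eta_w=\pm1$ ($w\in\mathfrak S_n$) with $\eta_wC_w\in Z_w+\hat{\mathcal N}^{\lambda}$ for $w\in\mathfrak R(\lambda)$, and for all $\lambda$ and all standard $\lambda$-tableaux $\mathfrak s,\mathfrak t$ the following hold. There is a unique $w\in\mathfrak R(\lambda)$ such that $$\tilde y_{\mathfrak s\mathfrak t}=\eta_wC_w+(\text{a }v\mathbb Z[v]\text{-combination of }C_y\text{ with }\lambda_y=\lambda)+(\text{an }A\text{-combination of }C_y\text{ with }\lambda\triangleleft\lambda_y).$$ There are $i,j$ with $d(\mathfrak s)=x_i$ and $d(\mathfrak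 t)=x_j$, and $w=\mathbf w_\lambda(i,j)$ for all such $i,j$. Moreover, for the same $w$, $$v^{-l(w_\lambda)}x_{\mathfrak s\mathfrak t}=\eta'_wC'_w+(\text{a }v^{-1}\mathbb Z[v^{-1}]\text{-combination of }C'_y\text{ with }\lambda_y=\lambda)+(\text{an }A\text{-combination of }C'_y\text{ with }\lambda\triangleleft\lambda_y),$$ where $\eta'_w=\varepsilon_{d(\mathfrak s)}\varepsilon_{d(\mathfrak t)}\varepsilon_{w_\lambda}\varepsilon_w\eta_w$. -/

import Mathlib

open Equiv (Perm)
open scoped LaurentPolynomial Matrix TensorProduct Polynomial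

namespace KLMurphy

noncomputable section

/-! ### The symmetric group as a Coxeter group -/

/-- The simple transposition exchanging `i` and `i + 1`. -/
def s {n : ℕ} (i : Fin (n - 1)) : Perm (Fin n) :=
  Equiv.swap ⟨i, by omega⟩ ⟨i + 1, by omega⟩

/-- The length of `w` with respect to the simple transpositions: the least length of a word in
the simple transpositions with product `w`. -/
def len {n : ℕ} (w : Perm (Fin n)) : ℕ :=
  sInf {k : ℕ | ∃ l : List (Fin (n - 1)), l.length = k ∧ (l.map s).prod = w}

/-- Number of inversions of `w⁻¹`; only used to prove facts on `len`. -/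
def inv {n : ℕ} (w : Perm (Fin n)) : ℕ :=
  (Finset.univ.filter fun p : Fin n × Fin n => p.1 < p.2 ∧ w⁻¹ p.2 < w⁻¹ p.1).card

section Length

variable {n : ℕ}

theorem s_mul_self (i : Fin (n - 1)) : s i * s i = 1 := Equiv.swap_mul_self _ _

theorem s_inv (i : Fin (n - 1)) : (s i)⁻¹ = s i := Equiv.swap_inv _ _

theorem s_s_apply (i : Fin (n - 1)) (a : Fin n) : s i (s i a) = a :=
  Equiv.swap_apply_self _ _ _

theorem s_apply_val (i : Fin (n - 1)) (a : Fin n) :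
    ((s i a : Fin n) : ℕ) = if (a : ℕ) = i then (i : ℕ) + 1 else if (a : ℕ) = i + 1 then i else a := by
  unfold s
  rw [Equiv.swap_apply_def]
  simp only [Fin.ext_iff]
  split_ifs <;> simp_all

theorem s_lt_s_iff (i : Fin (n - 1)) {a b : Fin n}
    (h : ¬ ((a : ℕ) = i ∧ (b : ℕ) = i + 1)) (h' : ¬ ((b : ℕ) = i ∧ (a : ℕ) = i + 1)) :
    s i a < s i b ↔ a < b := by
  rw [Fin.lt_def, Fin.lt_def, s_apply_val, s_apply_val]
  split_ifs <;> omega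

/-- `w` has the left descent `i`, in terms of the values of `w⁻¹`. -/
def Desc (i : Fin (n - 1)) (w : Perm (Fin n)) : Prop :=
  w⁻¹ ⟨i + 1, by omega⟩ < w⁻¹ ⟨i, by omega⟩

theorem desc_s_mul (i : Fin (n - 1)) (w : Perm (Fin n)) : Desc i (s i * w) ↔ ¬ Desc i w := by
  unfold Desc
  have h1 : s i ⟨i + 1, by omega⟩ = ⟨i, by omega⟩ := Equiv.swap_apply_right _ _
  have h2 : s i ⟨i, by omega⟩ = ⟨i + 1, by omega⟩ := Equiv.swap_apply_left _ _
  rw [mul_inv_rev, s_inv, Equiv.Perm.mul_apply, Equiv.Perm.mul_apply, h1, h2]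
  refine Iff.trans ?_ not_lt.symm
  refine ⟨le_of_lt, fun h => lt_of_le_of_ne h fun e => ?_⟩
  have := congrArg Fin.val (w⁻¹.injective e)
  simp at this

theorem inv_s_mul_of_desc (i : Fin (n - 1)) (w : Perm (Fin n)) (h : Desc i w) :
    inv w = inv (s i * w) + 1 := by
  classical
  set p : Fin n × Fin n := (⟨i, by omega⟩, ⟨i + 1, by omega⟩) with hp
  unfold inv
  set I := Finset.univ.filter fun p : Fin n × Fin n => p.1 < p.2 ∧ w⁻¹ p.2 < w⁻¹ p.1 with hI
  set J := Finset.univ.filter fun p : Fin n × Fin n =>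
    p.1 < p.2 ∧ (s i * w)⁻¹ p.2 < (s i * w)⁻¹ p.1 with hJ
  have hpI : p ∈ I := by
    simp only [hI, hp, Finset.mem_filter, Finset.mem_univ, true_and]
    exact ⟨by simp [Fin.lt_def], h⟩
  have hpJ : p ∉ J := by
    simp only [hJ, hp, Finset.mem_filter, Finset.mem_univ, true_and]
    rintro ⟨-, h2⟩
    exact (desc_s_mul i w).1 h2 h
  rw [← Finset.card_erase_add_one hpI]
  congr 1
  refine Finset.card_equiv (Equiv.prodCongr (s i) (s i)) ?_
  rintro ⟨a, b⟩
  simp only [Finset.mem_erase, hI, hJ, Finset.mem_filter, Finset.mem_univ, true_and,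
    Equiv.prodCongr_apply, Prod.map, mul_inv_rev, s_inv, Equiv.Perm.mul_apply, s_s_apply, hp, ne_eq,
    Prod.mk.injEq, Fin.ext_iff]
  by_cases h1 : (a : ℕ) = i ∧ (b : ℕ) = i + 1
  · have h2 : ¬ (s i a < s i b) := by
      rw [Fin.lt_def, s_apply_val, s_apply_val, if_pos h1.1, if_neg (by omega), if_pos h1.2]
      omega
    simp [h1, h2]
  · by_cases h1' : (b : ℕ) = i ∧ (a : ℕ) = i + 1
    · have h2 : ¬ (a < b) := by rw [Fin.lt_def]; omega
      have h3 : a = ⟨i + 1, by omega⟩ := Fin.ext h1'.2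
      have h4 : b = ⟨i, by omega⟩ := Fin.ext h1'.1
      have h5 : ¬ w⁻¹ b < w⁻¹ a := by
        have h6 : w⁻¹ a < w⁻¹ b := by
          unfold Desc at h
          rwa [← h3, ← h4] at h
        exact not_lt.2 (le_of_lt h6)
      have h7 : ¬ (a < b ∧ w⁻¹ b < w⁻¹ a) := fun h => h2 h.1
      have h8 : ¬ (s i a < s i b ∧ w⁻¹ b < w⁻¹ a) := fun h => h5 h.2
      exact iff_of_false (fun h => h7 h.2) h8
    · rw [s_lt_s_iff i h1 h1']
      simp [h1]

theorem inv_s_mul_of_not_desc (i : Fin (n - 1)) (w : Perm (Fin n)) (h : ¬ Desc i w) :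
    inv (s i * w) = inv w + 1 := by
  have := inv_s_mul_of_desc i (s i * w) ((desc_s_mul i w).2 h)
  rwa [← mul_assoc, s_mul_self, one_mul] at this

theorem invCount_one : inv (1 : Perm (Fin n)) = 0 := by
  simp only [inv, inv_one, Equiv.Perm.one_apply, Finset.card_eq_zero, Finset.filter_eq_empty_iff]
  rintro p - ⟨h1, h2⟩
  exact lt_asymm h1 h2

theorem exists_desc (w : Perm (Fin n)) (hw : w ≠ 1) : ∃ i, Desc i w := by
  by_contra! hd
  apply hw
  have key : ∀ k : ℕ, ∀ a : Fin n, ∀ h : (a : ℕ) + k + 1 < n,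
      w⁻¹ a < w⁻¹ ⟨(a : ℕ) + k + 1, h⟩ := by
    have step : ∀ (a : ℕ) (h : a + 1 < n), w⁻¹ ⟨a, by omega⟩ < w⁻¹ ⟨a + 1, h⟩ := by
      intro a h
      refine lt_of_le_of_ne (not_lt.1 (hd ⟨a, by omega⟩)) fun e => ?_
      have := congrArg Fin.val (w⁻¹.injective e)
      simp at this
    intro k
    induction k with
    | zero => intro a h; exact step a h
    | succ k ih =>
      intro a h
      exact (ih a (by omega)).trans (step (a + k + 1) h)
  have hmono : StrictMono (w⁻¹ : Perm (Fin n)) := by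
    intro a b hab
    rw [Fin.lt_def] at hab
    have := key (b - a - 1) a (by omega)
    have e : (⟨(a : ℕ) + (b - a - 1) + 1, by omega⟩ : Fin n) = b := Fin.ext (by
      show (a : ℕ) + (b - a - 1) + 1 = b
      omega)
    rwa [e] at this
  have h1 : (w⁻¹ : Perm (Fin n)) = 1 := by
    ext a
    have e : (hmono.orderIsoOfSurjective _ w⁻¹.surjective) = OrderIso.refl _ := Subsingleton.elim _ _
    have := congrArg (fun f : Fin n ≃o Fin n => f a) e
    simpa using congrArg Fin.val this
  exact inv_eq_one.1 h1

theorem exists_word (w : Perm (Fin n)) :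
    ∃ l : List (Fin (n - 1)), l.length = inv w ∧ (l.map s).prod = w := by
  induction h : inv w generalizing w with
  | zero =>
    by_cases hw : w = 1
    · exact ⟨[], rfl, by simp [hw]⟩
    · obtain ⟨i, hi⟩ := exists_desc w hw
      have := inv_s_mul_of_desc i w hi
      omega
  | succ k ih =>
    have hw : w ≠ 1 := by rintro rfl; rw [invCount_one] at h; omega
    obtain ⟨i, hi⟩ := exists_desc w hw
    have := inv_s_mul_of_desc i w hi
    obtain ⟨l, hl, hl'⟩ := ih (s i * w) (by omega)
    exact ⟨i :: l, by simp [hl], by simp [hl', ← mul_assoc, s_mul_self]⟩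

theorem inv_word_le (l : List (Fin (n - 1))) : inv (l.map s).prod ≤ l.length := by
  induction l with
  | nil => simp [invCount_one]
  | cons i l ih =>
    rw [List.map_cons, List.prod_cons, List.length_cons]
    by_cases h : Desc i (l.map s).prod
    · have := inv_s_mul_of_desc i _ h; omega
    · have := inv_s_mul_of_not_desc i _ h; omega

theorem len_eq_inv (w : Perm (Fin n)) : len w = inv w := by
  apply le_antisymm
  · exact Nat.sInf_le (exists_word w)
  · obtain ⟨l, hl, hw⟩ := Nat.sInf_mem (⟨_, exists_word w⟩ :
      {k : ℕ | ∃ l : List (Fin (n - 1)), l.length = k ∧ (l.map s).prod = w}.Nonempty)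
    have := inv_word_le l
    rw [hw, hl] at this
    exact this

theorem len_inv (w : Perm (Fin n)) : len w⁻¹ = len w := by
  have key : ∀ w : Perm (Fin n), len w⁻¹ ≤ len w := by
    intro w
    obtain ⟨l, hl, hw⟩ := exists_word w
    rw [len_eq_inv w, ← hl]
    refine Nat.sInf_le ⟨l.reverse, by simp, ?_⟩
    rw [← hw, List.prod_inv_reverse, List.map_map, List.map_reverse]
    congr 2
  exact le_antisymm (key w) (by simpa using key w⁻¹)

theorem len_s_mul_lt_iff (i : Fin (n - 1)) (w : Perm (Fin n)) :
    len (s i * w) < len w ↔ Desc i w := by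
  rw [len_eq_inv, len_eq_inv]
  by_cases h : Desc i w
  · have := inv_s_mul_of_desc i w h; simp only [h, iff_true]; omega
  · have := inv_s_mul_of_not_desc i w h; simp only [h, iff_false]; omega

theorem len_mul_s_lt_iff (w : Perm (Fin n)) (j : Fin (n - 1)) :
    len (w * s j) < len w ↔ Desc j w⁻¹ := by
  rw [← len_inv, ← len_inv w, mul_inv_rev, s_inv, len_s_mul_lt_iff]

end Length

/-! ### The generic Iwahori--Hecke algebra -/

/-- The ring `ℤ[v, v⁻¹]`. -/
abbrev A : Type := ℤ[T;T⁻¹]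

/-- The indeterminate `v` to the power `k`. -/
abbrev v (k : ℤ) : A := LaurentPolynomial.T k

/-- The generic Iwahori--Hecke algebra of the symmetric group: the free `A`-module with a basis
`T w` indexed by permutations. It becomes a ring below, in which
`T (s i) * T w` is `T (s i * w)` or `T (s i * w) + (v - v⁻¹) • T w`,
see `Hecke.T_s_mul_of_lt` and `Hecke.T_s_mul_of_gt`. -/
def Hecke (n : ℕ) : Type := Perm (Fin n) →₀ A

namespace Hecke

variable {n : ℕ}

instance : AddCommGroup (Hecke n) := inferInstanceAs (AddCommGroup (Perm (Fin n) →₀ A))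
instance : Module A (Hecke n) := inferInstanceAs (Module A (Perm (Fin n) →₀ A))

/-- The standard basis `T w`. -/
def basis (n : ℕ) : Module.Basis (Perm (Fin n)) A (Hecke n) := ⟨LinearEquiv.refl A (Perm (Fin n) →₀ A)⟩

/-- The standard basis element `T w`. -/
def T (w : Perm (Fin n)) : Hecke n := basis n w

/-- The operator `T w ↦ T (s i) * T w`. -/
def leftOp (i : Fin (n - 1)) : Module.End A (Hecke n) :=
  (basis n).constr A fun w =>
    T (s i * w) + if len (s i * w) < len w then (v 1 - v (-1)) • T w else 0

/-- The operator `T w ↦ T w * T (s j)`. -/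
def rightOp (j : Fin (n - 1)) : Module.End A (Hecke n) :=
  (basis n).constr A fun w =>
    T (w * s j) + if len (w * s j) < len w then (v 1 - v (-1)) • T w else 0

theorem leftOp_T (i : Fin (n - 1)) (w : Perm (Fin n)) : leftOp i (T w) =
    T (s i * w) + if len (s i * w) < len w then (v 1 - v (-1)) • T w else 0 :=
  (basis n).constr_basis A _ w

theorem rightOp_T (j : Fin (n - 1)) (w : Perm (Fin n)) : rightOp j (T w) =
    T (w * s j) + if len (w * s j) < len w then (v 1 - v (-1)) • T w else 0 :=
  (basis n).constr_basis A _ w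

/-- Either `s i * w = w * s j`, or right multiplication by `s j` does not affect the left descent `i`
of `w` and left multiplication by `s i` does not affect the right descent `j` of `w`. -/
theorem desc_mul_s (i j : Fin (n - 1)) (w : Perm (Fin n)) :
    (s i * w = w * s j) ∨
      ((Desc i (w * s j) ↔ Desc i w) ∧ (Desc j (s i * w)⁻¹ ↔ Desc j w⁻¹)) := by
  by_cases h : s i * w = w * s j
  · exact Or.inl h
  refine Or.inr ⟨?_, ?_⟩
  · unfold Desc
    rw [mul_inv_rev, s_inv, Equiv.Perm.mul_apply, Equiv.Perm.mul_apply]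
    apply s_lt_s_iff
    · rintro ⟨h1, h2⟩
      apply h
      have h3 : w ⟨j, by omega⟩ = ⟨i + 1, by omega⟩ := by
        rw [← Equiv.Perm.eq_inv_iff_eq]; exact Fin.ext h1.symm
      have h4 : w ⟨j + 1, by omega⟩ = ⟨i, by omega⟩ := by
        rw [← Equiv.Perm.eq_inv_iff_eq]; exact Fin.ext h2.symm
      unfold s
      rw [Equiv.mul_swap_eq_swap_mul, h3, h4, Equiv.swap_comm]
    · rintro ⟨h1, h2⟩
      apply h
      have h3 : w ⟨j, by omega⟩ = ⟨i, by omega⟩ := by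
        rw [← Equiv.Perm.eq_inv_iff_eq]; exact Fin.ext h1.symm
      have h4 : w ⟨j + 1, by omega⟩ = ⟨i + 1, by omega⟩ := by
        rw [← Equiv.Perm.eq_inv_iff_eq]; exact Fin.ext h2.symm
      unfold s
      rw [Equiv.mul_swap_eq_swap_mul, h3, h4]
  · unfold Desc
    rw [inv_inv, inv_inv, Equiv.Perm.mul_apply, Equiv.Perm.mul_apply]
    apply s_lt_s_iff
    · rintro ⟨h1, h2⟩
      apply h
      have h3 : w ⟨j + 1, by omega⟩ = ⟨i, by omega⟩ := Fin.ext h1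
      have h4 : w ⟨j, by omega⟩ = ⟨i + 1, by omega⟩ := Fin.ext h2
      unfold s
      rw [Equiv.mul_swap_eq_swap_mul, h3, h4, Equiv.swap_comm]
    · rintro ⟨h1, h2⟩
      apply h
      have h3 : w ⟨j + 1, by omega⟩ = ⟨i + 1, by omega⟩ := Fin.ext h2
      have h4 : w ⟨j, by omega⟩ = ⟨i, by omega⟩ := Fin.ext h1
      unfold s
      rw [Equiv.mul_swap_eq_swap_mul, h3, h4]

theorem leftOp_rightOp_comm (i j : Fin (n - 1)) (h : Hecke n) :
    leftOp i (rightOp j h) = rightOp j (leftOp i h) := by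
  suffices e : leftOp i ∘ₗ rightOp j = rightOp j ∘ₗ leftOp (n := n) i from LinearMap.congr_fun e h
  refine (basis n).ext fun w => ?_
  change leftOp i (rightOp j (T w)) = rightOp j (leftOp i (T w))
  have d1 : Desc i (s i * w) ↔ ¬ Desc i w := desc_s_mul i w
  have d2 : Desc j (s j * w⁻¹) ↔ ¬ Desc j w⁻¹ := desc_s_mul j w⁻¹
  have hz : ∀ (p : Prop) [Decidable p] (f : Module.End A (Hecke n)) (x : Hecke n),
      f (if p then x else 0) = if p then f x else 0 := by
    intro p _ f x; split_ifs <;> simp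
  rw [rightOp_T, leftOp_T, map_add, map_add, hz, hz, map_smul, map_smul, leftOp_T, leftOp_T,
    rightOp_T, rightOp_T]
  classical
  simp only [← mul_assoc]
  have c1 : len (s i * w * s j) < len (w * s j) ↔ Desc i (w * s j) := by
    rw [mul_assoc]; exact len_s_mul_lt_iff _ _
  have c2 : len (s i * w * s j) < len (s i * w) ↔ Desc j (s i * w)⁻¹ := len_mul_s_lt_iff _ _
  simp only [c1, c2, len_s_mul_lt_iff, len_mul_s_lt_iff]
  generalize v 1 - v (-1) = q
  rcases desc_mul_s i j w with e | ⟨e1, e2⟩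
  · have f1 : Desc i (w * s j) ↔ ¬ Desc i w := by rw [← e]; exact d1
    have f2 : Desc j (s i * w)⁻¹ ↔ ¬ Desc j w⁻¹ := by
      rw [e, mul_inv_rev, s_inv]; exact d2
    have f3 : Desc i w ↔ Desc j w⁻¹ := by
      rw [← len_s_mul_lt_iff, ← len_mul_s_lt_iff, e]
    simp only [f1, f2, f3]
    simp only [e]
  · simp only [e1, e2]
    generalize T (s i * w * s j) = t1
    generalize T (s i * w) = t2
    generalize T (w * s j) = t3
    generalize T w = t4
    by_cases h1 : Desc j w⁻¹ <;> by_cases h2 : Desc i w <;>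
      simp only [h1, h2, if_true, if_false, smul_add, add_zero] <;> abel

/-- Induction on the length, removing a simple transposition on the left. -/
theorem induction_s {P : Perm (Fin n) → Prop} (h1 : P 1)
    (hs : ∀ i w, Desc i w → P (s i * w) → P w) (w : Perm (Fin n)) : P w := by
  induction h : inv w generalizing w with
  | zero =>
    by_cases hw : w = 1
    · exact hw ▸ h1
    · obtain ⟨i, hi⟩ := exists_desc w hw
      have := inv_s_mul_of_desc i w hi
      omega
  | succ k ih =>
    have hw : w ≠ 1 := by rintro rfl; rw [invCount_one] at h; omega
    obtain ⟨i, hi⟩ := exists_desc w hw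
    have := inv_s_mul_of_desc i w hi
    exact hs i w hi (ih (s i * w) (by omega))

theorem leftOp_of_desc (i : Fin (n - 1)) (w : Perm (Fin n)) (h : Desc i w) :
    leftOp i (T (s i * w)) = T w := by
  rw [leftOp_T, ← mul_assoc, s_mul_self, one_mul, if_neg, add_zero]
  exact not_lt.2 (le_of_lt ((len_s_mul_lt_iff i w).2 h))

theorem rightOp_of_desc (j : Fin (n - 1)) (w : Perm (Fin n)) (h : Desc j w⁻¹) :
    rightOp j (T (w * s j)) = T w := by
  rw [rightOp_T, mul_assoc, s_mul_self, mul_one, if_neg, add_zero]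
  exact not_lt.2 (le_of_lt ((len_mul_s_lt_iff w j).2 h))

/-- There is an operator commuting with all right multiplications and sending `T 1` to `T w`;
it is left multiplication by `T w`. -/
theorem exists_lmul (w : Perm (Fin n)) : ∃ f : Module.End A (Hecke n),
    (∀ j h, f (rightOp j h) = rightOp j (f h)) ∧ f (T 1) = T w := by
  induction w using induction_s with
  | h1 => exact ⟨LinearMap.id, fun _ _ => rfl, rfl⟩
  | hs i w hi ih =>
    obtain ⟨f, hf, hf1⟩ := ih
    refine ⟨leftOp i ∘ₗ f, fun j h => ?_, ?_⟩
    · rw [LinearMap.comp_apply, hf, leftOp_rightOp_comm, LinearMap.comp_apply]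
    · rw [LinearMap.comp_apply, hf1, leftOp_of_desc i w hi]

theorem ext_of_comm {f g : Module.End A (Hecke n)}
    (hf : ∀ j h, f (rightOp j h) = rightOp j (f h))
    (hg : ∀ j h, g (rightOp j h) = rightOp j (g h)) (h1 : f (T 1) = g (T 1)) : f = g := by
  refine (basis n).ext fun w => ?_
  change f (T w) = g (T w)
  suffices H : f (T w⁻¹⁻¹) = g (T w⁻¹⁻¹) by rwa [inv_inv] at H
  generalize w⁻¹ = u
  induction u using induction_s with
  | h1 => simpa using h1
  | hs j u hj ih =>
    have e : rightOp j (T (u⁻¹ * s j)) = T u⁻¹ := rightOp_of_desc j u⁻¹ (by rwa [inv_inv])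
    rw [mul_inv_rev, s_inv] at ih
    rw [← e, hf, hg, ih]

/-- Left multiplication, as an operator depending linearly on the left factor. -/
def lmul (n : ℕ) : Hecke n →ₗ[A] Module.End A (Hecke n) :=
  (basis n).constr A fun w => (exists_lmul w).choose

theorem lmul_T_comm (w : Perm (Fin n)) (j : Fin (n - 1)) (h : Hecke n) :
    lmul n (T w) (rightOp j h) = rightOp j (lmul n (T w) h) := by
  rw [show lmul n (T w) = _ from (basis n).constr_basis A _ w]
  exact (exists_lmul w).choose_spec.1 j h

theorem lmul_comm (x : Hecke n) (j : Fin (n - 1)) (h : Hecke n) :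
    lmul n x (rightOp j h) = rightOp j (lmul n x h) := by
  suffices e : (LinearMap.applyₗ (rightOp j h)) ∘ₗ lmul n =
      (rightOp j) ∘ₗ (LinearMap.applyₗ h) ∘ₗ lmul n from LinearMap.congr_fun e x
  exact (basis n).ext fun w => lmul_T_comm w j h

theorem lmul_T_one (x : Hecke n) : lmul n x (T 1) = x := by
  suffices e : (LinearMap.applyₗ (T 1)) ∘ₗ lmul n = LinearMap.id from LinearMap.congr_fun e x
  refine (basis n).ext fun w => ?_
  change lmul n (T w) (T 1) = T w
  rw [show lmul n (T w) = _ from (basis n).constr_basis A _ w]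
  exact (exists_lmul w).choose_spec.2

theorem lmul_one : lmul n (T 1) = LinearMap.id :=
  ext_of_comm (lmul_comm _) (fun _ _ => rfl) (lmul_T_one _)

theorem lmul_lmul (x y : Hecke n) : lmul n (lmul n x y) = lmul n x ∘ₗ lmul n y := by
  refine ext_of_comm (lmul_comm _) (fun j h => ?_) ?_
  · rw [LinearMap.comp_apply, lmul_comm, lmul_comm, LinearMap.comp_apply]
  · rw [LinearMap.comp_apply, lmul_T_one, lmul_T_one]

theorem lmul_T_s (i : Fin (n - 1)) : lmul n (T (s i)) = leftOp i := by
  refine ext_of_comm (lmul_comm _) (fun j h => leftOp_rightOp_comm i j h) ?_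
  rw [lmul_T_one, leftOp_T, mul_one, if_neg, add_zero]
  rw [len_eq_inv (1 : Perm (Fin n)), invCount_one]
  omega

instance : Ring (Hecke n) :=
  { (inferInstance : AddCommGroup (Hecke n)) with
    mul := fun x y => lmul n x y
    one := T 1
    mul_assoc := fun x y z => LinearMap.congr_fun (lmul_lmul x y) z
    one_mul := fun x => LinearMap.congr_fun lmul_one x
    mul_one := fun x => lmul_T_one x
    left_distrib := fun x y z => map_add (lmul n x) y z
    right_distrib := fun x y z => by
      change lmul n (x + y) z = lmul n x z + lmul n y z
      rw [map_add, LinearMap.add_apply]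
    zero_mul := fun x => by
      change lmul n 0 x = 0
      rw [map_zero, LinearMap.zero_apply]
    mul_zero := fun x => map_zero (lmul n x) }

instance : Algebra A (Hecke n) :=
  Algebra.ofModule
    (fun a x y => by
      change lmul n (a • x) y = a • lmul n x y
      rw [map_smul, LinearMap.smul_apply])
    (fun a x y => map_smul (lmul n x) a y)

theorem T_one : (T 1 : Hecke n) = 1 := rfl

theorem T_s_mul_of_lt (i : Fin (n - 1)) (w : Perm (Fin n)) (h : len (s i * w) = len w + 1) :
    T (s i) * T w = T (s i * w) := by
  change lmul n (T (s i)) (T w) = _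
  rw [lmul_T_s, leftOp_T, if_neg (by omega), add_zero]

theorem T_s_mul_of_gt (i : Fin (n - 1)) (w : Perm (Fin n)) (h : len (s i * w) + 1 = len w) :
    T (s i) * T w = T (s i * w) + (v 1 - v (-1)) • T w := by
  change lmul n (T (s i)) (T w) = _
  rw [lmul_T_s, leftOp_T, if_pos (by omega)]

/-- The coefficient of `T w` in `h`. -/
def coeff (h : Hecke n) (w : Perm (Fin n)) : A := (basis n).repr h w

end Hecke

/-! ### Kazhdan--Lusztig bases -/

section KL

variable {n : ℕ}

open Hecke

/-- The sign `(-1) ^ len w`. -/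
def eps (w : Perm (Fin n)) : ℤ := (-1) ^ len w

/-- The ring involution `∑ a_w T_w ↦ ∑ eps w • (a_w with v replaced by v⁻¹) T_w`. -/
def jInv (h : Hecke n) : Hecke n :=
  ∑ w, (eps w • LaurentPolynomial.invert (coeff h w)) • T w

/-- The bar involution `∑ a_w T_w ↦ ∑ (a_w with v replaced by v⁻¹) (T_{w⁻¹})⁻¹`. -/
def bar (h : Hecke n) : Hecke n :=
  ∑ w, LaurentPolynomial.invert (coeff h w) • Ring.inverse (T w⁻¹)

/-- `v ℤ[v]`. -/
def APos : Set A := {f | ∀ k : ℤ, k ≤ 0 → f.coeff k = 0}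

/-- `v⁻¹ ℤ[v⁻¹]`. -/
def ANeg : Set A := {f | ∀ k : ℤ, 0 ≤ k → f.coeff k = 0}

/-- The Kazhdan--Lusztig basis element `C'_w`: the unique bar-invariant element that is congruent to
`T_w` modulo combinations of the `T_y` with coefficients in `v⁻¹ ℤ[v⁻¹]`. -/
def CPrime (w : Perm (Fin n)) : Hecke n :=
  Classical.epsilon fun c : Hecke n => bar c = c ∧ ∀ y, coeff (c - T w) y ∈ ANeg

/-- The Kazhdan--Lusztig basis element `C_w`. -/
def C (w : Perm (Fin n)) : Hecke n := eps w • jInv (CPrime w)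

end KL

/-! ### Partitions, Young subgroups and tableaux -/

section Tableaux

variable {n : ℕ}

/-- The parts of a partition, in weakly decreasing order. -/
def rows (lam : n.Partition) : List ℕ := lam.parts.sort (· ≥ ·)

/-- The sum of the `k` largest parts. -/
def partialSum (lam : n.Partition) (k : ℕ) : ℕ := ((rows lam).take k).sum

/-- The dominance order: `mu` dominates `lam`. -/
def Dom (lam mu : n.Partition) : Prop := ∀ k, partialSum lam k ≤ partialSum mu k

/-- `mu` strictly dominates `lam`. -/
def SDom (lam mu : n.Partition) : Prop := Dom lam mu ∧ lam ≠ mu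

/-- The Young subgroup of `lam`, generated by the transpositions `(k, k+1)` of `1, …, n` for which
`k` is not a partial sum of `lam` (here `k = i + 1`, since `Fin n` starts at `0`). -/
def young (lam : n.Partition) : Subgroup (Perm (Fin n)) :=
  Subgroup.closure {u | ∃ i : Fin (n - 1), (∀ k, partialSum lam k ≠ i + 1) ∧ u = s i}

/-- The unique longest element of the Young subgroup. -/
def wLong (lam : n.Partition) : Perm (Fin n) :=
  Classical.epsilon fun w => w ∈ young lam ∧ ∀ u ∈ young lam, len u ≤ len w

/-- The boxes of the Young diagram: a row number and a column number in that row. -/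
abbrev Cell (lam : n.Partition) : Type :=
  (i : Fin (rows lam).length) × Fin ((rows lam).get i)

theorem sum_rows (lam : n.Partition) : ∑ i, (rows lam).get i = n := by
  rw [Fin.sum_univ_def, ← List.ofFn_eq_map, List.ofFn_get, rows, ← Multiset.sum_coe,
    Multiset.sort_eq, lam.parts_sum]

/-- The tableau in which `0, …, n - 1` are entered row by row. -/
def rowTableau (lam : n.Partition) : Cell lam ≃ Fin n :=
  finSigmaFinEquiv.trans (finCongr (sum_rows lam))

/-- A tableau is standard if its entries increase along rows and down columns. -/
def IsStandard {lam : n.Partition} (t : Cell lam ≃ Fin n) : Prop :=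
  (∀ b c : Cell lam, b.1 = c.1 → (b.2 : ℕ) < c.2 → t b < t c) ∧
    ∀ b c : Cell lam, b.1 < c.1 → (b.2 : ℕ) = c.2 → t b < t c

/-- Standard tableaux of shape `lam`. -/
abbrev StdTableau (lam : n.Partition) : Type := {t : Cell lam ≃ Fin n // IsStandard t}

/-- The permutation `d` such that `t` arises from the row tableau by applying `d` to its entries. -/
def dPerm {lam : n.Partition} (t : StdTableau lam) : Perm (Fin n) :=
  (rowTableau lam).symm.trans t.1

theorem dPerm_rowTableau {lam : n.Partition} (t : StdTableau lam) (c : Cell lam) :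
    dPerm t (rowTableau lam c) = t.1 c := by simp [dPerm]

end Tableaux

/-! ### The Murphy basis -/

section Murphy

variable {n : ℕ}

open Hecke
open scoped Classical in
/-- `x_lam`, the sum of `v ^ len w • T w` over the Young subgroup. -/
def xSum (lam : n.Partition) : Hecke n :=
  ∑ w with w ∈ young lam, v (len w) • T w

open scoped Classical in
/-- The Poincaré polynomial of the Young subgroup. -/
def poincare (lam : n.Partition) : A := ∑ w with w ∈ young lam, v (2 * len w)

/-- The Murphy basis element `x_{st}`. -/
def murphyX {lam : n.Partition} (a b : StdTableau lam) : Hecke n :=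
  T (dPerm a) * xSum lam * T (dPerm b)⁻¹

/-- The twisted Murphy basis element `ỹ_{st}`. -/
def murphyY {lam : n.Partition} (a b : StdTableau lam) : Hecke n :=
  T (dPerm a) * C (wLong lam) * T (dPerm b)⁻¹

/-- The span of the `ỹ_{st}` for standard tableaux of shapes strictly dominating `lam`. -/
def NHat (lam : n.Partition) : Submodule A (Hecke n) :=
  Submodule.span A {h | ∃ mu : n.Partition, SDom lam mu ∧ ∃ a b : StdTableau mu, h = murphyY a b}

end Murphy

/-! ### Irreducible representations over `ℝ(v)` and leading matrix coefficients -/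

/-- The field `ℝ(v)`. -/
abbrev K : Type := RatFunc ℝ

/-- The embedding of `ℤ[v, v⁻¹]` into `ℝ(v)`. -/
instance : Algebra A K :=
  (LaurentPolynomial.eval₂ (Int.castRingHom K) (Units.mk0 RatFunc.X RatFunc.X_ne_zero)).toAlgebra

/-- The Iwahori--Hecke algebra with scalars extended to `ℝ(v)`. -/
abbrev HK (n : ℕ) : Type := K ⊗[A] Hecke n

/-- The canonical map from the generic Iwahori--Hecke algebra to its scalar extension. -/
def toHK {n : ℕ} : Hecke n →ₐ[A] HK n := Algebra.TensorProduct.includeRight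

/-- The constant term of a rational function without pole at `0`. -/
def constTerm (f : K) : ℝ := f.eval (RingHom.id ℝ) 0

section Rep

variable {n : ℕ}

open Hecke

/-- A matrix representation is irreducible if it is non-zero and has no proper non-zero
invariant subspace. -/
def IsIrreducible {d : ℕ} (ρ : HK n →ₐ[K] Matrix (Fin d) (Fin d) K) : Prop :=
  0 < d ∧ ∀ U : Submodule K (Fin d → K), (∀ h, ∀ u ∈ U, ρ h *ᵥ u ∈ U) → U = ⊥ ∨ U = ⊤

/-- The character of a matrix representation. -/
def character {d : ℕ} (ρ : HK n →ₐ[K] Matrix (Fin d) (Fin d) K) (h : HK n) : K := (ρ h).trace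

/-- The left ideal generated by the kernel of the sign representation
`T w ↦ (-1) ^ len w * v ^ (-len w)` of the parabolic subalgebra of the Young subgroup. -/
def signIdeal (lam : n.Partition) : Submodule (HK n) (HK n) :=
  Submodule.span (HK n)
    {h | ∃ w ∈ young lam, h = toHK (T w - (eps w • v (-(len w : ℤ))) • (1 : Hecke n))}

/-- The character of the representation induced from the sign representation `ε` of the parabolic
subalgebra `H'` of the Young subgroup. The induced module `H ⊗ ε` over `H'` is `H` modulo the left
ideal generated by the kernel of `ε`. -/
def indSignChar (lam : n.Partition) (h : HK n) : K :=
  LinearMap.trace K (HK n ⧸ signIdeal lam) (Algebra.lsmul K K (HK n ⧸ signIdeal lam) h)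

/-- Irreducible matrix representations affording the irreducible characters `χ_lam` of `HK n`,
where `lam` runs over the partitions of `n`. The labelling is the one in which the induced sign
character of the Young subgroup of `lam` is the sum of `χ_lam` and of characters `χ_mu` with
`mu` strictly dominating `lam`. -/
structure IrrFamily (n : ℕ) where
  /-- the degrees -/
  deg : n.Partition → ℕ
  /-- the representations -/
  rep : ∀ lam, HK n →ₐ[K] Matrix (Fin (deg lam)) (Fin (deg lam)) K
  irreducible : ∀ lam, IsIrreducible (rep lam)
  injective : ∀ lam mu, character (rep lam) = character (rep mu) → lam = mu
  exhaustive : ∀ (d : ℕ) (ρ : HK n →ₐ[K] Matrix (Fin d) (Fin d) K), IsIrreducible ρ →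
    ∃ lam, character (rep lam) = character ρ
  labelling : ∀ lam, ∃ m : n.Partition → ℕ, (∀ mu, m mu ≠ 0 → SDom lam mu) ∧
    ∀ h, indSignChar lam h = character (rep lam) h + ∑ mu, m mu * character (rep mu) h

namespace IrrFamily

variable (F : IrrFamily n)

/-- The Schur elements `c_lam`, determined by the decomposition `τ = ∑ (1 / c_lam) χ_lam` of the
symmetrizing trace `τ` with `τ (T 1) = 1` and `τ (T w) = 0` for `w ≠ 1`. -/
def schur : n.Partition → K :=
  Classical.epsilon fun c : n.Partition → K => (∀ lam, c lam ≠ 0) ∧ ∀ w : Perm (Fin n),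
    (if w = 1 then 1 else 0) = ∑ lam, (c lam)⁻¹ * character (F.rep lam) (toHK (T w))

/-- The `a`-invariant of `χ_lam`: the Schur element is `r * v ^ (-2 * a)` plus a combination of higher
powers of `v`, with `r` a positive real number. -/
def aInv (lam : n.Partition) : ℕ :=
  Classical.epsilon fun a : ℕ => ∃ r : ℝ, 0 < r ∧ ∃ q : ℝ[X],
    RatFunc.X ^ (2 * a) * F.schur lam = algebraMap ℝ[X] K (Polynomial.C r + Polynomial.X * q)

/-- The leading matrix coefficients: `(-1) ^ len w` times the constant term of the `(i, j)` entry of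
`v ^ a • ρ (T w)`. -/
def lead (lam : n.Partition) (i j : Fin (F.deg lam)) (w : Perm (Fin n)) : ℝ :=
  eps w * constTerm (RatFunc.X ^ F.aInv lam * F.rep lam (toHK (T w)) i j)

end IrrFamily

/-- A choice, for every partition `lam` of `n`, of an orthogonal representation affording `χ_lam` with
integral leading matrix coefficients, normalized such that the leading matrix coefficient of the
longest element of the Young subgroup at the first diagonal position is non-zero. -/
structure OrthFamily (n : ℕ) extends IrrFamily n where
  orthogonal : ∀ lam, ∃ p : Fin (deg lam) → ℝ[X], (∀ i, (p i).coeff 0 = 1) ∧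
    ∀ w : Perm (Fin n), rep lam (toHK (T w⁻¹)) =
      (Matrix.diagonal fun i => algebraMap ℝ[X] K (p i))⁻¹ * (rep lam (toHK (T w)))ᵀ *
        Matrix.diagonal fun i => algebraMap ℝ[X] K (p i)
  integral : ∀ lam i j w, ∃ m : ℤ, toIrrFamily.lead lam i j w = m
  normalized : ∀ lam, toIrrFamily.lead lam ⟨0, (irreducible lam).1⟩ ⟨0, (irreducible lam).1⟩
    (wLong lam) ≠ 0

namespace OrthFamily

variable (F : OrthFamily n)

/-- The first index. -/
def first (lam : n.Partition) : Fin (F.deg lam) := ⟨0, (F.irreducible lam).1⟩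

/-- The set of all `w` with some non-zero leading matrix coefficient at `lam`. The statement
`lam_w = lam` means that `w` belongs to this set. -/
def R (lam : n.Partition) : Set (Perm (Fin n)) := {w | ∃ i j, F.lead lam i j w ≠ 0}

/-- The unique permutation whose leading matrix coefficient at `lam`, `i`, `j` is non-zero. -/
def wElt (lam : n.Partition) (i j : Fin (F.deg lam)) : Perm (Fin n) :=
  Classical.epsilon fun w => F.lead lam i j w ≠ 0

/-- The permutation `x_i` determined by `w_lam (i, 1) = x_i * w_lam`. -/
def xElt (lam : n.Partition) (i : Fin (F.deg lam)) : Perm (Fin n) :=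
  F.wElt lam i (F.first lam) * (wLong lam)⁻¹

/-- The element `Z_w` for `w = w_lam (i, j)`. -/
def Z (lam : n.Partition) (i j : Fin (F.deg lam)) : HK n :=
  (algebraMap A K (poincare lam))⁻¹ • toHK ((eps (wLong lam) • v (len (wLong lam))) •
    (C (F.xElt lam i * wLong lam) * C (wLong lam * (F.xElt lam j)⁻¹)))

/-- The signs `η_w`, determined by `η_w C_w ∈ Z_w + NHat lam` for `w = w_lam (i, j)`. -/
def IsEta (η : Perm (Fin n) → ℤ) : Prop :=
  (∀ w, η w = 1 ∨ η w = -1) ∧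
    ∀ lam i j, ∃ u ∈ NHat lam,
      toHK (η (F.wElt lam i j) • C (F.wElt lam i j)) = F.Z lam i j + toHK u

/-- `h` is the sum of `c • B w`, a combination of elements `B y` with `lam_y = lam` and with
coefficients in `V`, and an `A`-combination of elements `B y` with `lam_y` strictly dominating
`lam`. -/
def HasExpansion (B : Perm (Fin n) → Hecke n) (V : Set A) (lam : n.Partition)
    (h : Hecke n) (c : ℤ) (w : Perm (Fin n)) : Prop :=
  ∃ f g : Perm (Fin n) → A,
    (∀ y, f y ∈ V ∧ (f y ≠ 0 → y ∈ F.R lam)) ∧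
    (∀ y, g y ≠ 0 → ∃ mu, SDom lam mu ∧ y ∈ F.R mu) ∧
    h = c • B w + ∑ y, f y • B y + ∑ y, g y • B y

end OrthFamily

end Rep

end

end KLMurphy

namespace KLMurphy

noncomputable section

open Hecke

variable {n : ℕ}

/-! ### Multiplication in the Hecke algebra -/

/-! The element `C w` is bar-invariant and equals `T w` up to a `v ℤ[v]`-combination of other `T y`.
Hence `v ^ a(λ)` times the matrix of `C w` in `χ_λ` is regular at `v = 0`, with the same constant
term as for `T w`, namely `low`. The Schur relations turn into orthogonality relations for these
constant terms. They are integers, and the Schur elements have leading coefficient 1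
(`schurLead_eq_one`), so each position `(λ, i, j)` belongs to exactly one permutation, with value
`±1`. Since the squares of the degrees sum to `n!`, this is a bijection (`wElt_bijective`).
Consequently an element whose scaled matrices are all regular at 0 has coefficients in `ℤ[v]` with
respect to the `C y`, and the constant terms of these coefficients are read off from the matrices
(`ccoeff_of_rep_mem`).

The anchor is `C (wLong lam)`. By the labelling it acts non-trivially in `χ_λ` and otherwise only in
`χ_ν` with `λ ◁ ν`. In `χ_λ` it has rank one, because sign vectors for the rows and symmetric
vectors for the columns of the diagram are linked by a single element `zElt`, up to scalars. Its
trace gives `a(λ) = l(w_λ)`, and integrality places its only leading coefficient at position `(1,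
1)`. Write `C (x * wLong lam) = factor lam x * C (wLong lam)`. Then `Z` becomes `zInt`, the product
of `factor lam x`, `C (wLong lam)` and `flip (factor lam y)`, which is integral and bar-invariant.
For `x = x_i`, `y = x_j` its leading matrix in `χ_λ` is `±` the matrix unit `(i, j)`. Coefficients
that are bar-invariant and lie in `ℤ[v]` are integers, so `Z` is `±C w` modulo `upIdeal lam`, the
ideal of elements acting only in `χ_ν` with `λ ◁ ν` (`cell_aux`).

The passage from `T d` to `factor lam x` is unitriangular with off-diagonal entries in `v ℤ[v]`.
Expanding both factors `T` of a Murphy element therefore gives one `zInt` with coefficient 1 and the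
others with coefficients in `v ℤ[v]`, and only pairs `(x_i, x_j)` survive modulo `upIdeal lam`.

It remains to identify the `x_i` with the `d(s)` of standard tableaux. The `x_i` are closed under
suffixes and contain the permutation of the column reading tableau, from which every standard
tableau is reached (`exists_xElt_of_isStd`). Conversely, a shortest non-standard `x_i` would yield
blocks violating the counting bound for transversals of the columns (`exists_blocks`, `isStd_xElt`).
Inverting the triangular relation gives `upIdeal lam ≤ NHat lam`, and `jInv` transports everything
to `CPrime` and `murphyX`. -/

theorem len_s_mul_of_desc {i : Fin (n - 1)} {w : Perm (Fin n)} (h : Desc i w) :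
    len (s i * w) + 1 = len w := by
  rw [len_eq_inv, len_eq_inv, inv_s_mul_of_desc i w h]

theorem len_s_mul_of_not_desc {i : Fin (n - 1)} {w : Perm (Fin n)} (h : ¬ Desc i w) :
    len (s i * w) = len w + 1 := by
  rw [len_eq_inv, len_eq_inv, inv_s_mul_of_not_desc i w h]

theorem len_mul_s_of_desc {j : Fin (n - 1)} {w : Perm (Fin n)} (h : Desc j w⁻¹) :
    len (w * s j) + 1 = len w := by
  rw [← len_inv (w * s j), ← len_inv w, mul_inv_rev, s_inv, len_s_mul_of_desc h]

theorem len_mul_s_of_not_desc {j : Fin (n - 1)} {w : Perm (Fin n)} (h : ¬ Desc j w⁻¹) :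
    len (w * s j) = len w + 1 := by
  rw [← len_inv (w * s j), ← len_inv w, mul_inv_rev, s_inv, len_s_mul_of_not_desc h]

theorem desc_mul_s_inv (j : Fin (n - 1)) (w : Perm (Fin n)) :
    Desc j (w * s j)⁻¹ ↔ ¬ Desc j w⁻¹ := by
  rw [mul_inv_rev, s_inv, desc_s_mul]

theorem s_mul_s_mul (i : Fin (n - 1)) (w : Perm (Fin n)) : s i * (s i * w) = w := by
  rw [← mul_assoc, s_mul_self, one_mul]

theorem mul_s_mul_s (w : Perm (Fin n)) (i : Fin (n - 1)) : w * s i * s i = w := by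
  rw [mul_assoc, s_mul_self, mul_one]

theorem not_desc_one (i : Fin (n - 1)) : ¬ Desc i (1 : Perm (Fin n)) := by
  simp [Desc, Fin.lt_def]

theorem len_one : len (1 : Perm (Fin n)) = 0 := by rw [len_eq_inv, invCount_one]

theorem len_eq_zero {w : Perm (Fin n)} (h : len w = 0) : w = 1 := by
  by_contra hw
  obtain ⟨i, hi⟩ := exists_desc w hw
  have := len_s_mul_of_desc hi
  omega

/-- The parameter `v - v⁻¹`. -/
abbrev qv : A := v 1 - v (-1)

theorem T_s_mul_T_of_desc {i : Fin (n - 1)} {w : Perm (Fin n)} (h : Desc i w) :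
    T (s i) * T w = T (s i * w) + qv • T w := T_s_mul_of_gt i w (len_s_mul_of_desc h)

theorem T_s_mul_T_of_not_desc {i : Fin (n - 1)} {w : Perm (Fin n)} (h : ¬ Desc i w) :
    T (s i) * T w = T (s i * w) := T_s_mul_of_lt i w (len_s_mul_of_not_desc h)

/-- The product is defined through left multiplications, which commute with every `rightOp j`.
Comparing values at `T 1` identifies right multiplication by a generator. -/
theorem mul_T_s (x : Hecke n) (j : Fin (n - 1)) : x * T (s j) = rightOp j x := by
  have e : rightOp j (T 1) = T (s j) := by
    rw [rightOp_T, one_mul, if_neg, add_zero]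
    rw [len_one]; omega
  rw [← e]
  change lmul n x (rightOp j (T 1)) = _
  rw [lmul_comm, lmul_T_one]

theorem T_mul_T_s_of_desc {j : Fin (n - 1)} {w : Perm (Fin n)} (h : Desc j w⁻¹) :
    T w * T (s j) = T (w * s j) + qv • T w := by
  rw [mul_T_s, rightOp_T, if_pos ((len_mul_s_lt_iff w j).2 h)]

theorem T_mul_T_s_of_not_desc {j : Fin (n - 1)} {w : Perm (Fin n)} (h : ¬ Desc j w⁻¹) :
    T w * T (s j) = T (w * s j) := by
  rw [mul_T_s, rightOp_T, if_neg (fun h' => h ((len_mul_s_lt_iff w j).1 h')), add_zero]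

theorem T_eq_s_mul {i : Fin (n - 1)} {w : Perm (Fin n)} (h : Desc i w) :
    T w = T (s i) * T (s i * w) := by
  rw [T_s_mul_T_of_not_desc (fun h' => (desc_s_mul i w).1 h' h), s_mul_s_mul]

theorem T_eq_mul_s {j : Fin (n - 1)} {w : Perm (Fin n)} (h : Desc j w⁻¹) :
    T w = T (w * s j) * T (s j) := by
  rw [T_mul_T_s_of_not_desc (fun h' => (desc_mul_s_inv j w).1 h' h), mul_s_mul_s]

theorem T_s_mul_T_s (i : Fin (n - 1)) : T (s i) * T (s i) = 1 + qv • T (s i) := by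
  have h : Desc i (s i) := by
    have := (desc_s_mul i 1).2 (not_desc_one i)
    rwa [mul_one] at this
  rw [T_s_mul_T_of_desc h, s_mul_self, T_one]

theorem induction_mul_s {P : Perm (Fin n) → Prop} (h1 : P 1)
    (hs : ∀ j w, Desc j w⁻¹ → P (w * s j) → P w) (w : Perm (Fin n)) : P w := by
  rw [← inv_inv w]
  generalize w⁻¹ = u
  induction u using induction_s with
  | h1 => simpa using h1
  | hs i u hi ih =>
    refine hs i u⁻¹ (by rwa [inv_inv]) ?_
    rwa [mul_inv_rev, s_inv] at ih

theorem len_mul_le (x y : Perm (Fin n)) : len (x * y) ≤ len x + len y := by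
  induction x using induction_s with
  | h1 => simp
  | hs i w hi ih =>
    have h1 := len_s_mul_of_desc hi
    have h2 : len (w * y) ≤ len (s i * w * y) + 1 := by
      rw [mul_assoc]
      by_cases h : Desc i (w * y)
      · have := len_s_mul_of_desc h; omega
      · have := len_s_mul_of_not_desc h; omega
    omega

theorem T_mul_T_of_len {x y : Perm (Fin n)} (h : len (x * y) = len x + len y) :
    T x * T y = T (x * y) := by
  induction x using induction_s with
  | h1 => rw [T_one, one_mul, one_mul]
  | hs i w hi ih =>
    have h1 := len_s_mul_of_desc hi
    have h2 := len_mul_le (s i * w) y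
    have hd : Desc i (w * y) := by
      rw [← len_s_mul_lt_iff, ← mul_assoc]; omega
    have h3 := len_s_mul_of_desc hd
    rw [T_eq_s_mul hi, mul_assoc, ih (by rw [mul_assoc]; omega), mul_assoc, ← T_eq_s_mul hd]

theorem induction_T {P : Hecke n → Prop} (hT : ∀ w, P (T w)) (hadd : ∀ x y, P x → P y → P (x + y))
    (hsmul : ∀ (a : A) x, P x → P (a • x)) (h : Hecke n) : P h := by
  rw [← (basis n).sum_repr h]
  refine Finset.sum_induction _ P hadd ?_ fun w _ => hsmul _ _ (hT w)
  simpa using hsmul 0 _ (hT 1)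

/-! ### Coordinates in the standard basis, semilinear maps and involutions -/

theorem coeff_add (x y : Hecke n) (w : Perm (Fin n)) :
    coeff (x + y) w = coeff x w + coeff y w := by simp [coeff]

theorem coeff_sub (x y : Hecke n) (w : Perm (Fin n)) :
    coeff (x - y) w = coeff x w - coeff y w := by simp [coeff]

theorem coeff_smul (a : A) (x : Hecke n) (w : Perm (Fin n)) :
    coeff (a • x) w = a * coeff x w := by simp [coeff]

theorem coeff_zero (w : Perm (Fin n)) : coeff (0 : Hecke n) w = 0 := by simp [coeff]

theorem coeff_sum {ι : Type*} (t : Finset ι) (f : ι → Hecke n) (w : Perm (Fin n)) :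
    coeff (∑ i ∈ t, f i) w = ∑ i ∈ t, coeff (f i) w := by
  simp [coeff, Finsupp.finsetSum_apply]

theorem coeff_T (x w : Perm (Fin n)) : coeff (T x) w = if x = w then 1 else 0 := by
  classical
  simp only [coeff, T, Module.Basis.repr_self, Finsupp.single_apply]

theorem sum_coeff_smul_T (h : Hecke n) : ∑ w, coeff h w • T w = h := (basis n).sum_repr h

theorem ext_coeff {x y : Hecke n} (h : ∀ w, coeff x w = coeff y w) : x = y :=
  (basis n).repr.injective (Finsupp.ext h)

/-- The automorphism of `ℤ[v, v⁻¹]` exchanging `v` and `v⁻¹`. -/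
abbrev barA : A →+* A := RingHomClass.toRingHom (LaurentPolynomial.invert : A ≃ₐ[ℤ] A)

theorem barA_v (k : ℤ) : barA (v k) = v (-k) := LaurentPolynomial.invert_T k

/-- The map that is semilinear for `barA` and has the given values at the standard basis. -/
def semi {R : Type*} [AddCommGroup R] [Module A R] (g : Perm (Fin n) → R) :
    Hecke n →ₛₗ[barA] R where
  toFun h := ∑ w, barA (coeff h w) • g w
  map_add' x y := by
    simp only [coeff_add, map_add, add_smul, Finset.sum_add_distrib]
  map_smul' a x := by
    simp only [coeff_smul, map_mul, mul_smul, Finset.smul_sum]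

theorem semi_T {R : Type*} [AddCommGroup R] [Module A R] (g : Perm (Fin n) → R)
    (w : Perm (Fin n)) : semi g (T w) = g w := by
  change ∑ u, barA (coeff (T w) u) • g u = g w
  simp only [coeff_T]
  rw [Finset.sum_eq_single w]
  · rw [if_pos rfl, map_one, one_smul]
  · intro u _ hu; rw [if_neg hu.symm, map_zero, zero_smul]
  · intro h; exact absurd (Finset.mem_univ _) h

/-- The `T (s i)` generate the algebra, so multiplicativity needs checking only for a generator
times a basis element. The criterion serves both semilinear involutions, and also the
anti-involution by taking `R` to be the opposite algebra. -/
theorem map_mul_of_T_s {σ : A →+* A} {R : Type*} [Ring R] [Algebra A R]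
    (φ : Hecke n →ₛₗ[σ] R) (h1 : φ 1 = 1)
    (h : ∀ i w, φ (T (s i) * T w) = φ (T (s i)) * φ (T w)) (x y : Hecke n) :
    φ (x * y) = φ x * φ y := by
  have hs : ∀ i y, φ (T (s i) * y) = φ (T (s i)) * φ y := by
    intro i y
    induction y using induction_T with
    | hT w => exact h i w
    | hadd x y hx hy => rw [mul_add, map_add, hx, hy, map_add, mul_add]
    | hsmul a x hx => rw [mul_smul_comm, map_smulₛₗ, hx, map_smulₛₗ, mul_smul_comm]
  induction x using induction_T with
  | hT w =>
    induction w using induction_s generalizing y with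
    | h1 => rw [T_one, h1, one_mul, one_mul]
    | hs i w hi ih => rw [T_eq_s_mul hi, mul_assoc, hs, ih, hs, mul_assoc]
  | hadd x z hx hz => rw [add_mul, map_add, hx, hz, map_add, add_mul]
  | hsmul a x hx => rw [smul_mul_assoc, map_smulₛₗ, hx, map_smulₛₗ, smul_mul_assoc]

/-- The anti-involution `T w ↦ T w⁻¹`. -/
def flip : Hecke n →ₗ[A] Hecke n := (basis n).constr A fun w => T w⁻¹

theorem flip_T (w : Perm (Fin n)) : flip (T w) = T w⁻¹ := (basis n).constr_basis A _ w

theorem flip_one : flip (1 : Hecke n) = 1 := by rw [← T_one, flip_T, inv_one]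

theorem flip_mul (x y : Hecke n) : flip (x * y) = flip y * flip x := by
  have := map_mul_of_T_s ((MulOpposite.opLinearEquiv A).toLinearMap ∘ₗ (flip (n := n)))
    (by simp [flip_one]) (fun i w => ?_) x y
  · simpa using congrArg MulOpposite.unop this
  · apply MulOpposite.unop_injective
    simp only [LinearMap.comp_apply, LinearEquiv.coe_coe, MulOpposite.coe_opLinearEquiv,
      MulOpposite.unop_op, MulOpposite.unop_mul]
    rw [flip_T, flip_T, s_inv]
    by_cases hd : Desc i w
    · rw [T_s_mul_T_of_desc hd, T_mul_T_s_of_desc (by rwa [inv_inv]), map_add, map_smul, flip_T,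
        flip_T, mul_inv_rev, s_inv]
    · rw [T_s_mul_T_of_not_desc hd, T_mul_T_s_of_not_desc (by rwa [inv_inv]), flip_T, mul_inv_rev,
        s_inv]

theorem flip_flip (x : Hecke n) : flip (flip x) = x := by
  induction x using induction_T with
  | hT w => rw [flip_T, flip_T, inv_inv]
  | hadd x y hx hy => rw [map_add, map_add, hx, hy]
  | hsmul a x hx => rw [map_smul, map_smul, hx]

theorem coeff_flip (x : Hecke n) (w : Perm (Fin n)) : coeff (flip x) w = coeff x w⁻¹ := by
  induction x using induction_T with
  | hT u =>
    rw [flip_T, coeff_T, coeff_T]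
    simp only [inv_eq_iff_eq_inv]
  | hadd x y hx hy => rw [map_add, coeff_add, hx, hy, coeff_add]
  | hsmul a x hx => rw [map_smul, coeff_smul, hx, coeff_smul]

theorem eps_one : eps (1 : Perm (Fin n)) = 1 := by simp [eps, len_one]

theorem eps_mul_self (w : Perm (Fin n)) : eps w * eps w = 1 := by
  rw [eps, ← mul_pow]; simp

theorem eps_inv (w : Perm (Fin n)) : eps w⁻¹ = eps w := by rw [eps, len_inv, eps]

theorem eps_s_mul (i : Fin (n - 1)) (w : Perm (Fin n)) : eps (s i * w) = - eps w := by
  unfold eps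
  by_cases h : Desc i w
  · rw [← len_s_mul_of_desc h, pow_succ]; simp
  · rw [len_s_mul_of_not_desc h, pow_succ]; simp

theorem eps_s (i : Fin (n - 1)) : eps (s i) = -1 := by simpa [eps_one] using eps_s_mul i 1

theorem eps_mul (x w : Perm (Fin n)) : eps (x * w) = eps x * eps w := by
  induction x using induction_s with
  | h1 => rw [one_mul, eps_one, one_mul]
  | hs i x hi ih => rw [mul_assoc, eps_s_mul, eps_s_mul] at ih; linarith

/-- The involution `jInv` as a semilinear map. -/
def jLin : Hecke n →ₛₗ[barA] Hecke n := semi fun w => eps w • T w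

theorem jLin_apply (h : Hecke n) : jLin h = jInv h := by
  change ∑ w, _ = ∑ w, _
  refine Finset.sum_congr rfl fun w _ => ?_
  rw [smul_comm, smul_assoc]
  rfl

theorem jInv_T (w : Perm (Fin n)) : jInv (T w) = eps w • T w := by
  rw [← jLin_apply]; exact semi_T _ w

theorem jInv_add (x y : Hecke n) : jInv (x + y) = jInv x + jInv y := by
  simp only [← jLin_apply, map_add]

theorem jInv_smul (a : A) (x : Hecke n) : jInv (a • x) = barA a • jInv x := by
  simp only [← jLin_apply, map_smulₛₗ]

theorem jInv_zsmul (a : ℤ) (x : Hecke n) : jInv (a • x) = a • jInv x := by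
  simp only [← jLin_apply, map_zsmul]

theorem jInv_sum {ι : Type*} (t : Finset ι) (f : ι → Hecke n) :
    jInv (∑ i ∈ t, f i) = ∑ i ∈ t, jInv (f i) := by
  simp only [← jLin_apply, map_sum]

theorem barA_qv : barA qv = - qv := by
  rw [map_sub, barA_v, barA_v]; simp

theorem barA_barA (a : A) : barA (barA a) = a := LaurentPolynomial.invert.left_inv a

theorem jInv_mul (x y : Hecke n) : jInv (x * y) = jInv x * jInv y := by
  simp only [← jLin_apply]
  refine map_mul_of_T_s jLin ?_ (fun i w => ?_) x y
  · rw [jLin_apply, ← T_one, jInv_T, eps_one, one_smul]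
  · simp only [jLin_apply, jInv_T, eps_s]
    rw [smul_mul_smul_comm]
    by_cases hd : Desc i w
    · rw [T_s_mul_T_of_desc hd, jInv_add, jInv_smul, jInv_T, jInv_T, eps_s_mul, barA_qv, smul_add,
        neg_one_mul, neg_smul qv, neg_smul (eps w), neg_smul (eps w), smul_comm]
    · rw [T_s_mul_T_of_not_desc hd, jInv_T, eps_s_mul, neg_one_mul]

theorem jInv_jInv (x : Hecke n) : jInv (jInv x) = x := by
  induction x using induction_T with
  | hT w => rw [jInv_T, jInv_zsmul, jInv_T, smul_smul, eps_mul_self, one_smul]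
  | hadd x y hx hy => rw [jInv_add, jInv_add, hx, hy]
  | hsmul a x hx => rw [jInv_smul, jInv_smul, hx, barA_barA]

theorem coeff_jInv (x : Hecke n) (w : Perm (Fin n)) :
    coeff (jInv x) w = eps w • barA (coeff x w) := by
  unfold jInv
  rw [coeff_sum, Finset.sum_eq_single w]
  · rw [coeff_smul, coeff_T, if_pos rfl, mul_one]; rfl
  · intro u _ hu; rw [coeff_smul, coeff_T, if_neg hu, mul_zero]
  · intro h; exact absurd (Finset.mem_univ _) h

/-- The inverse of `T (s i)`. -/
theorem T_s_mul_sub (i : Fin (n - 1)) : T (s i) * (T (s i) - qv • 1) = 1 := by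
  rw [mul_sub, T_s_mul_T_s, mul_smul_comm, mul_one, add_sub_cancel_right]

theorem T_s_sub_mul (i : Fin (n - 1)) : (T (s i) - qv • 1) * T (s i) = 1 := by
  rw [sub_mul, T_s_mul_T_s, smul_mul_assoc, one_mul, add_sub_cancel_right]

theorem isUnit_T (w : Perm (Fin n)) : IsUnit (T w) := by
  induction w using induction_s with
  | h1 => rw [T_one]; exact isUnit_one
  | hs i w hi ih =>
    rw [T_eq_s_mul hi]
    exact (isUnit_iff_exists.2 ⟨_, T_s_mul_sub i, T_s_sub_mul i⟩).mul ih

theorem inverse_eq_of_mul {x y : Hecke n} (h : x * y = 1) (h' : y * x = 1) :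
    Ring.inverse x = y :=
  Ring.inverse_unit ⟨x, y, h, h'⟩

theorem inverse_T_s_mul {i : Fin (n - 1)} {w : Perm (Fin n)} (h : Desc i w) :
    Ring.inverse (T w⁻¹) = (T (s i) - qv • 1) * Ring.inverse (T (s i * w)⁻¹) := by
  have e : T w⁻¹ = T (s i * w)⁻¹ * T (s i) := by
    rw [T_eq_mul_s (j := i) (w := w⁻¹) (by rwa [inv_inv]), mul_inv_rev, s_inv]
  have hu := isUnit_T (s i * w)⁻¹
  apply inverse_eq_of_mul
  · rw [e, mul_assoc, ← mul_assoc (T (s i)), T_s_mul_sub, one_mul, Ring.mul_inverse_cancel _ hu]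
  · rw [e, mul_assoc, ← mul_assoc (Ring.inverse _), Ring.inverse_mul_cancel _ hu, one_mul,
      T_s_sub_mul]

/-- The bar involution as a semilinear map. -/
def barLin : Hecke n →ₛₗ[barA] Hecke n := semi fun w => Ring.inverse (T w⁻¹)

theorem barLin_apply (h : Hecke n) : barLin h = bar h := rfl

theorem bar_T (w : Perm (Fin n)) : bar (T w) = Ring.inverse (T w⁻¹) := semi_T _ w

theorem bar_add (x y : Hecke n) : bar (x + y) = bar x + bar y := map_add barLin x y

theorem bar_sub (x y : Hecke n) : bar (x - y) = bar x - bar y := map_sub barLin x y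

theorem bar_smul (a : A) (x : Hecke n) : bar (a • x) = barA a • bar x := map_smulₛₗ barLin a x

theorem bar_sum {ι : Type*} (t : Finset ι) (f : ι → Hecke n) :
    bar (∑ i ∈ t, f i) = ∑ i ∈ t, bar (f i) := map_sum barLin f t

theorem bar_one : bar (1 : Hecke n) = 1 := by
  rw [← T_one, bar_T, inv_one, T_one]; exact Ring.inverse_one _

theorem bar_T_of_desc {i : Fin (n - 1)} {w : Perm (Fin n)} (h : Desc i w) :
    bar (T w) = (T (s i) - qv • 1) * bar (T (s i * w)) := by
  rw [bar_T, bar_T, inverse_T_s_mul h]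

theorem desc_s_self (i : Fin (n - 1)) : Desc i (s i) := by
  have := (desc_s_mul i 1).2 (not_desc_one i)
  rwa [mul_one] at this

theorem bar_T_s (i : Fin (n - 1)) : bar (T (s i)) = T (s i) - qv • 1 := by
  rw [bar_T_of_desc (desc_s_self i), s_mul_self, T_one, bar_one, mul_one]

theorem bar_mul (x y : Hecke n) : bar (x * y) = bar x * bar y := by
  refine map_mul_of_T_s barLin bar_one (fun i w => ?_) x y
  simp only [barLin_apply, bar_T_s]
  by_cases hd : Desc i w
  · rw [T_s_mul_T_of_desc hd, bar_add, bar_smul, barA_qv, bar_T_of_desc hd]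
    generalize bar (T (s i * w)) = b
    have : (T (s i) - qv • 1) * (T (s i) - qv • 1) = 1 - qv • (T (s i) - qv • 1 : Hecke n) := by
      rw [mul_sub, T_s_sub_mul, mul_smul_comm, mul_one]
    rw [← mul_assoc, this, sub_mul (1 : Hecke n), one_mul, smul_mul_assoc, neg_smul]
    exact (sub_eq_add_neg _ _).symm
  · have hd' : Desc i (s i * w) := (desc_s_mul i w).2 hd
    rw [T_s_mul_T_of_not_desc hd, bar_T_of_desc hd', s_mul_s_mul]

theorem bar_zsmul (a : ℤ) (x : Hecke n) : bar (a • x) = a • bar x := map_zsmul barLin a x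

theorem jInv_T_s_sub (i : Fin (n - 1)) :
    jInv (T (s i) - qv • (1 : Hecke n)) = -(T (s i) - qv • 1) := by
  rw [sub_eq_add_neg, ← neg_smul, jInv_add, jInv_smul, map_neg, barA_qv, ← T_one, jInv_T, jInv_T,
    eps_s, eps_one, one_smul, neg_one_smul, neg_neg, neg_add, ← neg_smul (-qv), neg_neg]

theorem jInv_bar_T (w : Perm (Fin n)) : jInv (bar (T w)) = eps w • bar (T w) := by
  induction w using induction_s with
  | h1 => rw [T_one, bar_one, ← T_one, jInv_T]
  | hs i w hi ih =>
    rw [eps_s_mul, neg_smul] at ih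
    rw [bar_T_of_desc hi, jInv_mul, ih, jInv_T_s_sub, mul_neg, neg_mul, neg_neg]
    exact mul_smul_comm _ _ _

theorem bar_jInv (x : Hecke n) : bar (jInv x) = jInv (bar x) := by
  induction x using induction_T with
  | hT w => rw [jInv_T, bar_zsmul, jInv_bar_T]
  | hadd x y hx hy => rw [jInv_add, bar_add, bar_add, jInv_add, hx, hy]
  | hsmul a x hx => rw [jInv_smul, bar_smul, bar_smul, jInv_smul, hx]

/-! ### Laurent polynomials without negative exponents -/

/-- The subring `ℤ[v]`. -/
def APlus : Subring A where
  carrier := {f | ∀ k : ℤ, k < 0 → f.coeff k = 0}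
  zero_mem' := fun _ _ => rfl
  one_mem' := fun k hk => by
    rw [← LaurentPolynomial.T_zero, LaurentPolynomial.T_apply, if_neg (by omega)]
  add_mem' := fun {f g} hf hg k hk => by
    rw [AddMonoidAlgebra.coeff_add, Finsupp.add_apply, hf k hk, hg k hk, add_zero]
  neg_mem' := fun {f} hf k hk => by
    rw [AddMonoidAlgebra.coeff_neg, Finsupp.neg_apply, hf k hk, neg_zero]
  mul_mem' := fun {f g} hf hg k hk => by
    rw [AddMonoidAlgebra.coeff_mul]
    refine Finset.sum_eq_zero fun a _ => Finset.sum_eq_zero fun b _ => ?_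
    dsimp only
    split_ifs with h
    · rcases lt_or_ge a 0 with ha | ha
      · rw [hf a ha, zero_mul]
      · rw [hg b (by omega), mul_zero]
    · rfl

theorem coeff_v_mul (m : ℤ) (f : A) (k : ℤ) : (v m * f).coeff k = f.coeff (k - m) := by
  have := AddMonoidAlgebra.coeff_single_mul_eq_mul_coeff (r := (1 : ℤ)) (m := m) (m₁ := k) (x := f)
    (k - m) (fun m' _ => by omega)
  rw [one_mul] at this
  exact this

theorem v_add (a b : ℤ) : v (a + b) = v a * v b := LaurentPolynomial.T_add a b

theorem v_zero : v 0 = 1 := LaurentPolynomial.T_zero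

theorem mem_APos_iff {f : A} : f ∈ APos ↔ ∃ g ∈ APlus, f = v 1 * g := by
  constructor
  · intro h
    refine ⟨v (-1) * f, fun k hk => ?_, ?_⟩
    · rw [coeff_v_mul]; exact h _ (by omega)
    · rw [← mul_assoc, ← v_add]; simp
  · rintro ⟨g, hg, rfl⟩ k hk
    rw [coeff_v_mul]; exact hg _ (by omega)

theorem APos_le {f : A} (h : f ∈ APos) : f ∈ APlus := fun k hk => h k (by omega)

theorem v_mem_APlus {k : ℤ} (hk : 0 ≤ k) : v k ∈ APlus := fun m hm => by
  rw [LaurentPolynomial.T_apply, if_neg (by omega)]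

theorem zero_mem_APos : (0 : A) ∈ APos := fun _ _ => rfl

theorem add_mem_APos {f g : A} (hf : f ∈ APos) (hg : g ∈ APos) : f + g ∈ APos := fun k hk => by
  rw [AddMonoidAlgebra.coeff_add, Finsupp.add_apply, hf k hk, hg k hk, add_zero]

theorem neg_mem_APos {f : A} (hf : f ∈ APos) : -f ∈ APos := fun k hk => by
  rw [AddMonoidAlgebra.coeff_neg, Finsupp.neg_apply, hf k hk, neg_zero]

theorem sub_mem_APos {f g : A} (hf : f ∈ APos) (hg : g ∈ APos) : f - g ∈ APos := by
  rw [sub_eq_add_neg]; exact add_mem_APos hf (neg_mem_APos hg)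

theorem mul_mem_APos {f g : A} (hf : f ∈ APlus) (hg : g ∈ APos) : f * g ∈ APos := by
  obtain ⟨g', hg', rfl⟩ := mem_APos_iff.1 hg
  exact mem_APos_iff.2 ⟨f * g', APlus.mul_mem hf hg', by ring⟩

theorem mul_mem_APos' {f g : A} (hf : f ∈ APos) (hg : g ∈ APlus) : f * g ∈ APos := by
  rw [mul_comm]; exact mul_mem_APos hg hf

theorem sum_mem_APos {ι : Type*} {t : Finset ι} {f : ι → A} (h : ∀ i ∈ t, f i ∈ APos) :
    ∑ i ∈ t, f i ∈ APos :=
  Finset.sum_induction f (· ∈ APos) (fun _ _ => add_mem_APos) zero_mem_APos h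

theorem v_mem_APos {k : ℤ} (hk : 0 < k) : v k ∈ APos := fun m hm => by
  rw [LaurentPolynomial.T_apply, if_neg (by omega)]

theorem coeff_intCast (a : ℤ) (k : ℤ) : ((a : ℤ) : A).coeff k = if k = 0 then a else 0 := by
  rw [← map_intCast (LaurentPolynomial.C : ℤ →+* A), LaurentPolynomial.C_apply]; rfl

theorem intCast_mem_APlus (a : ℤ) : ((a : ℤ) : A) ∈ APlus := intCast_mem APlus a

theorem sub_coeff_zero_mem_APos {f : A} (hf : f ∈ APlus) : f - ((f.coeff 0 : ℤ) : A) ∈ APos := by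
  intro k hk
  rw [AddMonoidAlgebra.coeff_sub, Finsupp.sub_apply, coeff_intCast]
  split_ifs with h
  · rw [h, sub_self]
  · rw [hf k (by omega), sub_zero]

/-- Exchanging `v` and `v⁻¹` reflects the coefficients, so without negative exponents there are no
positive ones either. -/
theorem eq_intCast_of_barA {f : A} (hf : f ∈ APlus) (h : barA f = f) :
    f = ((f.coeff 0 : ℤ) : A) := by
  refine LaurentPolynomial.ext fun k => ?_
  rw [coeff_intCast]
  have e : f.coeff (-k) = f.coeff k := by
    conv_rhs => rw [← h]
    exact (LaurentPolynomial.invert_apply f k).symm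
  rcases lt_trichotomy k 0 with hk | hk | hk
  · rw [if_neg hk.ne, hf k hk]
  · rw [if_pos hk, hk]
  · rw [if_neg hk.ne', ← e, hf _ (by omega)]

theorem eq_zero_of_barA {f : A} (hf : f ∈ APos) (h : barA f = f) : f = 0 := by
  rw [eq_intCast_of_barA (APos_le hf) h, hf 0 le_rfl, Int.cast_zero]

theorem barA_mem_ANeg {f : A} (hf : f ∈ APos) : barA f ∈ ANeg := fun k hk => by
  rw [show (barA f).coeff k = f.coeff (-k) from LaurentPolynomial.invert_apply f k]
  exact hf _ (by omega)

theorem barA_mem_APos {f : A} (hf : f ∈ ANeg) : barA f ∈ APos := fun k hk => by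
  rw [show (barA f).coeff k = f.coeff (-k) from LaurentPolynomial.invert_apply f k]
  exact hf _ (by omega)

theorem zsmul_mem_APos (a : ℤ) {f : A} (hf : f ∈ APos) : a • f ∈ APos := by
  rw [zsmul_eq_mul]; exact mul_mem_APos (intCast_mem_APlus a) hf

theorem zsmul_mem_ANeg (a : ℤ) {f : A} (hf : f ∈ ANeg) : a • f ∈ ANeg := by
  have := barA_mem_ANeg (zsmul_mem_APos a (barA_mem_APos hf))
  rwa [map_zsmul, barA_barA] at this

/-! ### Kazhdan--Lusztig bases -/

open scoped Classical in
theorem coeff_T_s_mul (i : Fin (n - 1)) (x : Hecke n) (y : Perm (Fin n)) :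
    coeff (T (s i) * x) y = coeff x (s i * y) + if Desc i y then qv * coeff x y else 0 := by
  induction x using induction_T with
  | hT w =>
    have e : s i * w = y ↔ w = s i * y :=
      ⟨fun h => by rw [← h, s_mul_s_mul], fun h => by rw [h, s_mul_s_mul]⟩
    by_cases h : Desc i w
    · rw [T_s_mul_T_of_desc h, coeff_add, coeff_smul, coeff_T, coeff_T, coeff_T]
      by_cases hy : w = y
      · subst hy; simp [h, e]
      · simp [hy, e]
    · rw [T_s_mul_T_of_not_desc h, coeff_T, coeff_T, coeff_T]
      by_cases hy : w = y
      · subst hy; simp [h, e]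
      · simp [hy, e]
  | hadd x z hx hz =>
    rw [mul_add, coeff_add, hx, hz, coeff_add, coeff_add]
    split_ifs <;> ring
  | hsmul a x hx =>
    rw [mul_smul_comm, coeff_smul, hx, coeff_smul, coeff_smul]
    split_ifs <;> ring

/-- Unitriangularity of the bar involution, measured by length instead of the Bruhat order. This
weaker form suffices for existence and uniqueness of the Kazhdan–Lusztig basis. -/
theorem coeff_bar_T (w : Perm (Fin n)) : coeff (bar (T w)) w = 1 ∧
    ∀ y, y ≠ w → coeff (bar (T w)) y ≠ 0 → len y < len w := by
  classical
  induction w using induction_s with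
  | h1 =>
    rw [T_one, bar_one, ← T_one]
    refine ⟨by rw [coeff_T, if_pos rfl], fun y hy h => ?_⟩
    rw [coeff_T, if_neg hy.symm] at h
    exact absurd rfl h
  | hs i w hi ih =>
    obtain ⟨ih1, ih2⟩ := ih
    have hl := len_s_mul_of_desc hi
    have key : ∀ y, coeff (bar (T w)) y = coeff (bar (T (s i * w))) (s i * y) -
        if Desc i y then 0 else qv * coeff (bar (T (s i * w))) y := by
      intro y
      rw [bar_T_of_desc hi, sub_mul, smul_mul_assoc, one_mul, coeff_sub, coeff_T_s_mul, coeff_smul]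
      split_ifs <;> ring
    constructor
    · rw [key, if_pos hi, ih1, sub_zero]
    · intro y hy h
      rw [key] at h
      by_contra hlt
      apply h
      have h1 : coeff (bar (T (s i * w))) (s i * y) = 0 := by
        by_contra h0
        have h2 := ih2 (s i * y) (fun e => hy (mul_left_cancel e)) h0
        by_cases hd : Desc i y
        · have := len_s_mul_of_desc hd; omega
        · have := len_s_mul_of_not_desc hd; omega
      rw [h1, zero_sub, neg_eq_zero]
      split_ifs with hd
      · rfl
      · have h0 : coeff (bar (T (s i * w))) y = 0 := by
          by_contra h0
          have := ih2 y (fun e => by rw [e] at hlt; omega) h0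
          omega
        rw [h0, mul_zero]

/-- At a longest element of the support, unitriangularity makes the coefficient itself invariant
under `v ↦ v⁻¹`, and no non-zero element of `v ℤ[v]` is invariant. -/
theorem eq_zero_of_bar {d : Hecke n} (hb : bar d = d) (h : ∀ y, coeff d y ∈ APos) : d = 0 := by
  classical
  by_contra hd
  have hne : (Finset.univ.filter fun y => coeff d y ≠ 0).Nonempty := by
    by_contra hne
    rw [Finset.not_nonempty_iff_eq_empty, Finset.filter_eq_empty_iff] at hne
    exact hd (ext_coeff fun w => by rw [coeff_zero]; exact not_not.1 (hne (Finset.mem_univ w)))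
  obtain ⟨y, hy, hmax⟩ := Finset.exists_max_image _ len hne
  simp only [Finset.mem_filter, Finset.mem_univ, true_and] at hy hmax
  apply hy
  refine eq_zero_of_barA (h y) ?_
  conv_rhs => rw [← hb]
  conv_rhs => rw [← sum_coeff_smul_T d]
  rw [bar_sum, coeff_sum, Finset.sum_eq_single y]
  · rw [bar_smul, coeff_smul, (coeff_bar_T y).1, mul_one]
  · intro z _ hz
    rw [bar_smul, coeff_smul]
    by_cases h0 : coeff d z = 0
    · rw [h0, map_zero, zero_mul]
    · have := hmax z h0
      have h1 : coeff (bar (T z)) y = 0 := by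
        by_contra h1
        have := (coeff_bar_T z).2 y hz.symm h1
        omega
      rw [h1, mul_zero]
  · intro h; exact absurd (Finset.mem_univ _) h

/-- The characterization of the Kazhdan--Lusztig basis element `C w`. -/
structure IsKL (w : Perm (Fin n)) (c : Hecke n) : Prop where
  bar_eq : bar c = c
  coeff_self : coeff c w = 1
  coeff_mem : ∀ y, y ≠ w → coeff c y ∈ APos
  len_lt : ∀ y, y ≠ w → coeff c y ≠ 0 → len y < len w

theorem IsKL.coeff_mem_APlus {w : Perm (Fin n)} {c : Hecke n} (h : IsKL w c) (y : Perm (Fin n)) :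
    coeff c y ∈ APlus := by
  by_cases hy : y = w
  · rw [hy, h.coeff_self]; exact APlus.one_mem
  · exact APos_le (h.coeff_mem y hy)

theorem eq_of_bar {w : Perm (Fin n)} {c c' : Hecke n} (hc : bar c = c) (hc' : bar c' = c')
    (h : ∀ y, coeff (c - T w) y ∈ APos) (h' : ∀ y, coeff (c' - T w) y ∈ APos) : c = c' := by
  rw [← sub_eq_zero]
  refine eq_zero_of_bar (by rw [bar_sub, hc, hc']) fun y => ?_
  have := sub_mem_APos (h y) (h' y)
  rwa [← coeff_sub, sub_sub_sub_cancel_right] at this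

theorem IsKL.coeff_sub_mem {w : Perm (Fin n)} {c : Hecke n} (h : IsKL w c) (y : Perm (Fin n)) :
    coeff (c - T w) y ∈ APos := by
  rw [coeff_sub, coeff_T]
  by_cases hy : w = y
  · rw [if_pos hy, ← hy, h.coeff_self, sub_self]; exact zero_mem_APos
  · rw [if_neg hy, sub_zero]; exact h.coeff_mem y (Ne.symm hy)

theorem IsKL.unique {w : Perm (Fin n)} {c c' : Hecke n} (hc : IsKL w c) (hc' : IsKL w c') :
    c = c' := eq_of_bar hc.bar_eq hc'.bar_eq hc.coeff_sub_mem hc'.coeff_sub_mem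

open scoped Classical in
theorem coeff_T_s_sub_mul (i : Fin (n - 1)) (x : Hecke n) (y : Perm (Fin n)) :
    coeff (T (s i) * x - v 1 • x) y =
      coeff x (s i * y) - (if Desc i y then v (-1) else v 1) * coeff x y := by
  rw [coeff_sub, coeff_T_s_mul, coeff_smul]
  split_ifs <;> ring

theorem bar_T_s_sub_mul (i : Fin (n - 1)) {x : Hecke n} (hx : bar x = x) :
    bar (T (s i) * x - v 1 • x) = T (s i) * x - v 1 • x := by
  rw [bar_sub, bar_mul, bar_smul, hx, barA_v, bar_T_s, sub_mul, smul_mul_assoc, one_mul, sub_sub,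
    ← add_smul, sub_add_cancel]

theorem T_s_mul_T_s_sub (i : Fin (n - 1)) (x : Hecke n) :
    T (s i) * (T (s i) * x - v 1 • x) = -(v (-1) • (T (s i) * x - v 1 • x)) := by
  have e : v (-1) * v 1 = 1 := by rw [← v_add]; exact v_zero
  rw [mul_sub, ← mul_assoc, T_s_mul_T_s, mul_smul_comm, add_mul, one_mul, smul_mul_assoc, smul_sub,
    smul_smul, e, one_smul, sub_smul]
  abel

/-- `(T_s - v) c` has the right leading term. It can violate the condition on the remaining
coefficients only by constant terms, and only at `y` with left descent `i`; just these have to be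
corrected. -/
theorem IsKL.coeff_T_s_sub {w : Perm (Fin n)} {c : Hecke n} (h : IsKL w c) {i : Fin (n - 1)}
    (hi : ¬ Desc i w) : coeff (T (s i) * c - v 1 • c) (s i * w) = 1 ∧
      (∀ y, coeff (T (s i) * c - v 1 • c) y ∈ APlus) ∧
      (∀ y, y ≠ s i * w → ¬ Desc i y → coeff (T (s i) * c - v 1 • c) y ∈ APos) ∧
      ∀ y, y ≠ s i * w → coeff (T (s i) * c - v 1 • c) y ≠ 0 → len y < len (s i * w) := by
  classical
  have hl := len_s_mul_of_not_desc hi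
  have hne : s i * w ≠ w := fun e => by rw [e] at hl; omega
  refine ⟨?_, fun y => ?_, fun y hy hd => ?_, fun y hy h0 => ?_⟩
  · rw [coeff_T_s_sub_mul, s_mul_s_mul, h.coeff_self]
    have : coeff c (s i * w) = 0 := by
      by_contra h0
      have := h.len_lt _ hne h0
      omega
    rw [this, mul_zero, sub_zero]
  · rw [coeff_T_s_sub_mul]
    refine APlus.sub_mem (h.coeff_mem_APlus _) ?_
    split_ifs with hd
    · have hy : y ≠ w := fun e => hi (e ▸ hd)
      obtain ⟨g, hg, e⟩ := mem_APos_iff.1 (h.coeff_mem y hy)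
      rw [e, ← mul_assoc, ← v_add]
      exact APlus.mul_mem (v_mem_APlus (by norm_num)) hg
    · exact APlus.mul_mem (v_mem_APlus (by norm_num)) (h.coeff_mem_APlus _)
  · rw [coeff_T_s_sub_mul, if_neg hd]
    refine sub_mem_APos (h.coeff_mem _ fun e => hy (by rw [← e, s_mul_s_mul])) ?_
    exact mul_mem_APos' (v_mem_APos (by norm_num)) (h.coeff_mem_APlus _)
  · by_contra hlt
    apply h0
    rw [coeff_T_s_sub_mul]
    have h1 : coeff c (s i * y) = 0 := by
      by_contra h1
      have := h.len_lt _ (fun e => hy (by rw [← e, s_mul_s_mul])) h1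
      by_cases hd : Desc i y
      · have := len_s_mul_of_desc hd; omega
      · have := len_s_mul_of_not_desc hd; omega
    have h2 : coeff c y = 0 := by
      by_contra h2
      have := h.len_lt y (fun e => by rw [e] at hlt; omega) h2
      omega
    rw [h1, h2, mul_zero, sub_zero]

/-- The constant terms of `(T_s - v) c'` are removed by subtracting integral multiples of the
elements already known for shorter `y` with left descent `i`. Each summand is an eigenvector of `T
(s i)` for `-v⁻¹`, so the result is one too. -/
theorem exists_isKL_aux {i : Fin (n - 1)} {w : Perm (Fin n)} (hi : Desc i w)
    (ih : ∀ y : Perm (Fin n), len y < len w → ∃ c, IsKL y c ∧ ∀ i, Desc i y → T (s i) * c = -(v (-1) • c)) :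
    ∃ c, IsKL w c ∧ T (s i) * c = -(v (-1) • c) := by
  classical
  have hl := len_s_mul_of_desc hi
  obtain ⟨c', hc', -⟩ := ih (s i * w) (by omega)
  have hi' : ¬ Desc i (s i * w) := fun h => (desc_s_mul i w).1 h hi
  have ih' : ∀ y, ∃ c, len y < len w →
      IsKL y c ∧ ∀ i, Desc i y → T (s i) * c = -(v (-1) • c) := fun y => by
    by_cases hy : len y < len w
    · obtain ⟨c, hc⟩ := ih y hy; exact ⟨c, fun _ => hc⟩
    · exact ⟨0, fun h => absurd h hy⟩
  choose b hb using ih'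
  have key := hc'.coeff_T_s_sub hi'
  have hbar := bar_T_s_sub_mul i hc'.bar_eq
  have hT := T_s_mul_T_s_sub i c'
  set h := T (s i) * c' - v 1 • c' with hh
  rw [s_mul_s_mul] at key
  obtain ⟨k1, k2, k3, k4⟩ := key
  set t := Finset.univ.filter fun y => Desc i y ∧ len y < len w with ht
  have mem_t : ∀ y, y ∈ t ↔ Desc i y ∧ len y < len w := by simp [ht]
  set m : Perm (Fin n) → ℤ := fun y => (coeff h y).coeff 0 with hm
  have hcoeff : ∀ z, coeff (h - ∑ y ∈ t, m y • b y) z =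
      coeff h z - ∑ y ∈ t, m y • coeff (b y) z := by
    intro z
    rw [coeff_sub, coeff_sum]
    congr 1
  clear_value h
  refine ⟨h - ∑ y ∈ t, m y • b y, ⟨?_, ?_, ?_, ?_⟩, ?_⟩
  · rw [bar_sub, hbar, bar_sum]
    congr 1
    refine Finset.sum_congr rfl fun y hy => ?_
    rw [bar_zsmul, (hb y ((mem_t y).1 hy).2).1.bar_eq]
  · rw [hcoeff, k1, Finset.sum_eq_zero, sub_zero]
    intro y hy
    have hy' := ((mem_t y).1 hy).2
    have : coeff (b y) w = 0 := by
      by_contra h0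
      have := (hb y hy').1.len_lt w (fun e => by rw [e] at hy'; omega) h0
      omega
    rw [this, smul_zero]
  · intro z hz
    rw [hcoeff]
    by_cases hzt : z ∈ t
    · have hz' := (mem_t z).1 hzt
      rw [← Finset.add_sum_erase _ _ hzt, (hb z hz'.2).1.coeff_self, ← sub_sub]
      refine sub_mem_APos ?_ (sum_mem_APos fun y hy => ?_)
      · rw [zsmul_eq_mul, mul_one]; exact sub_coeff_zero_mem_APos (k2 z)
      · rw [Finset.mem_erase] at hy
        exact zsmul_mem_APos _ ((hb y ((mem_t y).1 hy.2).2).1.coeff_mem z hy.1.symm)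
    · refine sub_mem_APos ?_ (sum_mem_APos fun y hy => ?_)
      · by_cases hd : Desc i z
        · have : coeff h z = 0 := by
            by_contra h0
            exact hzt ((mem_t z).2 ⟨hd, k4 z hz h0⟩)
          rw [this]; exact zero_mem_APos
        · exact k3 z hz hd
      · exact zsmul_mem_APos _ ((hb y ((mem_t y).1 hy).2).1.coeff_mem z fun e => hzt (e ▸ hy))
  · intro z hz h0
    by_contra hlt
    apply h0
    rw [hcoeff, Finset.sum_eq_zero, sub_zero]
    · by_contra h1; exact hlt (k4 z hz h1)
    · intro y hy
      have hy' := ((mem_t y).1 hy).2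
      have : coeff (b y) z = 0 := by
        by_contra h1
        have := (hb y hy').1.len_lt z (fun e => by rw [e] at hlt; omega) h1
        omega
      rw [this, smul_zero]
  · rw [mul_sub, hT, Finset.mul_sum, smul_sub, Finset.smul_sum, neg_sub, sub_eq_add_neg, add_comm,
      sub_eq_add_neg, ← Finset.sum_neg_distrib]
    congr 1
    refine Finset.sum_congr rfl fun y hy => ?_
    have hy' := (mem_t y).1 hy
    rw [mul_smul_comm, (hb y hy'.2).2 i hy'.1, smul_neg, neg_neg, smul_comm]

theorem exists_isKL (w : Perm (Fin n)) :
    ∃ c, IsKL w c ∧ ∀ i, Desc i w → T (s i) * c = -(v (-1) • c) := by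
  induction h : len w using Nat.strong_induction_on generalizing w with
  | _ N ih =>
    have ih' : ∀ y, len y < len w →
        ∃ c, IsKL y c ∧ ∀ i, Desc i y → T (s i) * c = -(v (-1) • c) :=
      fun y hy => ih (len y) (h ▸ hy) y rfl
    by_cases hw : w = 1
    · subst hw
      refine ⟨1, ⟨bar_one, ?_, fun y hy => ?_, fun y hy h0 => ?_⟩, fun i hi =>
        absurd hi (not_desc_one i)⟩
      · rw [← T_one, coeff_T, if_pos rfl]
      · rw [← T_one, coeff_T, if_neg hy.symm]; exact zero_mem_APos
      · rw [← T_one, coeff_T, if_neg hy.symm] at h0; exact absurd rfl h0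
    · obtain ⟨i, hi⟩ := exists_desc w hw
      obtain ⟨c, hc, -⟩ := exists_isKL_aux hi ih'
      refine ⟨c, hc, fun j hj => ?_⟩
      -- The construction depends on the chosen descent, but its result does not, by uniqueness.
      obtain ⟨c', hc', hT⟩ := exists_isKL_aux hj ih'
      rw [hc.unique hc', hT]

theorem zsmul_eq_smul (a : ℤ) (x : Hecke n) : a • x = (a : A) • x :=
  (Int.cast_smul_eq_zsmul A a x).symm

/-- `CPrime` is an arbitrary choice among elements with its defining property. Since `jInv` commutes
with `bar` and exchanges `v ℤ[v]` with `v⁻¹ ℤ[v⁻¹]`, existence and uniqueness of the element in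
`IsKL` determine that choice. -/
theorem CPrime_eq {w : Perm (Fin n)} {c : Hecke n} (h : IsKL w c) :
    CPrime w = eps w • jInv c := by
  have hT : ∀ c : Hecke n, eps w • jInv (c - T w) = eps w • jInv c - T w := by
    intro c
    rw [← jLin_apply, map_sub, jLin_apply, jLin_apply, jInv_T, smul_sub, smul_smul, eps_mul_self,
      one_smul]
  have hex : ∃ c : Hecke n, bar c = c ∧ ∀ y, coeff (c - T w) y ∈ ANeg := by
    refine ⟨eps w • jInv c, ?_, fun y => ?_⟩
    · rw [bar_zsmul, bar_jInv, h.bar_eq]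
    · rw [← hT, zsmul_eq_smul, coeff_smul, ← zsmul_eq_mul, coeff_jInv]
      exact zsmul_mem_ANeg _ (zsmul_mem_ANeg _ (barA_mem_ANeg (h.coeff_sub_mem y)))
  obtain ⟨h1, h2⟩ := Classical.epsilon_spec hex
  change bar (CPrime w) = CPrime w at h1
  change ∀ y, coeff (CPrime w - T w) y ∈ ANeg at h2
  have e : eps w • jInv (CPrime w) = c := by
    refine eq_of_bar (w := w) ?_ h.bar_eq (fun y => ?_) h.coeff_sub_mem
    · rw [bar_zsmul, bar_jInv, h1]
    · rw [← hT, zsmul_eq_smul, coeff_smul, ← zsmul_eq_mul, coeff_jInv]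
      exact zsmul_mem_APos _ (zsmul_mem_APos _ (barA_mem_APos (h2 y)))
  rw [← e, jInv_zsmul, jInv_jInv, smul_smul, eps_mul_self, one_smul]

theorem C_eq {w : Perm (Fin n)} {c : Hecke n} (h : IsKL w c) : C w = c := by
  rw [C, CPrime_eq h, jInv_zsmul, jInv_jInv, smul_smul, eps_mul_self, one_smul]

theorem isKL_C (w : Perm (Fin n)) : IsKL w (C w) := by
  obtain ⟨c, hc, -⟩ := exists_isKL w
  rwa [C_eq hc]

theorem T_s_mul_C {i : Fin (n - 1)} {w : Perm (Fin n)} (h : Desc i w) :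
    T (s i) * C w = -(v (-1) • C w) := by
  obtain ⟨c, hc, hT⟩ := exists_isKL w
  rw [C_eq hc, hT i h]

theorem jInv_C (w : Perm (Fin n)) : jInv (C w) = eps w • CPrime w := by
  rw [C, jInv_zsmul, jInv_jInv]

theorem bar_C (w : Perm (Fin n)) : bar (C w) = C w := (isKL_C w).bar_eq

theorem bar_flip (x : Hecke n) : bar (flip x) = flip (bar x) := by
  have hT : ∀ w : Perm (Fin n), flip (bar (T w)) = bar (T w⁻¹) := by
    intro w
    rw [bar_T, bar_T]
    symm
    have hu := isUnit_T w⁻¹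
    have e : T w = flip (T w⁻¹) := by rw [flip_T, inv_inv]
    apply inverse_eq_of_mul
    · rw [inv_inv, e, ← flip_mul, Ring.inverse_mul_cancel _ hu, flip_one]
    · rw [inv_inv, e, ← flip_mul, Ring.mul_inverse_cancel _ hu, flip_one]
  induction x using induction_T with
  | hT w => rw [flip_T, hT]
  | hadd x y hx hy => rw [map_add, bar_add, bar_add, map_add, hx, hy]
  | hsmul a x hx => rw [map_smul, bar_smul, bar_smul, map_smul, hx]

theorem flip_C (w : Perm (Fin n)) : flip (C w) = C w⁻¹ := by
  symm
  have h := isKL_C w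
  refine C_eq ⟨by rw [bar_flip, bar_C], ?_, fun y hy => ?_, fun y hy h0 => ?_⟩
  · rw [coeff_flip, inv_inv, h.coeff_self]
  · rw [coeff_flip]
    exact h.coeff_mem _ fun e => hy (by rw [← e, inv_inv])
  · rw [coeff_flip] at h0
    have := h.len_lt _ (fun e => hy (by rw [← e, inv_inv])) h0
    rwa [len_inv] at this ⊢

theorem C_mul_T_s {i : Fin (n - 1)} {w : Perm (Fin n)} (h : Desc i w⁻¹) :
    C w * T (s i) = -(v (-1) • C w) := by
  have := congrArg flip (T_s_mul_C h)
  rwa [flip_mul, flip_C, flip_T, s_inv, inv_inv, map_neg, map_smul, flip_C, inv_inv] at this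

/-! ### The elements `C w` as a basis -/

theorem linearIndependent_C : LinearIndependent A (C : Perm (Fin n) → Hecke n) := by
  classical
  rw [Fintype.linearIndependent_iff]
  intro g hg
  by_contra! hne
  obtain ⟨y₀, hy₀⟩ := hne
  obtain ⟨y, hy, hmax⟩ := Finset.exists_max_image (Finset.univ.filter fun y => g y ≠ 0) len
    ⟨y₀, by simpa using hy₀⟩
  simp only [Finset.mem_filter, Finset.mem_univ, true_and] at hy hmax
  apply hy
  have := congrArg (fun x => coeff x y) hg
  simp only [coeff_sum, coeff_smul, coeff_zero] at this
  rw [Finset.sum_eq_single y] at this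
  · rwa [(isKL_C y).coeff_self, mul_one] at this
  · intro z _ hz
    by_cases h0 : g z = 0
    · rw [h0, zero_mul]
    · have := hmax z h0
      have h1 : coeff (C z) y = 0 := by
        by_contra h1
        have := (isKL_C z).len_lt y hz.symm h1
        omega
      rw [h1, mul_zero]
  · intro h; exact absurd (Finset.mem_univ _) h

theorem span_C : Submodule.span A (Set.range (C : Perm (Fin n) → Hecke n)) = ⊤ := by
  classical
  have hT : ∀ w : Perm (Fin n), T w ∈ Submodule.span A (Set.range (C : Perm (Fin n) → Hecke n)) := by
    intro w
    induction h : len w using Nat.strong_induction_on generalizing w with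
    | _ N ih =>
      have e := sum_coeff_smul_T (C w)
      rw [← Finset.add_sum_erase _ _ (Finset.mem_univ w), (isKL_C w).coeff_self, one_smul] at e
      rw [eq_sub_of_add_eq e]
      refine Submodule.sub_mem _ (Submodule.subset_span ⟨w, rfl⟩) (Submodule.sum_mem _ fun y hy => ?_)
      by_cases h0 : coeff (C w) y = 0
      · rw [h0, zero_smul]; exact Submodule.zero_mem _
      · have := (isKL_C w).len_lt y (Finset.ne_of_mem_erase hy) h0
        exact Submodule.smul_mem _ _ (ih (len y) (h ▸ this) y rfl)
  rw [eq_top_iff]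
  intro x _
  rw [← sum_coeff_smul_T x]
  exact Submodule.sum_mem _ fun w _ => Submodule.smul_mem _ _ (hT w)

/-- The Kazhdan--Lusztig basis `C w`. -/
def CBasis (n : ℕ) : Module.Basis (Perm (Fin n)) A (Hecke n) :=
  Module.Basis.mk linearIndependent_C (by rw [span_C])

theorem CBasis_apply (w : Perm (Fin n)) : CBasis n w = C w := by simp [CBasis]

/-- The coefficient of `C w` in `h`. -/
def ccoeff (h : Hecke n) (w : Perm (Fin n)) : A := (CBasis n).repr h w

theorem sum_ccoeff_smul_C (h : Hecke n) : ∑ w, ccoeff h w • C w = h := by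
  have := (CBasis n).sum_repr h
  simp only [CBasis_apply] at this
  exact this

theorem barA_ccoeff {h : Hecke n} (hb : bar h = h) (w : Perm (Fin n)) :
    barA (ccoeff h w) = ccoeff h w := by
  have e : h = ∑ w, barA (ccoeff h w) • CBasis n w := by
    conv_lhs => rw [← hb, ← sum_ccoeff_smul_C h]
    rw [bar_sum]
    refine Finset.sum_congr rfl fun y _ => ?_
    rw [bar_smul, bar_C, CBasis_apply]
  have := congrArg (fun x => (CBasis n).repr x w) e
  simp only [Module.Basis.repr_sum_self] at this
  exact this.symm

/-! ### Parabolic subgroups as stabilizers of monotone functions -/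

theorem perm_apply_inv (w : Perm (Fin n)) (a : Fin n) : w (w⁻¹ a) = a := w.apply_symm_apply a

theorem perm_inv_apply (w : Perm (Fin n)) (a : Fin n) : w⁻¹ (w a) = a := w.symm_apply_apply a

/-- The smaller of the two points exchanged by `s i`. -/
abbrev lo (i : Fin (n - 1)) : Fin n := ⟨i, by omega⟩

/-- The larger of the two points exchanged by `s i`. -/
abbrev hi (i : Fin (n - 1)) : Fin n := ⟨i + 1, by omega⟩

theorem lo_lt_hi (i : Fin (n - 1)) : lo i < hi i := by simp [Fin.lt_def]

theorem s_lo (i : Fin (n - 1)) : s i (lo i) = hi i := Equiv.swap_apply_left _ _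

theorem s_hi (i : Fin (n - 1)) : s i (hi i) = lo i := Equiv.swap_apply_right _ _

theorem desc_inv_iff {i : Fin (n - 1)} {w : Perm (Fin n)} : Desc i w⁻¹ ↔ w (hi i) < w (lo i) := by
  simp [Desc]

theorem not_desc_inv_iff {i : Fin (n - 1)} {w : Perm (Fin n)} :
    ¬ Desc i w⁻¹ ↔ w (lo i) < w (hi i) := by
  rw [desc_inv_iff, not_lt]
  exact ⟨fun h => lt_of_le_of_ne h fun e => (lo_lt_hi i).ne (w.injective e), le_of_lt⟩

/-- The `s i` inside the blocks of `r`. -/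
def Par (r : Fin n → ℕ) : Set (Fin (n - 1)) := {i | r (lo i) = r (hi i)}

/-- The stabilizer of `r`. -/
def Stab (r : Fin n → ℕ) : Subgroup (Perm (Fin n)) where
  carrier := {w | ∀ i, r (w i) = r i}
  one_mem' := fun _ => rfl
  mul_mem' := fun {a b} ha hb i => by rw [Equiv.Perm.mul_apply, ha, hb]
  inv_mem' := fun {a} ha i => by rw [← ha, perm_apply_inv]

/-- The permutations that are increasing on the blocks of `r`. -/
def Inc (r : Fin n → ℕ) : Set (Perm (Fin n)) := {d | ∀ i j, i < j → r i = r j → d i < d j}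

/-- The longest element of the stabilizer of `r`. -/
structure IsTop (r : Fin n → ℕ) (w : Perm (Fin n)) : Prop where
  mem : w ∈ Stab r
  anti : ∀ i j, i < j → r i = r j → w j < w i

theorem s_mem_Stab {r : Fin n → ℕ} {i : Fin (n - 1)} (h : i ∈ Par r) : s i ∈ Stab r := by
  intro a
  by_cases h1 : a = lo i
  · rw [h1, s_lo]; exact h.symm
  · by_cases h2 : a = hi i
    · rw [h2, s_hi]; exact h
    · rw [s, Equiv.swap_apply_of_ne_of_ne h1 h2]

section Monotone

variable {r : Fin n → ℕ} (hr : Monotone r)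

include hr

/-- The blocks of a monotone function are intervals, so a transitive relation spreads from
neighbours to all pairs within a block. -/
theorem rel_of_adjacent {R : Fin n → Fin n → Prop} (htrans : ∀ a b c, R a b → R b c → R a c)
    (h : ∀ i ∈ Par r, R (lo i) (hi i)) (a b : Fin n) (hab : a < b) (hrab : r a = r b) : R a b := by
  obtain ⟨a, ha⟩ := a
  obtain ⟨b, hb⟩ := b
  rw [Fin.mk_lt_mk] at hab
  obtain ⟨k, rfl⟩ := Nat.exists_eq_add_of_lt hab
  clear hab
  induction k with
  | zero => exact h ⟨a, by omega⟩ hrab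
  | succ k ih =>
    have h1 : r ⟨a, ha⟩ ≤ r ⟨a + k + 1, by omega⟩ := hr (by simp [Fin.le_def]; omega)
    have h2 : r ⟨a + k + 1, by omega⟩ ≤ r ⟨a + (k + 1) + 1, hb⟩ := hr (by simp [Fin.le_def])
    refine htrans _ _ _ (ih (by omega) (by omega)) ?_
    exact h ⟨a + k + 1, by omega⟩ (by
      change r ⟨a + k + 1, _⟩ = r ⟨a + k + 1 + 1, _⟩
      have h3 : r ⟨a + (k + 1) + 1, hb⟩ = r ⟨a + k + 1 + 1, by omega⟩ := rfl
      omega)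

theorem mem_Inc_iff {d : Perm (Fin n)} : d ∈ Inc r ↔ ∀ i ∈ Par r, ¬ Desc i d⁻¹ := by
  constructor
  · intro h i hi
    rw [not_desc_inv_iff]
    exact h _ _ (lo_lt_hi i) hi
  · intro h a b hab hrab
    exact rel_of_adjacent hr (R := fun a b => d a < d b) (fun _ _ _ => lt_trans)
      (fun i hi => not_desc_inv_iff.1 (h i hi)) a b hab hrab

theorem anti_of_desc {w : Perm (Fin n)} (h : ∀ i ∈ Par r, Desc i w⁻¹) :
    ∀ i j, i < j → r i = r j → w j < w i :=
  rel_of_adjacent hr (R := fun a b => w b < w a) (fun _ _ _ h1 h2 => lt_trans h2 h1)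
    (fun i hi => desc_inv_iff.1 (h i hi))

omit hr in
theorem IsTop.desc {w : Perm (Fin n)} (h : IsTop r w) {i : Fin (n - 1)} (hi : i ∈ Par r) :
    Desc i w⁻¹ := desc_inv_iff.2 (h.anti _ _ (lo_lt_hi i) hi)

theorem mem_Par_of_desc {w : Perm (Fin n)} (hw : w ∈ Stab r) {i : Fin (n - 1)}
    (h : Desc i w⁻¹) : i ∈ Par r := by
  rw [desc_inv_iff] at h
  have h1 := hr h.le
  have h2 := hr (lo_lt_hi i).le
  rw [hw, hw] at h1
  exact le_antisymm h2 h1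

theorem lt_of_block_lt {a b : Fin n} (h : r a < r b) : a < b := by
  by_contra hab
  exact absurd (hr (not_lt.1 hab)) (not_le.2 h)

omit hr in
theorem desc_mul_iff {d u : Perm (Fin n)} (hd : d ∈ Inc r) (hu : u ∈ Stab r) {i : Fin (n - 1)}
    (hi : i ∈ Par r) : Desc i (d * u)⁻¹ ↔ Desc i u⁻¹ := by
  have e : r (u (lo i)) = r (u (KLMurphy.hi i)) := by rw [hu, hu]; exact hi
  constructor
  · intro h
    by_contra h'
    rw [not_desc_inv_iff] at h'
    rw [desc_inv_iff] at h
    exact lt_asymm h (hd _ _ h' e)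
  · intro h
    rw [desc_inv_iff] at h ⊢
    exact hd _ _ h e.symm

/-- `Inc r` consists of the shortest representatives of the cosets `d * Stab r`: at simple
transpositions inside the blocks, `d * u` and `u` have the same right descents, so a reduced word of
`u` can be removed letter by letter. -/
theorem len_mul_of_Inc {d u : Perm (Fin n)} (hd : d ∈ Inc r) (hu : u ∈ Stab r) :
    len (d * u) = len d + len u := by
  induction u using induction_mul_s with
  | h1 => rw [mul_one, len_one, add_zero]
  | hs j u hj ih =>
    have hp := mem_Par_of_desc hr hu hj
    have h1 := len_mul_s_of_desc hj
    have h2 := len_mul_s_of_desc ((desc_mul_iff hd hu hp).2 hj)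
    have h3 := ih ((Stab r).mul_mem hu (s_mem_Stab hp))
    rw [← mul_assoc] at h3
    omega

theorem exists_factor (w : Perm (Fin n)) : ∃ d ∈ Inc r, ∃ u ∈ Stab r, w = d * u := by
  induction h : len w using Nat.strong_induction_on generalizing w with
  | _ N ih =>
    by_cases hw : w ∈ Inc r
    · exact ⟨w, hw, 1, (Stab r).one_mem, by rw [mul_one]⟩
    · rw [mem_Inc_iff hr] at hw
      push Not at hw
      obtain ⟨i, hi, hd⟩ := hw
      have := len_mul_s_of_desc hd
      obtain ⟨d, hd, u, hu, e⟩ := ih (len (w * s i)) (by omega) _ rfl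
      exact ⟨d, hd, u * s i, (Stab r).mul_mem hu (s_mem_Stab hi), by
        rw [← mul_assoc, ← e, mul_s_mul_s]⟩

theorem eq_one_of_mem {x : Perm (Fin n)} (h : x ∈ Inc r) (h' : x ∈ Stab r) : x = 1 := by
  have := len_mul_of_Inc hr h ((Stab r).inv_mem h')
  rw [mul_inv_cancel, len_one] at this
  exact len_eq_zero (by omega)

theorem factor_unique {d d' u u' : Perm (Fin n)} (hd : d ∈ Inc r) (hd' : d' ∈ Inc r)
    (hu : u ∈ Stab r) (hu' : u' ∈ Stab r) (h : d * u = d' * u') : d = d' ∧ u = u' := by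
  have e : d = d' * (u' * u⁻¹) := by rw [← mul_assoc, ← h, mul_inv_cancel_right]
  have hx : u' * u⁻¹ ∈ Stab r := (Stab r).mul_mem hu' ((Stab r).inv_mem hu)
  have h1 := len_mul_of_Inc hr hd' hx
  have h2 := len_mul_of_Inc hr hd ((Stab r).inv_mem hx)
  rw [← e] at h1
  rw [e, mul_inv_cancel_right, ← e] at h2
  have h3 : u' * u⁻¹ = 1 := len_eq_zero (by omega)
  rw [h3, mul_one] at e
  exact ⟨e, (mul_inv_eq_one.1 h3).symm⟩

theorem IsTop.unique {w w' : Perm (Fin n)} (h : IsTop r w) (h' : IsTop r w') : w = w' := by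
  have hi' := (Stab r).inv_mem h'.mem
  have : w * w'⁻¹ = 1 := by
    refine eq_one_of_mem hr (fun i j hij hrij => ?_) ((Stab r).mul_mem h.mem hi')
    refine h.anti _ _ ?_ (by rw [hi', hi', hrij])
    by_contra hlt
    have hlt' : w'⁻¹ i < w'⁻¹ j :=
      lt_of_le_of_ne (not_lt.1 hlt) fun e => hij.ne (w'⁻¹.injective e)
    have := h'.anti _ _ hlt' (by rw [hi', hi', hrij])
    rw [perm_apply_inv, perm_apply_inv] at this
    exact lt_asymm this hij
  exact mul_inv_eq_one.1 this

omit hr in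
theorem IsTop.isTop_inv {w : Perm (Fin n)} (h : IsTop r w) : IsTop r w⁻¹ := by
  have hi := (Stab r).inv_mem h.mem
  refine ⟨hi, fun i j hij hrij => ?_⟩
  by_contra hlt
  have hlt' : w⁻¹ i < w⁻¹ j := lt_of_le_of_ne (not_lt.1 hlt) fun e => hij.ne (w⁻¹.injective e)
  have := h.anti _ _ hlt' (by rw [hi, hi, hrij])
  rw [perm_apply_inv, perm_apply_inv] at this
  exact lt_asymm this hij

theorem IsTop.inv_eq {w : Perm (Fin n)} (h : IsTop r w) : w⁻¹ = w := h.isTop_inv.unique hr h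

theorem isTop_of_max {w : Perm (Fin n)} (hw : w ∈ Stab r) (hmax : ∀ u ∈ Stab r, len u ≤ len w) :
    IsTop r w := by
  refine ⟨hw, anti_of_desc hr fun i hi => ?_⟩
  by_contra hd
  have h1 := len_mul_s_of_not_desc hd
  have h2 := hmax _ ((Stab r).mul_mem hw (s_mem_Stab hi))
  omega

omit hr in
theorem exists_max_len (H : Subgroup (Perm (Fin n))) : ∃ w ∈ H, ∀ u ∈ H, len u ≤ len w := by
  classical
  obtain ⟨w, hw, hmax⟩ := Finset.exists_max_image (Finset.univ.filter (· ∈ H)) len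
    ⟨1, by simp [H.one_mem]⟩
  simp only [Finset.mem_filter, Finset.mem_univ, true_and] at hw hmax
  exact ⟨w, hw, hmax⟩

theorem exists_isTop : ∃ w, IsTop r w := by
  obtain ⟨w, hw, h⟩ := exists_max_len (Stab r)
  exact ⟨w, isTop_of_max hr hw h⟩

theorem exists_eq_mul_top {w y : Perm (Fin n)} (hw : IsTop r w) (hy : ∀ i ∈ Par r, Desc i y⁻¹) :
    ∃ d ∈ Inc r, y = d * w := by
  obtain ⟨d, hd, u, hu, rfl⟩ := exists_factor hr y
  have : IsTop r u := ⟨hu, anti_of_desc hr fun i hi => (desc_mul_iff hd hu hi).1 (hy i hi)⟩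
  exact ⟨d, hd, by rw [this.unique hr hw]⟩

theorem IsTop.len_mul {w u : Perm (Fin n)} (hw : IsTop r w) (hu : u ∈ Stab r) :
    len (w * u) + len u = len w := by
  induction u using induction_mul_s with
  | h1 => rw [mul_one, len_one, add_zero]
  | hs j u hj ih =>
    have hp := mem_Par_of_desc hr hu hj
    have h1 := len_mul_s_of_desc hj
    have h3 := ih ((Stab r).mul_mem hu (s_mem_Stab hp))
    have h2 : ¬ Desc j (w * u)⁻¹ := by
      rw [not_desc_inv_iff]
      refine hw.anti _ _ (desc_inv_iff.1 hj) ?_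
      rw [hu, hu]; exact Eq.symm hp
    have h4 := len_mul_s_of_not_desc h2
    rw [← mul_assoc] at h3
    omega

theorem IsTop.len_eq {w : Perm (Fin n)} (hw : IsTop r w) :
    len w = (Finset.univ.filter fun p : Fin n × Fin n => p.1 < p.2 ∧ r p.1 = r p.2).card := by
  rw [len_eq_inv, KLMurphy.inv, hw.inv_eq hr]
  congr 1
  ext p
  simp only [Finset.mem_filter, Finset.mem_univ, true_and, and_congr_right_iff]
  refine fun hp => ⟨fun h => ?_, fun h => hw.anti _ _ hp h⟩
  have h1 := hr hp.le
  have h2 := hr h.le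
  rw [hw.mem, hw.mem] at h2
  exact le_antisymm h1 h2

/-! ### Elements transforming by the sign character of a parabolic subalgebra -/

omit hr

/-- Elements transforming under right multiplication according to the sign representation. -/
def RightSign (r : Fin n → ℕ) (h : Hecke n) : Prop :=
  ∀ i ∈ Par r, h * T (s i) = -(v (-1) • h)

theorem coeff_mul_s_of_sign {h : Hecke n} {i : Fin (n - 1)} (hi : h * T (s i) = -(v (-1) • h))
    {y : Perm (Fin n)} (hy : Desc i y⁻¹) : coeff h y = -(v (-1) * coeff h (y * s i)) := by
  have h1 := congrArg flip hi
  rw [flip_mul, flip_T, s_inv, map_neg, map_smul] at h1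
  have hd : ¬ Desc i (s i * y⁻¹) := fun h' => (desc_s_mul i _).1 h' hy
  have h2 := coeff_T_s_mul i (flip h) (s i * y⁻¹)
  rw [h1, if_neg hd, add_zero, s_mul_s_mul, coeff_flip, inv_inv, ← neg_smul, coeff_smul,
    coeff_flip, mul_inv_rev, s_inv, inv_inv] at h2
  rw [← h2, neg_mul]

theorem v_mul_v (a b : ℤ) : v a * v b = v (a + b) := (v_add a b).symm

include hr

theorem RightSign.coeff_mul {h : Hecke n} (hh : RightSign r h) {d u : Perm (Fin n)}
    (hd : d ∈ Inc r) (hu : u ∈ Stab r) :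
    coeff h (d * u) = (eps u : A) * v (-(len u : ℤ)) * coeff h d := by
  induction u using induction_mul_s with
  | h1 => simp [len_one, eps_one]
  | hs j u hj ih =>
    have hp := mem_Par_of_desc hr hu hj
    have h1 := len_mul_s_of_desc hj
    have h2 := ih ((Stab r).mul_mem hu (s_mem_Stab hp))
    rw [coeff_mul_s_of_sign (hh j hp) ((desc_mul_iff hd hu hp).2 hj), mul_assoc, h2]
    have e : eps u = - eps (u * s j) := by rw [eps_mul, eps_s]; ring
    have e2 : v (-(len u : ℤ)) = v (-1) * v (-(len (u * s j) : ℤ)) := by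
      rw [v_mul_v, ← h1]; congr 1; push_cast; ring
    rw [e, e2]; push_cast; ring

theorem RightSign.coeff_mul_top {h : Hecke n} (hh : RightSign r h) {d u w : Perm (Fin n)}
    (hw : IsTop r w) (hd : d ∈ Inc r) (hu : u ∈ Stab r) : coeff h (d * u) =
      (eps w : A) * (eps u : A) * v (len w - len u : ℤ) * coeff h (d * w) := by
  have e : (eps w : A) * (eps w : A) = 1 := by exact_mod_cast congrArg (Int.cast : ℤ → A) (eps_mul_self w)
  rw [hh.coeff_mul hr hd hu, hh.coeff_mul hr hd hw.mem]
  rw [show (eps w : A) * (eps u : A) * v (len w - len u : ℤ) *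
    ((eps w : A) * v (-(len w : ℤ)) * coeff h d) = ((eps w : A) * (eps w : A)) * (eps u : A) *
      (v (len w - len u : ℤ) * v (-(len w : ℤ))) * coeff h d by ring, e, v_mul_v, one_mul]
  congr 3; ring

/-- On each coset of the stabilizer one coefficient determines all others. The longest element of
the coset is used because it carries the leading coefficient of `C (d * w)`. -/
theorem RightSign.ext {h h' : Hecke n} (hh : RightSign r h) (hh' : RightSign r h')
    {w : Perm (Fin n)} (hw : IsTop r w)
    (e : ∀ d ∈ Inc r, coeff h (d * w) = coeff h' (d * w)) : h = h' := by
  refine ext_coeff fun y => ?_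
  obtain ⟨d, hd, u, hu, rfl⟩ := exists_factor hr y
  rw [hh.coeff_mul_top hr hw hd hu, hh'.coeff_mul_top hr hw hd hu, e d hd]

omit hr in
theorem rightSign_C {y : Perm (Fin n)} (hy : ∀ i ∈ Par r, Desc i y⁻¹) : RightSign r (C y) :=
  fun i hi => C_mul_T_s (hy i hi)

theorem coeff_C_top_mul {w d : Perm (Fin n)} (hw : IsTop r w) (hd : d ∈ Inc r) (h1 : d ≠ 1) :
    coeff (C w) (d * w) = 0 := by
  by_contra h0
  have := (isKL_C w).len_lt (d * w) (fun e => h1 (mul_eq_right.1 e)) h0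
  have := len_mul_of_Inc hr hd hw.mem
  omega

omit hr in
theorem one_mem_Inc : (1 : Perm (Fin n)) ∈ Inc r := fun _ _ h _ => h

theorem coeff_C_top {w u : Perm (Fin n)} (hw : IsTop r w) (hu : u ∈ Stab r) :
    coeff (C w) u = (eps w : A) * (eps u : A) * v (len w - len u : ℤ) := by
  have := (rightSign_C (r := r) fun i hi => hw.desc hi).coeff_mul_top hr hw one_mem_Inc hu
  rwa [one_mul, one_mul, (isKL_C w).coeff_self, mul_one] at this

theorem coeff_C_top_of_notMem {w u : Perm (Fin n)} (hw : IsTop r w) (hu : u ∉ Stab r) :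
    coeff (C w) u = 0 := by
  obtain ⟨d, hd, u, hu', rfl⟩ := exists_factor hr u
  rw [(rightSign_C (r := r) fun i hi => hw.desc hi).coeff_mul_top hr hw hd hu',
    coeff_C_top_mul hr hw hd, mul_zero]
  rintro rfl
  exact hu (by rwa [one_mul])

open scoped Classical in
theorem C_top_eq {w : Perm (Fin n)} (hw : IsTop r w) :
    C w = ∑ u with u ∈ Stab r, ((eps w : A) * (eps u : A) * v (len w - len u : ℤ)) • T u := by
  rw [Finset.sum_filter, ← sum_coeff_smul_T (C w)]
  refine Finset.sum_congr rfl fun u _ => ?_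
  split_ifs with h
  · rw [coeff_C_top hr hw h]
  · rw [coeff_C_top_of_notMem hr hw h, zero_smul]

open scoped Classical in
theorem coeff_T_mul_C_top {w d y : Perm (Fin n)} (hw : IsTop r w) (hd : d ∈ Inc r) :
    coeff (T d * C w) y = ∑ u with u ∈ Stab r,
      if d * u = y then (eps w : A) * (eps u : A) * v (len w - len u : ℤ) else 0 := by
  rw [C_top_eq hr hw, Finset.mul_sum, coeff_sum]
  refine Finset.sum_congr rfl fun u hu => ?_
  rw [mul_smul_comm, T_mul_T_of_len (len_mul_of_Inc hr hd (by simpa using hu)), coeff_smul, coeff_T,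
    mul_ite, mul_one, mul_zero]

theorem coeff_T_mul_C_top_mul {w d d' : Perm (Fin n)} (hw : IsTop r w) (hd : d ∈ Inc r)
    (hd' : d' ∈ Inc r) : coeff (T d * C w) (d' * w) = if d = d' then 1 else 0 := by
  classical
  have e : (eps w : A) * (eps w : A) = 1 := by exact_mod_cast congrArg (Int.cast : ℤ → A) (eps_mul_self w)
  rw [coeff_T_mul_C_top hr hw hd]
  split_ifs with h
  · subst h
    rw [Finset.sum_eq_single w]
    · rw [if_pos rfl, e, sub_self, v_zero, one_mul]
    · intro u _ hu; rw [if_neg fun h => hu (mul_left_cancel h)]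
    · intro h; exact absurd (by simpa using hw.mem) h
  · refine Finset.sum_eq_zero fun u hu => if_neg fun e => h ?_
    exact (factor_unique hr hd hd' (by simpa using hu) hw.mem e).1

omit hr in
theorem RightSign.mul {h : Hecke n} (hh : RightSign r h) (x : Hecke n) : RightSign r (x * h) :=
  fun i hi => by rw [mul_assoc, hh i hi, mul_neg, mul_smul_comm]

omit hr in
theorem rightSign_C_top {w : Perm (Fin n)} (hw : IsTop r w) : RightSign r (C w) :=
  rightSign_C fun _ hi => hw.desc hi

open scoped Classical in
-- The `T d * C w` with `d ∈ Inc r` are dual to the coefficients at the elements `d * w`. Applied to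
-- `C (x * w)`, this expansion yields the elements `factor`.
theorem RightSign.eq_sum {h : Hecke n} (hh : RightSign r h) {w : Perm (Fin n)} (hw : IsTop r w) :
    h = ∑ d with d ∈ Inc r, coeff h (d * w) • (T d * C w) := by
  refine hh.ext hr ?_ hw fun d hd => ?_
  · intro i hi
    rw [Finset.sum_mul, Finset.smul_sum, ← Finset.sum_neg_distrib]
    refine Finset.sum_congr rfl fun d _ => ?_
    rw [smul_mul_assoc, (rightSign_C_top hw).mul (T d) i hi, smul_neg, smul_comm]
  · rw [coeff_sum, Finset.sum_eq_single d]
    · rw [coeff_smul, coeff_T_mul_C_top_mul hr hw hd hd, if_pos rfl, mul_one]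
    · intro d' hd' hne
      rw [coeff_smul, coeff_T_mul_C_top_mul hr hw (by simpa using hd') hd, if_neg hne, mul_zero]
    · intro h; exact absurd (by simpa using hd) h

omit hr in
theorem desc_mul_top {w d : Perm (Fin n)} (hw : IsTop r w) (hd : d ∈ Inc r) {i : Fin (n - 1)}
    (hi : i ∈ Par r) : Desc i (d * w)⁻¹ := (desc_mul_iff hd hw.mem hi).2 (hw.desc hi)

omit hr in
theorem rightSign_C_mul_top {w d : Perm (Fin n)} (hw : IsTop r w) (hd : d ∈ Inc r) :
    RightSign r (C (d * w)) := rightSign_C fun _ hi => desc_mul_top hw hd hi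

omit hr in
theorem mul_T_of_rightSign_aux (hr : Monotone r) {h : Hecke n} (hh : RightSign r h)
    {u : Perm (Fin n)} (hu : u ∈ Stab r) :
    h * T u = ((eps u : A) * v (-(len u : ℤ))) • h := by
  induction u using induction_mul_s with
  | h1 => simp [len_one, eps_one, T_one]
  | hs j u hj ih =>
    have hp := mem_Par_of_desc hr hu hj
    have h1 := len_mul_s_of_desc hj
    have h2 := ih ((Stab r).mul_mem hu (s_mem_Stab hp))
    have e : eps u = - eps (u * s j) := by rw [eps_mul, eps_s]; ring
    have e2 : v (-(len u : ℤ)) = v (-1) * v (-(len (u * s j) : ℤ)) := by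
      rw [v_mul_v, ← h1]; congr 1; push_cast; ring
    rw [T_eq_mul_s hj, ← mul_assoc, h2, smul_mul_assoc, hh j hp, smul_neg, smul_smul, ← neg_smul, e,
      e2]
    congr 1; push_cast; ring

open scoped Classical in
theorem RightSign.mul_C_top {h : Hecke n} (hh : RightSign r h) {w : Perm (Fin n)} (hw : IsTop r w) :
    h * C w = ((eps w : A) * v (-(len w : ℤ)) * ∑ u with u ∈ Stab r, v (2 * len u)) • h := by
  rw [C_top_eq hr hw, Finset.mul_sum, Finset.mul_sum, Finset.sum_smul]
  -- The substitution `u ↦ w * u` is an involution since `w⁻¹ = w`, and it replaces `len u` by `len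
  -- w - len u`.
  refine Finset.sum_bij' (fun u _ => w * u) (fun u _ => w * u) ?_ ?_ ?_ ?_ ?_
  · intro u hu; simpa using (Stab r).mul_mem hw.mem (by simpa using hu)
  · intro u hu; simpa using (Stab r).mul_mem hw.mem (by simpa using hu)
  · intro u _
    have := hw.inv_eq hr
    rw [← mul_assoc]; nth_rw 1 [← this]; simp
  · intro u _
    have := hw.inv_eq hr
    rw [← mul_assoc]; nth_rw 1 [← this]; simp
  · intro u hu
    have hu' : u ∈ Stab r := by simpa using hu
    have hl := hw.len_mul hr hu'
    have e : (eps u : A) * (eps u : A) = 1 := by exact_mod_cast congrArg (Int.cast : ℤ → A) (eps_mul_self u)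
    rw [mul_smul_comm, mul_T_of_rightSign_aux hr hh hu', smul_smul]
    congr 1
    rw [show (eps w : A) * (eps u : A) * v (len w - len u : ℤ) * ((eps u : A) * v (-(len u : ℤ))) =
      ((eps u : A) * (eps u : A)) * (eps w : A) * (v (len w - len u : ℤ) * v (-(len u : ℤ))) by ring,
      e, one_mul, v_mul_v, mul_assoc, v_mul_v]
    congr 2
    omega

end Monotone

open scoped Classical in
/-- The sum of `v ^ len u • T u` over the stabilizer of `r`. -/
def symSum (r : Fin n → ℕ) : Hecke n := ∑ u with u ∈ Stab r, v (len u) • T u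

theorem jInv_C_top {r : Fin n → ℕ} (hr : Monotone r) {w : Perm (Fin n)} (hw : IsTop r w) :
    jInv (C w) = ((eps w : A) * v (-(len w : ℤ))) • symSum r := by
  classical
  rw [C_top_eq hr hw, jInv_sum, symSum, Finset.smul_sum]
  refine Finset.sum_congr rfl fun u _ => ?_
  have e : (eps u : A) * (eps u : A) = 1 := by exact_mod_cast congrArg (Int.cast : ℤ → A) (eps_mul_self u)
  rw [jInv_smul, jInv_T, map_mul, map_mul, map_intCast, map_intCast, barA_v, zsmul_eq_smul,
    smul_smul, smul_smul, mul_right_comm, mul_assoc (eps w : A), e, mul_one, mul_assoc, v_mul_v]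
  congr 3
  ring

theorem symSum_eq {r : Fin n → ℕ} (hr : Monotone r) {w : Perm (Fin n)} (hw : IsTop r w) :
    symSum r = ((eps w : A) * v (len w)) • jInv (C w) := by
  have e : (eps w : A) * (eps w : A) = 1 := by exact_mod_cast congrArg (Int.cast : ℤ → A) (eps_mul_self w)
  rw [jInv_C_top hr hw, smul_smul, mul_mul_mul_comm, e, v_mul_v, add_neg_cancel, v_zero, one_mul,
    one_smul]

theorem symSum_mul_T_s {r : Fin n → ℕ} (hr : Monotone r) {i : Fin (n - 1)} (hi : i ∈ Par r) :
    symSum r * T (s i) = v 1 • symSum r := by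
  obtain ⟨w, hw⟩ := exists_isTop hr
  have h := congrArg jInv (rightSign_C_top hw i hi)
  rw [jInv_mul, jInv_T, eps_s, neg_one_smul, mul_neg, ← neg_smul, jInv_smul, map_neg, barA_v,
    neg_smul, neg_inj, neg_neg] at h
  rw [symSum_eq hr hw, smul_mul_assoc, h, smul_comm]

theorem flip_symSum (r : Fin n → ℕ) : flip (symSum r) = symSum r := by
  classical
  rw [symSum, map_sum]
  refine Finset.sum_bij' (fun u _ => u⁻¹) (fun u _ => u⁻¹) ?_ ?_ ?_ ?_ ?_
  · intro u hu; simpa using hu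
  · intro u hu; simpa using hu
  · intro u _; exact inv_inv u
  · intro u _; exact inv_inv u
  · intro u _; rw [map_smul, flip_T, len_inv]

theorem T_s_mul_symSum {r : Fin n → ℕ} (hr : Monotone r) {i : Fin (n - 1)} (hi : i ∈ Par r) :
    T (s i) * symSum r = v 1 • symSum r := by
  have := congrArg flip (symSum_mul_T_s hr hi)
  rwa [flip_mul, flip_symSum, flip_T, s_inv, map_smul, flip_symSum] at this

theorem T_s_mul_C_top {r : Fin n → ℕ} (hr : Monotone r) {w : Perm (Fin n)} (hw : IsTop r w)
    {i : Fin (n - 1)} (hi : i ∈ Par r) : T (s i) * C w = -(v (-1) • C w) :=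
  T_s_mul_C (by rw [← hw.inv_eq hr]; exact hw.desc hi)

/-! ### Vanishing of sign-trivial functionals -/

/-- The coefficient at 1 is the symmetrizing trace; the bases `T y` and `T y⁻¹` are dual for it. -/
theorem coeff_mul_T_one (h : Hecke n) (y : Perm (Fin n)) : coeff (h * T y) 1 = coeff h y⁻¹ := by
  classical
  induction y using induction_s generalizing h with
  | h1 => rw [T_one, mul_one, inv_one]
  | hs i y hi ih =>
    have hd : ¬ Desc i (s i * y) := fun h => (desc_s_mul i y).1 h hi
    rw [T_eq_s_mul hi, ← mul_assoc, ih, ← flip_flip (h * T (s i)), coeff_flip, inv_inv, flip_mul,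
      flip_T, s_inv, coeff_T_s_mul, if_neg hd, s_mul_s_mul, coeff_flip, add_zero]

theorem coeff_T_mul_T_one (x y : Perm (Fin n)) :
    coeff (T x * T y) 1 = if x = y⁻¹ then 1 else 0 := by rw [coeff_mul_T_one, coeff_T]

/-- `d` is of minimal length in its double coset and its blocks meet in at most one point. -/
structure IsTransversal (r c : Fin n → ℕ) (d : Perm (Fin n)) : Prop where
  inv_mem : d⁻¹ ∈ Inc r
  mem : d ∈ Inc c
  ne : ∀ a b, a ≠ b → c a = c b → r (d a) ≠ r (d b)

/-- Letters of either parabolic subgroup can be stripped from `d` at the cost of a scalar, so `d`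
may be assumed minimal in its double coset. If two points of a block of `c` were then sent to the
same block of `r`, there would be simple transpositions with `s j * d = d * s i`, one in each
parabolic subgroup. The value at `T (d * s i)` would be both `-v⁻¹` and `v` times the value at `T
d`, which `htf` forbids. -/
theorem exists_isTransversal {r c : Fin n → ℕ} (hr : Monotone r) (hc : Monotone c) {M : Type*}
    [AddCommGroup M] [Module A M] (htf : ∀ m : M, (v 1 + v (-1)) • m = 0 → m = 0)
    (g : Hecke n →ₗ[A] M) (hL : ∀ i ∈ Par r, ∀ h, g (T (s i) * h) = -(v (-1) • g h))
    (hR : ∀ i ∈ Par c, ∀ h, g (h * T (s i)) = v 1 • g h) (d : Perm (Fin n)) (hd : g (T d) ≠ 0) :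
    ∃ d', IsTransversal r c d' ∧ (d' = d ∨ len d' < len d) ∧
      ∃ a : A, g (T d) = a • g (T d') := by
  induction h : len d using Nat.strong_induction_on generalizing d with
  | _ N ih =>
    by_cases h1 : ∃ i ∈ Par r, Desc i d
    · obtain ⟨i, hi, hdi⟩ := h1
      have e : g (T d) = -(v (-1) • g (T (s i * d))) := by rw [T_eq_s_mul hdi, hL i hi]
      have := len_s_mul_of_desc hdi
      obtain ⟨d', hd', h0, a, ha⟩ := ih (len (s i * d)) (by omega) (s i * d)
        (fun h0 => hd (by rw [e, h0, smul_zero, neg_zero])) rfl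
      exact ⟨d', hd', Or.inr (by rcases h0 with rfl | h0 <;> omega), -(v (-1) * a), by rw [e, ha, smul_smul, neg_smul]⟩
    by_cases h2 : ∃ i ∈ Par c, Desc i d⁻¹
    · obtain ⟨i, hi, hdi⟩ := h2
      have e : g (T d) = v 1 • g (T (d * s i)) := by rw [T_eq_mul_s hdi, hR i hi]
      have := len_mul_s_of_desc hdi
      obtain ⟨d', hd', h0, a, ha⟩ := ih (len (d * s i)) (by omega) (d * s i)
        (fun h0 => hd (by rw [e, h0, smul_zero])) rfl
      exact ⟨d', hd', Or.inr (by rcases h0 with rfl | h0 <;> omega), v 1 * a, by rw [e, ha, smul_smul]⟩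
    push Not at h1 h2
    have hdr : d⁻¹ ∈ Inc r := (mem_Inc_iff hr).2 (by simpa using h1)
    have hdc : d ∈ Inc c := (mem_Inc_iff hc).2 h2
    refine ⟨d, ⟨hdr, hdc, ?_⟩, Or.inl rfl, 1, (one_smul _ _).symm⟩
    -- Since `c` and `r` are monotone and `d` is increasing on blocks, a bad pair can be replaced by
    -- a bad pair of neighbours `a`, `a + 1`.
    have key : ∀ a b, a < b → c a = c b → r (d a) ≠ r (d b) := by
      intro a b hab hcab hrab
      rw [Fin.lt_def] at hab
      set i : Fin (n - 1) := ⟨a, by omega⟩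
      have hlo : lo i = a := rfl
      have hib : hi i ≤ b := by rw [Fin.le_def]; exact hab
      have hic : i ∈ Par c := le_antisymm (hc (lo_lt_hi i).le) (by
        rw [hlo, hcab]; exact hc hib)
      have hdi : d (lo i) < d (hi i) := not_desc_inv_iff.1 (h2 i hic)
      have hdb : d (hi i) ≤ d b := by
        rcases hib.eq_or_lt with e | hlt
        · rw [e]
        · exact (hdc _ _ hlt (by rw [← hcab, ← hlo]; exact hic.symm)).le
      have hri : r (d (hi i)) = r (d (lo i)) := by
        have e1 := hr hdi.le
        have e2 := hr hdb
        rw [hlo] at e1 ⊢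
        omega
      -- A value strictly between the two would lie in the same block of `r`, where `d⁻¹` is
      -- increasing, so its preimage would lie strictly between two neighbours.
      have hsucc : (d (hi i) : ℕ) = d (lo i) + 1 := by
        by_contra hne
        rw [Fin.lt_def] at hdi
        have hx : (d (lo i) : ℕ) + 1 < n := by omega
        set x : Fin n := ⟨(d (lo i) : ℕ) + 1, hx⟩ with hxdef
        have h3 : d (lo i) < x := by rw [Fin.lt_def]; simp [hxdef]
        have h4 : x < d (hi i) := by rw [Fin.lt_def]; simp only [hxdef]; omega
        have e1 := hr h3.le
        have e2 := hr h4.le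
        have h5 := hdr _ _ h3 (by omega)
        have h6 := hdr _ _ h4 (by omega)
        rw [perm_inv_apply] at h5 h6
        rw [Fin.lt_def] at h5 h6
        have : ((hi i : Fin n) : ℕ) = (lo i : Fin n) + 1 := rfl
        omega
      have hlt := (d (hi i)).2
      set j : Fin (n - 1) := ⟨d (lo i), by omega⟩ with hj
      have hjlo : lo j = d (lo i) := rfl
      have hjhi : hi j = d (hi i) := Fin.ext hsucc.symm
      have hjr : j ∈ Par r := by
        change r (lo j) = r (hi j)
        rw [hjlo, hjhi, hri]
      have hcomm : s j * d = d * s i := by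
        change Equiv.swap (lo j) (hi j) * d = d * Equiv.swap (lo i) (hi i)
        rw [Equiv.mul_swap_eq_swap_mul, hjlo, hjhi]
      have e1 := hL j hjr (T d)
      have e2 := hR i hic (T d)
      rw [T_s_mul_T_of_not_desc (h1 j hjr), hcomm] at e1
      rw [T_mul_T_s_of_not_desc (h2 i hic), e1] at e2
      exact hd (htf _ (by rw [add_smul, ← e2, neg_add_cancel]))
    intro a b hab hcab
    rcases lt_or_gt_of_ne hab with h | h
    · exact key a b h hcab
    · exact (key b a h hcab.symm).symm

/-! ### Row and column reading of a Young diagram -/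

/-- The row of a box in the row reading order. -/
def rowOf (lam : n.Partition) (p : Fin n) : ℕ := ((rowTableau lam).symm p).1

/-- The column of a box in the row reading order. -/
def colOf (lam : n.Partition) (p : Fin n) : ℕ := ((rowTableau lam).symm p).2

/-- The length of a row. -/
def rowLen (lam : n.Partition) (k : ℕ) : ℕ := (rows lam).getD k 0

theorem rowLen_antitone (lam : n.Partition) : Antitone (rowLen lam) := by
  have h : (rows lam).Pairwise (· ≥ ·) := Multiset.pairwise_sort _ _
  intro a b hab
  unfold rowLen
  rcases hab.eq_or_lt with rfl | hlt
  · exact le_rfl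
  · by_cases hb : b < (rows lam).length
    · rw [List.getD_eq_getElem _ _ hb, List.getD_eq_getElem _ _ (hlt.trans hb)]
      exact List.pairwise_iff_getElem.1 h a b _ _ hlt
    · rw [List.getD_eq_default _ _ (not_lt.1 hb)]
      exact Nat.zero_le _

theorem partialSum_succ (lam : n.Partition) (k : ℕ) :
    partialSum lam (k + 1) = partialSum lam k + rowLen lam k := by
  unfold partialSum rowLen
  by_cases hk : k < (rows lam).length
  · rw [List.take_succ_eq_append_getElem hk, List.sum_append, List.getD_eq_getElem _ _ hk]
    simp
  · rw [List.getD_eq_default _ _ (not_lt.1 hk), List.take_of_length_le (by omega),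
      List.take_of_length_le (by omega), add_zero]

theorem partialSum_mono (lam : n.Partition) : Monotone (partialSum lam) :=
  monotone_nat_of_le_succ fun k => by rw [partialSum_succ]; omega

theorem partialSum_zero (lam : n.Partition) : partialSum lam 0 = 0 := by simp [partialSum]

theorem colOf_lt (lam : n.Partition) (p : Fin n) : colOf lam p < rowLen lam (rowOf lam p) := by
  have h := ((rowTableau lam).symm p).2.2
  unfold colOf rowLen rowOf
  rw [List.getD_eq_getElem _ _ ((rowTableau lam).symm p).1.2]
  exact h

theorem partialSum_eq_sum (lam : n.Partition) (k : ℕ) :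
    partialSum lam k = ∑ i ∈ Finset.range k, rowLen lam i := by
  induction k with
  | zero => simp [partialSum_zero]
  | succ k ih => rw [partialSum_succ, ih, Finset.sum_range_succ]

theorem rowTableau_val (lam : n.Partition) (b : Cell lam) :
    (rowTableau lam b : ℕ) = partialSum lam b.1 + b.2 := by
  change ((finSigmaFinEquiv b : Fin _) : ℕ) = _
  rw [finSigmaFinEquiv_apply, partialSum_eq_sum, ← Fin.sum_univ_eq_sum_range]
  congr 1
  refine Finset.sum_congr rfl fun i _ => ?_
  unfold rowLen
  rw [List.getD_eq_getElem _ _ (i.2.trans b.1.2)]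
  rfl

theorem val_eq (lam : n.Partition) (p : Fin n) :
    (p : ℕ) = partialSum lam (rowOf lam p) + colOf lam p := by
  conv_lhs => rw [← (rowTableau lam).apply_symm_apply p, rowTableau_val]
  rfl

theorem exists_box (lam : n.Partition) {i j : ℕ} (h : j < rowLen lam i) :
    ∃ p, rowOf lam p = i ∧ colOf lam p = j := by
  have hi : i < (rows lam).length := by
    by_contra hi
    unfold rowLen at h
    rw [List.getD_eq_default _ _ (not_lt.1 hi)] at h
    omega
  unfold rowLen at h
  rw [List.getD_eq_getElem _ _ hi] at h
  have e := (rowTableau lam).symm_apply_apply ⟨⟨i, hi⟩, ⟨j, h⟩⟩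
  exact ⟨rowTableau lam ⟨⟨i, hi⟩, ⟨j, h⟩⟩, by rw [rowOf, e], by rw [colOf, e]⟩

theorem exists_box_le (lam : n.Partition) (p : Fin n) {i j : ℕ} (hi : i ≤ rowOf lam p)
    (hj : j ≤ colOf lam p) : ∃ q, rowOf lam q = i ∧ colOf lam q = j :=
  exists_box lam (lt_of_le_of_lt hj (lt_of_lt_of_le (colOf_lt lam p) (rowLen_antitone lam hi)))

theorem box_ext (lam : n.Partition) {p q : Fin n} (h1 : rowOf lam p = rowOf lam q)
    (h2 : colOf lam p = colOf lam q) : p = q :=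
  Fin.ext (by rw [val_eq lam p, val_eq lam q, h1, h2])

theorem lt_of_rowOf_lt (lam : n.Partition) {p q : Fin n} (h : rowOf lam p < rowOf lam q) :
    p < q := by
  rw [Fin.lt_def, val_eq lam p, val_eq lam q]
  have h1 := colOf_lt lam p
  have h2 := partialSum_succ lam (rowOf lam p)
  have h3 := partialSum_mono lam (show rowOf lam p + 1 ≤ rowOf lam q by omega)
  omega

theorem rowOf_monotone (lam : n.Partition) : Monotone (rowOf lam) := fun _ _ h => by
  by_contra hlt
  exact absurd (lt_of_rowOf_lt lam (not_le.1 hlt)) (not_lt.2 h)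

theorem lt_iff_colOf_lt (lam : n.Partition) {p q : Fin n} (h : rowOf lam p = rowOf lam q) :
    p < q ↔ colOf lam p < colOf lam q := by
  rw [Fin.lt_def, val_eq lam p, val_eq lam q, h, Nat.add_lt_add_iff_left]

theorem card_rowOf_eq (lam : n.Partition) (k : ℕ) :
    (Finset.univ.filter fun p => rowOf lam p = k).card = rowLen lam k := by
  rw [← Finset.card_range (rowLen lam k)]
  refine Finset.card_bij (fun p _ => colOf lam p) ?_ ?_ ?_
  · intro p hp
    simp only [Finset.mem_filter, Finset.mem_univ, true_and] at hp
    rw [Finset.mem_range, ← hp]; exact colOf_lt lam p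
  · intro p hp q hq h
    simp only [Finset.mem_filter, Finset.mem_univ, true_and] at hp hq
    exact box_ext lam (hp.trans hq.symm) h
  · intro j hj
    obtain ⟨p, h1, h2⟩ := exists_box lam (Finset.mem_range.1 hj)
    exact ⟨p, by simpa using h1, h2⟩

theorem card_rowOf_lt (lam : n.Partition) (k : ℕ) :
    (Finset.univ.filter fun p => rowOf lam p < k).card = partialSum lam k := by
  induction k with
  | zero => simp [partialSum_zero]
  | succ k ih =>
    rw [partialSum_succ, ← ih, ← card_rowOf_eq, ← Finset.card_union_of_disjoint]
    · congr 1
      ext p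
      simp only [Finset.mem_filter, Finset.mem_univ, true_and, Finset.mem_union]
      omega
    · rw [Finset.disjoint_filter]
      intro p _ h1 h2
      omega

theorem mem_Par_rowOf_iff (lam : n.Partition) (i : Fin (n - 1)) :
    i ∈ Par (rowOf lam) ↔ ∀ k, partialSum lam k ≠ i + 1 := by
  have e1 := val_eq lam (lo i)
  have e2 := val_eq lam (hi i)
  have e3 : ((hi i : Fin n) : ℕ) = i + 1 := rfl
  have e4 : ((lo i : Fin n) : ℕ) = i := rfl
  constructor
  · intro h k hk
    change rowOf lam (lo i) = rowOf lam (hi i) at h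
    have h1 := colOf_lt lam (hi i)
    have h2 := partialSum_succ lam (rowOf lam (hi i))
    rcases le_or_gt k (rowOf lam (hi i)) with h3 | h3
    · have := partialSum_mono lam h3; rw [h] at e1; omega
    · have := partialSum_mono lam (show rowOf lam (hi i) + 1 ≤ k by omega); omega
  · intro h
    by_contra hne
    have h1 : rowOf lam (lo i) < rowOf lam (hi i) :=
      lt_of_le_of_ne (rowOf_monotone lam (lo_lt_hi i).le) hne
    have h2 := partialSum_mono lam (show rowOf lam (lo i) + 1 ≤ rowOf lam (hi i) by omega)
    have h3 := partialSum_succ lam (rowOf lam (lo i))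
    have h4 := colOf_lt lam (lo i)
    exact h (rowOf lam (hi i)) (by omega)

theorem young_eq (lam : n.Partition) : young lam = Stab (rowOf lam) := by
  apply le_antisymm
  · rw [young, Subgroup.closure_le]
    rintro _ ⟨i, hi, rfl⟩
    exact s_mem_Stab ((mem_Par_rowOf_iff lam i).2 hi)
  · intro w hw
    induction w using induction_mul_s with
    | h1 => exact Subgroup.one_mem _
    | hs j w hj ih =>
      have hp := mem_Par_of_desc (rowOf_monotone lam) hw hj
      have hs : s j ∈ young lam := Subgroup.subset_closure ⟨j, (mem_Par_rowOf_iff lam j).1 hp, rfl⟩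
      have := (young lam).mul_mem (ih ((Stab _).mul_mem hw (s_mem_Stab hp))) hs
      rwa [mul_s_mul_s] at this

theorem isTop_wLong (lam : n.Partition) : IsTop (rowOf lam) (wLong lam) := by
  obtain ⟨h1, h2⟩ := Classical.epsilon_spec (exists_max_len (young lam))
  change wLong lam ∈ young lam at h1
  change ∀ u ∈ young lam, len u ≤ len (wLong lam) at h2
  rw [young_eq] at h1 h2
  exact isTop_of_max (rowOf_monotone lam) h1 h2

/-- The permutation taking the column reading order of the boxes to the row reading order. -/
def colPerm (lam : n.Partition) : Perm (Fin n) :=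
  Tuple.sort fun p => toLex (colOf lam p, rowOf lam p)

/-- The column of a box in the column reading order. -/
def colIdx (lam : n.Partition) (q : Fin n) : ℕ := colOf lam (colPerm lam q)

theorem colPerm_le (lam : n.Partition) {a b : Fin n} (h : a ≤ b) :
    colIdx lam a < colIdx lam b ∨ colIdx lam a = colIdx lam b ∧
      rowOf lam (colPerm lam a) ≤ rowOf lam (colPerm lam b) := by
  have := Tuple.monotone_sort (fun p => toLex (colOf lam p, rowOf lam p)) h
  simp only [Function.comp_apply, Prod.Lex.le_iff, ofLex_toLex] at this
  exact this

theorem colIdx_monotone (lam : n.Partition) : Monotone (colIdx lam) := fun a b h => by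
  rcases colPerm_le lam h with h | h
  · exact h.le
  · exact h.1.le

theorem colPerm_lt (lam : n.Partition) {a b : Fin n} (h : colIdx lam a = colIdx lam b) :
    rowOf lam (colPerm lam a) < rowOf lam (colPerm lam b) ↔ a < b := by
  have key : ∀ a b, colIdx lam a = colIdx lam b → a < b →
      rowOf lam (colPerm lam a) < rowOf lam (colPerm lam b) := by
    intro a b h hab
    rcases colPerm_le lam hab.le with h' | h'
    · exact absurd h' (by rw [h]; exact lt_irrefl _)
    · exact lt_of_le_of_ne h'.2 fun e => hab.ne ((colPerm lam).injective (box_ext lam e h))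
  refine ⟨fun hlt => ?_, key a b h⟩
  by_contra hab
  rcases (not_lt.1 hab).eq_or_lt with e | h'
  · rw [e] at hlt; exact lt_irrefl _ hlt
  · exact lt_asymm hlt (key b a h.symm h')

theorem colPerm_mem (lam : n.Partition) : colPerm lam ∈ Inc (colIdx lam) := fun _ _ hab h =>
  lt_of_rowOf_lt lam ((colPerm_lt lam h).2 hab)

theorem colIdx_colPerm_inv (lam : n.Partition) (p : Fin n) :
    colIdx lam ((colPerm lam)⁻¹ p) = colOf lam p := by rw [colIdx, perm_apply_inv]

theorem colPerm_inv_mem (lam : n.Partition) : (colPerm lam)⁻¹ ∈ Inc (rowOf lam) := by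
  intro a b hab h
  refine lt_of_block_lt (colIdx_monotone lam) ?_
  rw [colIdx_colPerm_inv, colIdx_colPerm_inv]
  exact (lt_iff_colOf_lt lam h).1 hab

/-- A box is determined by its row and its column, so the row stabilizer meets the transported
column stabilizer trivially. -/
theorem Stab_inter (lam : n.Partition) {u u' : Perm (Fin n)} (hu : u ∈ Stab (rowOf lam))
    (hu' : u' ∈ Stab (colIdx lam)) (h : u * colPerm lam = colPerm lam * u') : u = 1 ∧ u' = 1 := by
  have h' : u' = 1 := by
    ext q
    have e : u (colPerm lam q) = colPerm lam (u' q) := congrArg (fun f : Perm (Fin n) => f q) h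
    have : colPerm lam (u' q) = colPerm lam q :=
      box_ext lam (by rw [← e, hu]) (hu' q)
    rw [(colPerm lam).injective this, Equiv.Perm.one_apply]
  rw [h', mul_one] at h
  exact ⟨mul_eq_right.1 h, h'⟩

/-- The easy half of the Gale–Ryser theorem, column by column: a column of length `c` meets the
blocks in `B` at most `min c |B|` times, and this is the number of its boxes in the first `|B|`
rows. Arbitrary `r` and `B` are allowed because `isStd_xElt` applies the bound to blocks that are
not rows. -/
theorem IsTransversal.card_le {lam : n.Partition} {r : Fin n → ℕ} {d : Perm (Fin n)}
    (hd : IsTransversal r (colIdx lam) d) (B : Finset ℕ) :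
    (Finset.univ.filter fun p => r p ∈ B).card ≤ partialSum lam B.card := by
  classical
  rw [← card_rowOf_lt]
  have e : (Finset.univ.filter fun p => r p ∈ B).card =
      (Finset.univ.filter fun q => r (d q) ∈ B).card := by
    symm
    refine Finset.card_equiv d fun q => ?_
    simp
  have hN : ∀ p, colOf lam p ∈ Finset.univ.image (colOf lam) := fun p =>
    Finset.mem_image_of_mem _ (Finset.mem_univ p)
  rw [e, Finset.card_eq_sum_card_fiberwise (f := colIdx lam) (t := Finset.univ.image (colOf lam))
    (fun q _ => hN _), Finset.card_eq_sum_card_fiberwise (f := colOf lam)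
    (t := Finset.univ.image (colOf lam)) (fun q _ => hN _)]
  refine Finset.sum_le_sum fun j _ => ?_
  rw [Finset.filter_filter, Finset.filter_filter]
  -- Either the whole column lies in the first `B.card` rows, or it has more than `B.card` boxes; in
  -- the second case the bound comes from transversality.
  by_cases hj : ∀ p, colOf lam p = j → rowOf lam p < B.card
  · refine Finset.card_le_card_of_injOn (colPerm lam) ?_ (colPerm lam).injective.injOn
    intro q hq
    simp only [Finset.coe_filter, Finset.mem_univ, true_and, Set.mem_ofPred_eq] at hq ⊢
    exact ⟨hj _ hq.2, hq.2⟩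
  · push Not at hj
    obtain ⟨p, hp, hpB⟩ := hj
    calc _ ≤ B.card := by
          refine Finset.card_le_card_of_injOn (fun q => r (d q)) ?_ ?_
          · intro q hq
            simp only [Finset.coe_filter, Finset.mem_univ, true_and, Set.mem_ofPred_eq] at hq
            exact hq.1
          · intro q hq q' hq' h
            simp only [Finset.coe_filter, Finset.mem_univ, true_and, Set.mem_ofPred_eq] at hq hq'
            by_contra hne
            exact hd.ne q q' hne (hq.2.trans hq'.2.symm) h
      _ = (Finset.range B.card).card := (Finset.card_range _).symm
      _ ≤ _ := by
          have hbox : ∀ i, ∃ q, i < B.card → rowOf lam q = i ∧ colOf lam q = j := fun i => by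
            by_cases hi : i < B.card
            · obtain ⟨q, hq⟩ := exists_box_le lam p (hi.le.trans hpB) hp.ge
              exact ⟨q, fun _ => hq⟩
            · exact ⟨p, fun h => absurd h hi⟩
          choose f hf using hbox
          refine Finset.card_le_card_of_injOn f ?_ ?_
          · intro i hi
            have hi' : i < B.card := by simpa using hi
            simp only [Finset.coe_filter, Finset.mem_univ, true_and, Set.mem_ofPred_eq]
            exact ⟨by rw [(hf i hi').1]; exact hi', (hf i hi').2⟩
          · intro i hi i' hi' h
            have hi : i < B.card := by simpa using hi
            have hi' : i' < B.card := by simpa using hi'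
            rw [← (hf i hi).1, ← (hf i' hi').1, h]

theorem IsTransversal.dom {lam mu : n.Partition} {d : Perm (Fin n)}
    (hd : IsTransversal (rowOf mu) (colIdx lam) d) : Dom mu lam := fun k => by
  have := hd.card_le (Finset.range k)
  simp only [Finset.mem_range, Finset.card_range] at this
  rwa [card_rowOf_lt] at this

/-- The entries `d q` of a column lie in strictly increasing rows, so each lies at least as low as
for `colPerm`. The sums of the row indices agree, hence so do all rows, and minimality in the double
coset excludes permutations within the rows. -/
theorem IsTransversal.eq_colPerm {lam : n.Partition} {d : Perm (Fin n)}
    (hd : IsTransversal (rowOf lam) (colIdx lam) d) : d = colPerm lam := by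
  have h1 : ∀ k q, rowOf lam (colPerm lam q) = k → k ≤ rowOf lam (d q) := by
    intro k
    induction k with
    | zero => intro q _; exact Nat.zero_le _
    | succ k ih =>
      intro q hq
      obtain ⟨p, hp1, hp2⟩ := exists_box_le lam (colPerm lam q) (show k ≤ _ by omega) le_rfl
      set q' := (colPerm lam)⁻¹ p with hq'
      have e1 : colPerm lam q' = p := perm_apply_inv _ _
      have e2 : colIdx lam q' = colIdx lam q := by rw [colIdx, e1, hp2]; rfl
      have hlt : q' < q := (colPerm_lt lam e2).1 (by rw [e1]; omega)
      have h3 := ih q' (by rw [e1, hp1])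
      have h4 := rowOf_monotone lam (hd.mem _ _ hlt e2).le
      have h5 := hd.ne _ _ hlt.ne e2
      omega
  have h2 : ∑ q, rowOf lam (colPerm lam q) = ∑ q, rowOf lam (d q) := by
    rw [Equiv.sum_comp (colPerm lam) (rowOf lam), Equiv.sum_comp d (rowOf lam)]
  have h3 := (Finset.sum_eq_sum_iff_of_le fun q _ => h1 _ q rfl).1 h2
  have h4 : d * (colPerm lam)⁻¹ = 1 := by
    refine eq_one_of_mem (rowOf_monotone lam) ?_ ?_
    · intro p p' hpp h
      have hlt := colPerm_inv_mem lam _ _ hpp h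
      rw [Equiv.Perm.mul_apply, Equiv.Perm.mul_apply]
      by_contra hge
      have hlt' : d ((colPerm lam)⁻¹ p') < d ((colPerm lam)⁻¹ p) :=
        lt_of_le_of_ne (not_lt.1 hge) fun e => hlt.ne' (d.injective e)
      have := hd.inv_mem _ _ hlt' (by
        rw [← h3 _ (Finset.mem_univ _), ← h3 _ (Finset.mem_univ _), perm_apply_inv, perm_apply_inv,
          h])
      rw [perm_inv_apply, perm_inv_apply] at this
      exact lt_asymm this hlt
    · intro p
      rw [Equiv.Perm.mul_apply, ← h3 _ (Finset.mem_univ _), perm_apply_inv]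
  exact mul_inv_eq_one.1 h4

/-! ### The sign-trivial element -/

/-- The element spanning `C (wLong lam) * H * symSum (colIdx lam)`. -/
def zElt (lam : n.Partition) : Hecke n :=
  C (wLong lam) * T (colPerm lam) * symSum (colIdx lam)

theorem v_add_v_ne_zero : v 1 + v (-1) ≠ (0 : A) := fun h => by
  have := congrArg (fun f : A => f.coeff 1) h
  simp [LaurentPolynomial.T_apply] at this

theorem smul_eq_zero_hecke {a : A} {m : Hecke n} (ha : a ≠ 0) (h : a • m = 0) : m = 0 :=
  ext_coeff fun w => by
    have := congrArg (fun x => coeff x w) h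
    simp only [coeff_smul, coeff_zero] at this
    rw [coeff_zero]
    exact (mul_eq_zero.1 this).resolve_left ha

theorem exists_isTransversal_of_mul {r : Fin n → ℕ} (hr : Monotone r) (lam : n.Partition)
    {x : Hecke n} (hx : RightSign r x) {d : Perm (Fin n)}
    (h0 : x * T d * symSum (colIdx lam) ≠ 0) : ∃ d', IsTransversal r (colIdx lam) d' ∧
      (d' = d ∨ len d' < len d) ∧
      ∃ a : A, x * T d * symSum (colIdx lam) = a • (x * T d' * symSum (colIdx lam)) :=
  exists_isTransversal hr (colIdx_monotone lam) (fun m => smul_eq_zero_hecke v_add_v_ne_zero)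
    (LinearMap.mulRight A (symSum (colIdx lam)) ∘ₗ LinearMap.mulLeft A x)
    (fun i hi h => by
      simp only [LinearMap.comp_apply, LinearMap.mulLeft_apply, LinearMap.mulRight_apply]
      rw [← mul_assoc, hx i hi, neg_mul, neg_mul, smul_mul_assoc, smul_mul_assoc])
    (fun i hi h => by
      simp only [LinearMap.comp_apply, LinearMap.mulLeft_apply, LinearMap.mulRight_apply]
      rw [← mul_assoc, mul_assoc _ (T (s i)), T_s_mul_symSum (colIdx_monotone lam) hi, mul_smul_comm])
    d h0

/-- `colPerm lam` is the only transversal, and reduction to a transversal strictly shortens every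
other `d`. A competitor that is not longer than `colPerm lam` has nothing to reduce to. -/
theorem C_wLong_mul_T_mul_symSum (lam : n.Partition) {d : Perm (Fin n)}
    (hd : len d ≤ len (colPerm lam)) (hne : d ≠ colPerm lam) :
    C (wLong lam) * T d * symSum (colIdx lam) = 0 := by
  by_contra h0
  obtain ⟨d', hd', h, -⟩ := exists_isTransversal_of_mul (rowOf_monotone lam) lam
    (rightSign_C_top (isTop_wLong lam)) h0
  rw [hd'.eq_colPerm] at h
  rcases h with h | h
  · exact hne h.symm
  · omega

theorem exists_eq_smul_zElt (lam : n.Partition) (h : Hecke n) :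
    ∃ a : A, C (wLong lam) * h * symSum (colIdx lam) = a • zElt lam := by
  induction h using induction_T with
  | hT d =>
    by_cases h0 : C (wLong lam) * T d * symSum (colIdx lam) = 0
    · exact ⟨0, by rw [h0, zero_smul]⟩
    · obtain ⟨d', hd', -, a, ha⟩ := exists_isTransversal_of_mul (rowOf_monotone lam) lam
        (rightSign_C_top (isTop_wLong lam)) h0
      rw [hd'.eq_colPerm] at ha
      exact ⟨a, ha⟩
  | hadd x y hx hy =>
    obtain ⟨a, ha⟩ := hx
    obtain ⟨b, hb⟩ := hy
    exact ⟨a + b, by rw [mul_add, add_mul, ha, hb, add_smul]⟩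
  | hsmul c x hx =>
    obtain ⟨a, ha⟩ := hx
    exact ⟨c * a, by rw [mul_smul_comm, smul_mul_assoc, ha, smul_smul]⟩

/-- By `Stab_inter`, only the identity elements of the row and the column stabilizer contribute to
the coefficient at 1. That this value is a unit of `A` shows `zElt lam ≠ 0`, and later that the
Schur element is a Laurent polynomial. -/
theorem coeff_zElt_mul (lam : n.Partition) :
    coeff (zElt lam * T (colPerm lam)⁻¹) 1 =
      (eps (wLong lam) : A) * v (len (wLong lam)) := by
  classical
  have hr := rowOf_monotone lam
  have hc := colIdx_monotone lam
  have h1 : ∀ u ∈ Stab (rowOf lam), T u * T (colPerm lam) = T (u * colPerm lam) := by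
    intro u hu
    apply T_mul_T_of_len
    have := len_mul_of_Inc hr (colPerm_inv_mem lam) ((Stab _).inv_mem hu)
    rw [← mul_inv_rev, len_inv, len_inv, len_inv] at this
    omega
  have h2 : ∀ u ∈ Stab (colIdx lam), T u * T (colPerm lam)⁻¹ = T (u * (colPerm lam)⁻¹) := by
    intro u hu
    apply T_mul_T_of_len
    have := len_mul_of_Inc hc (colPerm_mem lam) ((Stab _).inv_mem hu)
    rw [← len_inv, mul_inv_rev, inv_inv, len_inv u] at this
    rw [len_inv]
    omega
  rw [zElt, mul_assoc, C_top_eq hr (isTop_wLong lam), symSum, Finset.sum_mul, Finset.sum_mul,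
    Finset.sum_mul, coeff_sum, Finset.sum_eq_single 1]
  · rw [Finset.mul_sum, coeff_sum, Finset.sum_eq_single 1]
    · rw [smul_mul_assoc, smul_mul_assoc, smul_mul_assoc, mul_smul_comm, coeff_smul, coeff_smul,
        h1 1 (one_mem _), h2 1 (one_mem _), one_mul, one_mul, coeff_T_mul_T_one, if_pos (by simp),
        eps_one, len_one]
      simp
    · intro u hu hu1
      have hu' : u ∈ Stab (colIdx lam) := by simpa using hu
      rw [smul_mul_assoc, smul_mul_assoc, smul_mul_assoc, mul_smul_comm, coeff_smul, coeff_smul,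
        h1 1 (one_mem _), h2 u hu', coeff_T_mul_T_one, if_neg, mul_zero, mul_zero]
      intro e
      rw [mul_inv_rev, inv_inv] at e
      exact hu1 (inv_eq_one.1 (Stab_inter lam (one_mem _) (inv_mem hu') e).2)
    · intro h; exact absurd (by simp) h
  · intro u hu hu1
    have hu' : u ∈ Stab (rowOf lam) := by simpa using hu
    rw [Finset.mul_sum, coeff_sum]
    refine Finset.sum_eq_zero fun u₂ hu₂ => ?_
    have hu₂' : u₂ ∈ Stab (colIdx lam) := by simpa using hu₂
    rw [smul_mul_assoc, smul_mul_assoc, smul_mul_assoc, mul_smul_comm, coeff_smul, coeff_smul,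
        h1 u hu', h2 u₂ hu₂', coeff_T_mul_T_one, if_neg, mul_zero, mul_zero]
    intro e
    rw [mul_inv_rev, inv_inv] at e
    exact hu1 (Stab_inter lam hu' (inv_mem hu₂') e).1
  · intro h; exact absurd (by simp) h

theorem zElt_ne_zero (lam : n.Partition) : zElt lam ≠ 0 := fun h => by
  have := coeff_zElt_mul lam
  rw [h, zero_mul, coeff_zero] at this
  have hu : IsUnit ((eps (wLong lam) : A) * v (len (wLong lam))) := by
    refine IsUnit.mul ?_ (LaurentPolynomial.isUnit_T _)
    refine IsUnit.of_mul_eq_one ((eps (wLong lam) : A)) ?_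
    exact_mod_cast congrArg (Int.cast : ℤ → A) (eps_mul_self (wLong lam))
  rw [← this] at hu
  exact not_isUnit_zero hu

/-! ### Rational functions without pole at zero -/

/-- The ring of rational functions without pole at `0`. -/
def Reg : Subring K where
  carrier := {f | ∃ p q : ℝ[X], q.eval 0 ≠ 0 ∧ f = algebraMap ℝ[X] K p / algebraMap ℝ[X] K q}
  zero_mem' := ⟨0, 1, by simp, by simp⟩
  one_mem' := ⟨1, 1, by simp, by simp⟩
  add_mem' := by
    rintro _ _ ⟨p, q, hq, rfl⟩ ⟨p', q', hq', rfl⟩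
    have h1 : algebraMap ℝ[X] K q ≠ 0 := RatFunc.algebraMap_ne_zero fun h => hq (by simp [h])
    have h2 : algebraMap ℝ[X] K q' ≠ 0 := RatFunc.algebraMap_ne_zero fun h => hq' (by simp [h])
    refine ⟨p * q' + q * p', q * q', by simp [hq, hq'], ?_⟩
    rw [div_add_div _ _ h1 h2]; simp
  mul_mem' := by
    rintro _ _ ⟨p, q, hq, rfl⟩ ⟨p', q', hq', rfl⟩
    refine ⟨p * p', q * q', by simp [hq, hq'], ?_⟩
    rw [div_mul_div_comm]; simp
  neg_mem' := by
    rintro _ ⟨p, q, hq, rfl⟩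
    exact ⟨-p, q, hq, by rw [map_neg, neg_div]⟩

theorem algebraMap_poly_ne_zero {q : ℝ[X]} (hq : q.eval 0 ≠ 0) : algebraMap ℝ[X] K q ≠ 0 :=
  RatFunc.algebraMap_ne_zero fun h => hq (by simp [h])

theorem denom_eval_ne_zero {f : K} (hf : f ∈ Reg) :
    Polynomial.eval₂ (RingHom.id ℝ) 0 f.denom ≠ 0 := by
  obtain ⟨p, q, hq, rfl⟩ := hf
  have := RatFunc.denom_div_dvd p q
  intro h0
  apply hq
  obtain ⟨r, hr⟩ := this
  rw [hr, Polynomial.eval_mul]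
  rw [Polynomial.eval₂_id] at h0
  rw [h0, zero_mul]

theorem constTerm_add {f g : K} (hf : f ∈ Reg) (hg : g ∈ Reg) :
    constTerm (f + g) = constTerm f + constTerm g :=
  RatFunc.eval_add _ _ (denom_eval_ne_zero hf) (denom_eval_ne_zero hg)

theorem constTerm_mul {f g : K} (hf : f ∈ Reg) (hg : g ∈ Reg) :
    constTerm (f * g) = constTerm f * constTerm g :=
  RatFunc.eval_mul _ _ (denom_eval_ne_zero hf) (denom_eval_ne_zero hg)

theorem constTerm_algebraMap (p : ℝ[X]) : constTerm (algebraMap ℝ[X] K p) = p.eval 0 := by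
  rw [constTerm, RatFunc.eval_algebraMap, Polynomial.eval₂_id, Algebra.algebraMap_self,
    RingHom.id_apply]

theorem constTerm_one : constTerm 1 = 1 := RatFunc.eval_one _ _

theorem constTerm_zero : constTerm 0 = 0 := RatFunc.eval_zero _ _

theorem constTerm_X : constTerm RatFunc.X = 0 := by simp [constTerm]

theorem constTerm_neg {f : K} (hf : f ∈ Reg) : constTerm (-f) = -constTerm f := by
  have := constTerm_add hf (Reg.neg_mem hf)
  rw [add_neg_cancel, constTerm_zero] at this
  linarith

theorem constTerm_sum {ι : Type*} (t : Finset ι) {f : ι → K} (hf : ∀ i ∈ t, f i ∈ Reg) :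
    constTerm (∑ i ∈ t, f i) = ∑ i ∈ t, constTerm (f i) := by
  classical
  induction t using Finset.induction_on with
  | empty => simp [constTerm_zero]
  | insert a t ha ih =>
    rw [Finset.sum_insert ha, Finset.sum_insert ha, constTerm_add (hf a (Finset.mem_insert_self a t))
      (Reg.sum_mem fun i hi => hf i (Finset.mem_insert_of_mem hi)),
      ih fun i hi => hf i (Finset.mem_insert_of_mem hi)]

theorem algebraMap_mem_Reg (p : ℝ[X]) : algebraMap ℝ[X] K p ∈ Reg := ⟨p, 1, by simp, by simp⟩

theorem X_mem_Reg : (RatFunc.X : K) ∈ Reg := by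
  rw [← RatFunc.algebraMap_X]; exact algebraMap_mem_Reg _

theorem inv_mem_Reg {f : K} (hf : f ∈ Reg) (h : constTerm f ≠ 0) : f⁻¹ ∈ Reg := by
  obtain ⟨p, q, hq, rfl⟩ := hf
  refine ⟨q, p, fun hp => h ?_, by rw [inv_div]⟩
  have h1 : algebraMap ℝ[X] K p = algebraMap ℝ[X] K p / algebraMap ℝ[X] K q * algebraMap ℝ[X] K q :=
    (div_mul_cancel₀ _ (algebraMap_poly_ne_zero hq)).symm
  have h2 := congrArg constTerm h1
  rw [constTerm_mul ⟨p, q, hq, rfl⟩ (algebraMap_mem_Reg q), constTerm_algebraMap,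
    constTerm_algebraMap, hp] at h2
  exact (mul_eq_zero.1 h2.symm).resolve_right hq

theorem constTerm_inv {f : K} (hf : f ∈ Reg) (h : constTerm f ≠ 0) :
    constTerm f⁻¹ = (constTerm f)⁻¹ := by
  have h0 : f ≠ 0 := by rintro rfl; exact h constTerm_zero
  have := constTerm_mul hf (inv_mem_Reg hf h)
  rw [mul_inv_cancel₀ h0, constTerm_one] at this
  exact eq_inv_of_mul_eq_one_right this.symm

theorem exists_eq_X_mul {f : K} (hf : f ∈ Reg) (h : constTerm f = 0) :
    ∃ g ∈ Reg, f = RatFunc.X * g := by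
  obtain ⟨p, q, hq, rfl⟩ := hf
  have h1 : algebraMap ℝ[X] K p = algebraMap ℝ[X] K p / algebraMap ℝ[X] K q * algebraMap ℝ[X] K q :=
    (div_mul_cancel₀ _ (algebraMap_poly_ne_zero hq)).symm
  have h2 := congrArg constTerm h1
  rw [constTerm_mul ⟨p, q, hq, rfl⟩ (algebraMap_mem_Reg q), h, zero_mul, constTerm_algebraMap] at h2
  have h3 : (Polynomial.X : ℝ[X]) ∣ p := by
    rwa [Polynomial.X_dvd_iff, Polynomial.coeff_zero_eq_eval_zero]
  obtain ⟨p', rfl⟩ := h3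
  exact ⟨_, ⟨p', q, hq, rfl⟩, by rw [map_mul, RatFunc.algebraMap_X, mul_div_assoc]⟩

theorem exists_poly_eq {p : ℝ[X]} (hp : p ≠ 0) :
    ∃ (N : ℕ) (p' : ℝ[X]), p'.eval 0 ≠ 0 ∧ p = Polynomial.X ^ N * p' := by
  obtain ⟨q, hq, hd⟩ := Polynomial.exists_eq_pow_rootMultiplicity_mul_and_not_dvd p hp 0
  rw [map_zero, sub_zero] at hq hd
  refine ⟨_, q, fun h => hd ?_, hq⟩
  rwa [Polynomial.X_dvd_iff, Polynomial.coeff_zero_eq_eval_zero]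

theorem exists_X_pow_mul_mem (f : K) : ∃ N : ℕ, RatFunc.X ^ N * f ∈ Reg := by
  obtain ⟨N, q, hq, e⟩ := exists_poly_eq f.denom_ne_zero
  refine ⟨N, f.num, q, hq, ?_⟩
  have h1 : (RatFunc.X : K) ^ N ≠ 0 := pow_ne_zero _ RatFunc.X_ne_zero
  conv_lhs => rw [← RatFunc.num_div_denom f, e, map_mul, map_pow, RatFunc.algebraMap_X]
  rw [← mul_div_assoc, mul_div_mul_left _ _ h1]

theorem eq_zero_of_forall_pow {f : K} (h : ∀ N : ℕ, ∃ g ∈ Reg, f = RatFunc.X ^ N * g) : f = 0 := by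
  by_contra h0
  have hn : f.num ≠ 0 := RatFunc.num_ne_zero h0
  obtain ⟨N, p, hp, e⟩ := exists_poly_eq hn
  obtain ⟨g, hg, e'⟩ := h (N + 1)
  have h1 : (RatFunc.X : K) ^ N ≠ 0 := pow_ne_zero _ RatFunc.X_ne_zero
  have h2 : algebraMap ℝ[X] K p = RatFunc.X * g * algebraMap ℝ[X] K f.denom := by
    have h3 : algebraMap ℝ[X] K f.num = f * algebraMap ℝ[X] K f.denom :=
      (div_eq_iff (RatFunc.algebraMap_ne_zero f.denom_ne_zero)).1 (RatFunc.num_div_denom f)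
    rw [e, map_mul, map_pow, RatFunc.algebraMap_X] at h3
    apply mul_left_cancel₀ h1
    rw [h3]
    nth_rw 1 [e']
    ring
  have h3 := congrArg constTerm h2
  rw [constTerm_mul (Reg.mul_mem X_mem_Reg hg) (algebraMap_mem_Reg _), constTerm_mul X_mem_Reg hg,
    constTerm_X, zero_mul, zero_mul, constTerm_algebraMap] at h3
  exact hp h3

theorem X_pow_mul_mem {f : K} (hf : f ∈ Reg) (N : ℕ) : RatFunc.X ^ N * f ∈ Reg :=
  Reg.mul_mem (Reg.pow_mem X_mem_Reg N) hf

theorem constTerm_X_pow_mul {f : K} (hf : f ∈ Reg) {N : ℕ} (hN : 0 < N) :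
    constTerm (RatFunc.X ^ N * f) = 0 := by
  obtain ⟨N, rfl⟩ := Nat.exists_eq_add_of_lt hN
  rw [zero_add, pow_succ', mul_assoc, constTerm_mul X_mem_Reg (X_pow_mul_mem hf N), constTerm_X,
    zero_mul]

/-- A family of rational functions has a least power of `v` clearing all poles at `0`. -/
theorem exists_min_pow {ι : Type*} [Finite ι] (a : ι → K) :
    ∃ N : ℕ, (∀ i, RatFunc.X ^ N * a i ∈ Reg) ∧
      (0 < N → ∃ i, constTerm (RatFunc.X ^ N * a i) ≠ 0) := by
  classical
  have hex : ∃ N : ℕ, ∀ i, RatFunc.X ^ N * a i ∈ Reg := by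
    choose N hN using fun i => exists_X_pow_mul_mem (a i)
    obtain ⟨M, hM⟩ := (Set.finite_range N).bddAbove
    refine ⟨M, fun i => ?_⟩
    have := hM ⟨i, rfl⟩
    rw [← Nat.sub_add_cancel this, pow_add, mul_assoc]
    exact X_pow_mul_mem (hN i) _
  obtain ⟨N, hN, hmin⟩ : ∃ N : ℕ, (∀ i, RatFunc.X ^ N * a i ∈ Reg) ∧
      ∀ M < N, ¬ ∀ i, RatFunc.X ^ M * a i ∈ Reg :=
    ⟨Nat.find hex, Nat.find_spec hex, fun _ => Nat.find_min hex⟩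
  refine ⟨N, hN, fun hpos => ?_⟩
  by_contra! h
  obtain ⟨M, rfl⟩ := Nat.exists_eq_add_of_lt hpos
  refine hmin M (by omega) fun i => ?_
  obtain ⟨g, hg, e⟩ := exists_eq_X_mul (hN i) (h i)
  rw [zero_add, pow_succ', mul_assoc] at e
  rw [mul_left_cancel₀ RatFunc.X_ne_zero e]
  exact hg

theorem constTerm_sum_sq {ι : Type*} [Fintype ι] {a p : ι → K} (hp : ∀ i, p i ∈ Reg)
    (ha : ∀ i, a i ∈ Reg) : ∑ i, p i * a i ^ 2 ∈ Reg ∧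
      constTerm (∑ i, p i * a i ^ 2) = ∑ i, constTerm (p i) * constTerm (a i) ^ 2 := by
  have h : ∀ i, p i * a i ^ 2 ∈ Reg := fun i => Reg.mul_mem (hp i) (Reg.pow_mem (ha i) 2)
  refine ⟨Reg.sum_mem fun i _ => h i, ?_⟩
  rw [constTerm_sum _ fun i _ => h i]
  refine Finset.sum_congr rfl fun i _ => ?_
  rw [constTerm_mul (hp i) (Reg.pow_mem (ha i) 2), pow_two, constTerm_mul (ha i) (ha i), ← pow_two]

/-- Leading terms of squares with positive weights cannot cancel: if the largest pole order is `N >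
0`, the coefficient of the sum at `v ^ (-2N)` is a sum of non-negative reals that are not all zero.
-/
theorem mem_Reg_of_sum_sq {ι : Type*} [Fintype ι] {a p : ι → K} (hp : ∀ i, p i ∈ Reg)
    (hp1 : ∀ i, 0 < constTerm (p i)) (h : ∑ i, p i * a i ^ 2 ∈ Reg) : ∀ i, a i ∈ Reg := by
  obtain ⟨N, hN, hne⟩ := exists_min_pow a
  rcases Nat.eq_zero_or_pos N with rfl | hpos
  · simpa using hN
  · exfalso
    obtain ⟨i, hi⟩ := hne hpos
    have h1 := (constTerm_sum_sq hp hN).2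
    have e : ∑ i, p i * (RatFunc.X ^ N * a i) ^ 2 = RatFunc.X ^ (2 * N) * ∑ i, p i * a i ^ 2 := by
      rw [Finset.mul_sum]
      refine Finset.sum_congr rfl fun i _ => ?_
      ring
    rw [e, constTerm_X_pow_mul h (by omega)] at h1
    have h2 : 0 < ∑ i, constTerm (p i) * constTerm (RatFunc.X ^ N * a i) ^ 2 :=
      Finset.sum_pos' (fun i _ => mul_nonneg (hp1 i).le (sq_nonneg _))
        ⟨i, Finset.mem_univ i, mul_pos (hp1 i) (by positivity)⟩
    exact h2.ne h1

/-- `ℝ(v)` is formally real: the relation survives division by any power of `v`, so every `a i` is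
divisible by all powers of `v`. -/
theorem eq_zero_of_sum_sq {ι : Type*} [Fintype ι] {a : ι → K} (h : ∑ i, a i ^ 2 = 0) (i : ι) :
    a i = 0 := by
  refine eq_zero_of_forall_pow fun N => ?_
  have hX : (RatFunc.X : K) ^ N ≠ 0 := pow_ne_zero _ RatFunc.X_ne_zero
  refine ⟨(RatFunc.X ^ N)⁻¹ * a i, ?_, (mul_inv_cancel_left₀ hX _).symm⟩
  refine mem_Reg_of_sum_sq (p := fun _ => 1) (a := fun i => (RatFunc.X ^ N)⁻¹ * a i)
    (fun _ => Reg.one_mem) (fun _ => by rw [constTerm_one]; exact one_pos) ?_ i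
  have : ∑ i, 1 * ((RatFunc.X ^ N)⁻¹ * a i) ^ 2 = ((RatFunc.X ^ N)⁻¹) ^ 2 * ∑ i, a i ^ 2 := by
    rw [Finset.mul_sum]
    refine Finset.sum_congr rfl fun i _ => ?_
    ring
  rw [this, h, mul_zero]
  exact Reg.zero_mem

/-! ### Laurent polynomials as rational functions -/

theorem algebraMap_A_v (k : ℤ) : algebraMap A K (v k) = RatFunc.X ^ k := by
  change LaurentPolynomial.eval₂ _ _ _ = _
  rw [LaurentPolynomial.eval₂_T]
  simp

theorem algebraMap_A_toLaurent (p : Polynomial ℤ) : algebraMap A K (Polynomial.toLaurent p) =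
    algebraMap ℝ[X] K (p.map (Int.castRingHom ℝ)) := by
  change LaurentPolynomial.eval₂ _ _ _ = _
  rw [LaurentPolynomial.eval₂_toLaurent]
  induction p using Polynomial.induction_on' with
  | add p q hp hq => rw [Polynomial.eval₂_add, hp, hq, Polynomial.map_add, map_add]
  | monomial k a =>
    rw [Polynomial.eval₂_monomial, Polynomial.map_monomial, ← Polynomial.C_mul_X_pow_eq_monomial,
      map_mul, map_pow, RatFunc.algebraMap_X]
    simp

theorem exists_toLaurent (f : A) : ∃ (N : ℕ) (p : Polynomial ℤ),
    f = v (-N) * Polynomial.toLaurent p := by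
  obtain ⟨N, p, hp⟩ := f.exists_T_pow
  refine ⟨N, p, ?_⟩
  rw [hp, mul_comm f, ← mul_assoc, v_mul_v]
  simp

theorem algebraMap_A_injective : Function.Injective (algebraMap A K) := by
  rw [injective_iff_map_eq_zero]
  intro f hf
  obtain ⟨N, p, rfl⟩ := exists_toLaurent f
  rw [map_mul, algebraMap_A_v, algebraMap_A_toLaurent] at hf
  have h1 := (mul_eq_zero.1 hf).resolve_left (zpow_ne_zero _ RatFunc.X_ne_zero)
  have h2 : p.map (Int.castRingHom ℝ) = 0 := by
    by_contra h; exact RatFunc.algebraMap_ne_zero h h1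
  have h3 : p = 0 := Polynomial.map_injective _ (RingHom.injective_int (Int.castRingHom ℝ))
    (by rw [h2, Polynomial.map_zero])
  rw [h3, map_zero, mul_zero]

theorem coeff_toLaurent_natCast (p : Polynomial ℤ) (k : ℕ) :
    (Polynomial.toLaurent p).coeff (k : ℤ) = p.coeff k := by
  have := Finsupp.mapDomain_apply (f := fun k : ℕ => (k : ℤ)) Nat.cast_injective p.toFinsupp.coeff k
  exact this

theorem exists_toLaurent_of_mem {f : A} (hf : f ∈ APlus) :
    ∃ p : Polynomial ℤ, f = Polynomial.toLaurent p := by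
  obtain ⟨N, p, rfl⟩ := exists_toLaurent f
  have h : (Polynomial.X : Polynomial ℤ) ^ N ∣ p := by
    rw [Polynomial.X_pow_dvd_iff]
    intro d hd
    have := hf (d - N) (by omega)
    rwa [coeff_v_mul, show (d : ℤ) - N - -N = (d : ℤ) by ring, coeff_toLaurent_natCast] at this
  obtain ⟨q, rfl⟩ := h
  refine ⟨q, ?_⟩
  rw [map_mul, Polynomial.toLaurent_X_pow, ← mul_assoc, v_mul_v, neg_add_cancel, v_zero, one_mul]

theorem algebraMap_A_mem {f : A} (hf : f ∈ APlus) : algebraMap A K f ∈ Reg ∧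
    constTerm (algebraMap A K f) = (f.coeff 0 : ℝ) := by
  obtain ⟨p, rfl⟩ := exists_toLaurent_of_mem hf
  rw [algebraMap_A_toLaurent]
  refine ⟨algebraMap_mem_Reg _, ?_⟩
  rw [constTerm_algebraMap, ← Polynomial.coeff_zero_eq_eval_zero, Polynomial.coeff_map]
  have := coeff_toLaurent_natCast p 0
  rw [Nat.cast_zero] at this
  rw [this]; rfl

theorem mem_APlus_of_mem_Reg {f : A} (hf : algebraMap A K f ∈ Reg) : f ∈ APlus := by
  classical
  have hex : ∃ N : ℕ, ∃ p : Polynomial ℤ, f = v (-N) * Polynomial.toLaurent p := exists_toLaurent f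
  obtain ⟨N, ⟨p, hp⟩, hmin⟩ : ∃ N : ℕ, (∃ p : Polynomial ℤ, f = v (-N) * Polynomial.toLaurent p) ∧
      ∀ M < N, ¬ ∃ p : Polynomial ℤ, f = v (-M) * Polynomial.toLaurent p :=
    ⟨Nat.find hex, Nat.find_spec hex, fun _ => Nat.find_min hex⟩
  rcases Nat.eq_zero_or_pos N with rfl | hN
  · rw [hp]
    intro k hk
    simp only [Nat.cast_zero, neg_zero, v_zero, one_mul]
    -- The image of an ordinary polynomial has no exponents outside the range of `ℕ → ℤ`.
    exact Finsupp.mapDomain_of_notMem_range _ _ (by rintro ⟨m, rfl⟩; exact absurd hk (by simp))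
  · exfalso
    obtain ⟨M, rfl⟩ := Nat.exists_eq_add_of_lt hN
    rw [zero_add] at *
    have h1 : algebraMap A K (Polynomial.toLaurent p) =
        RatFunc.X ^ (M + 1) * algebraMap A K f := by
      conv_rhs => rw [hp, map_mul, algebraMap_A_v]
      rw [← mul_assoc, ← zpow_natCast, ← zpow_add₀ RatFunc.X_ne_zero, add_neg_cancel, zpow_zero,
        one_mul]
    have h2 := congrArg constTerm h1
    rw [constTerm_X_pow_mul hf (Nat.succ_pos M), algebraMap_A_toLaurent, constTerm_algebraMap,
      ← Polynomial.coeff_zero_eq_eval_zero, Polynomial.coeff_map] at h2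
    have h3 : p.coeff 0 = 0 := by simpa using h2
    obtain ⟨q, rfl⟩ := Polynomial.X_dvd_iff.2 h3
    refine hmin M (by omega) ⟨q, ?_⟩
    rw [hp, map_mul, Polynomial.toLaurent_X, ← mul_assoc, v_mul_v]
    congr 2
    push_cast
    ring

/-! ### Semisimple algebras -/

section Semisimple

variable {k H : Type*} [Field k] [CharZero k] [Ring H] [Algebra k H] [Module.Finite k H]

omit [CharZero k] in
/-- In the presence of an anisotropic invariant form, a two-sided ideal has a central unit. -/
theorem exists_unit_of_ideal (B : LinearMap.BilinForm k H) (st : H → H)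
    (hsym : ∀ x y, B x y = B y x) (h0 : ∀ x, B x x = 0 → x = 0)
    (hBl : ∀ h x y, B x (h * y) = B (st h * x) y) (hBr : ∀ h x y, B x (y * h) = B (x * st h) y)
    (J : Submodule k H) (hl : ∀ h, ∀ x ∈ J, h * x ∈ J) (hr : ∀ h, ∀ x ∈ J, x * h ∈ J) :
    ∃ e ∈ J, (∀ x ∈ J, x * e = x) ∧ ∀ h, e * h = h * e := by
  have hrefl : B.IsRefl := fun x y h => by rw [hsym, h]
  have hdisj : ∀ x, x ∈ J → x ∈ B.orthogonal J → x = 0 := fun x h1 h2 => h0 x (h2 x h1)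
  have hc : IsCompl J (B.orthogonal J) := by
    rw [LinearMap.BilinForm.isCompl_orthogonal_iff_disjoint hrefl, Submodule.disjoint_def]
    exact hdisj
  have hol : ∀ h, ∀ x ∈ B.orthogonal J, h * x ∈ B.orthogonal J := by
    intro h x hx y hy
    change B y (h * x) = 0
    rw [hBl]
    exact hx _ (hl _ y hy)
  have hor : ∀ h, ∀ x ∈ B.orthogonal J, x * h ∈ B.orthogonal J := by
    intro h x hx y hy
    change B y (x * h) = 0
    rw [hBr]
    exact hx _ (hr _ y hy)
  -- The ideal and its orthogonal complement are both two-sided and meet trivially, so they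
  -- annihilate each other. Hence the component of 1 in the ideal is its unit.
  obtain ⟨e, he, f, hf, hef⟩ := Submodule.mem_sup.1 (hc.sup_eq_top ▸ Submodule.mem_top :
    (1 : H) ∈ J ⊔ B.orthogonal J)
  have h1 : ∀ x ∈ J, x * e = x := fun x hx => by
    have h0 : x * f = 0 := hdisj _ (hr f x hx) (hol x f hf)
    conv_rhs => rw [← mul_one x, ← hef, mul_add, h0, add_zero]
  have h2 : ∀ x ∈ J, e * x = x := fun x hx => by
    have h0 : f * x = 0 := hdisj _ (hl f x hx) (hor x f hf)
    conv_rhs => rw [← one_mul x, ← hef, add_mul, h0, add_zero]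
  refine ⟨e, he, h1, fun h => ?_⟩
  rw [← h1 _ (hr h e he), mul_assoc, h2 _ (hl h e he)]

/-- The image of the representation has no proper non-zero invariant subspace. -/
def IsIrr {d : ℕ} (ρ : H →ₐ[k] Matrix (Fin d) (Fin d) k) : Prop :=
  0 < d ∧ ∀ U : Submodule k (Fin d → k), (∀ h, ∀ u ∈ U, ρ h *ᵥ u ∈ U) → U = ⊥ ∨ U = ⊤

theorem exists_atom_le (k : Type*) [Field k] [Algebra k H] [Module.Finite k H] {N : Submodule H H} (hN : N ≠ ⊥) : ∃ I ≤ N, IsAtom I := by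
  have : IsArtinianRing H := IsArtinianRing.of_finite k H
  have : IsAtomic (Submodule H H) :=
    isAtomic_of_orderBot_wellFounded_lt (inferInstance : WellFoundedLT _).wf
  obtain ⟨I, hI, hle⟩ := (eq_bot_or_exists_atom_le N).resolve_left hN
  exact ⟨I, hle, hI⟩

/-- The character of a left ideal. -/
def idealChar (k : Type*) [Field k] [Algebra k H] (I : Submodule H H) (h : H) : k :=
  LinearMap.trace k I (Algebra.lsmul k k I h)

omit [CharZero k] [Module.Finite k H] in
-- Schur's lemma: acting on a vector that `ρ x` does not kill is a non-zero module map from the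
-- minimal left ideal to an irreducible module, hence an isomorphism.
theorem idealChar_eq {I : Submodule H H} (hI : IsAtom I) {d : ℕ}
    {ρ : H →ₐ[k] Matrix (Fin d) (Fin d) k} (hρ : IsIrr ρ) {x : H} (hx : x ∈ I)
    (h0 : ρ x ≠ 0) (h : H) : idealChar k I h = (ρ h).trace := by
  obtain ⟨u, hu⟩ : ∃ u, ρ x *ᵥ u ≠ 0 := by
    by_contra! hu
    exact h0 (Matrix.ext_of_mulVec_single fun i => by rw [hu, Matrix.zero_mulVec])
  let N : Submodule H H :=
    { carrier := {y | y ∈ I ∧ ρ y *ᵥ u = 0}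
      zero_mem' := ⟨I.zero_mem, by rw [map_zero, Matrix.zero_mulVec]⟩
      add_mem' := fun ha hb => ⟨I.add_mem ha.1 hb.1, by
        rw [map_add, Matrix.add_mulVec, ha.2, hb.2, add_zero]⟩
      smul_mem' := fun c y hy => ⟨I.smul_mem c hy.1, by
        rw [smul_eq_mul, map_mul, ← Matrix.mulVec_mulVec, hy.2, Matrix.mulVec_zero]⟩ }
  have hN : N = ⊥ := by
    rcases hI.le_iff.1 (show N ≤ I from fun y hy => hy.1) with e | e
    · exact e
    · exact absurd (show x ∈ N by rw [e]; exact hx).2 hu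
  let φ : I →ₗ[k] (Fin d → k) :=
    { toFun := fun y => ρ y *ᵥ u
      map_add' := fun a b => by
        change ρ (a.1 + b.1) *ᵥ u = _
        rw [map_add, Matrix.add_mulVec]
      map_smul' := fun c a => by
        change ρ (c • a.1) *ᵥ u = _
        rw [map_smul, Matrix.smul_mulVec, RingHom.id_apply] }
  have hinj : Function.Injective φ := by
    rw [injective_iff_map_eq_zero]
    intro a ha
    have : a.1 ∈ N := ⟨a.2, ha⟩
    rw [hN] at this
    exact Subtype.ext this
  have hsurj : Function.Surjective φ := by
    rw [← LinearMap.range_eq_top]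
    refine (hρ.2 (LinearMap.range φ) ?_).resolve_left fun e => hu ?_
    · rintro h _ ⟨y, rfl⟩
      refine ⟨h • y, ?_⟩
      change ρ (h * y.1) *ᵥ u = ρ h *ᵥ (ρ y.1 *ᵥ u)
      rw [map_mul, Matrix.mulVec_mulVec]
    · have : φ ⟨x, hx⟩ ∈ LinearMap.range φ := ⟨_, rfl⟩
      rwa [e] at this
  let e := LinearEquiv.ofBijective φ ⟨hinj, hsurj⟩
  have key : e.conj (Algebra.lsmul k k I h) = Matrix.toLin' (ρ h) := by
    refine LinearMap.ext fun z => ?_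
    obtain ⟨y, rfl⟩ := e.surjective z
    rw [LinearEquiv.conj_apply_apply, e.symm_apply_apply, Matrix.toLin'_apply]
    change ρ (h * y.1) *ᵥ u = ρ h *ᵥ (ρ y.1 *ᵥ u)
    rw [map_mul, Matrix.mulVec_mulVec]
  rw [idealChar, ← LinearMap.trace_conj' _ e, key, Matrix.trace_toLin'_eq]

omit [CharZero k] in
theorem exists_rep_of_atom {I : Submodule H H} (hI : IsAtom I) :
    ∃ (d : ℕ) (ρ : H →ₐ[k] Matrix (Fin d) (Fin d) k), IsIrr ρ ∧
      ∀ h, (ρ h).trace = idealChar k I h := by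
  have : Module.Finite k I := inferInstanceAs (Module.Finite k (I.restrictScalars k))
  let b := Module.finBasis k I
  have hpos : 0 < Module.finrank k I := by
    rw [Module.finrank_pos_iff, Submodule.nontrivial_iff_ne_bot]
    exact hI.1
  let ρ := (LinearMap.toMatrixAlgEquiv b).toAlgHom.comp
    (Algebra.lsmul k k I : H →ₐ[k] Module.End k I)
  refine ⟨_, ρ, ⟨hpos, fun U hU => ?_⟩, ?_⟩
  · have hρ : ∀ (h : H) (y : I), ρ h *ᵥ (b.equivFun y) = b.equivFun (h • y) := by
      intro h y
      exact LinearMap.toMatrix_mulVec_repr b b 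
        ((Algebra.lsmul k k I : H →ₐ[k] Module.End k I) h) y
    let N : Submodule H H :=
      { carrier := {y | ∃ hy : y ∈ I, b.equivFun ⟨y, hy⟩ ∈ U}
        zero_mem' := ⟨I.zero_mem, by
          have : (⟨0, I.zero_mem⟩ : I) = 0 := rfl
          rw [this, map_zero]; exact U.zero_mem⟩
        add_mem' := fun {x y} ⟨hx, hx'⟩ ⟨hy, hy'⟩ => ⟨I.add_mem hx hy, by
          have : (⟨x + y, I.add_mem hx hy⟩ : I) = ⟨x, hx⟩ + ⟨y, hy⟩ := rfl
          rw [this, map_add]; exact U.add_mem hx' hy'⟩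
        smul_mem' := fun c x ⟨hx, hx'⟩ => ⟨I.smul_mem c hx, by
          have : (⟨c • x, I.smul_mem c hx⟩ : I) = c • ⟨x, hx⟩ := rfl
          rw [this, ← hρ]; exact hU c _ hx'⟩ }
    rcases hI.le_iff.1 (show N ≤ I from fun y hy => hy.1) with e | e
    · left
      rw [eq_bot_iff]
      intro u hu
      obtain ⟨y, rfl⟩ := b.equivFun.surjective u
      have : y.1 ∈ N := ⟨y.2, hu⟩
      rw [e] at this
      have : y = 0 := Subtype.ext this
      rw [this, map_zero]
      exact Submodule.zero_mem _
    · right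
      rw [eq_top_iff]
      intro u _
      obtain ⟨y, rfl⟩ := b.equivFun.surjective u
      have : y.1 ∈ N := by rw [e]; exact y.2
      exact this.2
  · intro h
    exact (LinearMap.trace_eq_matrix_trace k b _).symm

/-- `e` acts as the identity, so its trace is the dimension of `I`, which is non-zero in
characteristic zero. -/
theorem idealChar_ne_zero {I : Submodule H H} (hI : IsAtom I) {e : H} (he : ∀ x ∈ I, e * x = x) :
    idealChar k I e ≠ 0 := by
  have h4 : Algebra.lsmul k k I e = LinearMap.id := LinearMap.ext fun y => Subtype.ext (he y.1 y.2)
  intro h3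
  have : Module.Finite k I := inferInstanceAs (Module.Finite k (I.restrictScalars k))
  rw [idealChar, h4, LinearMap.trace_id, Nat.cast_eq_zero, Module.finrank_eq_zero_iff_of_free,
    Submodule.subsingleton_iff_eq_bot] at h3
  exact hI.1 h3

/-- A central idempotent with vanishing trace on a cyclic module acts as zero. -/
theorem mem_of_trace_eq_zero {N : Submodule H H} {f : H} (hff : f * f = f)
    (h : LinearMap.trace k (H ⧸ N) (Algebra.lsmul k k (H ⧸ N) f) = 0) : f ∈ N := by
  have : Module.Finite k (H ⧸ N) :=
    Module.Finite.of_surjective (N.mkQ.restrictScalars k) N.mkQ_surjective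
  have hid : IsIdempotentElem (Algebra.lsmul k k (H ⧸ N) f) := by
    change _ * _ = _
    rw [← map_mul, hff]
  have h1 : f • N.mkQ 1 = 0 :=
    LinearMap.congr_fun (LinearMap.IsIdempotentElem.trace_eq_zero_iff hid |>.1 h) (N.mkQ 1)
  rw [← map_smul, smul_eq_mul, mul_one] at h1
  exact (Submodule.Quotient.mk_eq_zero N).1 h1

omit [CharZero k] [Module.Finite k H] in
theorem IsIrr.eq_zero_or_one {d : ℕ} {ρ : H →ₐ[k] Matrix (Fin d) (Fin d) k}
    (hρ : IsIrr ρ) {f : H} (hf : ∀ h, f * h = h * f) (hff : f * f = f) :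
    ρ f = 0 ∨ ρ f = 1 := by
  have hinv : ∀ h, ∀ u ∈ LinearMap.ker (Matrix.mulVecLin (ρ f)),
      ρ h *ᵥ u ∈ LinearMap.ker (Matrix.mulVecLin (ρ f)) := by
    intro h u hu
    rw [LinearMap.mem_ker, Matrix.mulVecLin_apply] at hu ⊢
    rw [Matrix.mulVec_mulVec, ← map_mul, hf, map_mul, ← Matrix.mulVec_mulVec, hu, Matrix.mulVec_zero]
  rcases hρ.2 _ hinv with e | e
  · right
    refine Matrix.ext_of_mulVec_single fun i => ?_
    have : ρ f *ᵥ Pi.single i 1 - Pi.single i 1 ∈ LinearMap.ker (Matrix.mulVecLin (ρ f)) := by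
      rw [LinearMap.mem_ker, Matrix.mulVecLin_apply, Matrix.mulVec_sub, Matrix.mulVec_mulVec,
        ← map_mul, hff, sub_self]
    rw [e, Submodule.mem_bot, sub_eq_zero] at this
    rw [this, Matrix.one_mulVec]
  · left
    refine Matrix.ext_of_mulVec_single fun i => ?_
    have : (Pi.single i 1 : Fin d → k) ∈ LinearMap.ker (Matrix.mulVecLin (ρ f)) := by
      rw [e]; exact Submodule.mem_top
    rw [Matrix.zero_mulVec]
    exact this

end Semisimple

/-! ### Extension of scalars to `ℝ(v)` -/

/-- The standard basis of the scalar extension. -/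
def bK (n : ℕ) : Module.Basis (Perm (Fin n)) K (HK n) := Algebra.TensorProduct.basis K (basis n)

theorem bK_apply (w : Perm (Fin n)) : bK n w = toHK (T w) := Algebra.TensorProduct.basis_apply _ w

instance : Module.Finite K (HK n) := Module.Finite.of_basis (bK n)

theorem toHK_smul (a : A) (h : Hecke n) : toHK (a • h) = algebraMap A K a • toHK h := by
  rw [map_smul, algebraMap_smul]

theorem toHK_eq_sum (h : Hecke n) : toHK h = ∑ w, algebraMap A K (coeff h w) • bK n w := by
  conv_lhs => rw [← sum_coeff_smul_T h, map_sum]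
  exact Finset.sum_congr rfl fun w _ => by rw [toHK_smul, bK_apply]

theorem repr_toHK (h : Hecke n) (w : Perm (Fin n)) :
    (bK n).repr (toHK h) w = algebraMap A K (coeff h w) := by
  rw [toHK_eq_sum, (bK n).repr_sum_self]

theorem toHK_injective : Function.Injective (toHK : Hecke n → HK n) := fun x y h =>
  ext_coeff fun w => algebraMap_A_injective (by rw [← repr_toHK, ← repr_toHK, h])

/-- The anti-involution `T w ↦ T w⁻¹` of the scalar extension. -/
def flipK : HK n →ₗ[K] HK n := (flip (n := n)).baseChange K

theorem flipK_toHK (h : Hecke n) : flipK (toHK h) = toHK (flip h) := rfl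

theorem flipK_mul (x y : HK n) : flipK (x * y) = flipK y * flipK x := by
  suffices e : (LinearMap.mul K (HK n)).compr₂ flipK =
      ((LinearMap.mul K (HK n)).flip.compl₁₂ flipK flipK) from
    LinearMap.congr_fun (LinearMap.congr_fun e x) y
  refine (bK n).ext fun u => (bK n).ext fun w => ?_
  simp only [LinearMap.compr₂_apply, LinearMap.mul_apply', LinearMap.compl₁₂_apply,
    LinearMap.flip_apply, bK_apply, flipK_toHK, ← map_mul, flip_mul]

/-- The symmetrizing trace. -/
def tauK : HK n →ₗ[K] K := (bK n).coord 1

theorem tauK_toHK (h : Hecke n) : tauK (toHK h) = algebraMap A K (coeff h 1) := repr_toHK h 1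

theorem tauK_T_mul_T (x y : Perm (Fin n)) :
    tauK (toHK (T x) * toHK (T y)) = if x = y⁻¹ then 1 else 0 := by
  rw [← map_mul, tauK_toHK, coeff_T_mul_T_one]
  split_ifs <;> simp

theorem tauK_mul_comm (x y : HK n) : tauK (x * y) = tauK (y * x) := by
  suffices e : (LinearMap.mul K (HK n)).compr₂ tauK = (LinearMap.mul K (HK n)).flip.compr₂ tauK from
    LinearMap.congr_fun (LinearMap.congr_fun e x) y
  refine (bK n).ext fun u => (bK n).ext fun w => ?_
  simp only [LinearMap.compr₂_apply, LinearMap.mul_apply', LinearMap.flip_apply, bK_apply,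
    tauK_T_mul_T]
  congr 1
  rw [eq_iff_iff]
  exact ⟨fun h => by rw [h, inv_inv], fun h => by rw [h, inv_inv]⟩

/-- The bilinear form for which the `T w` are orthonormal. -/
def formK (n : ℕ) : LinearMap.BilinForm K (HK n) :=
  ((LinearMap.mul K (HK n)).compl₁₂ LinearMap.id flipK).compr₂ tauK

theorem formK_apply (x y : HK n) : formK n x y = tauK (x * flipK y) := rfl

theorem formK_eq_sum (x y : HK n) :
    formK n x y = ∑ w, (bK n).repr x w * (bK n).repr y w := by
  suffices e : formK n = ∑ w, (LinearMap.mul K K).compl₁₂ ((bK n).coord w) ((bK n).coord w) by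
    rw [e]
    simp [LinearMap.sum_apply]
  refine (bK n).ext fun u => (bK n).ext fun w => ?_
  rw [formK_apply, bK_apply, bK_apply, flipK_toHK, flip_T, tauK_T_mul_T, inv_inv]
  simp only [← bK_apply, LinearMap.sum_apply, LinearMap.compl₁₂_apply,
    LinearMap.mul_apply', Module.Basis.coord_apply, Module.Basis.repr_self]
  by_cases h : u = w
  · subst h
    rw [Finset.sum_eq_single u (fun y _ hy => by rw [Finsupp.single_eq_of_ne hy, zero_mul])
      (fun h => absurd (Finset.mem_univ _) h)]
    simp
  · rw [if_neg h, Finset.sum_eq_zero]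
    intro y _
    by_cases hy : y = u
    · rw [Finsupp.single_eq_of_ne (a := w) (fun e => h (hy ▸ e)), mul_zero]
    · rw [Finsupp.single_eq_of_ne hy, zero_mul]

theorem formK_comm (x y : HK n) : formK n x y = formK n y x := by
  rw [formK_eq_sum, formK_eq_sum]
  exact Finset.sum_congr rfl fun _ _ => mul_comm _ _

/-- The form is a sum of squares in the basis `T w`, and `ℝ(v)` is formally real. This anisotropy
supplies the semisimplicity of the algebra. -/
theorem eq_zero_of_formK {x : HK n} (h : formK n x x = 0) : x = 0 := by
  rw [formK_eq_sum] at h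
  apply (bK n).repr.injective
  ext w
  rw [map_zero, Finsupp.zero_apply]
  exact eq_zero_of_sum_sq (by simpa only [pow_two] using h) w

theorem formK_mul_left (h x y : HK n) : formK n x (h * y) = formK n (flipK h * x) y := by
  rw [formK_apply, formK_apply, flipK_mul, ← mul_assoc, tauK_mul_comm, mul_assoc]

theorem formK_mul_right (h x y : HK n) : formK n x (y * h) = formK n (x * flipK h) y := by
  rw [formK_apply, formK_apply, flipK_mul, ← mul_assoc]

theorem exists_unit (J : Submodule K (HK n)) (hl : ∀ h, ∀ x ∈ J, h * x ∈ J)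
    (hr : ∀ h, ∀ x ∈ J, x * h ∈ J) : ∃ e ∈ J, (∀ x ∈ J, x * e = x) ∧ ∀ h, e * h = h * e :=
  exists_unit_of_ideal (formK n) flipK formK_comm (fun _ => eq_zero_of_formK) formK_mul_left
    formK_mul_right J hl hr

/-! ### Central idempotents -/

namespace IrrFamily

variable (F : IrrFamily n)

/-- Otherwise the common kernel contains a minimal left ideal. Its character is one of the `χ_λ` and
so vanishes at the unit of the kernel, whereas that unit acts on the ideal as the identity. -/
theorem eq_zero_of_rep {x : HK n} (hx : ∀ lam, F.rep lam x = 0) : x = 0 := by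
  by_contra h0
  let N : Submodule (HK n) (HK n) :=
    { carrier := {y | ∀ lam, F.rep lam y = 0}
      zero_mem' := fun lam => map_zero _
      add_mem' := fun ha hb lam => by rw [map_add, ha, hb, add_zero]
      smul_mem' := fun c y hy lam => by rw [smul_eq_mul, map_mul, hy, mul_zero] }
  obtain ⟨e, he, h1, h2⟩ := exists_unit (N.restrictScalars K)
    (fun h y hy => N.smul_mem h hy) (fun h y hy lam => by rw [map_mul, hy, zero_mul])
  have hN : N ≠ ⊥ := fun e => h0 (by
    have : x ∈ N := hx
    rwa [e] at this)
  obtain ⟨I, hIN, hI⟩ := exists_atom_le K hN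
  obtain ⟨d, ρ, hρ, hc⟩ := exists_rep_of_atom (k := K) hI
  obtain ⟨lam, hlam⟩ := F.exhaustive d ρ hρ
  refine idealChar_ne_zero (k := K) hI (e := e) (fun y hy => by rw [h2, h1 _ (hIN hy)]) ?_
  rw [← hc, ← character, ← hlam, character, he, Matrix.trace_zero]

theorem exists_centralIdem (lam : n.Partition) : ∃ f : HK n, (∀ h, f * h = h * f) ∧
    F.rep lam f = 1 ∧ ∀ x, F.rep lam x = 0 → x * f = 0 := by
  obtain ⟨e, he, h1, h2⟩ := exists_unit (LinearMap.ker (F.rep lam).toLinearMap)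
    (fun h y hy => by
      simp only [LinearMap.mem_ker, AlgHom.toLinearMap_apply] at hy ⊢
      rw [map_mul, hy, mul_zero])
    (fun h y hy => by
      simp only [LinearMap.mem_ker, AlgHom.toLinearMap_apply] at hy ⊢
      rw [map_mul, hy, zero_mul])
  refine ⟨1 - e, fun h => ?_, ?_, fun x hx => ?_⟩
  · rw [sub_mul, mul_sub, h2, one_mul, mul_one]
  · rw [map_sub, map_one, show F.rep lam e = 0 from he, sub_zero]
  · rw [mul_sub, mul_one, h1 x hx, sub_self]

/-- The central idempotent acting as the identity in the representation labelled `lam`. -/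
def centralIdem (lam : n.Partition) : HK n := (F.exists_centralIdem lam).choose

theorem centralIdem_comm (lam : n.Partition) (h : HK n) :
    F.centralIdem lam * h = h * F.centralIdem lam := (F.exists_centralIdem lam).choose_spec.1 h

theorem rep_centralIdem_self (lam : n.Partition) : F.rep lam (F.centralIdem lam) = 1 :=
  (F.exists_centralIdem lam).choose_spec.2.1

theorem mul_centralIdem {lam : n.Partition} {x : HK n} (hx : F.rep lam x = 0) :
    x * F.centralIdem lam = 0 := (F.exists_centralIdem lam).choose_spec.2.2 x hx

theorem centralIdem_mul_self (lam : n.Partition) :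
    F.centralIdem lam * F.centralIdem lam = F.centralIdem lam := by
  have := F.mul_centralIdem (lam := lam) (x := F.centralIdem lam - 1)
    (by rw [map_sub, rep_centralIdem_self, map_one, sub_self])
  rwa [sub_mul, one_mul, sub_eq_zero] at this

theorem one_ne_zero_matrix (lam : n.Partition) :
    (1 : Matrix (Fin (F.deg lam)) (Fin (F.deg lam)) K) ≠ 0 := by
  have : Nonempty (Fin (F.deg lam)) := ⟨⟨0, (F.irreducible lam).1⟩⟩
  exact one_ne_zero

/-- If the idempotent of `lam` acted as 1 in the representation of `mu`, the product of the two
idempotents would be non-zero. Some minimal left ideal would be fixed by both, and both characters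
would equal the character of that ideal. -/
theorem rep_centralIdem {lam mu : n.Partition} (h : mu ≠ lam) :
    F.rep mu (F.centralIdem lam) = 0 := by
  refine (IsIrr.eq_zero_or_one (F.irreducible mu) (F.centralIdem_comm lam)
    (F.centralIdem_mul_self lam)).resolve_right fun h1 => h ?_
  let N : Submodule (HK n) (HK n) :=
    { carrier := {x | x * F.centralIdem lam = x ∧ x * F.centralIdem mu = x}
      zero_mem' := ⟨zero_mul _, zero_mul _⟩
      add_mem' := fun ha hb => ⟨by rw [add_mul, ha.1, hb.1], by rw [add_mul, ha.2, hb.2]⟩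
      smul_mem' := fun c y hy => ⟨by rw [smul_eq_mul, mul_assoc, hy.1],
        by rw [smul_eq_mul, mul_assoc, hy.2]⟩ }
  have hg : F.centralIdem lam * F.centralIdem mu ∈ N :=
    ⟨by rw [mul_assoc, ← F.centralIdem_comm lam, ← mul_assoc, centralIdem_mul_self],
      by rw [mul_assoc, centralIdem_mul_self]⟩
  have hN : N ≠ ⊥ := fun e => by
    rw [e, Submodule.mem_bot] at hg
    have := congrArg (F.rep mu) hg
    rw [map_mul, h1, rep_centralIdem_self, mul_one, map_zero] at this
    exact F.one_ne_zero_matrix mu this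
  obtain ⟨I, hIN, hI⟩ := exists_atom_le K hN
  obtain ⟨x, hx, hx0⟩ := I.ne_bot_iff.1 hI.1
  have e1 : F.rep lam x ≠ 0 := fun h0 => hx0 (by rw [← (hIN hx).1, F.mul_centralIdem h0])
  have e2 : F.rep mu x ≠ 0 := fun h0 => hx0 (by rw [← (hIN hx).2, F.mul_centralIdem h0])
  refine F.injective mu lam (funext fun y => ?_)
  exact (idealChar_eq hI (F.irreducible mu) hx e2 y).symm.trans
    (idealChar_eq hI (F.irreducible lam) hx e1 y)

end IrrFamily

/-! ### The longest elements of Young subgroups in irreducible representations -/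

open scoped Classical in
theorem poincare_eq (lam : n.Partition) :
    poincare lam = ∑ u with u ∈ Stab (rowOf lam), v (2 * len u) := by
  unfold poincare
  rw [young_eq]

theorem poincare_mem (lam : n.Partition) : poincare lam ∈ APlus :=
  APlus.sum_mem fun _ _ => v_mem_APlus (by positivity)

theorem poincare_coeff_zero (lam : n.Partition) : (poincare lam).coeff 0 = 1 := by
  classical
  unfold poincare
  rw [← Finset.sum_erase_add _ _ (a := (1 : Perm (Fin n))) (by simp [(young lam).one_mem])]
  have h : ∑ w ∈ (Finset.univ.filter fun w => w ∈ young lam).erase 1, v (2 * len w) ∈ APos := by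
    refine sum_mem_APos fun w hw => v_mem_APos ?_
    have : len w ≠ 0 := fun h => (Finset.mem_erase.1 hw).1 (len_eq_zero h)
    omega
  rw [len_one, Nat.cast_zero, mul_zero, v_zero]
  have hadd : ∀ f g : A, (f + g).coeff 0 = f.coeff 0 + g.coeff 0 := fun _ _ => rfl
  have h1 := coeff_intCast 1 0
  rw [Int.cast_one, if_pos rfl] at h1
  rw [hadd, h 0 le_rfl, h1, zero_add]

theorem poincare_ne_zero (lam : n.Partition) : poincare lam ≠ 0 := fun h => by
  have := poincare_coeff_zero lam
  rw [h] at this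
  exact zero_ne_one this

/-- The scalar `q` with `C w * C w = q • C w` for the longest element `w` of the Young subgroup. -/
def topScalar (lam : n.Partition) : A :=
  (eps (wLong lam) : A) * v (-(len (wLong lam) : ℤ)) * poincare lam

theorem isUnit_eps (w : Perm (Fin n)) : IsUnit (eps w : A) :=
  IsUnit.of_mul_eq_one (eps w : A) (by exact_mod_cast congrArg (Int.cast : ℤ → A) (eps_mul_self w))

theorem topScalar_ne_zero (lam : n.Partition) : topScalar lam ≠ 0 :=
  mul_ne_zero (mul_ne_zero (isUnit_eps _).ne_zero (LaurentPolynomial.isUnit_T _).ne_zero)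
    (poincare_ne_zero lam)

theorem mul_C_wLong {lam : n.Partition} {h : Hecke n} (hh : RightSign (rowOf lam) h) :
    h * C (wLong lam) = topScalar lam • h := by
  rw [hh.mul_C_top (rowOf_monotone lam) (isTop_wLong lam), topScalar, poincare_eq]

theorem rightSign_C_wLong (lam : n.Partition) : RightSign (rowOf lam) (C (wLong lam)) :=
  rightSign_C_top (isTop_wLong lam)

theorem wLong_inv (lam : n.Partition) : (wLong lam)⁻¹ = wLong lam :=
  (isTop_wLong lam).inv_eq (rowOf_monotone lam)

theorem flip_C_wLong (lam : n.Partition) : flip (C (wLong lam)) = C (wLong lam) := by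
  rw [flip_C, wLong_inv]

theorem T_mul_C_wLong {lam : n.Partition} {u : Perm (Fin n)} (hu : u ∈ Stab (rowOf lam)) :
    T u * C (wLong lam) = ((eps u : A) * v (-(len u : ℤ))) • C (wLong lam) := by
  have := congrArg flip (mul_T_of_rightSign_aux (rowOf_monotone lam) (rightSign_C_wLong lam)
    ((Stab (rowOf lam)).inv_mem hu))
  rwa [flip_mul, flip_T, inv_inv, map_smul, flip_C_wLong, eps_inv, len_inv] at this

theorem C_wLong_ne_zero (lam : n.Partition) : C (wLong lam) ≠ 0 := fun h => by
  have := (isKL_C (wLong lam)).coeff_self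
  rw [h, coeff_zero] at this
  exact zero_ne_one this

theorem signIdeal_mul_C (lam : n.Partition) {h : HK n} (hh : h ∈ signIdeal lam) :
    h * toHK (C (wLong lam)) = 0 := by
  induction hh using Submodule.span_induction with
  | mem x hx =>
    obtain ⟨w, hw, rfl⟩ := hx
    rw [young_eq] at hw
    rw [← map_mul, sub_mul, T_mul_C_wLong hw, smul_mul_assoc, one_mul, zsmul_eq_mul, sub_self,
      map_zero]
  | zero => rw [zero_mul]
  | add x y _ _ hx hy => rw [add_mul, hx, hy, add_zero]
  | smul a x _ hx => rw [smul_eq_mul, mul_assoc, hx, mul_zero]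

/-- Modulo the left ideal each `T u` becomes its sign value, so `C (wLong lam)` becomes some scalar
`q`. Multiplication by `C (wLong lam)` on the right kills the ideal and identifies `q`. -/
theorem C_sub_mem_signIdeal (lam : n.Partition) :
    toHK (C (wLong lam)) - algebraMap A K (topScalar lam) • (1 : HK n) ∈ signIdeal lam := by
  classical
  obtain ⟨q, hq⟩ : ∃ q : A, toHK (C (wLong lam)) - algebraMap A K q • (1 : HK n) ∈ signIdeal lam := by
    refine ⟨∑ u with u ∈ Stab (rowOf lam), ((eps (wLong lam) : A) * (eps u : A) *
      v (len (wLong lam) - len u : ℤ)) * ((eps u : A) * v (-(len u : ℤ))), ?_⟩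
    rw [C_top_eq (rowOf_monotone lam) (isTop_wLong lam), map_sum, map_sum, Finset.sum_smul,
      ← Finset.sum_sub_distrib]
    refine Submodule.sum_mem _ fun u hu => ?_
    rw [Finset.mem_filter] at hu
    generalize (eps (wLong lam) : A) * (eps u : A) * v (len (wLong lam) - len u : ℤ) = c
    rw [toHK_smul, map_mul (algebraMap A K), mul_smul, ← smul_sub]
    refine ((signIdeal lam).restrictScalars K).smul_mem _ (Submodule.subset_span ?_)
    refine ⟨u, by rw [young_eq]; exact hu.2, ?_⟩
    rw [map_sub, toHK_smul, map_one, zsmul_eq_mul]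
  have h1 := signIdeal_mul_C lam hq
  rw [sub_mul, smul_mul_assoc, one_mul, ← map_mul, ← toHK_smul, ← map_sub,
    mul_C_wLong (rightSign_C_wLong lam), ← sub_smul] at h1
  have h2 : topScalar lam - q = 0 := by
    by_contra h0
    exact C_wLong_ne_zero lam (smul_eq_zero_hecke h0 (toHK_injective (by rw [h1, map_zero])))
  rwa [sub_eq_zero.1 h2]

/-! ### The dominance order -/

theorem rowLen_ext {lam mu : n.Partition} (h : ∀ k, rowLen lam k = rowLen mu k) : lam = mu := by
  have hpos : ∀ (lam : n.Partition), ∀ x ∈ rows lam, 0 < x := fun lam x hx =>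
    lam.parts_pos (by rwa [rows, Multiset.mem_sort] at hx)
  have hlen : ∀ (lam : n.Partition) k, k < (rows lam).length ↔ 0 < rowLen lam k := by
    intro lam k
    unfold rowLen
    by_cases hk : k < (rows lam).length
    · rw [List.getD_eq_getElem _ _ hk]
      exact iff_of_true hk (hpos lam _ (List.getElem_mem hk))
    · rw [List.getD_eq_default _ _ (not_lt.1 hk)]
      exact iff_of_false hk (lt_irrefl 0)
  have e : rows lam = rows mu := by
    have hl : (rows lam).length = (rows mu).length := by
      apply le_antisymm
      · by_contra hlt
        have := (hlen lam _).1 (not_le.1 hlt)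
        rw [h, ← hlen] at this
        exact lt_irrefl _ this
      · by_contra hlt
        have := (hlen mu _).1 (not_le.1 hlt)
        rw [← h, ← hlen] at this
        exact lt_irrefl _ this
    refine List.ext_getElem hl fun k h1 h2 => ?_
    have := h k
    unfold rowLen at this
    rwa [List.getD_eq_getElem _ _ h1, List.getD_eq_getElem _ _ h2] at this
  have e2 := congrArg (fun l : List ℕ => (l : Multiset ℕ)) e
  simp only [rows, Multiset.sort_eq] at e2
  exact Nat.Partition.ext e2

theorem Dom.antisymm {lam mu : n.Partition} (h1 : Dom lam mu) (h2 : Dom mu lam) : lam = mu := by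
  have h : ∀ k, partialSum lam k = partialSum mu k := fun k => le_antisymm (h1 k) (h2 k)
  refine rowLen_ext fun k => ?_
  have e1 := partialSum_succ lam k
  have e2 := partialSum_succ mu k
  rw [h, h] at e1
  omega

theorem Dom.trans {lam mu nu : n.Partition} (h1 : Dom lam mu) (h2 : Dom mu nu) : Dom lam nu :=
  fun k => (h1 k).trans (h2 k)

theorem SDom.trans {lam mu nu : n.Partition} (h1 : SDom lam mu) (h2 : SDom mu nu) : SDom lam nu :=
  ⟨h1.1.trans h2.1, fun e => h1.2 (h1.1.antisymm (e ▸ h2.1))⟩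

namespace IrrFamily

variable (F : IrrFamily n)

theorem trace_centralIdem (lam nu : n.Partition) :
    character (F.rep lam) (F.centralIdem nu) = if lam = nu then (F.deg lam : K) else 0 := by
  split_ifs with h
  · rw [← h, character, F.rep_centralIdem_self, Matrix.trace_one, Fintype.card_fin]
  · rw [character, F.rep_centralIdem h, Matrix.trace_zero]

/-- If `C (wLong lam)` acted as zero, the central idempotent of `lam` would lie in the sign ideal,
because there `C (wLong lam)` is congruent to a non-zero scalar. The idempotent would have trace
zero on the induced module, but by the labelling this trace is the degree of `χ_λ`. -/
theorem rep_C_wLong_self (lam : n.Partition) : F.rep lam (toHK (C (wLong lam))) ≠ 0 := by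
  intro h0
  have h1 : F.centralIdem lam * toHK (C (wLong lam)) = 0 := by
    rw [F.centralIdem_comm, F.mul_centralIdem h0]
  have hq : algebraMap A K (topScalar lam) ≠ 0 := fun h =>
    topScalar_ne_zero lam (algebraMap_A_injective (by rw [h, map_zero]))
  have h2 : F.centralIdem lam ∈ signIdeal lam := by
    have := (signIdeal lam).smul_mem (F.centralIdem lam) (C_sub_mem_signIdeal lam)
    rw [smul_eq_mul, mul_sub, h1, zero_sub, mul_smul_comm, mul_one] at this
    have := ((signIdeal lam).restrictScalars K).smul_mem (-(algebraMap A K (topScalar lam))⁻¹) this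
    rwa [neg_smul, smul_neg, neg_neg, smul_smul, inv_mul_cancel₀ hq, one_smul] at this
  have h3 : indSignChar lam (F.centralIdem lam) = 0 := by
    have : Algebra.lsmul K K (HK n ⧸ signIdeal lam) (F.centralIdem lam) = 0 := by
      refine LinearMap.ext fun x => ?_
      obtain ⟨y, rfl⟩ := (signIdeal lam).mkQ_surjective x
      change F.centralIdem lam • (signIdeal lam).mkQ y = 0
      rw [← map_smul, smul_eq_mul, F.centralIdem_comm]
      exact (Submodule.Quotient.mk_eq_zero _).2 ((signIdeal lam).smul_mem y h2)
    rw [indSignChar, this]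
    exact LinearMap.map_zero _
  obtain ⟨m, hm, e⟩ := F.labelling lam
  rw [e, F.trace_centralIdem, if_pos rfl, Finset.sum_eq_zero, add_zero, Nat.cast_eq_zero] at h3
  · exact (F.irreducible lam).1.ne' h3
  · intro mu _
    rw [F.trace_centralIdem]
    split_ifs with h
    · have : m mu = 0 := by
        by_contra h'
        exact (hm mu h').2 h.symm
      rw [this, Nat.cast_zero, zero_mul]
    · exact mul_zero _

/-- If `χ_ν` does not occur in the induced character, its central idempotent has trace zero on the
induced module, so it lies in the sign ideal and is annihilated by `C (wLong lam)`. -/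
theorem eq_or_sdom_of_rep_C_wLong {lam nu : n.Partition}
    (h0 : F.rep nu (toHK (C (wLong lam))) ≠ 0) : nu = lam ∨ SDom lam nu := by
  have h1 : indSignChar lam (F.centralIdem nu) ≠ 0 := fun h => by
    have h2 := signIdeal_mul_C lam (mem_of_trace_eq_zero (F.centralIdem_mul_self nu) h)
    have h3 := congrArg (F.rep nu) h2
    rw [map_mul, F.rep_centralIdem_self, one_mul, map_zero] at h3
    exact h0 h3
  obtain ⟨m, hm, e⟩ := F.labelling lam
  by_contra! hne
  apply h1
  rw [e, F.trace_centralIdem, if_neg (Ne.symm hne.1), zero_add]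
  refine Finset.sum_eq_zero fun mu _ => ?_
  rw [F.trace_centralIdem]
  split_ifs with h
  · have : m mu = 0 := by
      by_contra h'
      exact hne.2 (h ▸ hm mu h')
    rw [this, Nat.cast_zero, zero_mul]
  · exact mul_zero _

theorem exists_mulVec_eq (lam : n.Partition) {y : Fin (F.deg lam) → K} (hy : y ≠ 0)
    (u : Fin (F.deg lam) → K) : ∃ h, F.rep lam h *ᵥ y = u := by
  let φ : HK n →ₗ[K] (Fin (F.deg lam) → K) :=
    { toFun := fun h => F.rep lam h *ᵥ y
      map_add' := fun a b => by rw [map_add, Matrix.add_mulVec]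
      map_smul' := fun c a => by rw [map_smul, Matrix.smul_mulVec, RingHom.id_apply] }
  have h : LinearMap.range φ = ⊤ := by
    refine ((F.irreducible lam).2 (LinearMap.range φ) ?_).resolve_left fun e => hy ?_
    · rintro h _ ⟨g, rfl⟩
      refine ⟨h * g, ?_⟩
      change F.rep lam (h * g) *ᵥ y = F.rep lam h *ᵥ (F.rep lam g *ᵥ y)
      rw [map_mul, Matrix.mulVec_mulVec]
    · have : φ 1 ∈ LinearMap.range φ := ⟨_, rfl⟩
      rw [e, Submodule.mem_bot] at this
      change F.rep lam 1 *ᵥ y = 0 at this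
      rwa [map_one, Matrix.one_mulVec] at this
  have := LinearMap.range_eq_top.1 h u
  exact this

theorem exists_T_mulVec_ne_zero (lam : n.Partition) {y : Fin (F.deg lam) → K} (hy : y ≠ 0)
    {M : Matrix (Fin (F.deg lam)) (Fin (F.deg lam)) K} (hM : M ≠ 0) :
    ∃ w, M *ᵥ (F.rep lam (toHK (T w)) *ᵥ y) ≠ 0 := by
  by_contra! h0
  have h1 : ∀ h, M *ᵥ (F.rep lam h *ᵥ y) = 0 := by
    intro h
    rw [← (bK n).sum_repr h, map_sum, Matrix.sum_mulVec, Matrix.mulVec_sum]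
    refine Finset.sum_eq_zero fun w _ => ?_
    rw [map_smul, Matrix.smul_mulVec, Matrix.mulVec_smul, bK_apply, h0, smul_zero]
  refine hM (Matrix.ext_of_mulVec_single fun i => ?_)
  obtain ⟨h, hh⟩ := F.exists_mulVec_eq lam hy (Pi.single i 1)
  rw [← hh, h1, Matrix.zero_mulVec]

theorem exists_mulVec_ne_zero {d : ℕ} {M : Matrix (Fin d) (Fin d) K} (h : M ≠ 0) :
    ∃ u, M *ᵥ u ≠ 0 := by
  by_contra! hu
  exact h (Matrix.ext_of_mulVec_single fun i => by rw [hu, Matrix.zero_mulVec])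

/-- A sign vector and a symmetric vector in the same representation are linked by some `T w`. -/
theorem exists_mul_symSum_ne_zero {nu : n.Partition} {x y : Hecke n}
    (hx : F.rep nu (toHK x) ≠ 0) (hy : F.rep nu (toHK y) ≠ 0) : ∃ w, x * T w * y ≠ 0 := by
  obtain ⟨u, hu⟩ := exists_mulVec_ne_zero hy
  obtain ⟨w, hw⟩ := F.exists_T_mulVec_ne_zero nu hu hx
  refine ⟨w, fun h => hw ?_⟩
  rw [Matrix.mulVec_mulVec, Matrix.mulVec_mulVec, ← map_mul, ← map_mul, ← map_mul, ← map_mul,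
    h, map_zero, map_zero, Matrix.zero_mulVec]

/-- If `x` transforms by the sign character on the left for the blocks of `r` and does not vanish
together with the symmetrizer of the columns of `lam`, the blocks meet each column at most once. -/
theorem exists_isTransversal_of_rep {lam nu : n.Partition} {r : Fin n → ℕ} (hr : Monotone r)
    {x : Hecke n} (hx : F.rep nu (toHK x) ≠ 0) (hxr : RightSign r x)
    (hy : F.rep nu (toHK (symSum (colIdx lam))) ≠ 0) : ∃ d, IsTransversal r (colIdx lam) d := by
  obtain ⟨w, hw⟩ := F.exists_mul_symSum_ne_zero hx hy
  obtain ⟨d, hd, -⟩ := exists_isTransversal_of_mul hr lam hxr hw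
  exact ⟨d, hd⟩

/-- `χ_ν` contains sign vectors for the rows of `nu`, and symmetric vectors for the columns of `lam`
by hypothesis. By irreducibility some `T w` links them, which produces a transversal and with it
dominance. -/
theorem dom_of_rep_symSum {lam nu : n.Partition}
    (hy : F.rep nu (toHK (symSum (colIdx lam))) ≠ 0) : Dom nu lam := by
  obtain ⟨d, hd⟩ := F.exists_isTransversal_of_rep (rowOf_monotone nu) (F.rep_C_wLong_self nu)
    (rightSign_C_wLong nu) hy
  exact hd.dom

/-- The sign factor of `zElt lam` bounds `nu` from below by `lam` and the symmetric factor bounds it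
from above. -/
theorem eq_of_rep_zElt {lam nu : n.Partition} (hnu : F.rep nu (toHK (zElt lam)) ≠ 0) :
    nu = lam := by
  have h1 : F.rep nu (toHK (C (wLong lam))) ≠ 0 := fun h => hnu (by
    rw [zElt, map_mul, map_mul, map_mul, map_mul, h, zero_mul, zero_mul])
  have h2 : F.rep nu (toHK (symSum (colIdx lam))) ≠ 0 := fun h => hnu (by
    rw [zElt, map_mul, map_mul, map_mul, map_mul, h, mul_zero])
  have h3 := F.dom_of_rep_symSum h2
  rcases F.eq_or_sdom_of_rep_C_wLong h1 with h4 | h4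
  · exact h4
  · exact absurd (h4.1.antisymm h3) h4.2

theorem rep_zElt (lam : n.Partition) : F.rep lam (toHK (zElt lam)) ≠ 0 := by
  obtain ⟨nu, hnu⟩ : ∃ nu, F.rep nu (toHK (zElt lam)) ≠ 0 := by
    by_contra! h
    exact zElt_ne_zero lam (toHK_injective (by rw [F.eq_zero_of_rep h, map_zero]))
  rwa [F.eq_of_rep_zElt hnu] at hnu

theorem rep_symSum_self (lam : n.Partition) : F.rep lam (toHK (symSum (colIdx lam))) ≠ 0 := fun h =>
  F.rep_zElt lam (by rw [zElt, map_mul, map_mul, map_mul, map_mul, h, mul_zero])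

/-- A non-zero vector `y` in the image of the column symmetrizer generates the irreducible module.
Every `C (wLong lam) * h * symSum (colIdx lam)` is a multiple of `zElt lam`, so `C (wLong lam)` maps
the whole module into one line. -/
theorem exists_rep_C_wLong_eq (lam : n.Partition) : ∃ a b : Fin (F.deg lam) → K, a ≠ 0 ∧ b ≠ 0 ∧
    F.rep lam (toHK (C (wLong lam))) = Matrix.vecMulVec a b := by
  obtain ⟨u, hu⟩ := exists_mulVec_ne_zero (F.rep_symSum_self lam)
  set y := F.rep lam (toHK (symSum (colIdx lam))) *ᵥ u with hy
  set a := F.rep lam (toHK (zElt lam)) *ᵥ u with ha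
  have h1 : ∀ h, ∃ c : K, F.rep lam (toHK (C (wLong lam))) *ᵥ (F.rep lam h *ᵥ y) = c • a := by
    intro h
    have h2 : ∀ w, ∃ c : A, F.rep lam (toHK (C (wLong lam))) *ᵥ
        (F.rep lam (toHK (T w)) *ᵥ y) = algebraMap A K c • a := by
      intro w
      obtain ⟨c, hc⟩ := exists_eq_smul_zElt lam (T w)
      refine ⟨c, ?_⟩
      rw [hy, ha, Matrix.mulVec_mulVec, Matrix.mulVec_mulVec, ← map_mul, ← map_mul, ← map_mul,
        ← map_mul, hc, toHK_smul, map_smul, Matrix.smul_mulVec]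
    choose c hc using h2
    refine ⟨∑ w, (bK n).repr h w * algebraMap A K (c w), ?_⟩
    conv_lhs => rw [← (bK n).sum_repr h, map_sum, Matrix.sum_mulVec, Matrix.mulVec_sum]
    rw [Finset.sum_smul]
    refine Finset.sum_congr rfl fun w _ => ?_
    rw [map_smul, Matrix.smul_mulVec, Matrix.mulVec_smul, bK_apply, hc, smul_smul]
  have h3 : ∀ i, ∃ c : K, F.rep lam (toHK (C (wLong lam))) *ᵥ Pi.single i 1 = c • a := by
    intro i
    obtain ⟨h, hh⟩ := F.exists_mulVec_eq lam hu (Pi.single i 1)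
    rw [← hh]
    exact h1 h
  choose b hb using h3
  have e : F.rep lam (toHK (C (wLong lam))) = Matrix.vecMulVec a b := by
    refine Matrix.ext fun i j => ?_
    have := congrFun (hb j) i
    rw [Matrix.mulVec_single_one] at this
    rw [Matrix.vecMulVec_apply, mul_comm]
    exact this
  refine ⟨a, b, fun h => F.rep_C_wLong_self lam ?_, fun h => F.rep_C_wLong_self lam ?_, e⟩
  · rw [e, h, Matrix.zero_vecMulVec]
  · rw [e, h, Matrix.vecMulVec_zero]

end IrrFamily

/-! ### Matrix units and Schur elements -/

namespace OrthFamily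

variable (F : OrthFamily n)

/-- The polynomials on the diagonal of the matrix of the invariant form. -/
def diagPoly (lam : n.Partition) : Fin (F.deg lam) → ℝ[X] := (F.orthogonal lam).choose

/-- The diagonal of the matrix of the invariant form. -/
def diag (lam : n.Partition) (i : Fin (F.deg lam)) : K := algebraMap ℝ[X] K (F.diagPoly lam i)

theorem diag_mem (lam : n.Partition) (i : Fin (F.deg lam)) : F.diag lam i ∈ Reg :=
  algebraMap_mem_Reg _

theorem constTerm_diag (lam : n.Partition) (i : Fin (F.deg lam)) :
    constTerm (F.diag lam i) = 1 := by
  rw [diag, constTerm_algebraMap, ← Polynomial.coeff_zero_eq_eval_zero]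
  exact (F.orthogonal lam).choose_spec.1 i

theorem diag_ne_zero (lam : n.Partition) (i : Fin (F.deg lam)) : F.diag lam i ≠ 0 := fun h => by
  have := F.constTerm_diag lam i
  rw [h, constTerm_zero] at this
  exact zero_ne_one this

theorem inv_diag_mem (lam : n.Partition) (i : Fin (F.deg lam)) : (F.diag lam i)⁻¹ ∈ Reg :=
  inv_mem_Reg (F.diag_mem lam i) (by rw [constTerm_diag]; exact one_ne_zero)

theorem constTerm_inv_diag (lam : n.Partition) (i : Fin (F.deg lam)) :
    constTerm (F.diag lam i)⁻¹ = 1 := by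
  rw [constTerm_inv (F.diag_mem lam i) (by rw [constTerm_diag]; exact one_ne_zero), constTerm_diag,
    inv_one]

theorem rep_flipK_apply (lam : n.Partition) (h : HK n) (i j : Fin (F.deg lam)) :
    F.diag lam j * F.rep lam (flipK h) j i = F.rep lam h i j * F.diag lam i := by
  have hT : ∀ w : Perm (Fin n), F.diag lam j * F.rep lam (toHK (T w⁻¹)) j i =
      F.rep lam (toHK (T w)) i j * F.diag lam i := by
    intro w
    have h1 := (F.orthogonal lam).choose_spec.2 w
    have h2 : (Matrix.diagonal (F.diag lam))⁻¹ = Matrix.diagonal fun i => (F.diag lam i)⁻¹ := by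
      refine Matrix.inv_eq_left_inv ?_
      rw [Matrix.diagonal_mul_diagonal, ← Matrix.diagonal_one]
      congr 1
      funext k
      exact inv_mul_cancel₀ (F.diag_ne_zero lam k)
    change _ = (Matrix.diagonal (F.diag lam))⁻¹ * _ * Matrix.diagonal (F.diag lam) at h1
    rw [h1, h2, Matrix.mul_diagonal, Matrix.diagonal_mul, Matrix.transpose_apply, ← mul_assoc,
      ← mul_assoc, mul_inv_cancel₀ (F.diag_ne_zero lam j), one_mul]
  conv_lhs => rw [← (bK n).sum_repr h]
  conv_rhs => rw [← (bK n).sum_repr h]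
  simp only [map_sum, map_smul, Matrix.sum_apply, Matrix.smul_apply, smul_eq_mul, Finset.mul_sum,
    Finset.sum_mul]
  refine Finset.sum_congr rfl fun w _ => ?_
  rw [bK_apply, flipK_toHK, flip_T, mul_left_comm, hT, mul_assoc]

theorem rep_flipK_apply' (lam : n.Partition) (h : HK n) (i j : Fin (F.deg lam)) :
    F.rep lam (flipK h) j i = (F.diag lam j)⁻¹ * (F.rep lam h i j * F.diag lam i) := by
  rw [← rep_flipK_apply, inv_mul_cancel_left₀ (F.diag_ne_zero lam j)]

/-- Absolute irreducibility. The image contains a matrix of rank one, and left multiplication makes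
its column factor arbitrary. For the row factor, the matrices of `h` and `flipK h` are adjoint for
the form `diag`, so the admissible vectors `c` form an invariant subspace. -/
theorem rep_surjective (lam : n.Partition) : Function.Surjective (F.rep lam) := by
  obtain ⟨a, b, ha, hb, e⟩ := F.exists_rep_C_wLong_eq lam
  let R := LinearMap.range (F.rep lam).toLinearMap
  have hmul : ∀ h M, M ∈ R → F.rep lam h * M ∈ R := by
    rintro h _ ⟨g, rfl⟩
    exact ⟨h * g, map_mul (F.rep lam) h g⟩
  have hmul' : ∀ h M, M ∈ R → M * F.rep lam h ∈ R := by
    rintro h _ ⟨g, rfl⟩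
    exact ⟨g * h, map_mul (F.rep lam) g h⟩
  have h1 : ∀ u, Matrix.vecMulVec u b ∈ R := by
    intro u
    obtain ⟨h, rfl⟩ := F.exists_mulVec_eq lam ha u
    rw [← Matrix.mul_vecMulVec, ← e]
    exact hmul h _ ⟨_, rfl⟩
  let U : Submodule K (Fin (F.deg lam) → K) :=
    { carrier := {c | ∀ u, Matrix.vecMulVec u (fun i => F.diag lam i * c i) ∈ R}
      zero_mem' := fun u => by
        have : (fun i => F.diag lam i * (0 : Fin (F.deg lam) → K) i) = 0 := by funext i; simp
        rw [this, Matrix.vecMulVec_zero]; exact R.zero_mem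
      add_mem' := fun {c c'} hc hc' u => by
        have : (fun i => F.diag lam i * (c + c') i) =
          (fun i => F.diag lam i * c i) + fun i => F.diag lam i * c' i := by
          funext i; simp [mul_add]
        rw [this, Matrix.vecMulVec_add]; exact R.add_mem (hc u) (hc' u)
      smul_mem' := fun k c hc u => by
        have : (fun i => F.diag lam i * (k • c) i) = k • fun i => F.diag lam i * c i := by
          funext i; simp [mul_left_comm]
        rw [this, Matrix.vecMulVec_smul]; exact R.smul_mem k (hc u) }
  have hU : U = ⊤ := by
    refine ((F.irreducible lam).2 U fun h c hc u => ?_).resolve_left fun h0 => hb ?_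
    · have h2 := hmul' (flipK h) _ (hc u)
      rw [Matrix.vecMulVec_mul] at h2
      have e3 : (fun i => F.diag lam i * (F.rep lam h *ᵥ c) i) =
          (fun i => F.diag lam i * c i) ᵥ* F.rep lam (flipK h) := by
        funext i
        simp only [Matrix.mulVec, Matrix.vecMul, dotProduct, Finset.mul_sum]
        refine Finset.sum_congr rfl fun j _ => ?_
        have := F.rep_flipK_apply lam h i j
        linear_combination (-c j) * this
      change Matrix.vecMulVec u (fun i => F.diag lam i * (F.rep lam h *ᵥ c) i) ∈ R
      rw [e3]
      exact h2
    · have h3 : (fun i => (F.diag lam i)⁻¹ * b i) ∈ U := by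
        intro u
        convert h1 u using 2
        funext i
        exact mul_inv_cancel_left₀ (F.diag_ne_zero lam i) _
      rw [h0, Submodule.mem_bot] at h3
      funext i
      exact (mul_eq_zero.1 (congrFun h3 i)).resolve_left (inv_ne_zero (F.diag_ne_zero lam i))
  have h4 : ∀ u c, Matrix.vecMulVec u c ∈ R := by
    intro u c
    have h3 : (fun i => (F.diag lam i)⁻¹ * c i) ∈ U := by rw [hU]; exact Submodule.mem_top
    convert h3 u using 2
    funext i
    exact (mul_inv_cancel_left₀ (F.diag_ne_zero lam i) _).symm
  intro M
  have h5 : M ∈ R := by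
    rw [Matrix.matrix_eq_sum_single M]
    refine R.sum_mem fun i _ => R.sum_mem fun j _ => ?_
    rw [← mul_one (M i j), ← smul_eq_mul, ← Matrix.smul_single,
      Matrix.single_eq_single_vecMulVec_single]
    exact R.smul_mem _ (h4 _ _)
  exact h5

theorem exists_matUnit (lam : n.Partition) (M : Matrix (Fin (F.deg lam)) (Fin (F.deg lam)) K) :
    ∃ u, F.rep lam u = M ∧ ∀ mu, mu ≠ lam → F.rep mu u = 0 := by
  obtain ⟨h, rfl⟩ := F.rep_surjective lam M
  refine ⟨F.centralIdem lam * h, ?_, fun mu hmu => ?_⟩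
  · rw [map_mul, F.rep_centralIdem_self, one_mul]
  · rw [map_mul, F.rep_centralIdem hmu, zero_mul]

/-- The matrix units in the scalar extension of the Hecke algebra. -/
def matUnit (lam : n.Partition) (i j : Fin (F.deg lam)) : HK n :=
  (F.exists_matUnit lam (Matrix.single i j 1)).choose

theorem rep_matUnit_self (lam : n.Partition) (i j : Fin (F.deg lam)) :
    F.rep lam (F.matUnit lam i j) = Matrix.single i j 1 :=
  (F.exists_matUnit lam (Matrix.single i j 1)).choose_spec.1

theorem rep_matUnit {lam mu : n.Partition} (h : mu ≠ lam) (i j : Fin (F.deg lam)) :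
    F.rep mu (F.matUnit lam i j) = 0 :=
  (F.exists_matUnit lam (Matrix.single i j 1)).choose_spec.2 mu h

theorem ext_rep {x y : HK n} (h : ∀ lam, F.rep lam x = F.rep lam y) : x = y := by
  rw [← sub_eq_zero]
  exact F.eq_zero_of_rep fun lam => by rw [map_sub, h, sub_self]

theorem eq_sum_matUnit (x : HK n) :
    x = ∑ lam, ∑ i, ∑ j, F.rep lam x i j • F.matUnit lam i j := by
  refine F.ext_rep fun mu => ?_
  simp only [map_sum, map_smul]
  rw [Finset.sum_eq_single mu]
  · conv_lhs => rw [Matrix.matrix_eq_sum_single (F.rep mu x)]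
    refine Finset.sum_congr rfl fun i _ => Finset.sum_congr rfl fun j _ => ?_
    rw [rep_matUnit_self, Matrix.smul_single, smul_eq_mul, mul_one]
  · intro lam _ h
    refine Finset.sum_eq_zero fun i _ => Finset.sum_eq_zero fun j _ => ?_
    rw [F.rep_matUnit (Ne.symm h), smul_zero]
  · exact fun h => absurd (Finset.mem_univ _) h

theorem matUnit_mul (lam : n.Partition) (i j k l : Fin (F.deg lam)) :
    F.matUnit lam i j * F.matUnit lam k l = if j = k then F.matUnit lam i l else 0 := by
  refine F.ext_rep fun mu => ?_
  by_cases h : mu = lam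
  · subst h
    rw [map_mul, rep_matUnit_self, rep_matUnit_self]
    split_ifs with hjk
    · rw [hjk, Matrix.single_mul_single_same, rep_matUnit_self, mul_one]
    · rw [Matrix.single_mul_single_of_ne _ _ _ _ hjk, map_zero]
  · rw [map_mul, F.rep_matUnit h, zero_mul]
    split_ifs
    · rw [F.rep_matUnit h]
    · rw [map_zero]

/-- The coefficients of the symmetrizing trace in terms of the irreducible characters. -/
def weight (lam : n.Partition) : K := tauK (F.matUnit lam (F.first lam) (F.first lam))

theorem tauK_matUnit (lam : n.Partition) (i j : Fin (F.deg lam)) :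
    tauK (F.matUnit lam i j) = if i = j then F.weight lam else 0 := by
  have h1 : F.matUnit lam i j = F.matUnit lam i (F.first lam) * F.matUnit lam (F.first lam) j := by
    rw [matUnit_mul, if_pos rfl]
  rw [h1, tauK_mul_comm, matUnit_mul, apply_ite tauK, map_zero, ← weight]
  simp only [eq_comm]

/-- A zero weight would make the trace form vanish on everything in a right ideal containing a
matrix unit, against the anisotropy of `formK`. -/
theorem weight_ne_zero (lam : n.Partition) : F.weight lam ≠ 0 := by
  intro h0
  have h1 : ∀ h, tauK (F.matUnit lam (F.first lam) (F.first lam) * h) = 0 := by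
    intro h
    have : F.matUnit lam (F.first lam) (F.first lam) * h =
        F.matUnit lam (F.first lam) (F.first lam) *
          (F.matUnit lam (F.first lam) (F.first lam) * h) := by
      rw [← mul_assoc, matUnit_mul, if_pos rfl]
    rw [this, tauK_mul_comm]
    have h2 : F.matUnit lam (F.first lam) (F.first lam) * h *
        F.matUnit lam (F.first lam) (F.first lam) =
        F.rep lam h (F.first lam) (F.first lam) • F.matUnit lam (F.first lam) (F.first lam) := by
      refine F.ext_rep fun mu => ?_
      rw [map_smul]
      by_cases hm : mu = lam
      · subst hm
        rw [map_mul, map_mul, rep_matUnit_self, Matrix.single_mul_mul_single, Matrix.smul_single]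
        simp
      · rw [map_mul, map_mul, F.rep_matUnit hm, zero_mul, zero_mul, smul_zero]
    rw [h2, map_smul, ← weight, h0, smul_zero]
  have h3 : F.matUnit lam (F.first lam) (F.first lam) = 0 :=
    eq_zero_of_formK (by rw [formK_apply, h1])
  have h4 := F.rep_matUnit_self lam (F.first lam) (F.first lam)
  rw [h3, map_zero] at h4
  have h5 := congrFun (congrFun h4 (F.first lam)) (F.first lam)
  rw [Matrix.single_apply_same] at h5
  exact zero_ne_one h5

theorem tauK_eq (x : HK n) : tauK x = ∑ lam, F.weight lam * (F.rep lam x).trace := by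
  conv_lhs => rw [F.eq_sum_matUnit x]
  simp only [map_sum, map_smul, tauK_matUnit]
  refine Finset.sum_congr rfl fun lam _ => ?_
  rw [Matrix.trace, Finset.mul_sum]
  refine Finset.sum_congr rfl fun i _ => ?_
  rw [Finset.sum_eq_single i (fun j _ h => by rw [if_neg (Ne.symm h), smul_zero])
    (fun h => absurd (Finset.mem_univ _) h), if_pos rfl, smul_eq_mul, mul_comm]
  rfl

/-- `schur` is an arbitrary solution of its defining equations; evaluating the decomposition of the
trace at a diagonal matrix unit isolates one label and shows that the solution is unique. -/
theorem schur_eq (lam : n.Partition) : F.schur lam = (F.weight lam)⁻¹ := by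
  obtain ⟨h1, h2⟩ := Classical.epsilon_spec (p := fun c : n.Partition → K => (∀ lam, c lam ≠ 0) ∧
    ∀ w : Perm (Fin n), (if w = 1 then 1 else 0) =
      ∑ lam, (c lam)⁻¹ * character (F.rep lam) (toHK (T w)))
    ⟨fun lam => (F.weight lam)⁻¹, fun lam => inv_ne_zero (F.weight_ne_zero lam), fun w => by
      have := F.tauK_eq (toHK (T w))
      rw [tauK_toHK, coeff_T, apply_ite (algebraMap A K), map_one, map_zero] at this
      rw [this]
      simp only [inv_inv, character]⟩
  change ∀ lam, F.schur lam ≠ 0 at h1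
  change ∀ w : Perm (Fin n), _ = ∑ lam, (F.schur lam)⁻¹ * character (F.rep lam) (toHK (T w)) at h2
  have h3 : ∀ x, tauK x = ∑ lam, (F.schur lam)⁻¹ * (F.rep lam x).trace := by
    intro x
    conv_lhs => rw [← (bK n).sum_repr x]
    conv_rhs => rw [← (bK n).sum_repr x]
    simp only [map_sum, map_smul, Matrix.trace_sum, Matrix.trace_smul, Finset.mul_sum]
    rw [Finset.sum_comm]
    refine Finset.sum_congr rfl fun w _ => ?_
    rw [bK_apply, tauK_toHK, coeff_T, apply_ite (algebraMap A K), map_one, map_zero, h2,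
      Finset.smul_sum]
    refine Finset.sum_congr rfl fun lam _ => ?_
    rw [character, smul_eq_mul, smul_eq_mul]
    ring
  have h4 := h3 (F.matUnit lam (F.first lam) (F.first lam))
  rw [Finset.sum_eq_single lam (fun mu _ h => by rw [F.rep_matUnit h, Matrix.trace_zero, mul_zero])
    (fun h => absurd (Finset.mem_univ _) h), rep_matUnit_self, Matrix.trace_single_eq_same,
    mul_one] at h4
  rw [weight, h4, inv_inv]

theorem schur_ne_zero (lam : n.Partition) : F.schur lam ≠ 0 := by
  rw [schur_eq]; exact inv_ne_zero (F.weight_ne_zero lam)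

theorem matUnit_eq_sum (lam : n.Partition) (i j : Fin (F.deg lam)) :
    F.matUnit lam j i = (F.schur lam)⁻¹ •
      ∑ w, F.rep lam (toHK (T w⁻¹)) i j • toHK (T w) := by
  have h1 : ∀ x : HK n, x = ∑ w, tauK (x * toHK (T w⁻¹)) • toHK (T w) := by
    intro x
    conv_lhs => rw [← (bK n).sum_repr x]
    refine Finset.sum_congr rfl fun w _ => ?_
    rw [← bK_apply w, ← flip_T, ← flipK_toHK, ← formK_apply, ← bK_apply, formK_eq_sum,
      Finset.sum_eq_single w]
    · rw [Module.Basis.repr_self, Finsupp.single_eq_same, mul_one]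
    · intro y _ hy
      rw [Module.Basis.repr_self, Finsupp.single_eq_of_ne hy, mul_zero]
    · exact fun h => absurd (Finset.mem_univ _) h
  rw [h1 (F.matUnit lam j i), Finset.smul_sum]
  refine Finset.sum_congr rfl fun w _ => ?_
  rw [smul_smul]
  congr 1
  rw [F.tauK_eq, Finset.sum_eq_single lam]
  · rw [schur_eq, inv_inv, map_mul, rep_matUnit_self, Matrix.trace_single_mul]
    exact congrArg _ (one_smul _ _)
  · intro mu _ h
    rw [map_mul, F.rep_matUnit h, zero_mul, Matrix.trace_zero, mul_zero]
  · exact fun h => absurd (Finset.mem_univ _) h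

/-- The Schur relations. -/
theorem schur_relation (lam mu : n.Partition) (i j : Fin (F.deg lam)) (k l : Fin (F.deg mu)) :
    ∑ w, F.rep lam (toHK (T w⁻¹)) i j * F.rep mu (toHK (T w)) k l =
      F.schur lam * F.rep mu (F.matUnit lam j i) k l := by
  rw [matUnit_eq_sum, map_smul, map_sum, Matrix.smul_apply, smul_eq_mul,
    mul_inv_cancel_left₀ (F.schur_ne_zero lam), Matrix.sum_apply]
  exact Finset.sum_congr rfl fun w _ => by rw [map_smul, Matrix.smul_apply, smul_eq_mul]

/-- The representations together identify the algebra with a product of matrix algebras; compare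
dimensions over `K`. -/
theorem card_eq : Fintype.card ((lam : n.Partition) × Fin (F.deg lam) × Fin (F.deg lam)) =
    Fintype.card (Perm (Fin n)) := by
  let φ : HK n →ₗ[K] ((lam : n.Partition) → Matrix (Fin (F.deg lam)) (Fin (F.deg lam)) K) :=
    LinearMap.pi fun lam => (F.rep lam).toLinearMap
  have hφ : Function.Bijective φ := by
    refine ⟨fun x y h => F.ext_rep fun lam => congrFun h lam, fun M => ?_⟩
    choose u hu hu' using fun lam => F.exists_matUnit lam (M lam)
    refine ⟨∑ lam, u lam, ?_⟩
    funext mu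
    change F.rep mu (∑ lam, u lam) = _
    rw [map_sum, Finset.sum_eq_single mu (fun lam _ h => hu' lam mu (Ne.symm h))
      (fun h => absurd (Finset.mem_univ _) h), hu]
  have h1 := (LinearEquiv.ofBijective φ hφ).finrank_eq
  rw [Module.finrank_eq_card_basis (bK n), Module.finrank_pi_fintype] at h1
  rw [h1, Fintype.card_sigma]
  refine Finset.sum_congr rfl fun lam _ => ?_
  rw [Module.finrank_matrix, Module.finrank_self, mul_one, Fintype.card_prod]

end OrthFamily

/-! ### Leading matrix coefficients -/

/-- Abel summation; the induction carries the boundary term `x N * ∑ d`, which vanishes at the end.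
-/
theorem sum_mul_nonneg_of_partial {x d : ℕ → ℤ} (hx : Antitone x)
    (hd : ∀ k, 0 ≤ ∑ i ∈ Finset.range k, d i) {N : ℕ} (hN : x N = 0) :
    0 ≤ ∑ i ∈ Finset.range N, x i * d i := by
  have key : ∀ N, x N * ∑ i ∈ Finset.range N, d i ≤ ∑ i ∈ Finset.range N, x i * d i := by
    intro N
    induction N with
    | zero => simp
    | succ N ih =>
      rw [Finset.sum_range_succ (fun i => x i * d i)]
      have h1 := hd (N + 1)
      have h2 : x (N + 1) * ∑ i ∈ Finset.range (N + 1), d i ≤ x N * ∑ i ∈ Finset.range (N + 1), d i :=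
        mul_le_mul_of_nonneg_right (hx (Nat.le_succ N)) h1
      rw [Finset.sum_range_succ d, mul_add (x N)] at h2
      linarith [Finset.sum_range_succ d N ▸ h2]
  have := key N
  rwa [hN, zero_mul] at this

theorem rowLen_eq_zero (lam : n.Partition) : rowLen lam n = 0 := by
  by_contra h
  have h1 : ∀ k ≤ n, k < n + 1 → 1 ≤ rowLen lam k := fun k hk _ =>
    (Nat.one_le_iff_ne_zero.2 h).trans (rowLen_antitone lam hk)
  have h2 : n + 1 ≤ partialSum lam (n + 1) := by
    rw [partialSum_eq_sum]
    calc n + 1 = ∑ i ∈ Finset.range (n + 1), 1 := by simp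
      _ ≤ _ := Finset.sum_le_sum fun i hi => by
        have := Finset.mem_range.1 hi
        exact h1 i (by omega) this
  rw [← card_rowOf_lt] at h2
  have h3 := Finset.card_le_univ (Finset.univ.filter fun p => rowOf lam p < n + 1)
  rw [Fintype.card_fin] at h3
  omega

theorem rowOf_lt (lam : n.Partition) (p : Fin n) : rowOf lam p < n := by
  by_contra h
  have h1 := rowLen_antitone lam (not_lt.1 h)
  have h2 := colOf_lt lam p
  rw [rowLen_eq_zero] at h1
  omega

/-- Both sides count ordered pairs of boxes in the same row: each inversion of the longest element
gives two of them, and the diagonal gives `n`. -/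
theorem two_mul_len_wLong (lam : n.Partition) :
    2 * len (wLong lam) + n = ∑ i ∈ Finset.range n, rowLen lam i ^ 2 := by
  classical
  have h0 : (Finset.univ.filter fun p : Fin n × Fin n => rowOf lam p.1 = rowOf lam p.2).card =
      ∑ i ∈ Finset.range n, rowLen lam i ^ 2 := by
    rw [Finset.card_eq_sum_card_fiberwise (f := fun p => rowOf lam p.1) (t := Finset.range n)
      (fun p _ => Finset.mem_coe.2 (Finset.mem_range.2 (rowOf_lt lam p.1)))]
    refine Finset.sum_congr rfl fun i _ => ?_
    rw [pow_two, ← card_rowOf_eq, ← Finset.card_product]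
    congr 1
    ext p
    simp only [Finset.mem_filter, Finset.mem_univ, true_and, Finset.mem_product]
    constructor
    · rintro ⟨h1, h2⟩; exact ⟨h2, h1 ▸ h2⟩
    · rintro ⟨h1, h2⟩; exact ⟨h1.trans h2.symm, h1⟩
  rw [← h0, (isTop_wLong lam).len_eq (rowOf_monotone lam)]
  have h1 : (Finset.univ.filter fun p : Fin n × Fin n => p.2 < p.1 ∧ rowOf lam p.1 = rowOf lam p.2).card
      = (Finset.univ.filter fun p : Fin n × Fin n => p.1 < p.2 ∧ rowOf lam p.1 = rowOf lam p.2).card := by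
    refine Finset.card_equiv (Equiv.prodComm _ _) fun p => ?_
    simp [eq_comm]
  have h2 : (Finset.univ.filter fun p : Fin n × Fin n => p.1 = p.2).card = n := by
    refine Eq.trans ?_ (Finset.card_fin n)
    refine Finset.card_bij (fun p _ => p.1) (fun _ _ => Finset.mem_univ _) ?_ ?_
    · rintro ⟨a, b⟩ ha ⟨c, d⟩ hc h
      simp only [Finset.mem_filter, Finset.mem_univ, true_and] at ha hc
      subst ha hc
      change a = c at h
      rw [h]
    · exact fun b _ => ⟨(b, b), by simp, rfl⟩
  have h3 : (Finset.univ.filter fun p : Fin n × Fin n => rowOf lam p.1 = rowOf lam p.2) =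
      ((Finset.univ.filter fun p : Fin n × Fin n => p.1 < p.2 ∧ rowOf lam p.1 = rowOf lam p.2) ∪
      (Finset.univ.filter fun p : Fin n × Fin n => p.2 < p.1 ∧ rowOf lam p.1 = rowOf lam p.2)) ∪
      (Finset.univ.filter fun p : Fin n × Fin n => p.1 = p.2) := by
    ext ⟨a, b⟩
    simp only [Finset.mem_filter, Finset.mem_univ, true_and, Finset.mem_union]
    constructor
    · intro h
      rcases lt_trichotomy a b with h' | h' | h'
      · exact Or.inl (Or.inl ⟨h', h⟩)
      · exact Or.inr h'
      · exact Or.inl (Or.inr ⟨h', h⟩)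
    · rintro ((h | h) | h)
      · exact h.2
      · exact h.2
      · rw [h]
  rw [h3, Finset.card_union_of_disjoint, Finset.card_union_of_disjoint, h1, h2]
  · ring
  · rw [Finset.disjoint_filter]
    exact fun p _ h h' => lt_asymm h.1 h'.1
  · rw [Finset.disjoint_left]
    intro p hp hp'
    simp only [Finset.mem_filter, Finset.mem_univ, true_and, Finset.mem_union] at hp hp'
    rcases hp with h | h
    · exact h.1.ne hp'
    · exact h.1.ne hp'.symm

/-- With `λ_i`, `μ_i` the row lengths, `∑ μ_i² - ∑ λ_i² = ∑ (μ_i - λ_i)² + 2 ∑ λ_i (μ_i - λ_i)`. The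
first sum is positive, the second is non-negative by Abel summation. -/
theorem len_wLong_lt {lam mu : n.Partition} (h : SDom lam mu) :
    len (wLong lam) < len (wLong mu) := by
  have e1 := two_mul_len_wLong lam
  have e2 := two_mul_len_wLong mu
  suffices hs : (∑ i ∈ Finset.range n, rowLen lam i ^ 2 : ℕ) <
      (∑ i ∈ Finset.range n, rowLen mu i ^ 2 : ℕ) by omega
  zify
  have h1 : 0 ≤ ∑ i ∈ Finset.range n, (rowLen lam i : ℤ) * ((rowLen mu i : ℤ) - rowLen lam i) := by
    refine sum_mul_nonneg_of_partial (x := fun i => (rowLen lam i : ℤ))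
      (fun a b hab => Int.ofNat_le.2 (rowLen_antitone lam hab)) (fun k => ?_)
      (by exact_mod_cast rowLen_eq_zero lam)
    rw [Finset.sum_sub_distrib, sub_nonneg]
    have := h.1 k
    rw [partialSum_eq_sum, partialSum_eq_sum] at this
    exact_mod_cast this
  have h2 : 0 < ∑ i ∈ Finset.range n, ((rowLen mu i : ℤ) - rowLen lam i) ^ 2 := by
    obtain ⟨k, hk⟩ : ∃ k, rowLen lam k ≠ rowLen mu k := by
      by_contra! hne
      exact h.2 (rowLen_ext hne)
    have hkn : k < n := by
      by_contra hkn
      have a1 := rowLen_antitone lam (not_lt.1 hkn)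
      have a2 := rowLen_antitone mu (not_lt.1 hkn)
      rw [rowLen_eq_zero] at a1 a2
      omega
    refine Finset.sum_pos' (fun i _ => sq_nonneg _) ⟨k, Finset.mem_range.2 hkn, ?_⟩
    have : (rowLen mu k : ℤ) - rowLen lam k ≠ 0 := by omega
    positivity
  have h3 : ∑ i ∈ Finset.range n, (rowLen mu i : ℤ) ^ 2 =
      ∑ i ∈ Finset.range n, (rowLen lam i : ℤ) ^ 2 +
      ∑ i ∈ Finset.range n, ((rowLen mu i : ℤ) - rowLen lam i) ^ 2 +
      2 * ∑ i ∈ Finset.range n, (rowLen lam i : ℤ) * ((rowLen mu i : ℤ) - rowLen lam i) := by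
    rw [Finset.mul_sum, ← Finset.sum_add_distrib, ← Finset.sum_add_distrib]
    exact Finset.sum_congr rfl fun i _ => by ring
  omega

theorem trace_of_idempotent {d : ℕ} {M : Matrix (Fin d) (Fin d) K} (h : M * M = M) :
    ∃ m : ℕ, M.trace = m := by
  have hid : IsIdempotentElem (Matrix.toLin' M) := by
    change _ ∘ₗ _ = _
    rw [← Matrix.toLin'_mul, h]
  exact ⟨_, by rw [← Matrix.trace_toLin'_eq]; exact (LinearMap.IsIdempotentElem.isProj_range _ hid).trace⟩

namespace OrthFamily

variable (F : OrthFamily n)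

theorem algebraMap_topScalar_ne_zero (lam : n.Partition) : algebraMap A K (topScalar lam) ≠ 0 :=
  fun h => topScalar_ne_zero lam (algebraMap_A_injective (by rw [h, map_zero]))

theorem rep_C_wLong_mul_self (lam mu : n.Partition) :
    F.rep mu (toHK (C (wLong lam))) * F.rep mu (toHK (C (wLong lam))) =
      algebraMap A K (topScalar lam) • F.rep mu (toHK (C (wLong lam))) := by
  rw [← map_mul, ← map_mul, mul_C_wLong (rightSign_C_wLong lam), toHK_smul, map_smul]

theorem trace_C_wLong (lam : n.Partition) :
    (F.rep lam (toHK (C (wLong lam)))).trace = algebraMap A K (topScalar lam) := by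
  obtain ⟨a, b, ha, hb, e⟩ := F.exists_rep_C_wLong_eq lam
  have h1 := F.rep_C_wLong_mul_self lam lam
  rw [e, Matrix.vecMulVec_mul_vecMulVec, Matrix.vecMulVec_smul, ← sub_eq_zero, ← sub_smul] at h1
  have h2 : Matrix.vecMulVec a b ≠ 0 := by rw [← e]; exact F.rep_C_wLong_self lam
  rw [e, Matrix.trace_vecMulVec, dotProduct_comm]
  exact sub_eq_zero.1 ((smul_eq_zero.1 h1).resolve_right h2)

/-- The element `y = zElt lam * T (colPerm lam)⁻¹` acts only in `χ_λ`, with rank one there, and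
satisfies `y * y = phi • y`; so its trace in `χ_λ` is `phi`. The symmetrizing trace of `y` is a unit
of `A`, so the Schur element is `phi` divided by a unit. Integrality matters because `aInv` asks for
polynomial, not just regular, remainders. -/
theorem exists_schur_eq (lam : n.Partition) : ∃ f : A, F.schur lam = algebraMap A K f := by
  set y := zElt lam * T (colPerm lam)⁻¹ with hy
  obtain ⟨phi, hphi⟩ := exists_eq_smul_zElt lam
    (T (colPerm lam) * symSum (colIdx lam) * T (colPerm lam)⁻¹ * C (wLong lam) * T (colPerm lam))
  have hyy : y * y = phi • y := by
    rw [hy, ← smul_mul_assoc, ← hphi, zElt]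
    simp only [mul_assoc]
  have h0 : ∀ mu, mu ≠ lam → F.rep mu (toHK y) = 0 := by
    intro mu hmu
    by_contra h
    refine hmu (F.eq_of_rep_zElt fun h' => h ?_)
    rw [hy, map_mul, map_mul, h', zero_mul]
  obtain ⟨a, b, ha, hb, e⟩ := F.exists_rep_C_wLong_eq lam
  obtain ⟨b', hb'⟩ : ∃ b', F.rep lam (toHK y) = Matrix.vecMulVec a b' := by
    refine ⟨b ᵥ* F.rep lam (toHK (T (colPerm lam) * symSum (colIdx lam) * T (colPerm lam)⁻¹)), ?_⟩
    rw [← Matrix.vecMulVec_mul, ← e, ← map_mul, ← map_mul, hy, zElt]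
    simp only [mul_assoc]
  have htau := F.tauK_eq (toHK y)
  rw [tauK_toHK, hy, coeff_zElt_mul, ← hy, Finset.sum_eq_single lam (fun mu _ h => by
    rw [h0 mu h, Matrix.trace_zero, mul_zero]) (fun h => absurd (Finset.mem_univ _) h)] at htau
  have hunit : algebraMap A K ((eps (wLong lam) : A) * v (len (wLong lam))) ≠ 0 := fun h => by
    have := algebraMap_A_injective (h.trans (map_zero _).symm)
    exact mul_ne_zero (isUnit_eps _).ne_zero (LaurentPolynomial.isUnit_T _).ne_zero this
  have hy0 : F.rep lam (toHK y) ≠ 0 := fun h => by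
    rw [h, Matrix.trace_zero, mul_zero] at htau
    exact hunit htau
  have htr : (F.rep lam (toHK y)).trace = algebraMap A K phi := by
    have h1 : F.rep lam (toHK y) * F.rep lam (toHK y) = algebraMap A K phi • F.rep lam (toHK y) := by
      rw [← map_mul, ← map_mul, hyy, toHK_smul, map_smul]
    rw [hb', Matrix.vecMulVec_mul_vecMulVec, Matrix.vecMulVec_smul, ← sub_eq_zero, ← sub_smul] at h1
    rw [hb'] at hy0
    rw [hb', Matrix.trace_vecMulVec, dotProduct_comm]
    exact sub_eq_zero.1 ((smul_eq_zero.1 h1).resolve_right hy0)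
  refine ⟨phi * ((eps (wLong lam) : A) * v (-(len (wLong lam) : ℤ))), ?_⟩
  have hinv : ((eps (wLong lam) : A) * v (len (wLong lam))) *
      ((eps (wLong lam) : A) * v (-(len (wLong lam) : ℤ))) = 1 := by
    have e1 : (eps (wLong lam) : A) * (eps (wLong lam) : A) = 1 := by
      exact_mod_cast congrArg (Int.cast : ℤ → A) (eps_mul_self (wLong lam))
    rw [mul_mul_mul_comm, e1, v_mul_v, add_neg_cancel, v_zero, one_mul]
  have hinv' := congrArg (algebraMap A K) hinv
  rw [map_mul, map_one] at hinv'
  rw [schur_eq, map_mul, ← htr, inv_eq_iff_eq_inv, eq_comm, inv_eq_iff_eq_inv, eq_comm]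
  have hw := F.weight_ne_zero lam
  rw [htau] at hinv'
  rw [eq_comm, ← one_div, eq_div_iff hw]
  linear_combination hinv'

theorem sum_rep_mul_rep_aux (lam mu : n.Partition) (i j : Fin (F.deg lam)) (k l : Fin (F.deg mu)) :
    ∑ w, F.rep lam (toHK (T w)) i j * F.rep mu (toHK (T w)) k l =
      F.diag lam j * (F.diag lam i)⁻¹ * (F.schur lam * F.rep mu (F.matUnit lam i j) k l) := by
  rw [← F.schur_relation lam mu j i k l, Finset.mul_sum]
  refine Finset.sum_congr rfl fun w _ => ?_
  have e := F.rep_flipK_apply lam (toHK (T w)) i j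
  rw [flipK_toHK, flip_T] at e
  have hi := mul_inv_cancel₀ (F.diag_ne_zero lam i)
  linear_combination (-F.rep mu (toHK (T w)) k l * (F.diag lam i)⁻¹) * e -
    F.rep lam (toHK (T w)) i j * F.rep mu (toHK (T w)) k l * hi

theorem sum_rep_mul_rep (lam : n.Partition) (i j k l : Fin (F.deg lam)) :
    ∑ w, F.rep lam (toHK (T w)) i j * F.rep lam (toHK (T w)) k l =
      if i = k ∧ j = l then F.diag lam j * (F.diag lam i)⁻¹ * F.schur lam else 0 := by
  rw [sum_rep_mul_rep_aux, rep_matUnit_self, Matrix.single_apply]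
  split_ifs <;> simp

theorem sum_rep_mul_rep_of_ne {lam mu : n.Partition} (h : mu ≠ lam) (i j : Fin (F.deg lam))
    (k l : Fin (F.deg mu)) :
    ∑ w, F.rep lam (toHK (T w)) i j * F.rep mu (toHK (T w)) k l = 0 := by
  rw [sum_rep_mul_rep_aux, F.rep_matUnit h, Matrix.zero_apply, mul_zero, mul_zero]

/-- By the Schur relation at the first diagonal position, the Schur element is a sum of squares. Its
lowest exponent is therefore even with positive coefficient, which shows that the choice defining
`aInv` is possible. -/
theorem aInv_spec (lam : n.Partition) : RatFunc.X ^ (2 * F.aInv lam) * F.schur lam ∈ Reg ∧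
    0 < constTerm (RatFunc.X ^ (2 * F.aInv lam) * F.schur lam) := by
  have hex : ∃ a : ℕ, ∃ r : ℝ, 0 < r ∧ ∃ q : ℝ[X],
      RatFunc.X ^ (2 * a) * F.schur lam = algebraMap ℝ[X] K (Polynomial.C r + Polynomial.X * q) := by
    obtain ⟨N, hN, hne⟩ := exists_min_pow fun w : Perm (Fin n) =>
      F.rep lam (toHK (T w)) (F.first lam) (F.first lam)
    have hne' : ∃ w, constTerm
        (RatFunc.X ^ N * F.rep lam (toHK (T w)) (F.first lam) (F.first lam)) ≠ 0 := by
      -- When no pole has to be cleared, the diagonal entry at the identity permutation provides a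
      -- non-zero constant term.
      rcases Nat.eq_zero_or_pos N with rfl | h
      · refine ⟨1, ?_⟩
        rw [pow_zero, one_mul, T_one, map_one, map_one, Matrix.one_apply_eq, constTerm_one]
        exact one_ne_zero
      · exact hne h
    have e1 : RatFunc.X ^ (2 * N) * F.schur lam = ∑ w, 1 *
        (RatFunc.X ^ N * F.rep lam (toHK (T w)) (F.first lam) (F.first lam)) ^ 2 := by
      have := F.sum_rep_mul_rep lam (F.first lam) (F.first lam) (F.first lam) (F.first lam)
      rw [if_pos ⟨rfl, rfl⟩, mul_inv_cancel₀ (F.diag_ne_zero _ _), one_mul] at this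
      rw [← this, Finset.mul_sum]
      exact Finset.sum_congr rfl fun w _ => by ring
    obtain ⟨h1, h2⟩ := constTerm_sum_sq (p := fun _ => 1) (fun _ => Reg.one_mem) hN
    rw [← e1] at h1 h2
    obtain ⟨f, hf⟩ := F.exists_schur_eq lam
    have e2 : RatFunc.X ^ (2 * N) * F.schur lam = algebraMap A K (v (2 * N : ℕ) * f) := by
      rw [map_mul, algebraMap_A_v, hf, zpow_natCast]
    rw [e2] at h1
    obtain ⟨p, hp⟩ := exists_toLaurent_of_mem (mem_APlus_of_mem_Reg h1)
    rw [hp, algebraMap_A_toLaurent] at e2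
    refine ⟨N, constTerm (RatFunc.X ^ (2 * N) * F.schur lam), ?_,
      (p.map (Int.castRingHom ℝ)).divX, ?_⟩
    · obtain ⟨w, hw⟩ := hne'
      rw [h2]
      refine Finset.sum_pos' (fun i _ => ?_) ⟨w, Finset.mem_univ w, ?_⟩
      · rw [constTerm_one, one_mul]; positivity
      · rw [constTerm_one, one_mul]; positivity
    · rw [e2, constTerm_algebraMap, ← Polynomial.coeff_zero_eq_eval_zero, add_comm,
        Polynomial.X_mul_divX_add]
  obtain ⟨r, hr, q, e⟩ := Classical.epsilon_spec hex
  change RatFunc.X ^ (2 * F.aInv lam) * F.schur lam = _ at e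
  rw [e, constTerm_algebraMap]
  exact ⟨algebraMap_mem_Reg _, by simpa using hr⟩

/-- The leading coefficient of the Schur element. -/
def schurLead (lam : n.Partition) : ℝ := constTerm (RatFunc.X ^ (2 * F.aInv lam) * F.schur lam)

/-- By the Schur relation for a single position, the squares of these scaled entries, with a weight
of constant term 1, add up to a regular function, and poles of squares cannot cancel. -/
theorem rep_T_mem (lam : n.Partition) (i j : Fin (F.deg lam)) (w : Perm (Fin n)) :
    RatFunc.X ^ F.aInv lam * F.rep lam (toHK (T w)) i j ∈ Reg := by
  have h := F.sum_rep_mul_rep lam i j i j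
  rw [if_pos ⟨rfl, rfl⟩] at h
  refine mem_Reg_of_sum_sq (p := fun _ => F.diag lam i * (F.diag lam j)⁻¹)
    (a := fun w => RatFunc.X ^ F.aInv lam * F.rep lam (toHK (T w)) i j)
    (fun _ => Reg.mul_mem (F.diag_mem _ _) (F.inv_diag_mem _ _))
    (fun _ => ?_) ?_ w
  · rw [constTerm_mul (F.diag_mem _ _) (F.inv_diag_mem _ _), constTerm_diag, constTerm_inv_diag]
    norm_num
  · have e : ∑ w, F.diag lam i * (F.diag lam j)⁻¹ *
        (RatFunc.X ^ F.aInv lam * F.rep lam (toHK (T w)) i j) ^ 2 =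
        RatFunc.X ^ (2 * F.aInv lam) * F.schur lam := by
      have e2 : ∀ w, F.diag lam i * (F.diag lam j)⁻¹ *
        (RatFunc.X ^ F.aInv lam * F.rep lam (toHK (T w)) i j) ^ 2 =
        F.diag lam i * (F.diag lam j)⁻¹ * RatFunc.X ^ (2 * F.aInv lam) *
          (F.rep lam (toHK (T w)) i j * F.rep lam (toHK (T w)) i j) := fun w => by ring
      simp only [e2]
      rw [← Finset.mul_sum, h]
      field_simp [F.diag_ne_zero lam i, F.diag_ne_zero lam j]
    rw [e]
    exact (F.aInv_spec lam).1

/-- The leading matrix coefficients without the sign. -/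
def low (lam : n.Partition) (i j : Fin (F.deg lam)) (w : Perm (Fin n)) : ℝ :=
  constTerm (RatFunc.X ^ F.aInv lam * F.rep lam (toHK (T w)) i j)

theorem lead_eq (lam : n.Partition) (i j : Fin (F.deg lam)) (w : Perm (Fin n)) :
    F.lead lam i j w = eps w * F.low lam i j w := rfl

theorem eps_real_mul_self (w : Perm (Fin n)) : (eps w : ℝ) * eps w = 1 := by
  exact_mod_cast congrArg (Int.cast : ℤ → ℝ) (eps_mul_self w)

theorem low_eq (lam : n.Partition) (i j : Fin (F.deg lam)) (w : Perm (Fin n)) :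
    F.low lam i j w = eps w * F.lead lam i j w := by
  rw [lead_eq, ← mul_assoc, eps_real_mul_self, one_mul]

theorem exists_low_eq (lam : n.Partition) (i j : Fin (F.deg lam)) (w : Perm (Fin n)) :
    ∃ m : ℤ, F.low lam i j w = m := by
  obtain ⟨m, hm⟩ := F.integral lam i j w
  exact ⟨eps w * m, by rw [low_eq, hm, Int.cast_mul]⟩

theorem rep_mem_of_coeff (lam : n.Partition) (i j : Fin (F.deg lam)) {h : Hecke n}
    (hh : ∀ w, coeff h w ∈ APlus) : RatFunc.X ^ F.aInv lam * F.rep lam (toHK h) i j ∈ Reg ∧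
      constTerm (RatFunc.X ^ F.aInv lam * F.rep lam (toHK h) i j) =
        ∑ w, ((coeff h w).coeff 0 : ℝ) * F.low lam i j w := by
  have e : RatFunc.X ^ F.aInv lam * F.rep lam (toHK h) i j =
      ∑ w, algebraMap A K (coeff h w) * (RatFunc.X ^ F.aInv lam * F.rep lam (toHK (T w)) i j) := by
    rw [toHK_eq_sum, map_sum, Matrix.sum_apply, Finset.mul_sum]
    refine Finset.sum_congr rfl fun w _ => ?_
    rw [map_smul, Matrix.smul_apply, smul_eq_mul, bK_apply]
    ring
  have hm : ∀ w, algebraMap A K (coeff h w) *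
      (RatFunc.X ^ F.aInv lam * F.rep lam (toHK (T w)) i j) ∈ Reg := fun w =>
    Reg.mul_mem (algebraMap_A_mem (hh w)).1 (F.rep_T_mem lam i j w)
  rw [e]
  refine ⟨Reg.sum_mem fun w _ => hm w, ?_⟩
  rw [constTerm_sum _ fun w _ => hm w]
  refine Finset.sum_congr rfl fun w _ => ?_
  rw [constTerm_mul (algebraMap_A_mem (hh w)).1 (F.rep_T_mem lam i j w),
    (algebraMap_A_mem (hh w)).2]
  rfl

theorem rep_C_mem (lam : n.Partition) (i j : Fin (F.deg lam)) (w : Perm (Fin n)) :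
    RatFunc.X ^ F.aInv lam * F.rep lam (toHK (C w)) i j ∈ Reg ∧
      constTerm (RatFunc.X ^ F.aInv lam * F.rep lam (toHK (C w)) i j) = F.low lam i j w := by
  obtain ⟨h1, h2⟩ := F.rep_mem_of_coeff lam i j (isKL_C w).coeff_mem_APlus
  refine ⟨h1, ?_⟩
  rw [h2, Finset.sum_eq_single w]
  · have h1 := coeff_intCast 1 0
    rw [Int.cast_one, if_pos rfl] at h1
    rw [(isKL_C w).coeff_self, h1, Int.cast_one, one_mul]
  · intro y _ hy
    rw [(isKL_C w).coeff_mem y hy 0 le_rfl, Int.cast_zero, zero_mul]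
  · exact fun h => absurd (Finset.mem_univ _) h

theorem sum_low_mul_low (lam : n.Partition) (i j k l : Fin (F.deg lam)) :
    ∑ w, F.low lam i j w * F.low lam k l w = if i = k ∧ j = l then F.schurLead lam else 0 := by
  have h := congrArg (fun x => constTerm (RatFunc.X ^ (2 * F.aInv lam) * x))
    (F.sum_rep_mul_rep lam i j k l)
  have e : RatFunc.X ^ (2 * F.aInv lam) *
      ∑ w, F.rep lam (toHK (T w)) i j * F.rep lam (toHK (T w)) k l =
      ∑ w, (RatFunc.X ^ F.aInv lam * F.rep lam (toHK (T w)) i j) *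
        (RatFunc.X ^ F.aInv lam * F.rep lam (toHK (T w)) k l) := by
    rw [Finset.mul_sum]
    exact Finset.sum_congr rfl fun w _ => by ring
  simp only [e] at h
  rw [constTerm_sum _ fun w _ => Reg.mul_mem (F.rep_T_mem lam i j w) (F.rep_T_mem lam k l w)] at h
  simp only [constTerm_mul (F.rep_T_mem lam _ _ _) (F.rep_T_mem lam _ _ _)] at h
  change ∑ w, F.low lam i j w * F.low lam k l w = _ at h
  rw [h]
  split_ifs
  · have e3 : RatFunc.X ^ (2 * F.aInv lam) * (F.diag lam j * (F.diag lam i)⁻¹ * F.schur lam) =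
        F.diag lam j * (F.diag lam i)⁻¹ * (RatFunc.X ^ (2 * F.aInv lam) * F.schur lam) := by ring
    rw [e3, constTerm_mul (Reg.mul_mem (F.diag_mem _ _) (F.inv_diag_mem _ _)) (F.aInv_spec lam).1,
      constTerm_mul (F.diag_mem _ _) (F.inv_diag_mem _ _), constTerm_diag, constTerm_inv_diag,
      one_mul, one_mul]
    rfl
  · rw [mul_zero, constTerm_zero]

theorem sum_low_mul_low_of_ne {lam mu : n.Partition} (hne : mu ≠ lam) (i j : Fin (F.deg lam))
    (k l : Fin (F.deg mu)) : ∑ w, F.low lam i j w * F.low mu k l w = 0 := by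
  have e : ∑ w, (RatFunc.X ^ F.aInv lam * F.rep lam (toHK (T w)) i j) *
        (RatFunc.X ^ F.aInv mu * F.rep mu (toHK (T w)) k l) = 0 := by
    rw [← mul_zero (RatFunc.X ^ F.aInv lam * RatFunc.X ^ F.aInv mu),
      ← F.sum_rep_mul_rep_of_ne hne i j k l, Finset.mul_sum]
    exact Finset.sum_congr rfl fun w _ => by ring
  have h := congrArg constTerm e
  rw [constTerm_sum _ fun w _ => Reg.mul_mem (F.rep_T_mem lam i j w) (F.rep_T_mem mu k l w),
    constTerm_zero] at h
  simp only [constTerm_mul (F.rep_T_mem _ _ _ _) (F.rep_T_mem _ _ _ _)] at h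
  exact h

end OrthFamily

/-! ### The longest elements and the bijection -/

namespace OrthFamily

variable (F : OrthFamily n)

theorem low_inv (lam : n.Partition) (i j : Fin (F.deg lam)) (w : Perm (Fin n)) :
    F.low lam j i w⁻¹ = F.low lam i j w := by
  have h := F.rep_flipK_apply' lam (toHK (T w)) i j
  rw [flipK_toHK, flip_T] at h
  have e : RatFunc.X ^ F.aInv lam * F.rep lam (toHK (T w⁻¹)) j i = (F.diag lam j)⁻¹ *
      ((RatFunc.X ^ F.aInv lam * F.rep lam (toHK (T w)) i j) * F.diag lam i) := by rw [h]; ring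
  rw [low, e, constTerm_mul (F.inv_diag_mem _ _) (Reg.mul_mem (F.rep_T_mem _ _ _ _) (F.diag_mem _ _)),
    constTerm_mul (F.rep_T_mem _ _ _ _) (F.diag_mem _ _), constTerm_diag, constTerm_inv_diag,
    one_mul, mul_one]
  rfl

/-- The 2×2 minors of the rank-one matrix of `C (wLong lam)` vanish, hence so do those of its
leading terms. -/
theorem low_wLong_mul (lam : n.Partition) (i j k l : Fin (F.deg lam)) :
    F.low lam i j (wLong lam) * F.low lam k l (wLong lam) =
      F.low lam i l (wLong lam) * F.low lam k j (wLong lam) := by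
  obtain ⟨a, b, -, -, e⟩ := F.exists_rep_C_wLong_eq lam
  simp only [← (F.rep_C_mem lam _ _ (wLong lam)).2]
  rw [← constTerm_mul (F.rep_C_mem lam _ _ _).1 (F.rep_C_mem lam _ _ _).1,
    ← constTerm_mul (F.rep_C_mem lam _ _ _).1 (F.rep_C_mem lam _ _ _).1, e]
  simp only [Matrix.vecMulVec_apply]
  congr 1
  ring

theorem low_first_ne_zero (lam : n.Partition) :
    F.low lam (F.first lam) (F.first lam) (wLong lam) ≠ 0 := fun h =>
  F.normalized lam (by
    change F.lead lam (F.first lam) (F.first lam) (wLong lam) = 0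
    rw [lead_eq, h, mul_zero])

/-- The rank-one property and the symmetry coming from `wLong⁻¹ = wLong` turn the trace into a sum
of squares along the first column, which the normalization makes non-zero. -/
theorem sum_low_wLong_mul (lam : n.Partition) :
    (∑ i, F.low lam i i (wLong lam)) * F.low lam (F.first lam) (F.first lam) (wLong lam) =
      ∑ i, F.low lam i (F.first lam) (wLong lam) ^ 2 := by
  rw [Finset.sum_mul]
  refine Finset.sum_congr rfl fun i _ => ?_
  rw [low_wLong_mul]
  conv_lhs => rw [← F.low_inv lam i (F.first lam), wLong_inv]
  rw [pow_two, ← F.low_inv lam i (F.first lam), wLong_inv]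

theorem sum_low_wLong_ne_zero (lam : n.Partition) : ∑ i, F.low lam i i (wLong lam) ≠ 0 := by
  intro h
  have h1 := F.sum_low_wLong_mul lam
  rw [h, zero_mul] at h1
  have h2 := (Finset.sum_eq_zero_iff_of_nonneg (fun i _ => sq_nonneg _)).1 h1.symm (F.first lam)
    (Finset.mem_univ _)
  exact F.low_first_ne_zero lam (pow_eq_zero_iff two_ne_zero |>.1 h2)

/-- The trace of `C (wLong lam)` in `χ_λ` is `±v ^ (-l)` times a polynomial with constant term 1,
where `l = len (wLong lam)`. Its lowest exponent is also `-aInv`, as the leading diagonal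
coefficients have non-zero sum. Comparison gives both claims. -/
theorem aInv_eq_and (lam : n.Partition) : F.aInv lam = len (wLong lam) ∧
    ∑ i, F.low lam i i (wLong lam) = eps (wLong lam) := by
  set S := ∑ i, RatFunc.X ^ F.aInv lam * F.rep lam (toHK (C (wLong lam))) i i with hS
  have hm : ∀ i, RatFunc.X ^ F.aInv lam * F.rep lam (toHK (C (wLong lam))) i i ∈ Reg :=
    fun i => (F.rep_C_mem lam i i _).1
  have hSR : S ∈ Reg := Reg.sum_mem fun i _ => hm i
  have hSc : constTerm S = ∑ i, F.low lam i i (wLong lam) := by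
    rw [hS, constTerm_sum _ fun i _ => hm i]
    exact Finset.sum_congr rfl fun i _ => (F.rep_C_mem lam i i _).2
  have hP : (eps (wLong lam) : A) * poincare lam ∈ APlus :=
    APlus.mul_mem (intCast_mem_APlus _) (poincare_mem lam)
  obtain ⟨hPR, hPc⟩ := algebraMap_A_mem hP
  have hPc' : constTerm (algebraMap A K ((eps (wLong lam) : A) * poincare lam)) =
      eps (wLong lam) := by
    rw [map_mul, constTerm_mul (algebraMap_A_mem (intCast_mem_APlus _)).1
      (algebraMap_A_mem (poincare_mem lam)).1, (algebraMap_A_mem (intCast_mem_APlus _)).2,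
      (algebraMap_A_mem (poincare_mem lam)).2, poincare_coeff_zero, coeff_intCast, if_pos rfl,
      Int.cast_one, mul_one]
  have hne : (eps (wLong lam) : ℝ) ≠ 0 := fun h => by
    have := eps_real_mul_self (wLong lam)
    rw [h, zero_mul] at this
    exact zero_ne_one this
  have e : RatFunc.X ^ len (wLong lam) * S =
      RatFunc.X ^ F.aInv lam * algebraMap A K ((eps (wLong lam) : A) * poincare lam) := by
    have h1 := F.trace_C_wLong lam
    have h2 : S = RatFunc.X ^ F.aInv lam * algebraMap A K (topScalar lam) := by
      rw [← h1, hS, Matrix.trace, Finset.mul_sum]; rfl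
    have h3 : (RatFunc.X : K) ^ len (wLong lam) * RatFunc.X ^ (-(len (wLong lam) : ℤ)) = 1 := by
      rw [← zpow_natCast, ← zpow_add₀ RatFunc.X_ne_zero, add_neg_cancel, zpow_zero]
    rw [h2, topScalar, map_mul, map_mul, map_mul, algebraMap_A_v]
    linear_combination (RatFunc.X ^ F.aInv lam * algebraMap A K (eps (wLong lam) : A) *
      algebraMap A K (poincare lam)) * h3
  rcases lt_trichotomy (F.aInv lam) (len (wLong lam)) with h | h | h
  · exfalso
    obtain ⟨k, hk⟩ := Nat.exists_eq_add_of_lt h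
    rw [hk, add_assoc, pow_add, mul_assoc] at e
    have e2 := mul_left_cancel₀ (pow_ne_zero _ RatFunc.X_ne_zero) e
    have e3 := congrArg constTerm e2
    rw [constTerm_X_pow_mul hSR (Nat.succ_pos k), hPc'] at e3
    exact hne e3.symm
  · refine ⟨h, ?_⟩
    rw [h] at e
    have e2 := mul_left_cancel₀ (pow_ne_zero _ RatFunc.X_ne_zero) e
    rw [← hSc, e2, hPc']
  · exfalso
    obtain ⟨k, hk⟩ := Nat.exists_eq_add_of_lt h
    rw [hk, add_assoc, pow_add, mul_assoc] at e
    have e2 := mul_left_cancel₀ (pow_ne_zero _ RatFunc.X_ne_zero) e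
    have e3 := congrArg constTerm e2
    rw [constTerm_X_pow_mul hPR (Nat.succ_pos k), hSc] at e3
    exact F.sum_low_wLong_ne_zero lam e3

theorem aInv_eq (lam : n.Partition) : F.aInv lam = len (wLong lam) := (F.aInv_eq_and lam).1

/-- With `m i` the integers in the first column and `ε` the sign, `ε * m 1 = ∑ (m i)²` and `m 1 ≠
0`. This forces `m 1 = ε` and all other `m i = 0`; the remaining entries follow from the rank-one
relation. -/
theorem low_wLong (lam : n.Partition) (i j : Fin (F.deg lam)) : F.low lam i j (wLong lam) =
    if i = F.first lam ∧ j = F.first lam then (eps (wLong lam) : ℝ) else 0 := by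
  choose m hm using fun i => F.exists_low_eq lam i (F.first lam) (wLong lam)
  have h1 := F.sum_low_wLong_mul lam
  rw [(F.aInv_eq_and lam).2] at h1
  simp only [hm] at h1
  have h2 : eps (wLong lam) * m (F.first lam) = ∑ i, m i ^ 2 := by exact_mod_cast h1
  have h0 : m (F.first lam) ≠ 0 := fun h => F.low_first_ne_zero lam (by rw [hm, h, Int.cast_zero])
  rw [← Finset.add_sum_erase _ _ (Finset.mem_univ (F.first lam))] at h2
  have h3 : 0 ≤ ∑ i ∈ Finset.univ.erase (F.first lam), m i ^ 2 :=
    Finset.sum_nonneg fun i _ => sq_nonneg _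
  have heps := eps_mul_self (wLong lam)
  have heps' : eps (wLong lam) = 1 ∨ eps (wLong lam) = -1 := mul_self_eq_one_iff.1 heps
  have h4 : ∑ i ∈ Finset.univ.erase (F.first lam), m i ^ 2 = 0 ∧ m (F.first lam) = eps (wLong lam) := by
    rcases heps' with e | e <;> rw [e] at h2 ⊢ <;> rcases lt_or_gt_of_ne h0 with h | h
    · nlinarith
    · constructor <;> nlinarith
    · constructor <;> nlinarith
    · nlinarith
  have h5 : ∀ i, i ≠ F.first lam → m i = 0 := fun i hi => pow_eq_zero_iff two_ne_zero |>.1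
    ((Finset.sum_eq_zero_iff_of_nonneg fun i _ => sq_nonneg _).1 h4.1 i
      (Finset.mem_erase.2 ⟨hi, Finset.mem_univ i⟩))
  have h6 := F.low_wLong_mul lam i j (F.first lam) (F.first lam)
  have h7 : F.low lam (F.first lam) j (wLong lam) = m j := by
    rw [← hm, ← F.low_inv lam (F.first lam) j, wLong_inv]
  rw [h7, hm, hm] at h6
  split_ifs with hij
  · rw [hij.1, hij.2, hm, h4.2]
  · have h8 : (m i : ℝ) * m j = 0 := by
      rcases not_and_or.1 hij with h | h
      · rw [h5 i h, Int.cast_zero, zero_mul]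
      · rw [h5 j h, Int.cast_zero, mul_zero]
    rw [h8] at h6
    exact (mul_eq_zero.1 h6).resolve_right (by exact_mod_cast h0)

/-- The symmetrizing trace of `C (wLong lam)` is computed twice. As a coefficient at `T 1` it is `±v
^ l`, `l = len (wLong lam)`. As a weighted sum of characters it is `topScalar` times `∑ weight mu *
m mu`, where the `m mu` are traces of idempotents, hence natural numbers, with `m lam = 1`; they
vanish unless `mu` is `lam` or strictly dominates it. Since `weight mu` has order `2 * len (wLong
mu)` and this length strictly increases under strict dominance, only `mu = lam` contributes to the
lowest term. -/
theorem schurLead_eq_one (lam : n.Partition) : F.schurLead lam = 1 := by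
  have hX : (RatFunc.X : K) ≠ 0 := RatFunc.X_ne_zero
  set q := algebraMap A K (topScalar lam) with hq
  have hq0 : q ≠ 0 := algebraMap_topScalar_ne_zero lam
  have htr : ∀ mu, ∃ m : ℕ, (F.rep mu (toHK (C (wLong lam)))).trace = q * m := by
    intro mu
    obtain ⟨m, hm⟩ := trace_of_idempotent (M := q⁻¹ • F.rep mu (toHK (C (wLong lam)))) (by
      rw [Matrix.smul_mul, Matrix.mul_smul, rep_C_wLong_mul_self, ← hq, smul_smul q⁻¹ q,
        inv_mul_cancel₀ hq0, one_smul])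
    refine ⟨m, ?_⟩
    rw [← hm, Matrix.trace_smul, smul_eq_mul, mul_inv_cancel_left₀ hq0]
  choose m hm using htr
  have hm1 : m lam = 1 := by
    have := hm lam
    rw [trace_C_wLong, ← hq] at this
    have h1 : (m lam : K) = 1 := mul_left_cancel₀ hq0 (by rw [← this, mul_one])
    exact_mod_cast h1
  have hm0 : ∀ mu, m mu ≠ 0 → mu = lam ∨ SDom lam mu := by
    intro mu h
    refine F.eq_or_sdom_of_rep_C_wLong fun h0 => h ?_
    have := hm mu
    rw [h0, Matrix.trace_zero] at this
    have h1 : (m mu : K) = 0 := (mul_eq_zero.1 this.symm).resolve_left hq0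
    exact_mod_cast h1
  have htau := F.tauK_eq (toHK (C (wLong lam)))
  have hc1 : coeff (C (wLong lam)) 1 = (eps (wLong lam) : A) * v (len (wLong lam)) := by
    rw [coeff_C_top (rowOf_monotone lam) (isTop_wLong lam) (Stab (rowOf lam)).one_mem, len_one]
    simp [eps, len_one]
  set u : n.Partition → K := fun mu => RatFunc.X ^ (2 * F.aInv mu) * F.schur mu with hu
  have hu0 : ∀ mu, constTerm (u mu) ≠ 0 := fun mu => (F.aInv_spec mu).2.ne'
  have huR : ∀ mu, (u mu)⁻¹ ∈ Reg := fun mu => inv_mem_Reg (F.aInv_spec mu).1 (hu0 mu)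
  have hw : ∀ mu, F.weight mu = RatFunc.X ^ (2 * F.aInv mu) * (u mu)⁻¹ := by
    intro mu
    rw [hu]
    simp only [schur_eq, mul_inv, inv_inv]
    rw [mul_inv_cancel_left₀ (pow_ne_zero _ hX)]
  -- This is `weight mu * m mu` divided by `v ^ (2 * len (wLong lam))`, in a form that is visibly
  -- regular at 0.
  set g : n.Partition → K := fun mu => if mu = lam then (u lam)⁻¹ else if m mu = 0 then 0 else
        RatFunc.X ^ (2 * (len (wLong mu) - len (wLong lam))) * ((u mu)⁻¹ * (m mu : K)) with hg
  have hterm : ∀ mu, RatFunc.X ^ (2 * len (wLong lam)) *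
      g mu =
      F.weight mu * (m mu : K) := by
    intro mu
    simp only [hg]
    split_ifs with h1 h2
    · rw [h1, hw, hm1, aInv_eq, Nat.cast_one, mul_one]
    · rw [h2, Nat.cast_zero, mul_zero, mul_zero]
    · have h3 := len_wLong_lt ((hm0 mu h2).resolve_left h1)
      rw [hw, aInv_eq, ← mul_assoc, ← pow_add, ← mul_assoc]
      congr 3
      omega
  rw [tauK_toHK, hc1] at htau
  have e : (1 : K) = algebraMap A K (poincare lam) * ∑ mu, g mu := by
    have h1 : (algebraMap A K (eps (wLong lam) : A)) * algebraMap A K (eps (wLong lam) : A) = 1 := by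
      rw [← map_mul, ← map_one (algebraMap A K)]
      congr 1
      exact_mod_cast congrArg (Int.cast : ℤ → A) (eps_mul_self (wLong lam))
    have h2 : ∑ mu, F.weight mu * (F.rep mu (toHK (C (wLong lam)))).trace =
        q * (RatFunc.X ^ (2 * len (wLong lam)) * ∑ mu, g mu) := by
      rw [Finset.mul_sum, Finset.mul_sum]
      refine Finset.sum_congr rfl fun mu _ => ?_
      rw [hterm, hm]
      ring
    rw [h2, hq, topScalar, map_mul, map_mul, map_mul, algebraMap_A_v, algebraMap_A_v, zpow_neg,
      zpow_natCast] at htau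
    have h3 : (RatFunc.X : K) ^ len (wLong lam) ≠ 0 := pow_ne_zero _ hX
    have h4 : algebraMap A K (eps (wLong lam) : A) ≠ 0 := fun h => by
      rw [h, zero_mul] at h1; exact zero_ne_one h1
    rw [two_mul, pow_add] at htau
    apply mul_left_cancel₀ (mul_ne_zero h4 h3)
    refine (mul_one _).trans (htau.trans ?_)
    generalize ∑ mu, g mu = G
    have h5 := inv_mul_cancel₀ h3
    linear_combination (algebraMap A K (eps (wLong lam) : A) * algebraMap A K (poincare lam) * G *
      RatFunc.X ^ len (wLong lam)) * h5
  have hR : ∀ mu, g mu ∈ Reg := by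
    intro mu
    simp only [hg]
    split_ifs
    · exact huR lam
    · exact Reg.zero_mem
    · exact X_pow_mul_mem (Reg.mul_mem (huR mu) (natCast_mem Reg _)) _
  have h5 := congrArg constTerm e
  rw [constTerm_one, constTerm_mul (algebraMap_A_mem (poincare_mem lam)).1
    (Reg.sum_mem fun mu _ => hR mu), (algebraMap_A_mem (poincare_mem lam)).2, poincare_coeff_zero,
    Int.cast_one, one_mul, constTerm_sum _ fun mu _ => hR mu, Finset.sum_eq_single lam,
    show g lam = (u lam)⁻¹ from if_pos rfl, constTerm_inv (F.aInv_spec lam).1 (hu0 lam)] at h5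
  · rw [eq_comm, inv_eq_one] at h5
    exact h5
  · intro mu _ h1
    simp only [hg, if_neg h1]
    split_ifs with h2
    · exact constTerm_zero
    · have h3 := len_wLong_lt ((hm0 mu h2).resolve_left h1)
      exact constTerm_X_pow_mul (Reg.mul_mem (huR mu) (natCast_mem Reg _)) (by omega)
  · exact fun h => absurd (Finset.mem_univ _) h

/-- Integer squares with sum 1 have a single non-zero term. -/
theorem existsUnique_of_sum_sq {ι : Type*} [Fintype ι] {f : ι → ℝ} (hf : ∀ i, ∃ m : ℤ, f i = m)
    (h : ∑ i, f i * f i = 1) : ∃ i, (f i = 1 ∨ f i = -1) ∧ ∀ k, f k ≠ 0 → k = i := by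
  classical
  choose m hm using hf
  have h1 : ∑ i, m i * m i = 1 := by
    simp only [hm] at h
    exact_mod_cast h
  obtain ⟨i, hi⟩ : ∃ i, m i ≠ 0 := by
    by_contra! h0
    simp [h0] at h1
  have h2 : ∀ k, m k ≠ 0 → 1 ≤ m k * m k := fun k hk => by
    have := mul_self_pos.2 hk
    omega
  rw [← Finset.add_sum_erase _ _ (Finset.mem_univ i)] at h1
  have h3 : 0 ≤ ∑ k ∈ Finset.univ.erase i, m k * m k :=
    Finset.sum_nonneg fun k _ => mul_self_nonneg _
  have h4 := h2 i hi
  refine ⟨i, ?_, fun k hk => ?_⟩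
  · rw [hm]
    rcases mul_self_eq_one_iff.1 (show m i * m i = 1 by omega) with e | e <;> rw [e] <;> simp
  · by_contra hne
    have h5 : m k * m k ≤ ∑ k ∈ Finset.univ.erase i, m k * m k :=
      Finset.single_le_sum (f := fun k => m k * m k) (fun k _ => mul_self_nonneg _)
        (Finset.mem_erase.2 ⟨hne, Finset.mem_univ k⟩)
    have h6 := h2 k (fun h0 => hk (by rw [hm, h0, Int.cast_zero]))
    omega

theorem exists_wElt (lam : n.Partition) (i j : Fin (F.deg lam)) : ∃ w,
    (F.low lam i j w = 1 ∨ F.low lam i j w = -1) ∧ ∀ y, F.low lam i j y ≠ 0 → y = w :=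
  existsUnique_of_sum_sq (F.exists_low_eq lam i j) (by
    rw [sum_low_mul_low, if_pos ⟨rfl, rfl⟩, schurLead_eq_one])

theorem lead_ne_zero_iff {lam : n.Partition} {i j : Fin (F.deg lam)} {w : Perm (Fin n)} :
    F.lead lam i j w ≠ 0 ↔ F.low lam i j w ≠ 0 := by
  have hne : (eps w : ℝ) ≠ 0 := fun h => by
    have := eps_real_mul_self w
    rw [h, zero_mul] at this
    exact zero_ne_one this
  rw [lead_eq, mul_ne_zero_iff, and_iff_right hne]

theorem low_ne_zero_iff {lam : n.Partition} {i j : Fin (F.deg lam)} {w : Perm (Fin n)} :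
    F.low lam i j w ≠ 0 ↔ w = F.wElt lam i j := by
  obtain ⟨w', h1, h2⟩ := F.exists_wElt lam i j
  have h0 : F.low lam i j w' ≠ 0 := by rcases h1 with e | e <;> rw [e] <;> norm_num
  have h3 : F.lead lam i j (F.wElt lam i j) ≠ 0 :=
    Classical.epsilon_spec (p := fun w => F.lead lam i j w ≠ 0) ⟨w', F.lead_ne_zero_iff.2 h0⟩
  have h4 := h2 _ (F.lead_ne_zero_iff.1 h3)
  rw [h4]
  exact ⟨h2 w, fun h => h ▸ h0⟩

theorem low_wElt (lam : n.Partition) (i j : Fin (F.deg lam)) :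
    F.low lam i j (F.wElt lam i j) = 1 ∨ F.low lam i j (F.wElt lam i j) = -1 := by
  obtain ⟨w', h1, h2⟩ := F.exists_wElt lam i j
  rwa [h2 _ (F.low_ne_zero_iff.2 rfl)]

theorem low_eq_zero {lam : n.Partition} {i j : Fin (F.deg lam)} {w : Perm (Fin n)}
    (h : w ≠ F.wElt lam i j) : F.low lam i j w = 0 := by
  by_contra h0
  exact h (F.low_ne_zero_iff.1 h0)

theorem mem_R_iff {lam : n.Partition} {w : Perm (Fin n)} :
    w ∈ F.R lam ↔ ∃ i j, w = F.wElt lam i j := by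
  simp only [R, Set.mem_ofPred_eq, lead_ne_zero_iff, low_ne_zero_iff]

/-- The bijection between matrix positions and permutations. -/
theorem wElt_bijective : Function.Bijective
    fun p : (lam : n.Partition) × Fin (F.deg lam) × Fin (F.deg lam) => F.wElt p.1 p.2.1 p.2.2 := by
  rw [Fintype.bijective_iff_injective_and_card]
  refine ⟨?_, F.card_eq⟩
  -- If two positions shared a permutation, the sum in their orthogonality relation would consist of
  -- a single non-zero term.
  have hs : ∀ lam mu (i j : Fin (F.deg lam)) (k l : Fin (F.deg mu)),
      F.wElt lam i j = F.wElt mu k l → ∑ w, F.low lam i j w * F.low mu k l w ≠ 0 := by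
    intro lam mu i j k l h
    rw [Finset.sum_eq_single (F.wElt lam i j) (fun w _ hw => by rw [F.low_eq_zero hw, zero_mul])
      (fun h => absurd (Finset.mem_univ _) h)]
    exact mul_ne_zero (F.low_ne_zero_iff.2 rfl) (F.low_ne_zero_iff.2 h)
  rintro ⟨lam, i, j⟩ ⟨mu, k, l⟩ h
  have h1 := hs lam mu i j k l h
  by_cases hm : mu = lam
  · subst hm
    rw [sum_low_mul_low] at h1
    split_ifs at h1 with h2
    · rw [h2.1, h2.2]
    · exact absurd rfl h1
  · exact absurd (F.sum_low_mul_low_of_ne hm i j k l) h1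

theorem wElt_inj {lam : n.Partition} {i j k l : Fin (F.deg lam)}
    (h : F.wElt lam i j = F.wElt lam k l) : i = k ∧ j = l := by
  have := F.wElt_bijective.1 (a₁ := ⟨lam, i, j⟩) (a₂ := ⟨lam, k, l⟩) h
  simpa using this

theorem eq_of_wElt_eq {lam mu : n.Partition} {i j : Fin (F.deg lam)} {k l : Fin (F.deg mu)}
    (h : F.wElt lam i j = F.wElt mu k l) : lam = mu :=
  congrArg Sigma.fst (F.wElt_bijective.1 (a₁ := ⟨lam, i, j⟩) (a₂ := ⟨mu, k, l⟩) h)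

theorem exists_eq_wElt (w : Perm (Fin n)) : ∃ lam i j, w = F.wElt lam i j := by
  obtain ⟨⟨lam, i, j⟩, h⟩ := F.wElt_bijective.2 w
  exact ⟨lam, i, j, h.symm⟩

theorem eq_of_mem_R {lam mu : n.Partition} {w : Perm (Fin n)} (h1 : w ∈ F.R lam)
    (h2 : w ∈ F.R mu) : lam = mu := by
  obtain ⟨i, j, e1⟩ := F.mem_R_iff.1 h1
  obtain ⟨k, l, e2⟩ := F.mem_R_iff.1 h2
  exact F.eq_of_wElt_eq (e1.symm.trans e2)

theorem wElt_inv (lam : n.Partition) (i j : Fin (F.deg lam)) :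
    (F.wElt lam i j)⁻¹ = F.wElt lam j i :=
  F.low_ne_zero_iff.1 (by rw [F.low_inv lam i j]; exact F.low_ne_zero_iff.2 rfl)

theorem wElt_eq_xElt_mul (lam : n.Partition) (i : Fin (F.deg lam)) :
    F.wElt lam i (F.first lam) = F.xElt lam i * wLong lam := by
  rw [xElt, inv_mul_cancel_right]

theorem xElt_injective (lam : n.Partition) : Function.Injective (F.xElt lam) := fun i j h => by
  refine (F.wElt_inj (j := F.first lam) (l := F.first lam) ?_).1
  rw [wElt_eq_xElt_mul, wElt_eq_xElt_mul, h]

end OrthFamily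

/-! ### Decomposition of the elements `Z` -/

namespace OrthFamily

variable (F : OrthFamily n)

theorem eps_K_mul_self (w : Perm (Fin n)) : (eps w : K) * eps w = 1 := by
  exact_mod_cast congrArg (Int.cast : ℤ → K) (eps_mul_self w)

theorem eps_K_mem (w : Perm (Fin n)) : (eps w : K) ∈ Reg := intCast_mem Reg _

theorem constTerm_intCast (m : ℤ) : constTerm (m : K) = m := by
  have h := (algebraMap_A_mem (intCast_mem_APlus m)).2
  rw [map_intCast, coeff_intCast, if_pos rfl] at h
  exact h

/-- The longest element of the Young subgroup acts by a matrix of rank one. -/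
theorem exists_alpha (lam : n.Partition) : ∃ (α : Fin (F.deg lam) → K) (κ : K),
    (∀ i, α i ∈ Reg) ∧ (∀ i, constTerm (α i) = if i = F.first lam then 1 else 0) ∧ κ ∈ Reg ∧
    constTerm κ = 1 ∧ ∀ i j, RatFunc.X ^ len (wLong lam) * F.rep lam (toHK (C (wLong lam))) i j =
      (eps (wLong lam) : K) * (α i * (κ * F.diag lam j * α j)) := by
  set M : Fin (F.deg lam) → Fin (F.deg lam) → K := fun i j =>
    RatFunc.X ^ len (wLong lam) * F.rep lam (toHK (C (wLong lam))) i j with hM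
  set o := F.first lam with ho
  set e : K := (eps (wLong lam) : K) with he
  have hee : e * e = 1 := eps_K_mul_self _
  have hMR : ∀ i j, M i j ∈ Reg ∧ constTerm (M i j) = F.low lam i j (wLong lam) := fun i j => by
    have := F.rep_C_mem lam i j (wLong lam)
    rwa [aInv_eq] at this
  have hoo : constTerm (M o o) = eps (wLong lam) := by
    rw [(hMR o o).2, low_wLong, if_pos ⟨rfl, rfl⟩]
  have hoo0 : constTerm (M o o) ≠ 0 := by
    rw [hoo]
    intro h
    have := eps_real_mul_self (wLong lam)
    rw [h, zero_mul] at this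
    exact zero_ne_one this
  have hM0 : M o o ≠ 0 := fun h => hoo0 (by rw [h, constTerm_zero])
  have hinv : (M o o)⁻¹ ∈ Reg := inv_mem_Reg (hMR o o).1 hoo0
  -- The first column is divided by its top entry, so its constant terms form the first unit vector.
  -- The row is proportional to the column, up to `diag`, by invariance under `flip`, and `κ`
  -- absorbs the remaining scalar.
  refine ⟨fun i => M i o * (M o o)⁻¹, e * M o o * (F.diag lam o)⁻¹,
    fun i => Reg.mul_mem (hMR i o).1 hinv, fun i => ?_,
    Reg.mul_mem (Reg.mul_mem (eps_K_mem _) (hMR o o).1) (F.inv_diag_mem _ _), ?_, fun i j => ?_⟩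
  · rw [constTerm_mul (hMR i o).1 hinv, constTerm_inv (hMR o o).1 hoo0, (hMR i o).2, hoo, low_wLong]
    split_ifs with h1 h2 h2
    · rw [← hoo]; exact mul_inv_cancel₀ hoo0
    · exact absurd h1.1 h2
    · exact absurd ⟨h2, rfl⟩ h1
    · exact zero_mul _
  · rw [constTerm_mul (Reg.mul_mem (eps_K_mem _) (hMR o o).1) (F.inv_diag_mem _ _),
      constTerm_mul (eps_K_mem _) (hMR o o).1, constTerm_inv_diag, hoo, constTerm_intCast,
      mul_one, eps_real_mul_self]
  · obtain ⟨a, b, -, -, hab⟩ := F.exists_rep_C_wLong_eq lam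
    have h1 : M i j * M o o = M i o * M o j := by
      simp only [hM, hab, Matrix.vecMulVec_apply]; ring
    have h2 : F.diag lam o * M o j = M j o * F.diag lam j := by
      have := F.rep_flipK_apply lam (toHK (C (wLong lam))) j o
      rw [flipK_toHK, flip_C_wLong] at this
      simp only [hM]
      linear_combination RatFunc.X ^ len (wLong lam) * this
    have hD := F.diag_ne_zero lam o
    change M i j = _
    have h3 : M o j = M j o * F.diag lam j * (F.diag lam o)⁻¹ := by
      rw [← h2, mul_comm (F.diag lam o), mul_assoc, mul_inv_cancel₀ hD, mul_one]
    have h4 : M i j = M i o * M o j * (M o o)⁻¹ := by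
      rw [← h1, mul_assoc, mul_inv_cancel₀ hM0, mul_one]
    have h5 := mul_inv_cancel₀ hM0
    rw [h4, h3]
    linear_combination (- M i o * M j o * F.diag lam j * (F.diag lam o)⁻¹ * (M o o)⁻¹) * hee -
      (e * e * M i o * (M o o)⁻¹ * (F.diag lam o)⁻¹ * F.diag lam j * M j o) * h5

/-- The column factor of the matrix of the longest element of the Young subgroup. -/
def alpha (lam : n.Partition) : Fin (F.deg lam) → K := (F.exists_alpha lam).choose

/-- The factor relating the row and the column factor of the matrix of the longest element. -/
def kappa (lam : n.Partition) : K := (F.exists_alpha lam).choose_spec.choose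

theorem alpha_mem (lam : n.Partition) (i : Fin (F.deg lam)) : F.alpha lam i ∈ Reg :=
  (F.exists_alpha lam).choose_spec.choose_spec.1 i

theorem constTerm_alpha (lam : n.Partition) (i : Fin (F.deg lam)) :
    constTerm (F.alpha lam i) = if i = F.first lam then 1 else 0 :=
  (F.exists_alpha lam).choose_spec.choose_spec.2.1 i

theorem kappa_mem (lam : n.Partition) : F.kappa lam ∈ Reg :=
  (F.exists_alpha lam).choose_spec.choose_spec.2.2.1

theorem constTerm_kappa (lam : n.Partition) : constTerm (F.kappa lam) = 1 :=
  (F.exists_alpha lam).choose_spec.choose_spec.2.2.2.1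

theorem rep_C_wLong_apply (lam : n.Partition) (i j : Fin (F.deg lam)) :
    RatFunc.X ^ len (wLong lam) * F.rep lam (toHK (C (wLong lam))) i j =
      (eps (wLong lam) : K) * (F.alpha lam i * (F.kappa lam * F.diag lam j * F.alpha lam j)) :=
  (F.exists_alpha lam).choose_spec.choose_spec.2.2.2.2 i j

/-- The action on the vector `alpha`. -/
def orbit (lam : n.Partition) (h : Hecke n) : Fin (F.deg lam) → K :=
  F.rep lam (toHK h) *ᵥ F.alpha lam

theorem rep_mul_C_wLong_apply (lam : n.Partition) (h : Hecke n) (i j : Fin (F.deg lam)) :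
    RatFunc.X ^ len (wLong lam) * F.rep lam (toHK (h * C (wLong lam))) i j =
      (eps (wLong lam) : K) * (F.orbit lam h i * (F.kappa lam * F.diag lam j * F.alpha lam j)) := by
  rw [map_mul, map_mul, Matrix.mul_apply, Finset.mul_sum, orbit, Matrix.mulVec, dotProduct,
    Finset.sum_mul, Finset.mul_sum]
  refine Finset.sum_congr rfl fun k _ => ?_
  linear_combination F.rep lam (toHK h) i k * F.rep_C_wLong_apply lam k j

/-- The value at the first position of the row factor. -/
def unitFactor (lam : n.Partition) : K :=
  F.kappa lam * F.diag lam (F.first lam) * F.alpha lam (F.first lam)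

theorem unitFactor_mem (lam : n.Partition) : F.unitFactor lam ∈ Reg :=
  Reg.mul_mem (Reg.mul_mem (F.kappa_mem _) (F.diag_mem _ _)) (F.alpha_mem _ _)

theorem constTerm_unitFactor (lam : n.Partition) : constTerm (F.unitFactor lam) = 1 := by
  rw [unitFactor, constTerm_mul (Reg.mul_mem (F.kappa_mem _) (F.diag_mem _ _)) (F.alpha_mem _ _),
    constTerm_mul (F.kappa_mem _) (F.diag_mem _ _), constTerm_kappa, constTerm_diag,
    constTerm_alpha, if_pos rfl, one_mul, one_mul]

theorem unitFactor_ne_zero (lam : n.Partition) : F.unitFactor lam ≠ 0 := fun h => by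
  have := F.constTerm_unitFactor lam
  rw [h, constTerm_zero] at this
  exact zero_ne_one this

theorem inv_unitFactor_mem (lam : n.Partition) : (F.unitFactor lam)⁻¹ ∈ Reg :=
  inv_mem_Reg (F.unitFactor_mem lam) (by rw [constTerm_unitFactor]; exact one_ne_zero)

theorem constTerm_inv_unitFactor (lam : n.Partition) : constTerm (F.unitFactor lam)⁻¹ = 1 := by
  rw [constTerm_inv (F.unitFactor_mem lam) (by rw [constTerm_unitFactor]; exact one_ne_zero),
    constTerm_unitFactor, inv_one]

/-- The row factor of the rank-one matrix has an invertible first entry, so the first column of the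
matrix of `h * C (wLong lam)` recovers the vector. -/
theorem orbit_apply (lam : n.Partition) (h : Hecke n) (i : Fin (F.deg lam)) :
    F.orbit lam h i = (eps (wLong lam) : K) * (RatFunc.X ^ len (wLong lam) *
      F.rep lam (toHK (h * C (wLong lam))) i (F.first lam)) * (F.unitFactor lam)⁻¹ := by
  rw [rep_mul_C_wLong_apply, ← unitFactor]
  have h1 := mul_inv_cancel₀ (F.unitFactor_ne_zero lam)
  have h2 := eps_K_mul_self (wLong lam)
  linear_combination (-(eps (wLong lam) : K) * eps (wLong lam) * F.orbit lam h i) * h1 -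
    F.orbit lam h i * h2

theorem orbit_smul_of_mul {lam : n.Partition} {h h' : Hecke n} {c : A}
    (e : h * C (wLong lam) = c • (h' * C (wLong lam))) :
    F.orbit lam h = algebraMap A K c • F.orbit lam h' := by
  funext i
  rw [Pi.smul_apply, smul_eq_mul, orbit_apply, orbit_apply, e, toHK_smul, map_smul,
    Matrix.smul_apply, smul_eq_mul]
  ring

theorem orbit_mul (lam : n.Partition) (h h' : Hecke n) :
    F.orbit lam (h * h') = F.rep lam (toHK h) *ᵥ F.orbit lam h' := by
  rw [orbit, orbit, map_mul, map_mul, Matrix.mulVec_mulVec]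

theorem orbit_one (lam : n.Partition) : F.orbit lam 1 = F.alpha lam := by
  rw [orbit, map_one, map_one, Matrix.one_mulVec]

theorem orbit_T_s {lam : n.Partition} {k : Fin (n - 1)} (hk : k ∈ Par (rowOf lam)) :
    F.orbit lam (T (s k)) = -((RatFunc.X : K)⁻¹ • F.alpha lam) := by
  have h := F.orbit_smul_of_mul (lam := lam) (h := T (s k)) (h' := 1) (c := -v (-1)) (by
    rw [T_s_mul_C_top (rowOf_monotone lam) (isTop_wLong lam) hk, one_mul, neg_smul])
  rw [h, orbit_one, map_neg, algebraMap_A_v, zpow_neg_one, neg_smul]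

theorem rep_C_mulVec_alpha (lam : n.Partition) (w : Perm (Fin n)) (i : Fin (F.deg lam)) :
    RatFunc.X ^ len (wLong lam) * F.orbit lam (C w) i ∈ Reg ∧
      constTerm (RatFunc.X ^ len (wLong lam) * F.orbit lam (C w) i) =
        F.low lam i (F.first lam) w := by
  have e : RatFunc.X ^ len (wLong lam) * F.orbit lam (C w) i =
      ∑ k, RatFunc.X ^ len (wLong lam) * F.rep lam (toHK (C w)) i k * F.alpha lam k := by
    rw [orbit, Matrix.mulVec, dotProduct, Finset.mul_sum]
    exact Finset.sum_congr rfl fun k _ => (mul_assoc _ _ _).symm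
  have hm : ∀ k, RatFunc.X ^ len (wLong lam) * F.rep lam (toHK (C w)) i k ∈ Reg ∧
      constTerm (RatFunc.X ^ len (wLong lam) * F.rep lam (toHK (C w)) i k) = F.low lam i k w :=
    fun k => by
      have := F.rep_C_mem lam i k w
      rwa [aInv_eq] at this
  rw [e]
  refine ⟨Reg.sum_mem fun k _ => Reg.mul_mem (hm k).1 (F.alpha_mem _ _), ?_⟩
  rw [constTerm_sum _ fun k _ => Reg.mul_mem (hm k).1 (F.alpha_mem _ _),
    Finset.sum_eq_single (F.first lam)]
  · rw [constTerm_mul (hm _).1 (F.alpha_mem _ _), (hm _).2, constTerm_alpha, if_pos rfl, mul_one]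
  · intro k _ hk
    rw [constTerm_mul (hm _).1 (F.alpha_mem _ _), constTerm_alpha, if_neg hk, mul_zero]
  · exact fun h => absurd (Finset.mem_univ _) h

/-- Integrality of the coefficients of `C w * T s - v • C w`. -/
theorem coeff_C_mul_T_s_sub {k : Fin (n - 1)} {w : Perm (Fin n)} (hk : ¬ Desc k w⁻¹)
    (y : Perm (Fin n)) : coeff (C w * T (s k) - v 1 • C w) y ∈ APlus := by
  have h := ((isKL_C w⁻¹).coeff_T_s_sub hk).2.1 y⁻¹
  have e : C w * T (s k) - v 1 • C w = flip (T (s k) * C w⁻¹ - v 1 • C w⁻¹) := by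
    rw [map_sub, flip_mul, map_smul, flip_C, flip_T, s_inv, inv_inv]
  rwa [e, coeff_flip]

/-- The vector `alpha` is an eigenvector of `T (s k)` for `-v⁻¹`. If `k` were not a right descent of
`w`, then `C w * T (s k) - v • C w` would have coefficients in `ℤ[v]`, so its scaled action on
`alpha` would be regular. But this action is `-(v + v⁻¹)` times that of `C w`, which has a pole in
coordinate `i`. -/
theorem desc_of_low_ne_zero {lam : n.Partition} {i : Fin (F.deg lam)} {w : Perm (Fin n)}
    (h : F.low lam i (F.first lam) w ≠ 0) {k : Fin (n - 1)} (hk : k ∈ Par (rowOf lam)) :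
    Desc k w⁻¹ := by
  by_contra hd
  obtain ⟨h1, h2⟩ := F.rep_C_mulVec_alpha lam w i
  set x := C w * T (s k) - v 1 • C w with hx
  have hR : RatFunc.X ^ len (wLong lam) * F.orbit lam x i ∈ Reg := by
    rw [orbit, Matrix.mulVec, dotProduct, Finset.mul_sum]
    refine Reg.sum_mem fun j _ => ?_
    rw [← mul_assoc]
    refine Reg.mul_mem ?_ (F.alpha_mem _ _)
    have := (F.rep_mem_of_coeff lam i j (coeff_C_mul_T_s_sub hd)).1
    rwa [aInv_eq] at this
  have e : F.orbit lam x = -(((RatFunc.X : K)⁻¹ + RatFunc.X) • F.orbit lam (C w)) := by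
    have e1 : F.orbit lam (C w * T (s k)) = -((RatFunc.X : K)⁻¹ • F.orbit lam (C w)) := by
      rw [orbit_mul, F.orbit_T_s hk, Matrix.mulVec_neg, Matrix.mulVec_smul]
      rfl
    have e2 : F.orbit lam (v 1 • C w) = (RatFunc.X : K) • F.orbit lam (C w) := by
      rw [orbit, toHK_smul, map_smul, Matrix.smul_mulVec, algebraMap_A_v, zpow_one]
      rfl
    have e3 : F.orbit lam x = F.orbit lam (C w * T (s k)) - F.orbit lam (v 1 • C w) := by
      rw [hx, orbit, map_sub, map_sub, Matrix.sub_mulVec]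
      rfl
    rw [e3, e1, e2, add_smul]
    abel
  have e2 : RatFunc.X * (RatFunc.X ^ len (wLong lam) * F.orbit lam x i) =
      -((1 + RatFunc.X * RatFunc.X) * (RatFunc.X ^ len (wLong lam) * F.orbit lam (C w) i)) := by
    rw [e, Pi.neg_apply, Pi.smul_apply, smul_eq_mul]
    have := mul_inv_cancel₀ (RatFunc.X_ne_zero (K := ℝ))
    linear_combination (-RatFunc.X ^ len (wLong lam) * F.orbit lam (C w) i) * this
  have e3 := congrArg constTerm e2
  have hXX : (1 + RatFunc.X * RatFunc.X : K) ∈ Reg :=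
    Reg.add_mem Reg.one_mem (Reg.mul_mem X_mem_Reg X_mem_Reg)
  rw [constTerm_mul X_mem_Reg hR, constTerm_X, zero_mul, constTerm_neg (Reg.mul_mem hXX h1),
    constTerm_mul hXX h1, constTerm_add Reg.one_mem (Reg.mul_mem X_mem_Reg X_mem_Reg),
    constTerm_mul X_mem_Reg X_mem_Reg, constTerm_X, constTerm_one, h2] at e3
  apply h
  linarith

theorem xElt_mem (lam : n.Partition) (i : Fin (F.deg lam)) : F.xElt lam i ∈ Inc (rowOf lam) := by
  obtain ⟨d, hd, e⟩ := exists_eq_mul_top (rowOf_monotone lam) (isTop_wLong lam)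
    (y := F.wElt lam i (F.first lam))
    (fun k hk => F.desc_of_low_ne_zero (F.low_ne_zero_iff.2 rfl) hk)
  rwa [xElt, e, mul_inv_cancel_right]

end OrthFamily

open scoped Classical in
/-- The element of the span of the `T d` with product `C (x * w)` with `C w`, for the longest element
`w` of the Young subgroup. -/
def factor (lam : n.Partition) (x : Perm (Fin n)) : Hecke n :=
  ∑ d with d ∈ Inc (rowOf lam), coeff (C (x * wLong lam)) (d * wLong lam) • T d

theorem factor_mul (lam : n.Partition) {x : Perm (Fin n)} (hx : x ∈ Inc (rowOf lam)) :
    factor lam x * C (wLong lam) = C (x * wLong lam) := by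
  conv_rhs => rw [(rightSign_C_mul_top (isTop_wLong lam) hx).eq_sum (rowOf_monotone lam) (isTop_wLong lam)]
  rw [factor, Finset.sum_mul]
  exact Finset.sum_congr rfl fun d _ => smul_mul_assoc _ _ _

/-- The integral form of the element `Z`. -/
def zInt (lam : n.Partition) (x y : Perm (Fin n)) : Hecke n :=
  factor lam x * C (wLong lam) * flip (factor lam y)

theorem topScalar_smul_zInt (lam : n.Partition) {x y : Perm (Fin n)} (hx : x ∈ Inc (rowOf lam))
    (hy : y ∈ Inc (rowOf lam)) :
    topScalar lam • zInt lam x y = C (x * wLong lam) * C (wLong lam * y⁻¹) := by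
  have h1 : C (wLong lam * y⁻¹) = C (wLong lam) * flip (factor lam y) := by
    have := congrArg flip (factor_mul lam hy)
    rw [flip_mul, flip_C_wLong, flip_C, mul_inv_rev, wLong_inv] at this
    exact this.symm
  rw [h1, ← factor_mul lam hx, mul_assoc, ← mul_assoc (C (wLong lam)),
    mul_C_wLong (rightSign_C_wLong lam), zInt, smul_mul_assoc, mul_smul_comm, mul_assoc]

theorem barA_topScalar (lam : n.Partition) : barA (topScalar lam) = topScalar lam := by
  have h := mul_C_wLong (rightSign_C_wLong lam)
  have h2 := congrArg bar h
  rw [bar_mul, bar_C, h, bar_smul, bar_C, ← sub_eq_zero, ← sub_smul] at h2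
  by_contra h0
  exact C_wLong_ne_zero lam (smul_eq_zero_hecke (sub_ne_zero.2 (Ne.symm h0)) h2)

/-- After multiplication by the bar-invariant `topScalar lam` the element is a product of two
elements `C`, and the algebra is torsion-free over `A`. -/
theorem bar_zInt (lam : n.Partition) {x y : Perm (Fin n)} (hx : x ∈ Inc (rowOf lam))
    (hy : y ∈ Inc (rowOf lam)) : bar (zInt lam x y) = zInt lam x y := by
  have h := topScalar_smul_zInt lam hx hy
  have h2 := congrArg bar h
  rw [bar_mul, bar_C, bar_C, ← h, bar_smul, barA_topScalar, ← sub_eq_zero, ← smul_sub] at h2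
  exact sub_eq_zero.1 (smul_eq_zero_hecke (topScalar_ne_zero lam) h2)

namespace OrthFamily

variable (F : OrthFamily n)

theorem Z_eq (lam : n.Partition) (i j : Fin (F.deg lam)) :
    F.Z lam i j = toHK (zInt lam (F.xElt lam i) (F.xElt lam j)) := by
  rw [Z, ← topScalar_smul_zInt lam (F.xElt_mem lam i) (F.xElt_mem lam j), smul_smul, toHK_smul,
    smul_smul]
  have e : (eps (wLong lam) • v (len (wLong lam))) * topScalar lam = poincare lam := by
    have e1 : (eps (wLong lam) : A) * (eps (wLong lam) : A) = 1 := by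
      exact_mod_cast congrArg (Int.cast : ℤ → A) (eps_mul_self (wLong lam))
    have e2 : v (len (wLong lam)) * v (-(len (wLong lam) : ℤ)) = 1 := by
      rw [v_mul_v, add_neg_cancel, v_zero]
    rw [zsmul_eq_mul, topScalar]
    linear_combination (v (len (wLong lam)) * v (-(len (wLong lam) : ℤ)) * poincare lam) * e1 +
      poincare lam * e2
  rw [e, inv_mul_cancel₀, one_smul]
  exact fun h => poincare_ne_zero lam (algebraMap_A_injective (by rw [h, map_zero]))

theorem orbit_factor (lam : n.Partition) {x : Perm (Fin n)} (hx : x ∈ Inc (rowOf lam))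
    (i : Fin (F.deg lam)) : F.orbit lam (factor lam x) i ∈ Reg ∧
      constTerm (F.orbit lam (factor lam x) i) =
        (eps (wLong lam) : ℝ) * F.low lam i (F.first lam) (x * wLong lam) := by
  have h := F.rep_C_mem lam i (F.first lam) (x * wLong lam)
  rw [aInv_eq] at h
  rw [orbit_apply, factor_mul lam hx]
  refine ⟨Reg.mul_mem (Reg.mul_mem (eps_K_mem _) h.1) (F.inv_unitFactor_mem _), ?_⟩
  rw [constTerm_mul (Reg.mul_mem (eps_K_mem _) h.1) (F.inv_unitFactor_mem _),
    constTerm_mul (eps_K_mem _) h.1, h.2, constTerm_inv_unitFactor, mul_one, constTerm_intCast]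

/-- Adjointness for the form `diag` moves `flip h'` from the right onto the row factor, where it
becomes the action of `h'` on `alpha`. -/
theorem rep_mul_flip_apply (lam : n.Partition) (h h' : Hecke n) (a b : Fin (F.deg lam)) :
    RatFunc.X ^ len (wLong lam) * F.rep lam (toHK (h * C (wLong lam) * flip h')) a b =
      (eps (wLong lam) : K) * (F.orbit lam h a * (F.kappa lam * F.diag lam b * F.orbit lam h' b)) := by
  rw [map_mul, map_mul, Matrix.mul_apply, Finset.mul_sum]
  have e : ∀ k, RatFunc.X ^ len (wLong lam) * (F.rep lam (toHK (h * C (wLong lam))) a k *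
      F.rep lam (toHK (flip h')) k b) = ((eps (wLong lam) : K) * F.orbit lam h a * F.kappa lam *
        F.diag lam b) * (F.rep lam (toHK h') b k * F.alpha lam k) := by
    intro k
    have h1 := F.rep_flipK_apply lam (toHK h') b k
    rw [flipK_toHK] at h1
    have h2 := F.rep_mul_C_wLong_apply lam h a k
    linear_combination (F.rep lam (toHK (flip h')) k b) * h2 +
      ((eps (wLong lam) : K) * F.orbit lam h a * F.kappa lam * F.alpha lam k) * h1
  simp only [e]
  have e2 : F.orbit lam h' b = ∑ k, F.rep lam (toHK h') b k * F.alpha lam k := rfl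
  rw [← Finset.mul_sum, e2]
  ring

/-- The scaled matrix is a product of a column and a row, coming from `factor` applied to `alpha`.
Their constant terms are `±` the unit vectors at `i` and `j`, by uniqueness of the positions `(i,
1)` and `(j, 1)`. -/
theorem rep_zInt (lam : n.Partition) (i j a b : Fin (F.deg lam)) :
    RatFunc.X ^ F.aInv lam * F.rep lam (toHK (zInt lam (F.xElt lam i) (F.xElt lam j))) a b ∈ Reg ∧
    constTerm (RatFunc.X ^ F.aInv lam *
      F.rep lam (toHK (zInt lam (F.xElt lam i) (F.xElt lam j))) a b) =
      if a = i ∧ b = j then (eps (wLong lam) : ℝ) *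
        (F.low lam i (F.first lam) (F.wElt lam i (F.first lam)) *
          F.low lam j (F.first lam) (F.wElt lam j (F.first lam))) else 0 := by
  obtain ⟨h1, h2⟩ := F.orbit_factor lam (F.xElt_mem lam i) a
  obtain ⟨h3, h4⟩ := F.orbit_factor lam (F.xElt_mem lam j) b
  rw [← wElt_eq_xElt_mul] at h2 h4
  have hk := F.kappa_mem lam
  have hd := F.diag_mem lam b
  rw [aInv_eq, zInt, rep_mul_flip_apply]
  have hR := Reg.mul_mem h1 (Reg.mul_mem (Reg.mul_mem hk hd) h3)
  refine ⟨Reg.mul_mem (eps_K_mem _) hR, ?_⟩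
  rw [constTerm_mul (eps_K_mem _) hR, constTerm_mul h1 (Reg.mul_mem (Reg.mul_mem hk hd) h3),
    constTerm_mul (Reg.mul_mem hk hd) h3, constTerm_mul hk hd, constTerm_kappa, constTerm_diag,
    constTerm_intCast, h2, h4]
  have he := eps_real_mul_self (wLong lam)
  split_ifs with hab
  · rw [hab.1, hab.2]
    linear_combination (eps (wLong lam) : ℝ) *
      (F.low lam i (F.first lam) (F.wElt lam i (F.first lam)) *
          F.low lam j (F.first lam) (F.wElt lam j (F.first lam))) * he
  · rcases not_and_or.1 hab with h | h
    · rw [F.low_eq_zero (i := a) fun e => h (F.wElt_inj e).1.symm]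
      ring
    · rw [F.low_eq_zero (i := b) fun e => h (F.wElt_inj e).1.symm]
      ring

end OrthFamily

/-! ### The cell ideals -/

theorem sDom_irrefl (lam : n.Partition) : ¬ SDom lam lam := fun h => h.2 rfl

/-- Induction along the dominance order, starting from the dominating partitions. -/
theorem sDom_induction {P : n.Partition → Prop}
    (h : ∀ lam, (∀ mu, SDom lam mu → P mu) → P lam) (lam : n.Partition) : P lam := by
  have : IsTrans n.Partition (fun mu lam => SDom lam mu) := ⟨fun _ _ _ h1 h2 => h2.trans h1⟩
  have : Std.Irrefl (fun mu lam : n.Partition => SDom lam mu) := ⟨sDom_irrefl⟩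
  exact (Finite.wellFounded_of_trans_of_irrefl fun mu lam : n.Partition => SDom lam mu).induction
    lam h

theorem ccoeff_smul (a : A) (h : Hecke n) (w : Perm (Fin n)) : ccoeff (a • h) w = a * ccoeff h w := by
  rw [ccoeff, map_smul]
  rfl

theorem ccoeff_C (w y : Perm (Fin n)) [Decidable (w = y)] : ccoeff (C w) y = if w = y then 1 else 0 := by
  rw [ccoeff, ← CBasis_apply, Module.Basis.repr_self, Finsupp.single_apply]

theorem ccoeff_sub (h h' : Hecke n) (w : Perm (Fin n)) :
    ccoeff (h - h') w = ccoeff h w - ccoeff h' w := by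
  rw [ccoeff, map_sub]
  rfl

namespace OrthFamily

variable (F : OrthFamily n)

/-- The permutations in the cells of the partitions strictly dominating `lam`. -/
def Up (lam : n.Partition) : Set (Perm (Fin n)) := {y | ∃ mu, SDom lam mu ∧ y ∈ F.R mu}

/-- The ideal of the elements acting as zero on all the representations, except possibly those
labelled by the partitions strictly dominating `lam`. -/
def upIdeal (lam : n.Partition) : Submodule A (Hecke n) where
  carrier := {h | ∀ nu, ¬ SDom lam nu → F.rep nu (toHK h) = 0}
  zero_mem' := fun nu _ => by rw [map_zero, map_zero]
  add_mem' := fun ha hb nu h => by rw [map_add, map_add, ha nu h, hb nu h, add_zero]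
  smul_mem' := fun c x hx nu h => by rw [toHK_smul, map_smul, hx nu h, smul_zero]

theorem mul_mem_upIdeal_left {lam : n.Partition} {h : Hecke n} (hh : h ∈ F.upIdeal lam)
    (g : Hecke n) : g * h ∈ F.upIdeal lam := fun nu hnu => by
  rw [map_mul, map_mul, hh nu hnu, mul_zero]

theorem mul_mem_upIdeal_right {lam : n.Partition} {h : Hecke n} (hh : h ∈ F.upIdeal lam)
    (g : Hecke n) : h * g ∈ F.upIdeal lam := fun nu hnu => by
  rw [map_mul, map_mul, hh nu hnu, zero_mul]

theorem wElt_mem_R (lam : n.Partition) (i j : Fin (F.deg lam)) : F.wElt lam i j ∈ F.R lam :=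
  F.mem_R_iff.2 ⟨i, j, rfl⟩

theorem wElt_notMem_Up {lam nu : n.Partition} (h : ¬ SDom lam nu) (i j : Fin (F.deg nu)) :
    F.wElt nu i j ∉ F.Up lam := by
  rintro ⟨mu, h1, h2⟩
  exact h (F.eq_of_mem_R h2 (F.wElt_mem_R nu i j) ▸ h1)

theorem notMem_Up_of_mem_R {lam : n.Partition} {y : Perm (Fin n)} (hy : y ∈ F.R lam) :
    y ∉ F.Up lam := by
  obtain ⟨i, j, rfl⟩ := F.mem_R_iff.1 hy
  exact F.wElt_notMem_Up (sDom_irrefl lam) i j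

/-- The coefficients of an element with respect to the basis `C` are governed by the leading terms of
its matrices. -/
theorem ccoeff_of_rep_mem {lam : n.Partition} (hup : ∀ y ∈ F.Up lam, C y ∈ F.upIdeal lam)
    {h : Hecke n} (hR : ∀ nu, ¬ SDom lam nu → ∀ i j,
      RatFunc.X ^ F.aInv nu * F.rep nu (toHK h) i j ∈ Reg)
    {nu : n.Partition} (hnu : ¬ SDom lam nu) (i j : Fin (F.deg nu)) :
    ccoeff h (F.wElt nu i j) ∈ APlus ∧
      ((ccoeff h (F.wElt nu i j)).coeff 0 : ℝ) * F.low nu i j (F.wElt nu i j) =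
        constTerm (RatFunc.X ^ F.aInv nu * F.rep nu (toHK h) i j) := by
  classical
  -- The coefficients at `Up lam` are invisible to the representations considered, so they are
  -- replaced by 0 before the common pole order is taken.
  set a : Perm (Fin n) → K := fun y => if y ∈ F.Up lam then 0 else algebraMap A K (ccoeff h y)
    with ha
  obtain ⟨N, hN, hpos⟩ := exists_min_pow a
  have key : ∀ nu, ¬ SDom lam nu → ∀ i j,
      RatFunc.X ^ N * (RatFunc.X ^ F.aInv nu * F.rep nu (toHK h) i j) =
        ∑ y, RatFunc.X ^ N * a y * (RatFunc.X ^ F.aInv nu * F.rep nu (toHK (C y)) i j) := by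
    intro nu hnu i j
    have e : F.rep nu (toHK h) = ∑ y, a y • F.rep nu (toHK (C y)) := by
      conv_lhs => rw [← sum_ccoeff_smul_C h]
      rw [map_sum, map_sum]
      refine Finset.sum_congr rfl fun y _ => ?_
      rw [toHK_smul, map_smul, ha]
      by_cases hy : y ∈ F.Up lam
      · rw [hup y hy nu hnu, smul_zero, smul_zero]
      · simp only [if_neg hy]
    rw [e, Matrix.sum_apply, Finset.mul_sum, Finset.mul_sum]
    refine Finset.sum_congr rfl fun y _ => ?_
    rw [Matrix.smul_apply, smul_eq_mul]
    ring
  have hconst : ∀ nu, ¬ SDom lam nu → ∀ i j,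
      constTerm (RatFunc.X ^ N * (RatFunc.X ^ F.aInv nu * F.rep nu (toHK h) i j)) =
        constTerm (RatFunc.X ^ N * a (F.wElt nu i j)) * F.low nu i j (F.wElt nu i j) := by
    intro nu hnu i j
    rw [key nu hnu, constTerm_sum _ fun y _ => Reg.mul_mem (hN y) (F.rep_C_mem nu i j y).1,
      Finset.sum_eq_single (F.wElt nu i j)]
    · rw [constTerm_mul (hN _) (F.rep_C_mem nu i j _).1, (F.rep_C_mem nu i j _).2]
    · intro y _ hy
      rw [constTerm_mul (hN _) (F.rep_C_mem nu i j _).1, (F.rep_C_mem nu i j _).2,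
        F.low_eq_zero hy, mul_zero]
    · exact fun h => absurd (Finset.mem_univ _) h
  -- A coefficient at `F.wElt nu i j` with a pole of the maximal order `N > 0` would cause a pole in
  -- the scaled entry `(i, j)` of `h` in `nu`, the only position where this permutation has a
  -- leading term.
  have hN0 : N = 0 := by
    by_contra h0
    obtain ⟨y, hy⟩ := hpos (Nat.pos_of_ne_zero h0)
    by_cases hyU : y ∈ F.Up lam
    · simp only [ha, if_pos hyU, mul_zero, constTerm_zero, ne_eq, not_true_eq_false] at hy
    · obtain ⟨nu, i, j, rfl⟩ := F.exists_eq_wElt y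
      have hnu : ¬ SDom lam nu := fun h => hyU ⟨nu, h, F.wElt_mem_R nu i j⟩
      have h1 := hconst nu hnu i j
      rw [constTerm_X_pow_mul (hR nu hnu i j) (Nat.pos_of_ne_zero h0)] at h1
      exact mul_ne_zero hy (F.low_ne_zero_iff.2 rfl) h1.symm
  subst hN0
  have haw : a (F.wElt nu i j) = algebraMap A K (ccoeff h (F.wElt nu i j)) :=
    if_neg (F.wElt_notMem_Up hnu i j)
  have h1 := hN (F.wElt nu i j)
  have h2 := hconst nu hnu i j
  rw [pow_zero, one_mul, haw] at h1
  rw [pow_zero, one_mul, one_mul, haw] at h2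
  have h3 := mem_APlus_of_mem_Reg h1
  exact ⟨h3, by rw [h2, (algebraMap_A_mem h3).2]⟩

/-- The properties of the cell of a single partition: its elements act as zero on the representations
whose label does not dominate `lam`, and the elements `Z` are the elements of the basis `C` up to sign
and elements of the ideal. -/
theorem cell_aux (lam : n.Partition) :
    (∀ y ∈ F.R lam, ∀ nu, F.rep nu (toHK (C y)) ≠ 0 → nu = lam ∨ SDom lam nu) ∧
    ∀ i j, ∃ η : ℤ, (η = 1 ∨ η = -1) ∧
      zInt lam (F.xElt lam i) (F.xElt lam j) - (η : A) • C (F.wElt lam i j) ∈ F.upIdeal lam := by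
  classical
  induction lam using sDom_induction with
  | h lam ih =>
  have hup : ∀ y ∈ F.Up lam, C y ∈ F.upIdeal lam := by
    rintro y ⟨mu, h1, h2⟩ nu hnu
    by_contra h0
    rcases (ih mu h1).1 y h2 nu h0 with e | h
    · exact hnu (e ▸ h1)
    · exact hnu (h1.trans h)
  have hz0 : ∀ i j nu, F.rep nu (toHK (zInt lam (F.xElt lam i) (F.xElt lam j))) ≠ 0 →
      nu = lam ∨ SDom lam nu := fun i j nu h => by
    refine F.eq_or_sdom_of_rep_C_wLong fun h0 => h ?_
    rw [zInt, map_mul, map_mul, map_mul, map_mul, h0, mul_zero, zero_mul]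
  have hZ : ∀ i j, ∃ η : ℤ, (η = 1 ∨ η = -1) ∧
      zInt lam (F.xElt lam i) (F.xElt lam j) - (η : A) • C (F.wElt lam i j) ∈ F.upIdeal lam := by
    intro i j
    set z := zInt lam (F.xElt lam i) (F.xElt lam j) with hz
    have hR : ∀ nu, ¬ SDom lam nu → ∀ k l,
        RatFunc.X ^ F.aInv nu * F.rep nu (toHK z) k l ∈ Reg := by
      intro nu hnu k l
      by_cases e : nu = lam
      · subst e
        exact (F.rep_zInt nu i j k l).1
      · have : F.rep nu (toHK z) = 0 := by
          by_contra h0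
          rcases hz0 i j nu h0 with h | h
          · exact e h
          · exact hnu h
        rw [this, Matrix.zero_apply, mul_zero]
        exact Reg.zero_mem
    have hbar : bar z = z := bar_zInt lam (F.xElt_mem lam i) (F.xElt_mem lam j)
    -- The coefficients lie in `ℤ[v]` and are fixed by `v ↦ v⁻¹`, so they are integers and their
    -- constant terms determine them.
    have hint : ∀ nu, ¬ SDom lam nu → ∀ k l, ccoeff z (F.wElt nu k l) =
        (((ccoeff z (F.wElt nu k l)).coeff 0 : ℤ) : A) := fun nu hnu k l =>
      eq_intCast_of_barA (F.ccoeff_of_rep_mem hup hR hnu k l).1 (barA_ccoeff hbar _)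
    have hcoeff : ∀ y, y ∉ F.Up lam → y ≠ F.wElt lam i j → ccoeff z y = 0 := by
      intro y hy hne
      obtain ⟨nu, k, l, rfl⟩ := F.exists_eq_wElt y
      have hnu : ¬ SDom lam nu := fun h => hy ⟨nu, h, F.wElt_mem_R nu k l⟩
      have h1 := (F.ccoeff_of_rep_mem hup hR hnu k l).2
      have h2 : constTerm (RatFunc.X ^ F.aInv nu * F.rep nu (toHK z) k l) = 0 := by
        by_cases e : nu = lam
        · subst e
          rw [(F.rep_zInt nu i j k l).2, if_neg]
          rintro ⟨rfl, rfl⟩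
          exact hne rfl
        · have : F.rep nu (toHK z) = 0 := by
            by_contra h0
            rcases hz0 i j nu h0 with h | h
            · exact e h
            · exact hnu h
          rw [this, Matrix.zero_apply, mul_zero, constTerm_zero]
      rw [h2, mul_eq_zero, or_iff_left (F.low_ne_zero_iff.2 rfl)] at h1
      rw [hint nu hnu k l, Int.cast_eq_zero.1 h1, Int.cast_zero]
    refine ⟨(ccoeff z (F.wElt lam i j)).coeff 0, ?_, ?_⟩
    · have h1 := (F.ccoeff_of_rep_mem hup hR (sDom_irrefl lam) i j).2
      rw [(F.rep_zInt lam i j i j).2, if_pos ⟨rfl, rfl⟩] at h1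
      have h2 : ((((ccoeff z (F.wElt lam i j)).coeff 0 : ℤ) : ℝ)) ^ 2 = 1 := by
        have e1 : ∀ k l, F.low lam k l (F.wElt lam k l) ^ 2 = 1 := fun k l => by
          rcases F.low_wElt lam k l with e | e <;> rw [e] <;> norm_num
        have e2 := congrArg (· ^ 2) h1
        simp only [mul_pow, e1, mul_one] at e2
        rw [e2, sq, eps_real_mul_self]
      have h3 : ((ccoeff z (F.wElt lam i j)).coeff 0 : ℤ) ^ 2 = 1 := by exact_mod_cast h2
      exact mul_self_eq_one_iff.1 (by rw [← sq, h3])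
    · rw [← hint lam (sDom_irrefl lam) i j]
      have e := Finset.add_sum_erase _ (fun y => ccoeff z y • C y) (Finset.mem_univ (F.wElt lam i j))
      rw [sum_ccoeff_smul_C] at e
      rw [← eq_sub_iff_add_eq'.2 e]
      refine Submodule.sum_mem _ fun y hy => ?_
      by_cases hyU : y ∈ F.Up lam
      · exact Submodule.smul_mem _ _ (hup y hyU)
      · rw [hcoeff y hyU (Finset.ne_of_mem_erase hy), zero_smul]
        exact Submodule.zero_mem _
  -- Vanishing is inherited from `zInt`, which contains the factor `C (wLong lam)`, since `C y` is
  -- `±zInt` modulo the ideal.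
  refine ⟨fun y hy nu h0 => ?_, hZ⟩
  by_contra hne
  push Not at hne
  obtain ⟨i, j, rfl⟩ := F.mem_R_iff.1 hy
  obtain ⟨η, hη, hmem⟩ := hZ i j
  have h1 := hmem nu hne.2
  have h2 : F.rep nu (toHK (zInt lam (F.xElt lam i) (F.xElt lam j))) = 0 := by
    by_contra h
    rcases hz0 i j nu h with h | h
    · exact hne.1 h
    · exact hne.2 h
  rw [map_sub, map_sub, h2, zero_sub, toHK_smul, map_smul, neg_eq_zero, smul_eq_zero] at h1
  rcases h1 with h1 | h1
  · rcases hη with rfl | rfl <;> simp at h1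
  · exact h0 h1

theorem eq_or_sDom_of_rep_C {lam nu : n.Partition} {y : Perm (Fin n)} (hy : y ∈ F.R lam)
    (h : F.rep nu (toHK (C y)) ≠ 0) : nu = lam ∨ SDom lam nu := (F.cell_aux lam).1 y hy nu h

theorem C_mem_upIdeal {lam : n.Partition} {y : Perm (Fin n)} (hy : y ∈ F.Up lam) :
    C y ∈ F.upIdeal lam := by
  obtain ⟨mu, h1, h2⟩ := hy
  intro nu hnu
  by_contra h0
  rcases F.eq_or_sDom_of_rep_C h2 h0 with e | h
  · exact hnu (e ▸ h1)
  · exact hnu (h1.trans h)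

/-- The sign relating the elements `Z` to the elements of the basis `C`. -/
def zSign (lam : n.Partition) (i j : Fin (F.deg lam)) : ℤ := ((F.cell_aux lam).2 i j).choose

theorem zSign_eq (lam : n.Partition) (i j : Fin (F.deg lam)) :
    F.zSign lam i j = 1 ∨ F.zSign lam i j = -1 := ((F.cell_aux lam).2 i j).choose_spec.1

theorem zInt_sub_mem (lam : n.Partition) (i j : Fin (F.deg lam)) :
    zInt lam (F.xElt lam i) (F.xElt lam j) - (F.zSign lam i j : A) • C (F.wElt lam i j) ∈
      F.upIdeal lam := ((F.cell_aux lam).2 i j).choose_spec.2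

/-- The ideal is spanned by elements of the basis `C`. -/
theorem ccoeff_eq_zero_of_mem_upIdeal {lam : n.Partition} {h : Hecke n} (hh : h ∈ F.upIdeal lam)
    {y : Perm (Fin n)} (hy : y ∉ F.Up lam) : ccoeff h y = 0 := by
  obtain ⟨nu, i, j, rfl⟩ := F.exists_eq_wElt y
  have hnu : ¬ SDom lam nu := fun h => hy ⟨nu, h, F.wElt_mem_R nu i j⟩
  refine LaurentPolynomial.ext fun k => ?_
  -- The ideal is stable under multiplication by `v ^ (-k)`, which moves the coefficient of `v ^ k`
  -- to the constant term.
  have hz : ∀ nu, ¬ SDom lam nu → F.rep nu (toHK (v (-k) • h)) = 0 :=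
    (F.upIdeal lam).smul_mem _ hh
  have h1 := (F.ccoeff_of_rep_mem (fun y => F.C_mem_upIdeal) (h := v (-k) • h)
    (fun nu hnu i j => by rw [hz nu hnu, Matrix.zero_apply, mul_zero]; exact Reg.zero_mem) hnu i j).2
  rw [hz nu hnu, Matrix.zero_apply, mul_zero, constTerm_zero, mul_eq_zero,
    or_iff_left (F.low_ne_zero_iff.2 rfl), Int.cast_eq_zero, ccoeff_smul, coeff_v_mul, zero_sub,
    neg_neg] at h1
  exact h1

end OrthFamily

/-! ### Standard tableaux -/

theorem mem_Inc_of_s_mul {r : Fin n → ℕ} (hr : Monotone r) {k : Fin (n - 1)} {x : Perm (Fin n)}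
    (hx : s k * x ∈ Inc r) (hd : ¬ Desc k x) : x ∈ Inc r := by
  refine (mem_Inc_iff hr).2 fun j hj hdj => ?_
  have h1 := len_mul_s_of_desc hdj
  have h2 := len_mul_s_of_not_desc ((mem_Inc_iff hr).1 hx j hj)
  have h3 := len_s_mul_of_not_desc hd
  rw [mul_assoc] at h2
  by_cases h : Desc k (x * s j)
  · have := len_s_mul_of_desc h
    omega
  · have := len_s_mul_of_not_desc h
    omega

namespace OrthFamily

variable (F : OrthFamily n)

theorem rep_C_wElt (lam : n.Partition) (i j : Fin (F.deg lam)) :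
    F.rep lam (toHK (C (F.wElt lam i j))) ≠ 0 := fun h => by
  have h1 := (F.rep_C_mem lam i j (F.wElt lam i j)).2
  rw [h, Matrix.zero_apply, mul_zero, constTerm_zero] at h1
  exact F.low_ne_zero_iff.2 rfl h1.symm

/-- The permutation `x * wLong lam` sits at some position of some `nu`. As `C (x * wLong lam)` is a
left multiple of `C (wLong lam)`, `nu` equals or strictly dominates `lam`. In the first case the row
factor, congruent to the first unit vector, forces the position into the first column. -/
theorem exists_xElt_or_mem_upIdeal {lam : n.Partition} {x : Perm (Fin n)}
    (hx : x ∈ Inc (rowOf lam)) :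
    (∃ i, x = F.xElt lam i) ∨ C (x * wLong lam) ∈ F.upIdeal lam := by
  obtain ⟨nu, a, b, e⟩ := F.exists_eq_wElt (x * wLong lam)
  have h0 : F.rep nu (toHK (C (wLong lam))) ≠ 0 := fun h => by
    apply F.rep_C_wElt nu a b
    rw [← e, ← factor_mul lam hx, map_mul, map_mul, h, mul_zero]
  rcases F.eq_or_sdom_of_rep_C_wLong h0 with rfl | h
  · left
    have hb : b = F.first nu := by
      by_contra hne
      have h1 := (F.rep_C_mem nu a b (x * wLong nu)).2
      have h2 := F.orbit_factor nu hx a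
      have hk := Reg.mul_mem (F.kappa_mem nu) (F.diag_mem nu b)
      have h3 := Reg.mul_mem hk (F.alpha_mem nu b)
      rw [← factor_mul nu hx, aInv_eq, rep_mul_C_wLong_apply,
        constTerm_mul (eps_K_mem _) (Reg.mul_mem h2.1 h3), constTerm_mul h2.1 h3,
        constTerm_mul hk (F.alpha_mem nu b), constTerm_alpha, if_neg hne, mul_zero, mul_zero,
        mul_zero] at h1
      exact F.low_ne_zero_iff.2 e h1.symm
    exact ⟨a, by rw [xElt, ← hb, ← e, mul_inv_cancel_right]⟩
  · exact Or.inr (F.C_mem_upIdeal ⟨nu, h, e ▸ F.wElt_mem_R nu a b⟩)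

/-- The `x_i` are closed under taking suffixes. -/
theorem exists_xElt_of_s_mul {lam : n.Partition} {i : Fin (F.deg lam)} {k : Fin (n - 1)}
    {x : Perm (Fin n)} (h : s k * x = F.xElt lam i) (hd : ¬ Desc k x) : ∃ j, x = F.xElt lam j := by
  have hi := F.xElt_mem lam i
  rw [← h] at hi
  have hx := mem_Inc_of_s_mul (rowOf_monotone lam) hi hd
  refine (F.exists_xElt_or_mem_upIdeal hx).resolve_right fun hup => ?_
  have hr := rowOf_monotone lam
  have hm := (isTop_wLong lam).mem
  have hdw : ¬ Desc k (x * wLong lam) := fun h' => by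
    have h1 := len_s_mul_of_desc h'
    have h2 := len_s_mul_of_not_desc hd
    rw [← mul_assoc, len_mul_of_Inc hr hi hm, len_mul_of_Inc hr hx hm] at h1
    omega
  obtain ⟨h1, h2, -, -⟩ := (isKL_C (x * wLong lam)).coeff_T_s_sub hdw
  -- If `C (x * wLong lam)` were in the ideal, `u` would act as zero in `χ_λ`. But `u` has
  -- coefficients in `ℤ[v]` and coefficient 1 at `F.wElt lam i 1`, so its leading coefficient at
  -- `(i, 1)` is non-zero.
  set u := T (s k) * C (x * wLong lam) - v 1 • C (x * wLong lam) with hu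
  have hu0 : F.rep lam (toHK u) = 0 :=
    (F.upIdeal lam).sub_mem (F.mul_mem_upIdeal_left hup _) ((F.upIdeal lam).smul_mem _ hup) lam
      (sDom_irrefl lam)
  have h3 := (F.rep_mem_of_coeff lam i (F.first lam) h2).2
  have e : s k * (x * wLong lam) = F.wElt lam i (F.first lam) := by
    rw [wElt_eq_xElt_mul, ← h, mul_assoc]
  rw [hu0, Matrix.zero_apply, mul_zero, constTerm_zero,
    Finset.sum_eq_single (F.wElt lam i (F.first lam))
      (fun y _ hy => by rw [F.low_eq_zero hy, mul_zero])
      (fun h => absurd (Finset.mem_univ _) h), ← e, h1] at h3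
  have h4 : ((1 : A).coeff 0) = 1 := by
    have := coeff_intCast 1 0
    rwa [Int.cast_one, if_pos rfl] at this
  rw [h4, Int.cast_one, one_mul] at h3
  exact F.low_ne_zero_iff.2 e h3.symm

/-- Apply `flip` to `C ((colPerm lam)⁻¹ * wLong lam)` and multiply by the column symmetrizer: all
terms shorter than the leading one are killed, and `zElt lam` is left. It acts non-trivially in
`χ_λ`, so the element is not in the ideal. -/
theorem exists_xElt_colPerm_inv (lam : n.Partition) : ∃ i, (colPerm lam)⁻¹ = F.xElt lam i := by
  classical
  have hx := colPerm_inv_mem lam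
  refine (F.exists_xElt_or_mem_upIdeal hx).resolve_right fun hup => ?_
  have h0 := hup lam (sDom_irrefl lam)
  have h1 : F.rep lam (toHK (flip (C ((colPerm lam)⁻¹ * wLong lam)))) = 0 := by
    ext j i
    rw [← flipK_toHK, rep_flipK_apply', h0, Matrix.zero_apply, zero_mul, mul_zero,
      Matrix.zero_apply]
  have h2 : flip (C ((colPerm lam)⁻¹ * wLong lam)) * symSum (colIdx lam) = zElt lam := by
    rw [← factor_mul lam hx, flip_mul, flip_C_wLong, factor, map_sum, Finset.mul_sum,
      Finset.sum_mul, Finset.sum_eq_single (colPerm lam)⁻¹]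
    · rw [map_smul, flip_T, inv_inv, (isKL_C _).coeff_self, one_smul, zElt]
    · intro d hd hne
      rw [map_smul, flip_T, mul_smul_comm, smul_mul_assoc]
      by_cases hc : coeff (C ((colPerm lam)⁻¹ * wLong lam)) (d * wLong lam) = 0
      · rw [hc, zero_smul]
      · have h3 := (isKL_C _).len_lt _ (fun e => hne (mul_right_cancel e)) hc
        have hdi : d ∈ Inc (rowOf lam) := (Finset.mem_filter.1 hd).2
        have hm := (isTop_wLong lam).mem
        rw [len_mul_of_Inc (rowOf_monotone lam) hdi hm, len_mul_of_Inc (rowOf_monotone lam) hx hm,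
          len_inv] at h3
        rw [C_wLong_mul_T_mul_symSum lam (by rw [len_inv]; omega)
          (fun e => hne (by rw [← e, inv_inv])), smul_zero]
    · exact fun h => absurd (Finset.mem_filter.2 ⟨Finset.mem_univ _, hx⟩) h
  apply F.rep_zElt lam
  rw [← h2, map_mul, map_mul, h1, zero_mul]

end OrthFamily

/-- The permutations whose images of the row reading tableau are standard. -/
def IsStd (lam : n.Partition) (d : Perm (Fin n)) : Prop :=
  ∀ a b, a < b → rowOf lam a = rowOf lam b ∨ colOf lam a = colOf lam b → d a < d b

theorem isStd_dPerm {lam : n.Partition} (t : StdTableau lam) : IsStd lam (dPerm t) := by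
  have hrow : ∀ a b, a < b → rowOf lam a = rowOf lam b → dPerm t a < dPerm t b := by
    intro a b hab h
    exact t.2.1 _ _ (Fin.ext h) ((lt_iff_colOf_lt lam h).1 hab)
  rintro a b hab (h | h)
  · exact hrow a b hab h
  · rcases (rowOf_monotone lam hab.le).eq_or_lt with e | e
    · exact hrow a b hab e
    · exact t.2.2 _ _ (Fin.lt_def.2 e) h

theorem exists_dPerm_eq {lam : n.Partition} {d : Perm (Fin n)} (hd : IsStd lam d) :
    ∃ t : StdTableau lam, dPerm t = d := by
  have h1 : ∀ c : Cell lam, rowOf lam (rowTableau lam c) = c.1 := fun c => by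
    rw [rowOf, Equiv.symm_apply_apply]
  have h2 : ∀ c : Cell lam, colOf lam (rowTableau lam c) = c.2 := fun c => by
    rw [colOf, Equiv.symm_apply_apply]
  refine ⟨⟨(rowTableau lam).trans d, fun b c e h => ?_, fun b c e h => ?_⟩, ?_⟩
  · have e' : rowOf lam (rowTableau lam b) = rowOf lam (rowTableau lam c) := by rw [h1, h1, e]
    exact hd _ _ ((lt_iff_colOf_lt lam e').2 (by rwa [h2, h2])) (Or.inl e')
  · exact hd _ _ (lt_of_rowOf_lt lam (by rw [h1, h1]; exact e)) (Or.inr (by rw [h2, h2, h]))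
  · ext p
    simp [dPerm]

theorem lo_hi_of_not_lt {k : Fin (n - 1)} {a b : Fin n} (hab : a < b) (h : ¬ s k a < s k b) :
    a = lo k ∧ b = hi k := by
  by_contra hne
  refine h ((s_lt_s_iff k (fun h' => hne ⟨Fin.ext h'.1, Fin.ext h'.2⟩) fun h' => ?_).2 hab)
  rw [Fin.lt_def] at hab
  omega

/-- A standard tableau other than the column reading tableau has a standard neighbour with a longer
permutation. -/
theorem IsStd.exists_ascent {lam : n.Partition} {d : Perm (Fin n)} (hd : IsStd lam d)
    (hne : d ≠ (colPerm lam)⁻¹) : ∃ k, ¬ Desc k d ∧ IsStd lam (s k * d) := by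
  by_contra! h
  set f : Fin n → ℕ ×ₗ ℕ := fun p => toLex (colOf lam p, rowOf lam p) with hf
  -- If no ascent preserves standardness, consecutive entries occur in column reading order. Then
  -- `d⁻¹` sorts the boxes just as `colPerm` does.
  have hadj : ∀ k : Fin (n - 1), f (d⁻¹ (lo k)) < f (d⁻¹ (hi k)) := by
    intro k
    set p := d⁻¹ (lo k) with hp
    set q := d⁻¹ (hi k) with hq
    have hdp : d p = lo k := perm_apply_inv _ _
    have hdq : d q = hi k := perm_apply_inv _ _
    have hlt : d p < d q := by rw [hdp, hdq]; exact lo_lt_hi k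
    rw [hf, Prod.Lex.lt_iff]
    simp only [ofLex_toLex]
    by_cases hk : Desc k d
    · left
      have hqp : q < p := hk
      have hrow : rowOf lam q < rowOf lam p :=
        lt_of_le_of_ne (rowOf_monotone lam hqp.le) fun e => lt_asymm hlt (hd _ _ hqp (Or.inl e))
      by_contra hcol
      -- The box `m` in the row of `p` and the column of `q` would have its entry strictly above `d
      -- q` and at most `d p`, although these satisfy `d p < d q`.
      obtain ⟨m, hm1, hm2⟩ := exists_box_le lam p le_rfl (not_lt.1 hcol)
      have h1 : d q < d m := hd _ _ (lt_of_rowOf_lt lam (by rw [hm1]; exact hrow)) (Or.inr hm2.symm)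
      have h2 : d m ≤ d p := by
        rcases (not_lt.1 hcol).eq_or_lt with e | e
        · rw [box_ext lam hm1 (hm2.trans e)]
        · exact (hd _ _ ((lt_iff_colOf_lt lam hm1).2 (by rwa [hm2])) (Or.inl hm1)).le
      exact lt_asymm hlt (h1.trans_le h2)
    · have hpq : p < q := by
        refine lt_of_le_of_ne (not_lt.1 hk) fun e => hlt.ne (by rw [e])
      have h1 := h k hk
      unfold IsStd at h1
      push Not at h1
      obtain ⟨a, b, hab, hc, hs⟩ := h1
      rw [Equiv.Perm.mul_apply, Equiv.Perm.mul_apply] at hs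
      obtain ⟨ha, hb⟩ := lo_hi_of_not_lt (hd a b hab hc) (not_lt.2 hs)
      have ea : a = p := d.injective (ha.trans hdp.symm)
      have eb : b = q := d.injective (hb.trans hdq.symm)
      subst ea eb
      rcases hc with hc | hc
      · exact Or.inl ((lt_iff_colOf_lt lam hc).1 hab)
      · exact Or.inr ⟨hc, lt_of_le_of_ne (rowOf_monotone lam hab.le)
          fun e => hab.ne (box_ext lam e hc)⟩
  have hmono : Monotone (f ∘ (d⁻¹ : Perm (Fin n))) := by
    refine (StrictMono.monotone fun a b hab => ?_)
    exact rel_of_adjacent (r := fun _ => 0) (fun _ _ _ => le_rfl)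
      (R := fun a b => f (d⁻¹ a) < f (d⁻¹ b)) (fun _ _ _ => lt_trans) (fun k _ => hadj k) a b hab rfl
  have e := Tuple.unique_monotone hmono (Tuple.monotone_sort f)
  have hinj : Function.Injective f := fun p q hpq => by
    simp only [hf, EmbeddingLike.apply_eq_iff_eq, Prod.mk.injEq] at hpq
    exact box_ext lam hpq.2 hpq.1
  apply hne
  rw [eq_inv_iff_mul_eq_one, ← inv_eq_iff_mul_eq_one]
  exact Equiv.ext fun p => hinj (congrFun e p)

namespace OrthFamily

variable (F : OrthFamily n)

/-- A longest counterexample is not the column reading tableau, so it has a longer standard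
neighbour. That neighbour is some `x_i`, and closure under suffixes then applies. -/
theorem exists_xElt_of_isStd {lam : n.Partition} {d : Perm (Fin n)} (hd : IsStd lam d) :
    ∃ i, d = F.xElt lam i := by
  classical
  by_contra h0
  obtain ⟨d, hd, hmax⟩ := Finset.exists_max_image
    (Finset.univ.filter fun d => IsStd lam d ∧ ¬ ∃ i, d = F.xElt lam i) len
    ⟨d, by simpa using ⟨hd, by simpa using h0⟩⟩
  simp only [Finset.mem_filter, Finset.mem_univ, true_and] at hd hmax
  have hne : d ≠ (colPerm lam)⁻¹ := fun e => hd.2 (by rw [e]; exact F.exists_xElt_colPerm_inv lam)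
  obtain ⟨k, hk, hs⟩ := hd.1.exists_ascent hne
  by_cases h : ∃ i, s k * d = F.xElt lam i
  · obtain ⟨i, hi⟩ := h
    exact hd.2 (F.exists_xElt_of_s_mul hi hk)
  · have h1 := hmax _ ⟨hs, h⟩
    have h2 := len_s_mul_of_not_desc hk
    omega

end OrthFamily

/-! ### The permutations of the leading matrix coefficients -/

/-- The configuration excluded by dominance: a permutation with a single left descent exchanging the
entries of two boxes that are adjacent in a column. -/
theorem exists_blocks {lam : n.Partition} {x : Perm (Fin n)} (hx : x ∈ Inc (rowOf lam))
    {k : Fin (n - 1)} {a b : Fin n} (ha : x a = hi k) (hb : x b = lo k)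
    (hrow : rowOf lam b = rowOf lam a + 1) (hcol : colOf lam a = colOf lam b)
    (huniq : ∀ j, Desc j x → j = k) : ∃ (r : Fin n → ℕ) (B : Finset ℕ), Monotone r ∧
      (∀ j ∈ Par r, Desc j (x * wLong lam)) ∧
      partialSum lam B.card < (Finset.univ.filter fun p => r p ∈ B).card := by
  classical
  have hk : lo k < hi k := lo_lt_hi k
  have hlohi : ∀ p, lo k < p → hi k ≤ p := fun p hp => by
    rw [Fin.lt_def] at hp
    rw [Fin.le_def]
    exact hp
  have hxa : x⁻¹ (hi k) = a := by rw [← ha, perm_inv_apply]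
  have hxb : x⁻¹ (lo k) = b := by rw [← hb, perm_inv_apply]
  -- With `k` as the only left descent of `x`, the inverse `x⁻¹` is increasing on the values up to
  -- `lo k` and on those from `hi k` on.
  set r0 : Fin n → ℕ := fun p => if p ≤ lo k then 0 else 1 with hr0
  have hr0m : Monotone r0 := fun p q hpq => by
    by_cases h : q ≤ lo k
    · simp only [hr0, if_pos h, if_pos (hpq.trans h), le_rfl]
    · simp only [hr0, if_neg h]
      split_ifs <;> omega
  have hinc : x⁻¹ ∈ Inc r0 := (mem_Inc_iff hr0m).2 fun j hj hd => by
    rw [inv_inv] at hd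
    rw [huniq j hd] at hj
    have h1 : r0 (lo k) = 0 := if_pos le_rfl
    have h2 : r0 (hi k) = 1 := if_neg (not_le.2 hk)
    have h3 : r0 (lo k) = r0 (hi k) := hj
    omega
  have hsmall : ∀ p q, p ≤ q → q ≤ lo k → x⁻¹ p ≤ x⁻¹ q := fun p q hpq hq => by
    rcases hpq.eq_or_lt with e | h
    · rw [e]
    · exact (hinc p q h (by simp only [hr0, if_pos hq, if_pos (hpq.trans hq)])).le
  have hlarge : ∀ p q, p ≤ q → lo k < p → x⁻¹ p ≤ x⁻¹ q := fun p q hpq hp => by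
    rcases hpq.eq_or_lt with e | h
    · rw [e]
    · exact (hinc p q h (by
        simp only [hr0, if_neg (not_le.2 hp), if_neg (not_le.2 (hp.trans_le hpq))])).le
  set f : Fin n → ℕ := fun p => rowOf lam (x⁻¹ p) with hf
  have hfs : ∀ p q, p ≤ q → q ≤ lo k → f p ≤ f q := fun p q h1 h2 =>
    rowOf_monotone lam (hsmall p q h1 h2)
  have hfl : ∀ p q, p ≤ q → lo k < p → f p ≤ f q := fun p q h1 h2 =>
    rowOf_monotone lam (hlarge p q h1 h2)
  have hflo : f (lo k) = rowOf lam a + 1 := by simp only [hf, hxb, hrow]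
  have hfhi : f (hi k) = rowOf lam a := by simp only [hf, hxa]
  set i := rowOf lam a with hi0
  -- Values up to `lo k` are grouped by rows. Larger values in row `i` join the small values of row
  -- `i + 1` in a common block, and the other large values become singletons with labels beyond `i +
  -- 1`. The set `B` consists of the labels up to `i + 1` except `i`, which belongs to the small
  -- values of row `i`.
  set r : Fin n → ℕ := fun p => if p ≤ lo k then f p else if f p = i then i + 1 else i + 2 + p
    with hr
  have hrs : ∀ p, p ≤ lo k → r p = f p := fun p hp => if_pos hp
  have hrl : ∀ p, lo k < p → f p = i → r p = i + 1 := fun p hp h => by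
    simp only [hr, if_neg (not_le.2 hp), if_pos h]
  have hrl' : ∀ p, lo k < p → f p ≠ i → r p = i + 2 + p := fun p hp h => by
    simp only [hr, if_neg (not_le.2 hp), if_neg h]
  refine ⟨r, (Finset.range (i + 2)).erase i, ?_, ?_, ?_⟩
  · intro p q hpq
    have hpq' : (p : ℕ) ≤ q := hpq
    rcases le_or_gt q (lo k) with hq | hq
    · rw [hrs q hq, hrs p (hpq.trans hq)]
      exact hfs p q hpq hq
    · have h1 : i + 1 ≤ r q := by
        by_cases h : f q = i
        · rw [hrl q hq h]
        · rw [hrl' q hq h]; omega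
      rcases le_or_gt p (lo k) with hp | hp
      · rw [hrs p hp]
        have := hfs p _ hp le_rfl
        omega
      · have h2 := hfl p q hpq hp
        have h3 := hfl _ p (hlohi p hp) hk
        by_cases h : f p = i
        · rw [hrl p hp h]; exact h1
        · rw [hrl' p hp h, hrl' q hq (by omega)]; omega
  · intro j hj
    have hj : r (lo j) = r (hi j) := hj
    have hjlt : lo j < hi j := lo_lt_hi j
    have hgoal : ∀ {p q : Fin n}, wLong lam (x⁻¹ q) < wLong lam (x⁻¹ p) →
        lo j = p → hi j = q → Desc j (x * wLong lam) := by
      rintro p q h rfl rfl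
      change (x * wLong lam)⁻¹ (hi j) < (x * wLong lam)⁻¹ (lo j)
      rwa [mul_inv_rev, wLong_inv]
    have htop := isTop_wLong lam
    have hlt : ∀ {p q : Fin n}, p < q → x⁻¹ p ≤ x⁻¹ q → x⁻¹ p < x⁻¹ q := fun h1 h2 =>
      lt_of_le_of_ne h2 fun e => h1.ne (x⁻¹.injective e)
    rcases le_or_gt (hi j) (lo k) with h1 | h1
    · rw [hrs _ h1, hrs _ (hjlt.le.trans h1)] at hj
      exact hgoal (htop.anti _ _ (hlt hjlt (hsmall _ _ hjlt.le h1)) hj) rfl rfl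
    · rcases le_or_gt (lo j) (lo k) with h2 | h2
      · have e : j = k := by
          rw [Fin.lt_def] at h1
          rw [Fin.le_def] at h2
          have e1 : ((hi j : Fin n) : ℕ) = j + 1 := rfl
          have e2 : ((lo j : Fin n) : ℕ) = j := rfl
          have e3 : ((lo k : Fin n) : ℕ) = k := rfl
          exact Fin.ext (by omega)
        subst e
        refine hgoal (p := lo j) (q := hi j) ?_ rfl rfl
        rw [hxa, hxb]
        exact lt_of_block_lt (rowOf_monotone lam) (by rw [htop.mem, htop.mem]; omega)
      · have hjlt' : (lo j : ℕ) < hi j := hjlt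
        by_cases h3 : f (lo j) = i <;> by_cases h4 : f (hi j) = i
        · exact hgoal (htop.anti _ _ (hlt hjlt (hlarge _ _ hjlt.le h2)) (h3.trans h4.symm)) rfl rfl
        · rw [hrl _ h2 h3, hrl' _ h1 h4] at hj; omega
        · rw [hrl' _ h2 h3, hrl _ h1 h4] at hj; omega
        · rw [hrl' _ h2 h3, hrl' _ h1 h4] at hj; omega
  · have hcard : ((Finset.range (i + 2)).erase i).card = i + 1 := by
      rw [Finset.card_erase_of_mem (Finset.mem_range.2 (by omega)), Finset.card_range]
      omega
    rw [hcard, ← card_rowOf_lt]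
    have hbl : ∀ m, ∃ m', colOf lam m < colOf lam a → rowOf lam m' = i + 1 ∧
        colOf lam m' = colOf lam m := fun m => by
      by_cases h : colOf lam m < colOf lam a
      · obtain ⟨m', h1, h2⟩ := exists_box lam (i := i + 1) (j := colOf lam m) (by
          have := colOf_lt lam b
          rw [hrow] at this
          omega)
        exact ⟨m', fun _ => ⟨h1, h2⟩⟩
      · exact ⟨m, fun h' => absurd h' h⟩
    choose bl hbl using hbl
    set S := Finset.univ.filter fun p => r (x p) ∈ (Finset.range (i + 2)).erase i with hS
    have hSc : (Finset.univ.filter fun p => r p ∈ (Finset.range (i + 2)).erase i).card = S.card :=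
      (Finset.card_equiv x fun p => by simp [hS]).symm
    have hfx : ∀ m, f (x m) = rowOf lam m := fun m => by simp only [hf, perm_inv_apply]
    have hcl : ∀ m, rowOf lam m = i → x m ≤ lo k → colOf lam m < colOf lam a := fun m h1 h2 => by
      refine (lt_iff_colOf_lt lam h1).1 ?_
      by_contra h
      rcases (not_lt.1 h).eq_or_lt with e | h
      · rw [← e, ha] at h2
        exact absurd h2 (not_le.2 hk)
      · have := hx _ _ h h1.symm
        rw [ha] at this
        exact absurd h2 (not_le.2 (hk.trans this))
    have hbS : b ∈ S := by
      rw [hS, Finset.mem_filter, hb, hrs _ le_rfl, hflo]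
      simp
    rw [hSc, Nat.lt_iff_add_one_le, ← Finset.card_erase_add_one hbS, Nat.add_le_add_iff_right]
    -- A box of row `i` with a small entry goes to the box below it, which lies left of `b`; every
    -- other box of the first `i + 1` rows goes to itself. The box `b` is not hit, which gives the
    -- strict inequality.
    refine Finset.card_le_card_of_injOn
      (fun m => if rowOf lam m = i ∧ x m ≤ lo k then bl m else m) ?_ ?_
    · intro m hm
      have hm : rowOf lam m < i + 1 := by simpa using hm
      rw [Finset.mem_coe, Finset.mem_erase, hS, Finset.mem_filter, Finset.mem_erase,
        Finset.mem_range]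
      beta_reduce
      split_ifs with h
      · have hc := hcl m h.1 h.2
        obtain ⟨h1, h2⟩ := hbl m hc
        have hlt : bl m < b := (lt_iff_colOf_lt lam (by rw [h1, hrow])).2 (by rw [h2]; omega)
        have h3 := hx _ _ hlt (by rw [h1, hrow])
        rw [hb] at h3
        rw [hrs _ h3.le, hfx, h1]
        exact ⟨hlt.ne, Finset.mem_univ _, by omega, by omega⟩
      · refine ⟨fun e => by rw [e] at hm; omega, Finset.mem_univ _, ?_⟩
        rcases (Nat.lt_succ_iff.1 hm).eq_or_lt with e | e
        · have h1 : lo k < x m := by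
            by_contra h1
            exact h ⟨e, not_lt.1 h1⟩
          rw [hrl _ h1 (by rw [hfx, e])]
          omega
        · have h1 : x m ≤ lo k := by
            by_contra h1
            have h2 := hfl _ _ (hlohi _ (not_le.1 h1)) hk
            rw [hfhi, hfx] at h2
            omega
          rw [hrs _ h1, hfx]
          omega
    · intro m hm m' hm' e
      have hm : rowOf lam m < i + 1 := by simpa using hm
      have hm' : rowOf lam m' < i + 1 := by simpa using hm'
      simp only at e
      split_ifs at e with h h' h'
      · obtain ⟨h1, h2⟩ := hbl m (hcl m h.1 h.2)
        obtain ⟨h3, h4⟩ := hbl m' (hcl m' h'.1 h'.2)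
        exact box_ext lam (h.1.trans h'.1.symm) (by rw [← h2, ← h4, e])
      · obtain ⟨h1, h2⟩ := hbl m (hcl m h.1 h.2)
        rw [e] at h1
        omega
      · obtain ⟨h1, h2⟩ := hbl m' (hcl m' h'.1 h'.2)
        rw [← e] at h1
        omega
      · exact e

namespace OrthFamily

variable (F : OrthFamily n)

/-- In a shortest counterexample every left descent leads to a standard tableau. So there is only
one left descent, and it exchanges the entries of two boxes adjacent in a column. `exists_blocks`
then gives a parabolic subgroup for which the inverse of `x_i * wLong lam` labels a sign vector in
`χ_λ`. Together with the column symmetrizer this yields a transversal, but the blocks are too large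
for one. -/
theorem isStd_xElt (lam : n.Partition) (i : Fin (F.deg lam)) : IsStd lam (F.xElt lam i) := by
  classical
  by_contra h0
  obtain ⟨i, hi, hmin⟩ := Finset.exists_min_image
    (Finset.univ.filter fun i => ¬ IsStd lam (F.xElt lam i)) (fun i => len (F.xElt lam i))
    ⟨i, by simpa using h0⟩
  simp only [Finset.mem_filter, Finset.mem_univ, true_and] at hi hmin
  have hx := F.xElt_mem lam i
  have hi' := hi
  unfold IsStd at hi'
  push Not at hi'
  obtain ⟨a, b, hab, hc, hs⟩ := hi'
  have hdesc : ∀ k, Desc k (F.xElt lam i) → IsStd lam (s k * F.xElt lam i) := by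
    intro k hk
    have h1 : ¬ Desc k (s k * F.xElt lam i) := fun h => (desc_s_mul k _).1 h hk
    obtain ⟨j, hj⟩ := F.exists_xElt_of_s_mul (s_mul_s_mul k _) h1
    by_contra h2
    have h3 := hmin j (by rwa [← hj])
    have h4 := len_s_mul_of_desc hk
    rw [← hj] at h3
    omega
  have hpair : ∀ k, Desc k (F.xElt lam i) →
      s k (F.xElt lam i a) = lo k ∧ s k (F.xElt lam i b) = KLMurphy.hi k := by
    intro k hk
    refine lo_hi_of_not_lt (k := k) (hdesc k hk a b hab hc) ?_
    rw [s_s_apply, s_s_apply]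
    exact not_lt.2 hs
  have hne : F.xElt lam i ≠ 1 := fun e => by
    rw [e] at hs
    exact absurd hab (not_lt.2 hs)
  obtain ⟨k, hk⟩ := exists_desc _ hne
  obtain ⟨h1, h2⟩ := hpair k hk
  have ha : F.xElt lam i a = KLMurphy.hi k := by rw [← s_lo, ← h1, s_s_apply]
  have hb : F.xElt lam i b = lo k := by rw [← s_hi, ← h2, s_s_apply]
  have huniq : ∀ j, Desc j (F.xElt lam i) → j = k := fun j hj => by
    have e := (hpair j hj).1
    rw [ha] at e
    have e2 : KLMurphy.hi k = KLMurphy.hi j := by rw [← s_lo j, ← e, s_s_apply]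
    have e3 := congrArg Fin.val e2
    exact Fin.ext (by simpa using e3.symm)
  have hrne : rowOf lam a ≠ rowOf lam b := fun e => absurd (hx a b hab e) (not_lt.2 hs)
  have hcol : colOf lam a = colOf lam b := hc.resolve_left hrne
  have hrlt : rowOf lam a < rowOf lam b :=
    lt_of_le_of_ne (rowOf_monotone lam hab.le) hrne
  -- The entry of a box strictly between would have to lie strictly between two consecutive numbers.
  have hrow : rowOf lam b = rowOf lam a + 1 := by
    by_contra hne
    obtain ⟨m, hm1, hm2⟩ := exists_box_le lam b (show rowOf lam a + 1 ≤ rowOf lam b by omega) le_rfl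
    have hst := hdesc k hk
    have h3 := hst a m (lt_of_rowOf_lt lam (by omega)) (Or.inr (hcol.trans hm2.symm))
    have h4 := hst m b (lt_of_rowOf_lt lam (by omega)) (Or.inr hm2)
    rw [Equiv.Perm.mul_apply, Equiv.Perm.mul_apply] at h3 h4
    rw [h1, Fin.lt_def] at h3
    rw [h2, Fin.lt_def] at h4
    have e1 : ((lo k : Fin n) : ℕ) = k := rfl
    have e2 : ((KLMurphy.hi k : Fin n) : ℕ) = k + 1 := rfl
    omega
  obtain ⟨r, B, hr, hP, hB⟩ := exists_blocks hx ha hb hrow hcol huniq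
  have hw : (F.xElt lam i * wLong lam)⁻¹ = F.wElt lam (F.first lam) i := by
    rw [← wElt_eq_xElt_mul, wElt_inv]
  obtain ⟨d, hd⟩ := F.exists_isTransversal_of_rep hr (F.rep_C_wElt lam (F.first lam) i)
    (rightSign_C fun j hj => by rw [← hw, inv_inv]; exact hP j hj) (F.rep_symSum_self lam)
  exact absurd (hd.card_le B) (not_le.2 hB)

theorem exists_dPerm_eq_xElt (lam : n.Partition) (i : Fin (F.deg lam)) :
    ∃ t : StdTableau lam, dPerm t = F.xElt lam i := exists_dPerm_eq (F.isStd_xElt lam i)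

theorem exists_xElt_eq_dPerm {lam : n.Partition} (t : StdTableau lam) :
    ∃ i, dPerm t = F.xElt lam i := F.exists_xElt_of_isStd (isStd_dPerm t)

end OrthFamily

/-! ### The Murphy basis in terms of the elements `Z` -/

theorem coeff_factor_lt {lam : n.Partition} {x d : Perm (Fin n)} (hx : x ∈ Inc (rowOf lam))
    (hd : d ∈ Inc (rowOf lam)) (hne : d ≠ x)
    (h0 : coeff (C (x * wLong lam)) (d * wLong lam) ≠ 0) : len d < len x := by
  have h := (isKL_C _).len_lt _ (fun e => hne (mul_right_cancel e)) h0
  have hm := (isTop_wLong lam).mem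
  have hr := rowOf_monotone lam
  rw [len_mul_of_Inc hr hd hm, len_mul_of_Inc hr hx hm] at h
  omega

/-- `factor lam x` is `T x` plus a `v ℤ[v]`-combination of shorter `T d`, so the unitriangular
system is inverted by induction on the length. -/
theorem exists_T_eq_sum_factor (lam : n.Partition) {d : Perm (Fin n)} (hd : d ∈ Inc (rowOf lam)) :
    ∃ p : Perm (Fin n) → A, p d = 1 ∧ (∀ x, x ≠ d → p x ∈ APos) ∧
      (∀ x, x ≠ d → p x ≠ 0 → len x < len d ∧ x ∈ Inc (rowOf lam)) ∧
      T d = ∑ x, p x • factor lam x := by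
  classical
  induction h : len d using Nat.strong_induction_on generalizing d with
  | _ N ih =>
  subst h
  set I : Finset (Perm (Fin n)) := Finset.univ.filter (· ∈ Inc (rowOf lam)) with hI
  set q : Perm (Fin n) → A := fun y => coeff (C (d * wLong lam)) (y * wLong lam) with hq
  have hqd : q d = 1 := (isKL_C _).coeff_self
  have hqm : ∀ y, y ≠ d → q y ∈ APos := fun y hy =>
    (isKL_C _).coeff_mem _ fun e => hy (mul_right_cancel e)
  have hP : ∀ y, ∃ P : Perm (Fin n) → A, y ∈ I → y ≠ d → q y ≠ 0 →
      P y = 1 ∧ (∀ x, x ≠ y → P x ∈ APos) ∧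
      (∀ x, x ≠ y → P x ≠ 0 → len x < len y ∧ x ∈ Inc (rowOf lam)) ∧
      T y = ∑ x, P x • factor lam x := fun y => by
    by_cases hy : y ∈ I ∧ y ≠ d ∧ q y ≠ 0
    · have hyI : y ∈ Inc (rowOf lam) := (Finset.mem_filter.1 hy.1).2
      obtain ⟨P, h⟩ := ih (len y) (coeff_factor_lt hd hyI hy.2.1 hy.2.2) hyI rfl
      exact ⟨P, fun _ _ _ => h⟩
    · exact ⟨0, fun h1 h2 h3 => absurd ⟨h1, h2, h3⟩ hy⟩
  choose P hP using hP
  have hdI : d ∈ I := Finset.mem_filter.2 ⟨Finset.mem_univ _, hd⟩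
  have hT : T d = factor lam d - ∑ y ∈ I.erase d, q y • T y := by
    have e : factor lam d = ∑ y ∈ I, q y • T y := rfl
    rw [e, ← Finset.add_sum_erase _ _ hdI, hqd, one_smul, add_sub_cancel_right]
  have hlt : ∀ y ∈ I.erase d, q y ≠ 0 → len y < len d ∧ y ∈ Inc (rowOf lam) := fun y hy h0 => by
    have hy' := Finset.mem_erase.1 hy
    have hyI : y ∈ Inc (rowOf lam) := (Finset.mem_filter.1 hy'.2).2
    exact ⟨coeff_factor_lt hd hyI hy'.1 h0, hyI⟩
  have hnz : ∀ x, ∀ y ∈ I.erase d, q y * P y x ≠ 0 → len x < len d ∧ x ∈ Inc (rowOf lam) := by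
    intro x y hy h0
    have hy' := Finset.mem_erase.1 hy
    have hq0 := left_ne_zero_of_mul h0
    obtain ⟨-, -, h2, -⟩ := hP y hy'.2 hy'.1 hq0
    have h3 := hlt y hy hq0
    by_cases e : x = y
    · rw [e]; exact h3
    · have h4 := h2 x e (right_ne_zero_of_mul h0)
      exact ⟨h4.1.trans h3.1, h4.2⟩
  refine ⟨fun x => (if x = d then 1 else 0) - ∑ y ∈ I.erase d, q y * P y x, ?_, ?_, ?_, ?_⟩
  · beta_reduce
    rw [if_pos rfl, Finset.sum_eq_zero, sub_zero]
    intro y hy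
    by_contra h0
    exact lt_irrefl _ (hnz d y hy h0).1
  · intro x hx
    beta_reduce
    rw [if_neg hx]
    refine sub_mem_APos zero_mem_APos (sum_mem_APos fun y hy => ?_)
    have hy' := Finset.mem_erase.1 hy
    by_cases hq0 : q y = 0
    · rw [hq0, zero_mul]; exact zero_mem_APos
    · obtain ⟨h1, h2, -, -⟩ := hP y hy'.2 hy'.1 hq0
      refine mul_mem_APos' (hqm y hy'.1) ?_
      by_cases e : x = y
      · rw [e, h1]; exact APlus.one_mem
      · exact APos_le (h2 x e)
  · intro x hx h0
    beta_reduce at h0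
    rw [if_neg hx, zero_sub, neg_ne_zero] at h0
    obtain ⟨y, hy, hy0⟩ := Finset.exists_ne_zero_of_sum_ne_zero h0
    exact hnz x y hy hy0
  · have e : ∑ y ∈ I.erase d, q y • T y =
        ∑ x, (∑ y ∈ I.erase d, q y * P y x) • factor lam x := by
      simp only [Finset.sum_smul]
      rw [Finset.sum_comm]
      refine Finset.sum_congr rfl fun y hy => ?_
      have hy' := Finset.mem_erase.1 hy
      by_cases hq0 : q y = 0
      · simp only [hq0, zero_mul, zero_smul, Finset.sum_const_zero]
      · rw [(hP y hy'.2 hy'.1 hq0).2.2.2, Finset.smul_sum]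
        exact Finset.sum_congr rfl fun x _ => smul_smul _ _ _
    simp only [sub_smul, Finset.sum_sub_distrib, ite_smul, one_smul, zero_smul,
      Finset.sum_ite_eq', Finset.mem_univ, if_true]
    rw [hT, e]

namespace OrthFamily

variable (F : OrthFamily n)

theorem flip_mem_upIdeal {lam : n.Partition} {h : Hecke n} (hh : h ∈ F.upIdeal lam) :
    flip h ∈ F.upIdeal lam := fun nu hnu => by
  ext j i
  rw [← flipK_toHK, rep_flipK_apply', hh nu hnu, Matrix.zero_apply, zero_mul, mul_zero,
    Matrix.zero_apply]

theorem zInt_mem_upIdeal {lam : n.Partition} {x y : Perm (Fin n)} (hx : x ∈ Inc (rowOf lam))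
    (hy : y ∈ Inc (rowOf lam)) (h : ¬ ((∃ i, x = F.xElt lam i) ∧ ∃ j, y = F.xElt lam j)) :
    zInt lam x y ∈ F.upIdeal lam := by
  rcases not_and_or.1 h with h | h
  · rw [zInt, factor_mul lam hx]
    exact F.mul_mem_upIdeal_right ((F.exists_xElt_or_mem_upIdeal hx).resolve_left h) _
  · have e : zInt lam x y = factor lam x * flip (C (y * wLong lam)) := by
      rw [zInt, ← factor_mul lam hy, flip_mul, flip_C_wLong, mul_assoc]
    rw [e]
    exact F.mul_mem_upIdeal_left
      (F.flip_mem_upIdeal ((F.exists_xElt_or_mem_upIdeal hy).resolve_left h)) _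

/-- The coefficients in the expansion of the elements of the Murphy basis. -/
theorem exists_murphyY_eq {lam : n.Partition} {a b : StdTableau lam} {i j : Fin (F.deg lam)}
    (hi : dPerm a = F.xElt lam i) (hj : dPerm b = F.xElt lam j) :
    ∃ p q : Perm (Fin n) → A, (p (F.xElt lam i) = 1 ∧ q (F.xElt lam j) = 1) ∧
      ((∀ x, x ≠ F.xElt lam i → p x ∈ APos) ∧ ∀ x, x ≠ F.xElt lam j → q x ∈ APos) ∧
      ((∀ x, x ≠ F.xElt lam i → p x ≠ 0 → len x < len (F.xElt lam i) ∧ x ∈ Inc (rowOf lam)) ∧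
        ∀ x, x ≠ F.xElt lam j → q x ≠ 0 → len x < len (F.xElt lam j) ∧ x ∈ Inc (rowOf lam)) ∧
      murphyY a b = ∑ x, ∑ y, (p x * q y) • zInt lam x y := by
  obtain ⟨p, hp1, hp2, hp3, hp⟩ := exists_T_eq_sum_factor lam (F.xElt_mem lam i)
  obtain ⟨q, hq1, hq2, hq3, hq⟩ := exists_T_eq_sum_factor lam (F.xElt_mem lam j)
  refine ⟨p, q, ⟨hp1, hq1⟩, ⟨hp2, hq2⟩, ⟨hp3, hq3⟩, ?_⟩
  rw [murphyY, hi, hj, ← flip_T (F.xElt lam j), hp, hq, map_sum, Finset.sum_mul, Finset.sum_mul]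
  refine Finset.sum_congr rfl fun x _ => ?_
  rw [Finset.mul_sum]
  refine Finset.sum_congr rfl fun y _ => ?_
  rw [map_smul, smul_mul_assoc, smul_mul_assoc, mul_smul_comm, smul_smul, zInt]

/-- The elements whose expansion modulo the ideal has coefficients in `v ℤ[v]`. -/
def smallSpan (lam : n.Partition) : AddSubgroup (Hecke n) where
  carrier := {h | ∀ y, (y ∈ F.R lam → ccoeff h y ∈ APos) ∧
    (y ∉ F.R lam → y ∉ F.Up lam → ccoeff h y = 0)}
  zero_mem' := fun y => by
    have : ccoeff (0 : Hecke n) y = 0 := by rw [ccoeff, map_zero]; rfl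
    exact ⟨fun _ => this ▸ zero_mem_APos, fun _ _ => this⟩
  add_mem' := fun {g h} hg hh y => by
    have : ccoeff (g + h) y = ccoeff g y + ccoeff h y := by rw [ccoeff, map_add]; rfl
    rw [this]
    exact ⟨fun hy => add_mem_APos ((hg y).1 hy) ((hh y).1 hy), fun h1 h2 => by
      rw [(hg y).2 h1 h2, (hh y).2 h1 h2, add_zero]⟩
  neg_mem' := fun {h} hh y => by
    have : ccoeff (-h) y = -ccoeff h y := by rw [ccoeff, map_neg]; rfl
    rw [this]
    exact ⟨fun hy => neg_mem_APos ((hh y).1 hy), fun h1 h2 => by rw [(hh y).2 h1 h2, neg_zero]⟩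

theorem mem_smallSpan_of_mem_upIdeal {lam : n.Partition} {h : Hecke n} (hh : h ∈ F.upIdeal lam) :
    h ∈ F.smallSpan lam := fun _ =>
  ⟨fun hy => by
    rw [F.ccoeff_eq_zero_of_mem_upIdeal hh (F.notMem_Up_of_mem_R hy)]; exact zero_mem_APos,
    fun _ h2 => F.ccoeff_eq_zero_of_mem_upIdeal hh h2⟩

theorem smul_C_mem_smallSpan {lam : n.Partition} {a : A} (ha : a ∈ APos) {w : Perm (Fin n)}
    (hw : w ∈ F.R lam) : a • C w ∈ F.smallSpan lam := fun y => by
  classical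
  rw [ccoeff_smul, ccoeff_C]
  split_ifs with h
  · rw [mul_one]
    exact ⟨fun _ => ha, fun h1 => absurd (h ▸ hw) h1⟩
  · rw [mul_zero]
    exact ⟨fun _ => zero_mem_APos, fun _ _ => rfl⟩

theorem smul_zInt_mem_smallSpan {lam : n.Partition} {a : A} (ha : a ∈ APos) {x y : Perm (Fin n)}
    (hx : x ∈ Inc (rowOf lam)) (hy : y ∈ Inc (rowOf lam)) :
    a • zInt lam x y ∈ F.smallSpan lam := by
  by_cases h : (∃ i, x = F.xElt lam i) ∧ ∃ j, y = F.xElt lam j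
  · obtain ⟨⟨i, rfl⟩, j, rfl⟩ := h
    have h1 := (F.upIdeal lam).smul_mem a (F.zInt_sub_mem lam i j)
    have h2 := F.smul_C_mem_smallSpan (mul_mem_APos' ha (intCast_mem_APlus (F.zSign lam i j)))
      (F.wElt_mem_R lam i j)
    have h3 := (F.smallSpan lam).add_mem (F.mem_smallSpan_of_mem_upIdeal h1) h2
    rwa [smul_sub, smul_smul, sub_add_cancel] at h3
  · exact F.mem_smallSpan_of_mem_upIdeal
      ((F.upIdeal lam).smul_mem _ (F.zInt_mem_upIdeal hx hy h))

/-- In the double expansion into elements `zInt`, only the pair `(x_i, x_j)` has coefficient 1.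
Every other coefficient has at least one factor in `v ℤ[v]`, the other factor being in `ℤ[v]`. -/
theorem murphyY_sub_mem {lam : n.Partition} {a b : StdTableau lam} {i j : Fin (F.deg lam)}
    (hi : dPerm a = F.xElt lam i) (hj : dPerm b = F.xElt lam j) :
    murphyY a b - (F.zSign lam i j : A) • C (F.wElt lam i j) ∈ F.smallSpan lam := by
  classical
  obtain ⟨p, q, ⟨hp1, hq1⟩, ⟨hp2, hq2⟩, ⟨hp3, hq3⟩, e⟩ := F.exists_murphyY_eq hi hj
  have hz := F.mem_smallSpan_of_mem_upIdeal (F.zInt_sub_mem lam i j)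
  have hI : ∀ {x : Perm (Fin n)}, p x ≠ 0 → x ∈ Inc (rowOf lam) := fun {x} h => by
    by_cases hx : x = F.xElt lam i
    · rw [hx]; exact F.xElt_mem lam i
    · exact (hp3 x hx h).2
  have hJ : ∀ {x : Perm (Fin n)}, q x ≠ 0 → x ∈ Inc (rowOf lam) := fun {x} h => by
    by_cases hx : x = F.xElt lam j
    · rw [hx]; exact F.xElt_mem lam j
    · exact (hq3 x hx h).2
  have hterm : ∀ x y, ¬ (x = F.xElt lam i ∧ y = F.xElt lam j) →
      (p x * q y) • zInt lam x y ∈ F.smallSpan lam := by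
    intro x y hne
    by_cases h0 : p x * q y = 0
    · rw [h0, zero_smul]; exact (F.smallSpan lam).zero_mem
    refine F.smul_zInt_mem_smallSpan ?_ (hI (left_ne_zero_of_mul h0)) (hJ (right_ne_zero_of_mul h0))
    by_cases hx : x = F.xElt lam i
    · have hy : y ≠ F.xElt lam j := fun hy => hne ⟨hx, hy⟩
      rw [hx, hp1, one_mul]
      exact hq2 y hy
    · refine mul_mem_APos' (hp2 x hx) ?_
      by_cases hy : y = F.xElt lam j
      · rw [hy, hq1]; exact APlus.one_mem
      · exact APos_le (hq2 y hy)
  rw [e, ← Fintype.sum_prod_type' fun x y => (p x * q y) • zInt lam x y,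
    ← Finset.add_sum_erase _ _ (Finset.mem_univ (F.xElt lam i, F.xElt lam j)), hp1, hq1, one_mul,
    one_smul, add_sub_right_comm]
  refine (F.smallSpan lam).add_mem hz ((F.smallSpan lam).sum_mem fun x hx => hterm x.1 x.2 ?_)
  rintro ⟨h1, h2⟩
  exact (Finset.mem_erase.1 hx).1 (Prod.ext h1 h2)

/-- Expansions in the basis `C` in terms of coefficients. -/
theorem hasExpansion_C_iff {lam : n.Partition} {h : Hecke n} {c : ℤ} {w : Perm (Fin n)} :
    F.HasExpansion C APos lam h c w ↔ h - (c : A) • C w ∈ F.smallSpan lam := by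
  classical
  constructor
  · rintro ⟨f, g, hf, hg, rfl⟩ y
    have e : ccoeff (c • C w + ∑ y, f y • C y + ∑ y, g y • C y - (c : A) • C w) y = f y + g y := by
      rw [zsmul_eq_smul, add_assoc, add_sub_cancel_left, ← Finset.sum_add_distrib]
      simp only [← add_smul, ← CBasis_apply]
      rw [ccoeff, Module.Basis.repr_sum_self]
    rw [e]
    have hg' : y ∉ F.Up lam → g y = 0 := fun hy => by
      by_contra h0
      exact hy (hg y h0)
    refine ⟨fun hy => ?_, fun h1 h2 => ?_⟩
    · rw [hg' (F.notMem_Up_of_mem_R hy), add_zero]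
      exact (hf y).1
    · rw [hg' h2, add_zero]
      by_contra h0
      exact h1 ((hf y).2 h0)
  · intro hh
    set u := h - (c : A) • C w with hu
    refine ⟨fun y => if y ∈ F.R lam then ccoeff u y else 0,
      fun y => if y ∈ F.R lam then 0 else ccoeff u y, fun y => ?_, fun y hy => ?_, ?_⟩
    · beta_reduce
      split_ifs with hy
      · exact ⟨(hh y).1 hy, fun _ => hy⟩
      · exact ⟨zero_mem_APos, fun h0 => absurd rfl h0⟩
    · beta_reduce at hy
      split_ifs at hy with hyR
      · exact absurd rfl hy
      · by_contra hU
        exact hy ((hh y).2 hyR hU)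
    · rw [add_assoc, ← Finset.sum_add_distrib]
      have e : ∀ y, (if y ∈ F.R lam then ccoeff u y else 0) • C y +
          (if y ∈ F.R lam then 0 else ccoeff u y) • C y = ccoeff u y • C y := fun y => by
        split_ifs <;> simp
      simp only [e]
      rw [sum_ccoeff_smul_C, hu, zsmul_eq_smul, add_sub_cancel]

/-- The constant term of the coefficient of `C w` is `c` by the first expansion, and would be 0 by
the second if `w'` were different. -/
theorem eq_of_hasExpansion {lam : n.Partition} {h : Hecke n} {c c' : ℤ} {w w' : Perm (Fin n)}
    (hw : w ∈ F.R lam) (h1 : F.HasExpansion C APos lam h c w)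
    (h2 : F.HasExpansion C APos lam h c' w') (hc : c ≠ 0) : w' = w := by
  classical
  by_contra hne
  have h3 := (F.smallSpan lam).sub_mem ((F.hasExpansion_C_iff).1 h2) ((F.hasExpansion_C_iff).1 h1)
  rw [sub_sub_sub_cancel_left] at h3
  have h4 := (h3 w).1 hw 0 le_rfl
  rw [ccoeff_sub, ccoeff_smul, ccoeff_smul, ccoeff_C, ccoeff_C, if_pos rfl, if_neg hne, mul_zero,
    mul_one, sub_zero, coeff_intCast, if_pos rfl] at h4
  exact hc h4

/-- `jInv` takes each `C y` to `±CPrime y` and exchanges `v ℤ[v]` with `v⁻¹ ℤ[v⁻¹]`, so the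
expansion is carried over term by term. -/
theorem HasExpansion.zsmul_jInv {F : OrthFamily n} {lam : n.Partition} {h : Hecke n} {c : ℤ}
    {w : Perm (Fin n)} (hh : F.HasExpansion C APos lam h c w) (m : ℤ) :
    F.HasExpansion CPrime ANeg lam (m • jInv h) (m * eps w * c) w := by
  obtain ⟨f, g, hf, hg, rfl⟩ := hh
  have key : ∀ f : Perm (Fin n) → A, m • jInv (∑ y, f y • C y) =
      ∑ y, ((m * eps y) • barA (f y)) • CPrime y := fun f => by
    rw [jInv_sum, Finset.smul_sum]
    refine Finset.sum_congr rfl fun y _ => ?_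
    rw [jInv_smul, jInv_C, smul_assoc, smul_comm (barA (f y)), smul_smul]
  have hz : ∀ {f : Perm (Fin n) → A} {y}, (m * eps y) • barA (f y) ≠ 0 → f y ≠ 0 :=
    fun h0 e => h0 (by rw [e, map_zero, smul_zero])
  refine ⟨fun y => (m * eps y) • barA (f y), fun y => (m * eps y) • barA (g y),
    fun y => ⟨zsmul_mem_ANeg _ (barA_mem_ANeg (hf y).1), fun h0 => (hf y).2 (hz h0)⟩,
    fun y h0 => hg y (hz h0), ?_⟩
  rw [jInv_add, jInv_add, smul_add, smul_add, key, key, jInv_zsmul, jInv_C, smul_smul, smul_smul,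
    mul_right_comm m]

/-! ### The ideal is spanned by elements of the Murphy basis -/

/-- The Murphy element equals `zInt` plus terms of smaller total length and terms in the ideal, so
induction on the total length inverts the relation. Here it is needed that every `x_i` comes from a
standard tableau. -/
theorem zInt_mem_NHat {lam mu : n.Partition} (h : SDom lam mu) (hup : F.upIdeal mu ≤ NHat lam)
    (i j : Fin (F.deg mu)) : zInt mu (F.xElt mu i) (F.xElt mu j) ∈ NHat lam := by
  classical
  induction hN : len (F.xElt mu i) + len (F.xElt mu j) using Nat.strong_induction_on
    generalizing i j with
  | _ N ih =>
  obtain ⟨a, ha⟩ := F.exists_dPerm_eq_xElt mu i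
  obtain ⟨b, hb⟩ := F.exists_dPerm_eq_xElt mu j
  obtain ⟨p, q, ⟨hp1, hq1⟩, -, ⟨hp3, hq3⟩, e⟩ := F.exists_murphyY_eq ha hb
  have hmem : murphyY a b ∈ NHat lam := Submodule.subset_span ⟨mu, h, a, b, rfl⟩
  rw [← Fintype.sum_prod_type' fun x y => (p x * q y) • zInt mu x y,
    ← Finset.add_sum_erase _ _ (Finset.mem_univ (F.xElt mu i, F.xElt mu j)), hp1, hq1, one_mul,
    one_smul] at e
  rw [eq_sub_of_add_eq e.symm]
  refine Submodule.sub_mem _ hmem (Submodule.sum_mem _ fun x hx => ?_)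
  obtain ⟨x, y⟩ := x
  have hne := (Finset.mem_erase.1 hx).1
  change (p x * q y) • zInt mu x y ∈ NHat lam
  by_cases h0 : p x * q y = 0
  · rw [h0, zero_smul]; exact Submodule.zero_mem _
  have hx' : x = F.xElt mu i ∨ len x < len (F.xElt mu i) ∧ x ∈ Inc (rowOf mu) :=
    or_iff_not_imp_left.2 fun hx => hp3 x hx (left_ne_zero_of_mul h0)
  have hy' : y = F.xElt mu j ∨ len y < len (F.xElt mu j) ∧ y ∈ Inc (rowOf mu) :=
    or_iff_not_imp_left.2 fun hy => hq3 y hy (right_ne_zero_of_mul h0)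
  have hxI : x ∈ Inc (rowOf mu) := by
    rcases hx' with h | h
    · rw [h]; exact F.xElt_mem mu i
    · exact h.2
  have hyI : y ∈ Inc (rowOf mu) := by
    rcases hy' with h | h
    · rw [h]; exact F.xElt_mem mu j
    · exact h.2
  have hlt : len x + len y < N := by
    rcases hx' with hx' | hx' <;> rcases hy' with hy' | hy'
    · exact absurd (Prod.ext hx' hy') hne
    · rw [hx']; omega
    · rw [hy']; omega
    · omega
  refine Submodule.smul_mem _ _ ?_
  by_cases hX : (∃ i, x = F.xElt mu i) ∧ ∃ j, y = F.xElt mu j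
  · obtain ⟨⟨k, rfl⟩, l, rfl⟩ := hX
    exact ih _ hlt k l rfl
  · exact hup (F.zInt_mem_upIdeal hxI hyI hX)

theorem NHat_le {lam mu : n.Partition} (h : SDom lam mu) : NHat mu ≤ NHat lam :=
  Submodule.span_mono fun _ ⟨nu, h1, h2⟩ => ⟨nu, h.trans h1, h2⟩

/-- The ideal is spanned by the `C y` in strictly dominating cells. Such a `C y` with `y` in the
cell of `mu` is `±zInt` modulo `upIdeal mu`, to which the induction hypothesis applies. -/
theorem upIdeal_le_NHat (lam : n.Partition) : F.upIdeal lam ≤ NHat lam := by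
  induction lam using sDom_induction with
  | h lam ih =>
  intro x hx
  rw [← sum_ccoeff_smul_C x]
  refine Submodule.sum_mem _ fun y _ => ?_
  by_cases hy : y ∈ F.Up lam
  · refine Submodule.smul_mem _ _ ?_
    obtain ⟨mu, h, hy⟩ := hy
    obtain ⟨i, j, rfl⟩ := F.mem_R_iff.1 hy
    have hup : F.upIdeal mu ≤ NHat lam := (ih mu h).trans (NHat_le h)
    have h1 := Submodule.sub_mem _ (F.zInt_mem_NHat h hup i j) (hup (F.zInt_sub_mem mu i j))
    rw [sub_sub_cancel] at h1
    rcases F.zSign_eq mu i j with e | e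
    · rwa [e, Int.cast_one, one_smul] at h1
    · rw [e, Int.cast_neg, Int.cast_one, neg_smul, one_smul] at h1
      exact (Submodule.neg_mem_iff _).1 h1
  · rw [F.ccoeff_eq_zero_of_mem_upIdeal hx hy, zero_smul]
    exact Submodule.zero_mem _

/-- The signs relating the elements `Z` to the elements of the basis `C`. -/
def sign (w : Perm (Fin n)) : ℤ :=
  let p := (Equiv.ofBijective _ F.wElt_bijective).symm w
  F.zSign p.1 p.2.1 p.2.2

theorem sign_wElt (lam : n.Partition) (i j : Fin (F.deg lam)) :
    F.sign (F.wElt lam i j) = F.zSign lam i j := by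
  have e : (Equiv.ofBijective _ F.wElt_bijective).symm (F.wElt lam i j) = ⟨lam, i, j⟩ :=
    Equiv.ofBijective_symm_apply_apply _ F.wElt_bijective ⟨lam, i, j⟩
  rw [sign, e]

theorem isEta_sign : F.IsEta F.sign := by
  refine ⟨fun w => F.zSign_eq _ _ _, fun lam i j => ?_⟩
  refine ⟨-(zInt lam (F.xElt lam i) (F.xElt lam j) - (F.zSign lam i j : A) • C (F.wElt lam i j)),
    F.upIdeal_le_NHat lam (Submodule.neg_mem _ (F.zInt_sub_mem lam i j)), ?_⟩
  rw [Z_eq, sign_wElt, ← map_add, neg_sub, add_sub_cancel, zsmul_eq_smul]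

end OrthFamily

/-- `jInv` is multiplicative, fixes the `T d` up to sign, and takes `C (wLong lam)` to `x_λ` up to a
sign and the power `v ^ (-len (wLong lam))`. -/
theorem v_smul_murphyX {lam : n.Partition} (a b : StdTableau lam) :
    v (-(len (wLong lam) : ℤ)) • murphyX a b =
      (eps (dPerm a) * eps (dPerm b) * eps (wLong lam)) • jInv (murphyY a b) := by
  have e : xSum lam = symSum (rowOf lam) := by
    rw [xSum, symSum, young_eq]
  rw [murphyX, murphyY, e, jInv_mul, jInv_mul, jInv_T, jInv_T,
    jInv_C_top (rowOf_monotone lam) (isTop_wLong lam), eps_inv]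
  simp only [zsmul_eq_smul, smul_mul_assoc, mul_smul_comm, smul_smul]
  congr 1
  have h : ∀ w : Perm (Fin n), (eps w : A) * eps w = 1 := fun w => by
    exact_mod_cast congrArg (Int.cast : ℤ → A) (eps_mul_self w)
  push_cast
  linear_combination (-(v (-(len (wLong lam) : ℤ)))) * (h (dPerm a) * (eps (dPerm b) : A) ^ 2 *
    (eps (wLong lam) : A) ^ 2 + h (dPerm b) * (eps (wLong lam) : A) ^ 2 + h (wLong lam))

end

end KLMurphy

theorem mainTheorem2 (n : ℕ) (F : KLMurphy.OrthFamily n) :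
    ∃ η : Equiv.Perm (Fin n) → ℤ, F.IsEta η ∧
      ∀ (lam : n.Partition) (s t : KLMurphy.StdTableau lam),
        ∃ w ∈ F.R lam,
          F.HasExpansion KLMurphy.C KLMurphy.APos lam (KLMurphy.murphyY s t) (η w) w ∧
          (∀ w' ∈ F.R lam,
            F.HasExpansion KLMurphy.C KLMurphy.APos lam (KLMurphy.murphyY s t) (η w') w' →
              w' = w) ∧
          (∃ i j, KLMurphy.dPerm s = F.xElt lam i ∧ KLMurphy.dPerm t = F.xElt lam j) ∧
          (∀ i j, KLMurphy.dPerm s = F.xElt lam i → KLMurphy.dPerm t = F.xElt lam j →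
            w = F.wElt lam i j) ∧
          F.HasExpansion KLMurphy.CPrime KLMurphy.ANeg lam
            (KLMurphy.v (-(KLMurphy.len (KLMurphy.wLong lam) : ℤ)) • KLMurphy.murphyX s t)
            (KLMurphy.eps (KLMurphy.dPerm s) * KLMurphy.eps (KLMurphy.dPerm t) *
              KLMurphy.eps (KLMurphy.wLong lam) * KLMurphy.eps w * η w) w := by
  refine ⟨F.sign, F.isEta_sign, fun lam s t => ?_⟩
  obtain ⟨i, hi⟩ := F.exists_xElt_eq_dPerm s
  obtain ⟨j, hj⟩ := F.exists_xElt_eq_dPerm t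
  have hexp : F.HasExpansion KLMurphy.C KLMurphy.APos lam (KLMurphy.murphyY s t)
      (F.sign (F.wElt lam i j)) (F.wElt lam i j) := by
    rw [F.hasExpansion_C_iff, F.sign_wElt]
    exact F.murphyY_sub_mem hi hj
  have hne : F.sign (F.wElt lam i j) ≠ 0 := by
    rcases F.isEta_sign.1 (F.wElt lam i j) with e | e <;> rw [e] <;> norm_num
  refine ⟨F.wElt lam i j, F.wElt_mem_R lam i j, hexp,
    fun w' _ h' => F.eq_of_hasExpansion (F.wElt_mem_R lam i j) hexp h' hne, ⟨i, j, hi, hj⟩,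
    fun k l hk hl => ?_, ?_⟩
  · rw [F.xElt_injective lam (hi.symm.trans hk), F.xElt_injective lam (hj.symm.trans hl)]
  · rw [KLMurphy.v_smul_murphyX]
    exact hexp.zsmul_jInv _
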